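/- Let $q:[0,1]\to\mathbb R$ belong to $W_2^1[0,1]$ (absolutely continuous, $q'\in L^2(0,1)$), with $q(1)\neq0$, and put $\omega:=\int_0^1q(t)\,dt$. A number $\lambda\in\mathbb C$ is a *Dirichlet transmission eigenvalue* if there are nontrivial $\psi,\psi_0$ on $[0,1]$ with $$-\psi''+q\psi=\lambda\psi,\quad -\psi_0''=\lambda\psi_0,\quad \psi(0)=0=\psi_0(0),\quad \psi_0(1)=\psi(1),\quad \psi_0'(1)=\psi'(1).$$ The eigenvalues are the zeros of the entire function $\Delta(\lambda)=\varphi_0(1,\lambda)\varphi'(1,\lambda)-\varphi_0'(1,\lambda)\varphi(1,\lambda)$, where $\varphi$ and $\varphi_0$ solve the two equations with $\varphi(0)=\varphi_0(0)=0$, $\varphi'(0)=\varphi_0'(0)=1$; below each eigenvalue is listed as many times as its order as a zero of $\Delta$. Write $\sqrt{\cdot}$ for the principal square root, $z^*$ for the complex conjugate, and $$Q_3=-q'(1)+q(1)\omega,\qquad Q_4=-q'(0)+q(0)\omega-\int_0^1q^2(s)\,ds+\frac{\omega^3}{6}\qquad(q\in W_2^2[0,1]).$$ (i) Assume $\omega\ne0$.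 Then the Dirichlet transmission eigenvalues can be listed as $\{\lambda_n\}_{n\ge1}\cup\{\lambda_n'\}_{n\ge1}$ if $q(1)/\omega>0$, and as $\{\lambda_n\}_{n\ge0}\cup\{\lambda_n'\}_{n\ge1}$ if $q(1)/\omega<0$, where $\lambda_n'=\lambda_n^*$ for all sufficiently large $n$, so that $$\sqrt{\lambda_n}=\mu_n+\varepsilon_n,\qquad \{\varepsilon_n\}\in l^2,$$ and, if moreover $q\in W_2^2[0,1]$ (that is, $q$ is differentiable and $q'\in W_2^1[0,1]$), $$\sqrt{\lambda_n}=\mu_n+\frac{Q_3}{4n\pi q(1)}+\frac{\beta_n}{n}\quad(n\ge1),\qquad \{\beta_n\}\in l^2.$$ Here $\{\mu_n\}$ consists, up to finitely many terms, of the zeros of $2\omega k-q(1)\sin 2k$ in the open first quadrant, and satisfies, as $n\to\infty$, $$\operatorname{Re}\mu_n=(n+a)\pi-\frac{\log(2n\pi)-\log\left|\frac{q(1)}{2\omega}\right|}{4n\pi}+O\Big(\frac{\log^2n}{n^2}\Big),\qquad \operatorname{Im}\mu_n=\frac12\Big[\log(2n\pi)-\log\left|\frac{q(1)}{2\omega}\right|+\frac{a}{n}\Big]+O\Big(\frac{\log^2n}{n^2}\Big),$$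 with $a=\frac14$ if $q(1)/\omega>0$ and $a=\frac34$ if $q(1)/\omega<0$. (ii) Assume $\omega=0$. Then the Dirichlet transmission eigenvalues can be listed as $\{\lambda_n\}_{n\ge1}$ so that $$\sqrt{\lambda_n}=\frac{(n+1)\pi}{2}+\alpha_n,\qquad\{\alpha_n\}\in l^2,$$ and, if moreover $q\in W_2^2[0,1]$, $$\sqrt{\lambda_n}=\frac{(n+1)\pi}{2}+\frac{Q_3+(-1)^nQ_4}{2q(1)n\pi}+\frac{\kappa_n}{n},\qquad\{\kappa_n\}\in l^2.$$ -/

import Mathlib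

open Set Filter Topology MeasureTheory Asymptotics
open scoped ComplexConjugate Interval

/-- `q ∈ W_2^1[0,1]`: `q` is absolutely continuous on `[0,1]` and `q' ∈ L²(0,1)`. -/
def MemW21 (q : ℝ → ℝ) : Prop :=
  AbsolutelyContinuousOnInterval q 0 1 ∧ MemLp (deriv q) 2 (volume.restrict (Ioo (0 : ℝ) 1))

/-- `q ∈ W_2^2[0,1]`: `q` is differentiable on `[0,1]` (one-sidedly at the end points) and
`q' ∈ W_2^1[0,1]`. -/
def MemW22 (q : ℝ → ℝ) : Prop :=
  DifferentiableOn ℝ q (Icc 0 1) ∧ MemW21 (derivWithin q (Icc 0 1))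

/-- `ψ` solves `-ψ'' + q ψ = lam ψ` on `[0,1]`, and `dψ` is its derivative there.  (For
continuous `q` the solutions are the classical, twice continuously differentiable ones.) -/
structure IsSchrodingerSolution (q : ℝ → ℝ) (lam : ℂ) (ψ dψ : ℝ → ℂ) : Prop where
  hasDeriv : ∀ x ∈ Icc (0 : ℝ) 1, HasDerivWithinAt ψ (dψ x) (Icc 0 1) x
  hasDeriv_deriv : ∀ x ∈ Icc (0 : ℝ) 1,
    HasDerivWithinAt dψ (((q x : ℂ) - lam) * ψ x) (Icc 0 1) x

/-- `lam` is a Dirichlet transmission eigenvalue of `q`: there are nontrivial `ψ`, `ψ₀` with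
`-ψ'' + q ψ = lam ψ`, `-ψ₀'' = lam ψ₀` on `[0,1]`, `ψ(0) = 0 = ψ₀(0)`, `ψ₀(1) = ψ(1)`,
`ψ₀'(1) = ψ'(1)`. -/
def IsDirichletTransmissionEigenvalue (q : ℝ → ℝ) (lam : ℂ) : Prop :=
  ∃ ψ dψ ψ₀ dψ₀ : ℝ → ℂ,
    IsSchrodingerSolution q lam ψ dψ ∧ IsSchrodingerSolution (fun _ => 0) lam ψ₀ dψ₀ ∧
    (∃ x ∈ Icc (0 : ℝ) 1, ψ x ≠ 0) ∧ (∃ x ∈ Icc (0 : ℝ) 1, ψ₀ x ≠ 0) ∧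
    ψ 0 = 0 ∧ ψ₀ 0 = 0 ∧ ψ₀ 1 = ψ 1 ∧ dψ₀ 1 = dψ 1

/-- The solution `φ(·, lam)` of `-φ'' + q φ = lam φ` on `[0,1]` with `φ(0) = 0`, `φ'(0) = 1`,
together with its derivative.  For continuous `q` it exists and is unique on `[0,1]`. -/
noncomputable def dirichletSolution (q : ℝ → ℝ) (lam : ℂ) : (ℝ → ℂ) × (ℝ → ℂ) :=
  Classical.epsilon fun p : (ℝ → ℂ) × (ℝ → ℂ) =>
    IsSchrodingerSolution q lam p.1 p.2 ∧ p.1 0 = 0 ∧ p.2 0 = 1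

/-- The characteristic function `Δ(lam) = φ₀(1) φ'(1) - φ₀'(1) φ(1)`, where `φ₀` is the solution
`φ` for the zero potential.  For `lam = k² ≠ 0` this is `(sin k / k) φ'(1) - (cos k) φ(1)`, which
by constancy of Wronskians is `(f(k,0) - f(-k,0)) / (2 i k)` with the Jost solution `f(k,·)`. -/
noncomputable def dirichletCharFun (q : ℝ → ℝ) (lam : ℂ) : ℂ :=
  (dirichletSolution (fun _ => 0) lam).1 1 * (dirichletSolution q lam).2 1 -
    (dirichletSolution (fun _ => 0) lam).2 1 * (dirichletSolution q lam).1 1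

/-- The family `lam` lists all Dirichlet transmission eigenvalues of `q`, each one as often as its
algebraic multiplicity, the order of the zero of the characteristic function. -/
def EnumeratesDirichletEigenvalues {ι : Type} (q : ℝ → ℝ) (lam : ι → ℂ) : Prop :=
  (∀ z : ℂ, IsDirichletTransmissionEigenvalue q z ↔ ∃ i, lam i = z) ∧
    ∀ z : ℂ, analyticOrderAt (dirichletCharFun q) z = {i | lam i = z}.encard

/-- `ω = ∫₀¹ q`. -/
noncomputable def omega (q : ℝ → ℝ) : ℝ := ∫ t in (0 : ℝ)..1, q t

/-- `Q₃ = -q'(1) + q(1) ω`. -/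
noncomputable def Q₃ (q : ℝ → ℝ) : ℝ := -derivWithin q (Icc 0 1) 1 + q 1 * omega q

/-- `Q₄ = -q'(0) + q(0) ω - ∫₀¹ q² + ω³ / 6`. -/
noncomputable def Q₄ (q : ℝ → ℝ) : ℝ :=
  -derivWithin q (Icc 0 1) 0 + q 0 * omega q - (∫ s in (0 : ℝ)..1, q s ^ 2) + omega q ^ 3 / 6

/-- The sequence `mu` consists, from some index on, of zeros in the open first quadrant of the
leading function `2 ω k - q(1) sin 2k` (that is, `4 k³ (ω / (2 k²) - q(1) sin 2k / (4 k³))`), and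
it contains all but finitely many of those zeros. -/
def IsLeadingZeroSequence (q : ℝ → ℝ) (mu : ℕ → ℂ) : Prop :=
  (∀ᶠ n in atTop, 0 < (mu n).re ∧ 0 < (mu n).im ∧
      2 * (omega q : ℂ) * mu n - (q 1 : ℂ) * Complex.sin (2 * mu n) = 0) ∧
    ({k : ℂ | 0 < k.re ∧ 0 < k.im ∧
      2 * (omega q : ℂ) * k - (q 1 : ℂ) * Complex.sin (2 * k) = 0} \ range mu).Finite

/-- As `n → ∞`, with `L_n = log (2 n π) - log c`,
`Re mu_n = (n + a) π - L_n / (4 n π) + O(log² n / n²)` and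
`Im mu_n = (L_n + a / n) / 2 + O(log² n / n²)`. -/
def HasZeroAsymptotics (a c : ℝ) (mu : ℕ → ℂ) : Prop :=
  ((fun n : ℕ => (mu n).re -
      (((n : ℝ) + a) * Real.pi - (Real.log (2 * n * Real.pi) - Real.log c) / (4 * n * Real.pi)))
    =O[atTop] fun n : ℕ => Real.log n ^ 2 / (n : ℝ) ^ 2) ∧
  ((fun n : ℕ => (mu n).im -
      (1 / 2) * (Real.log (2 * n * Real.pi) - Real.log c + a / n))
    =O[atTop] fun n : ℕ => Real.log n ^ 2 / (n : ℝ) ^ 2)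

/-- `{ε_n} ∈ l²`. -/
def MemL2Seq (ε : ℕ → ℂ) : Prop := Summable fun n => ‖ε n‖ ^ 2

/-!
The eigenvalues are the zeros of the entire function `Δ` (`isDirichletTransmissionEigenvalue_iff`),
so everything rests on the behaviour of `Δ(k²)` for large `k`.  The Wronskian of the two solutions
gives `k Δ(k²) = ∫₀¹ q(t) sin (kt) φ(t, k²) dt`, and inserting an approximate solution of the
Volterra equation for `φ` and integrating by parts yields
`4 k³ Δ(k²) = 2 ω k - q(1) sin 2k + R(k)` (`charFun_expansion_first_order`).  Up to smaller terms
the remainder `R(k)` is `∫₀¹ g(t) sin (2kt) dt` with `g ∈ L²`; for `q ∈ W_2^2` it is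
`(2k)⁻¹ (Q₃ cos 2k + c₀ + ∫₀¹ h(t) cos (2kt) dt)` with `h ∈ L²`, and `c₀ = -Q₄` if `ω = 0`
(`charFun_expansion_second_order`).

*Location of the zeros.*  If `ω = 0`, the leading part is a multiple of `sin 2k`, with zeros
`(n + 1) π / 2`.  If `ω ≠ 0`, its two dominant terms `2 ω k` and `q(1) exp (-2ik) / (2i)` balance
near `c_n = (n + a) π + (i / 2) log (κ n π)`, `κ = 4 |ω / q(1)|`, where the leading part is, up to a
factor of order `n`, close to `1 - exp (-2i (k - c_n))`; away from these points it is too large to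
vanish (`exists_near_logCentre`).  Since `R(k) = o(exp (2 |Im k|))`, perturbation of a simple zero
(`exists_zero_of_close`) shows that `4 k³ Δ(k²)` and its leading part have exactly one zero near
each of these points, that it is simple, and that the distance of the two zeros is bounded by the
size of the suitably normalized remainder.

*Square summability.*  The values of the remainder at the zeros are Fourier–Laplace coefficients of
`L²` functions at points whose real parts are separated and whose imaginary parts grow
logarithmically.  The corresponding exponentials are almost orthogonal: their Gram matrix has
bounded row sums, and a Bessel inequality follows (`summable_norm_integral_mul_exp_sq`).  This gives
the first order asymptotics.  For `q ∈ W_2^2`, a Taylor expansion of the sine at the zeros of the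
leading part extracts the term with `Q₃` (and `Q₄`) and leaves a square summable error.

*Numbering.*  The claims include how many eigenvalues there are besides the asymptotically located
ones.  This number is found by Jensen's formula.  On circles `|λ| = R` that avoid the zeros, the
mean of `log |Δ|` differs by `-log R + O(1)` from that of the model function `sin (2√λ) / (2√λ)`,
because `4 k³ Δ(k²)` and `sin 2k` are comparable except near the real axis, where their quotient is
at most `O(|k|)` on a small portion of the circle (`exists_circleAverage_bound`).  The zeros of the
two functions can be matched so that the differences of the logarithms of their moduli, taken
together for the two zeros of a conjugate pair, are summable.  Comparing the coefficients of
`log R`, the function `Δ` has one zero fewer than the model function, whose zeros `(m π / 2)²`,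
`m ≥ 1`, are explicit (`HasSimpleTail.card_exceptional_eq`, `exists_enumeration_of_tail`).  If `ω ≠ 0`, each pair `c_n`,
`conj c_n` corresponds to two consecutive values of `m`; the positions `a = 1/4` and `a = 3/4`
shift this correspondence by one, which accounts for the different index sets in the two cases.
-/

/-! ### Solutions of the Schrödinger equation -/

theorem IsSchrodingerSolution.eqOn {q : ℝ → ℝ} (hq : ContinuousOn q (Icc 0 1)) {lam : ℂ}
    {ψ dψ φ dφ : ℝ → ℂ} (h : IsSchrodingerSolution q lam ψ dψ)
    (h' : IsSchrodingerSolution q lam φ dφ) (h0 : ψ 0 = φ 0) (h1 : dψ 0 = dφ 0) :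
    EqOn ψ φ (Icc 0 1) ∧ EqOn dψ dφ (Icc 0 1) := by
  obtain ⟨M, hM⟩ := isCompact_Icc.exists_bound_of_continuousOn hq
  have hM0 : 0 ≤ M := (norm_nonneg _).trans (hM 0 (by simp))
  let v : ℝ → ℂ × ℂ → ℂ × ℂ := fun t p => (p.2, ((q t : ℂ) - lam) * p.1)
  let K : NNReal := ⟨1 + M + ‖lam‖, by positivity⟩
  have hv : ∀ t ∈ Ico (0 : ℝ) 1, LipschitzOnWith K (v t) univ := by
    intro t ht
    refine LipschitzOnWith.of_dist_le_mul fun x _ y _ => ?_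
    have hx1 : ‖x.1 - y.1‖ ≤ dist x y := by
      rw [← dist_eq_norm, Prod.dist_eq]; exact le_max_left _ _
    have hx2 : ‖x.2 - y.2‖ ≤ dist x y := by
      rw [← dist_eq_norm x.2, Prod.dist_eq]; exact le_max_right _ _
    have hd : 0 ≤ dist x y := dist_nonneg
    have hqt : ‖(q t : ℂ) - lam‖ ≤ M + ‖lam‖ :=
      (norm_sub_le _ _).trans (by gcongr; simpa using hM t ⟨ht.1, ht.2.le⟩)
    rw [Prod.dist_eq]
    refine max_le ?_ ?_
    · simp only [v, dist_eq_norm]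
      rw [dist_eq_norm] at hx2 hd
      calc ‖x.2 - y.2‖ ≤ 1 * ‖x - y‖ := by simpa using hx2
        _ ≤ K * ‖x - y‖ := by
          gcongr
          change (1 : ℝ) ≤ 1 + M + ‖lam‖
          linarith [norm_nonneg lam]
    · simp only [v]
      rw [dist_eq_norm, ← mul_sub, norm_mul]
      calc _ ≤ (M + ‖lam‖) * dist x y := by gcongr
        _ ≤ K * dist x y := by
          gcongr
          change M + ‖lam‖ ≤ 1 + M + ‖lam‖
          linarith
  have key : ∀ {ψ dψ : ℝ → ℂ}, IsSchrodingerSolution q lam ψ dψ →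
      ContinuousOn (fun t => (ψ t, dψ t)) (Icc 0 1) ∧ ∀ t ∈ Ico (0 : ℝ) 1,
        HasDerivWithinAt (fun t => (ψ t, dψ t)) (v t (ψ t, dψ t)) (Ici t) t := by
    intro ψ dψ h
    refine ⟨fun t ht => ((h.hasDeriv t ht).continuousWithinAt).prodMk
      (h.hasDeriv_deriv t ht).continuousWithinAt, fun t ht => ?_⟩
    have ht' : t ∈ Icc (0 : ℝ) 1 := ⟨ht.1, ht.2.le⟩
    have hmem : Icc (0 : ℝ) 1 ∈ 𝓝[Ici t] t := by
      have h1 : Icc t 1 ∈ 𝓝[Ici t] t := Icc_mem_nhdsGE ht.2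
      exact mem_of_superset h1 (Icc_subset_Icc_left ht.1)
    exact ((h.hasDeriv t ht').mono_of_mem_nhdsWithin hmem).prodMk
      ((h.hasDeriv_deriv t ht').mono_of_mem_nhdsWithin hmem)
  have := ODE_solution_unique_of_mem_Icc_right (s := fun _ => univ) hv (key h).1 (key h).2
    (fun _ _ => trivial) (key h').1 (key h').2 (fun _ _ => trivial) (by simp [h0, h1])
  exact ⟨fun t ht => congrArg Prod.fst (this ht), fun t ht => congrArg Prod.snd (this ht)⟩

/-- The Volterra operator `f ↦ ∫₀ˣ f` on `C([0,1], ℂ)`. -/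
noncomputable def volterra : C(Icc (0 : ℝ) 1, ℂ) →L[ℂ] C(Icc (0 : ℝ) 1, ℂ) :=
  LinearMap.mkContinuous
    { toFun := fun f => ⟨fun x => ∫ t in (0 : ℝ)..x, IccExtend zero_le_one f t, by
        have : Continuous (fun x : ℝ => ∫ t in (0 : ℝ)..x, IccExtend zero_le_one f t) :=
          intervalIntegral.continuous_primitive
            (fun a b => (f.continuous.Icc_extend' (h := zero_le_one)).intervalIntegrable a b) 0
        exact this.comp continuous_subtype_val⟩
      map_add' := fun f g => by
        ext x
        simp only [ContinuousMap.coe_mk, ContinuousMap.add_apply]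
        rw [← intervalIntegral.integral_add
          ((f.continuous.Icc_extend' (h := zero_le_one)).intervalIntegrable _ _)
          ((g.continuous.Icc_extend' (h := zero_le_one)).intervalIntegrable _ _)]
        rfl
      map_smul' := fun c f => by
        ext x
        simp only [ContinuousMap.coe_mk, ContinuousMap.smul_apply, RingHom.id_apply]
        rw [← intervalIntegral.integral_smul]
        rfl } 1 (fun f => by
      rw [one_mul, ContinuousMap.norm_le _ (norm_nonneg _)]
      intro x
      have := intervalIntegral.norm_integral_le_of_norm_le_const (a := (0 : ℝ)) (b := x)
        (f := IccExtend zero_le_one f) (C := ‖f‖) (fun t _ => f.norm_coe_le_norm _)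
      refine this.trans ?_
      have hx := x.2
      rw [sub_zero, abs_of_nonneg hx.1]
      exact mul_le_of_le_one_right (norm_nonneg _) hx.2)

theorem volterra_apply (f : C(Icc (0 : ℝ) 1, ℂ)) (x : Icc (0 : ℝ) 1) :
    volterra f x = ∫ t in (0 : ℝ)..x, IccExtend zero_le_one f t := rfl

theorem norm_volterra_apply_le {f : C(Icc (0 : ℝ) 1, ℂ)} {c : ℝ} (n : ℕ)
    (hf : ∀ t, ‖f t‖ ≤ c * (t : ℝ) ^ n / n.factorial) (x : Icc (0 : ℝ) 1) :
    ‖volterra f x‖ ≤ c * (x : ℝ) ^ (n + 1) / (n + 1).factorial := by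
  rw [volterra_apply]
  have hx := x.2
  have hint : ∫ t in (0 : ℝ)..x, c * t ^ n / n.factorial
      = c * (x : ℝ) ^ (n + 1) / (n + 1).factorial := by
    rw [intervalIntegral.integral_div, intervalIntegral.integral_const_mul, integral_pow,
      Nat.factorial_succ]
    push_cast
    have : (n.factorial : ℝ) ≠ 0 := by positivity
    field_simp
    simp
  rw [← hint]
  refine intervalIntegral.norm_integral_le_of_norm_le hx.1 ?_ (by
    apply Continuous.intervalIntegrable; fun_prop)
  refine Eventually.of_forall fun t ht => ?_
  have ht' : t ∈ Icc (0 : ℝ) 1 := ⟨ht.1.le, ht.2.trans hx.2⟩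
  rw [IccExtend_of_mem _ _ ht']
  exact hf ⟨t, ht'⟩

/-- `1 - a ^ n` is a multiple of `1 - a`, so only some power of `a` has to be small. -/
theorem isUnit_one_sub_of_norm_pow_lt_one {A : Type*} [NormedRing A] [CompleteSpace A] {a : A}
    {n : ℕ} (h : ‖a ^ n‖ < 1) : IsUnit (1 - a) := by
  have hu : IsUnit (1 - a ^ n) := (Units.oneSub (a ^ n) h).isUnit
  rw [← mul_neg_geom_sum] at hu
  refine ((Commute.isUnit_mul_iff ?_).1 hu).1
  refine Commute.sub_left (Commute.one_left _) ?_
  exact Commute.sum_right _ _ _ fun i _ => (Commute.refl a).pow_right i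

theorem differentiable_ringInverse_add_smul {A : Type*} [NormedRing A] [NormedAlgebra ℂ A]
    [CompleteSpace A] {a b : A} (h : ∀ z : ℂ, IsUnit (a + z • b)) :
    Differentiable ℂ (fun z : ℂ => Ring.inverse (a + z • b)) := by
  intro z
  have h1 : DifferentiableAt ℂ (Ring.inverse : A → A) (a + z • b) := by
    obtain ⟨u, hu⟩ := h z
    rw [← hu]
    exact (analyticAt_inverse (𝕜 := ℂ) u).differentiableAt
  have h2 : DifferentiableAt ℂ (fun z : ℂ => a + z • b) z := by fun_prop
  exact h1.comp z h2

/-- Since `volterra` is quasi-nilpotent, `1 - V² ∘ g` is invertible for every multiplication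
operator `g`. -/
theorem isUnit_one_sub_volterra_mul (g : C(Icc (0 : ℝ) 1, ℂ)) :
    IsUnit (1 - volterra * volterra * ContinuousLinearMap.mul ℂ C(Icc (0 : ℝ) 1, ℂ) g) := by
  set K := volterra * volterra * ContinuousLinearMap.mul ℂ C(Icc (0 : ℝ) 1, ℂ) g with hK
  have hpow : ∀ (n : ℕ) (f : C(Icc (0 : ℝ) 1, ℂ)) (x : Icc (0 : ℝ) 1),
      ‖(K ^ n) f x‖ ≤ (‖g‖ ^ n * ‖f‖) * (x : ℝ) ^ n / n.factorial := by
    intro n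
    induction n with
    | zero => intro f x; simpa using f.norm_coe_le_norm x
    | succ n ih =>
      intro f x
      have h1 : ∀ t : Icc (0 : ℝ) 1, ‖(g * (K ^ n) f) t‖
          ≤ (‖g‖ ^ (n + 1) * ‖f‖) * (t : ℝ) ^ n / n.factorial := by
        intro t
        rw [ContinuousMap.mul_apply, norm_mul]
        calc _ ≤ ‖g‖ * ((‖g‖ ^ n * ‖f‖) * (t : ℝ) ^ n / n.factorial) := by
              gcongr
              · exact g.norm_coe_le_norm t
              · exact ih f t
          _ = _ := by ring
      have h2 := norm_volterra_apply_le (n + 1) (norm_volterra_apply_le n h1) x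
      have h3 : (K ^ (n + 1)) f x = volterra (volterra (g * (K ^ n) f)) x := by
        rw [pow_succ', hK]; rfl
      rw [h3]
      refine h2.trans ?_
      have hx := x.2
      have h4 : (x : ℝ) ^ (n + 1 + 1) ≤ (x : ℝ) ^ (n + 1) :=
        pow_le_pow_of_le_one hx.1 hx.2 (by omega)
      have h5 : ((n + 1).factorial : ℝ) ≤ ((n + 1 + 1).factorial : ℝ) := by
        exact_mod_cast Nat.factorial_le (by omega)
      have h6 : (0 : ℝ) ≤ (x : ℝ) ^ (n + 1) := pow_nonneg hx.1 _
      gcongr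
  have hnorm : ∀ n : ℕ, ‖K ^ n‖ ≤ ‖g‖ ^ n / n.factorial := by
    intro n
    refine ContinuousLinearMap.opNorm_le_bound _ (by positivity) fun f => ?_
    rw [ContinuousMap.norm_le _ (by positivity)]
    intro x
    refine (hpow n f x).trans ?_
    have hx := x.2
    calc _ ≤ (‖g‖ ^ n * ‖f‖) * 1 / n.factorial := by
          gcongr
          exact pow_le_one₀ hx.1 hx.2
      _ = _ := by ring
  have htend : Tendsto (fun n : ℕ => ‖g‖ ^ n / n.factorial) atTop (𝓝 0) :=
    FloorSemiring.tendsto_pow_div_factorial_atTop _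
  obtain ⟨n, hn⟩ := (htend.eventually (gt_mem_nhds zero_lt_one)).exists
  exact isUnit_one_sub_of_norm_pow_lt_one
    (A := C(Icc (0 : ℝ) 1, ℂ) →L[ℂ] C(Icc (0 : ℝ) 1, ℂ)) ((hnorm n).trans_lt hn)

/-- Existence of the solution with `ψ 0 = 0`, `ψ' 0 = 1`, with boundary data at `1` depending
holomorphically on the spectral parameter. -/
theorem exists_analytic_dirichletSolution {q : ℝ → ℝ} (hq : ContinuousOn q (Icc 0 1)) :
    ∃ ψ dψ : ℂ → ℝ → ℂ, (∀ lam, IsSchrodingerSolution q lam (ψ lam) (dψ lam) ∧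
      ψ lam 0 = 0 ∧ dψ lam 0 = 1) ∧ Differentiable ℂ (fun lam => ψ lam 1) ∧
      Differentiable ℂ (fun lam => dψ lam 1) := by
  let qc : C(Icc (0 : ℝ) 1, ℂ) := ⟨fun x => (q x : ℂ), by
    have := hq.domRestrict
    exact Complex.continuous_ofReal.comp this⟩
  let M : ℂ → C(Icc (0 : ℝ) 1, ℂ) := fun lam => qc - algebraMap ℂ _ lam
  -- The initial value problem is the equation `y = X + V² ((q - lam) y)` with `X x = x`.
  let X : C(Icc (0 : ℝ) 1, ℂ) := ⟨fun x => ((x : ℝ) : ℂ), by fun_prop⟩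
  let T : ℂ → (C(Icc (0 : ℝ) 1, ℂ) →L[ℂ] C(Icc (0 : ℝ) 1, ℂ)) := fun lam =>
    1 - volterra * volterra * ContinuousLinearMap.mul ℂ C(Icc (0 : ℝ) 1, ℂ) (M lam)
  let y : ℂ → C(Icc (0 : ℝ) 1, ℂ) := fun lam => Ring.inverse (T lam) X
  have hMd : Differentiable ℂ M := by
    have : M = fun lam => qc - lam • (1 : C(Icc (0 : ℝ) 1, ℂ)) := by
      funext lam; simp only [M, Algebra.algebraMap_eq_smul_one]
    rw [this]
    fun_prop
  have hT : ∀ lam, T lam = T 0 + lam • (volterra * volterra) := by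
    intro lam
    ext f : 1
    change f - volterra (volterra ((qc - algebraMap ℂ _ lam) * f)) =
      f - volterra (volterra ((qc - algebraMap ℂ _ 0) * f)) + lam • volterra (volterra f)
    rw [← map_smul, ← map_smul, map_zero, sub_zero, Algebra.algebraMap_eq_smul_one, sub_mul,
      smul_mul_assoc, one_mul, map_sub, map_sub]
    abel
  have hyd : Differentiable ℂ y := by
    have h1 := differentiable_ringInverse_add_smul
      (A := C(Icc (0 : ℝ) 1, ℂ) →L[ℂ] C(Icc (0 : ℝ) 1, ℂ)) (a := T 0)
      (b := volterra * volterra) (fun z => by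
        have := isUnit_one_sub_volterra_mul (M z)
        change IsUnit (T z) at this
        rw [hT z] at this
        exact this)
    have h2 : y = fun lam => Ring.inverse (T 0 + lam • (volterra * volterra)) X := by
      funext lam
      simp only [y]
      rw [hT lam]
    rw [h2]
    intro lam
    exact (h1 lam).clm_apply (differentiableAt_const X)
  have hy : ∀ lam, y lam = X + volterra (volterra (M lam * y lam)) := by
    intro lam
    have hu : IsUnit (T lam) := isUnit_one_sub_volterra_mul (M lam)
    have h1 : T lam (y lam) = X := by
      have := Ring.mul_inverse_cancel _ hu
      change (T lam * Ring.inverse (T lam)) X = X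
      rw [this]; rfl
    have h2 : T lam (y lam) = y lam - volterra (volterra (M lam * y lam)) := rfl
    rw [h2] at h1
    rw [← h1]; abel
  let g : ℂ → ℝ → ℂ := fun lam => IccExtend zero_le_one (M lam * y lam)
  have hg : ∀ lam, Continuous (g lam) := fun lam =>
    (M lam * y lam).continuous.Icc_extend' (h := zero_le_one)
  let G : ℂ → ℝ → ℂ := fun lam x => ∫ t in (0 : ℝ)..x, g lam t
  have hG : ∀ lam x, HasDerivAt (G lam) (g lam x) x := fun lam x =>
    intervalIntegral.integral_hasDerivAt_right ((hg lam).intervalIntegrable _ _)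
      (hg lam).stronglyMeasurable.stronglyMeasurableAtFilter (hg lam).continuousAt
  have hGc : ∀ lam, Continuous (G lam) := fun lam =>
    continuous_iff_continuousAt.2 fun x => (hG lam x).continuousAt
  have hGG : ∀ lam, ∀ x : ℝ, HasDerivAt (fun x : ℝ => (x : ℂ) + ∫ t in (0 : ℝ)..x, G lam t)
      (1 + G lam x) x := fun lam x =>
    (HasDerivAt.ofReal_comp (hasDerivAt_id x)).add (intervalIntegral.integral_hasDerivAt_right
      ((hGc lam).intervalIntegrable _ _)
      (hGc lam).stronglyMeasurable.stronglyMeasurableAtFilter (hGc lam).continuousAt)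
  have hvG : ∀ lam, ∀ x (hx : x ∈ Icc (0 : ℝ) 1), volterra (M lam * y lam) ⟨x, hx⟩ = G lam x :=
    fun lam x hx => rfl
  have hvv : ∀ lam, ∀ x (hx : x ∈ Icc (0 : ℝ) 1),
      y lam ⟨x, hx⟩ = (x : ℂ) + ∫ t in (0 : ℝ)..x, G lam t := by
    intro lam x hx
    conv_lhs => rw [hy lam]
    rw [ContinuousMap.add_apply, volterra_apply]
    congr 1
    refine intervalIntegral.integral_congr fun t ht => ?_
    rw [uIcc_of_le hx.1] at ht
    have ht' : t ∈ Icc (0 : ℝ) 1 := ⟨ht.1, ht.2.trans hx.2⟩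
    simp only [IccExtend_of_mem _ _ ht', hvG]
  refine ⟨fun lam x => (x : ℂ) + ∫ t in (0 : ℝ)..x, G lam t, fun lam x => 1 + G lam x,
    fun lam => ⟨⟨fun x _ => (hGG lam x).hasDerivWithinAt, fun x hx => ?_⟩, by simp,
      by simp [G]⟩, ?_, ?_⟩
  · have h1 : g lam x = ((q x : ℂ) - lam) * ((x : ℂ) + ∫ t in (0 : ℝ)..x, G lam t) := by
      rw [← hvv lam x hx]
      simp only [g, IccExtend_of_mem _ _ hx]
      rfl
    rw [← h1]
    exact ((hG lam x).const_add 1).hasDerivWithinAt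
  · have : (fun lam => ((1 : ℝ) : ℂ) + ∫ t in (0 : ℝ)..1, G lam t)
        = fun lam => ContinuousMap.evalCLM ℂ (⟨1, by simp⟩ : Icc (0 : ℝ) 1) (y lam) := by
      funext lam
      exact (hvv lam 1 (by simp)).symm
    rw [this]
    exact (ContinuousLinearMap.differentiable _).comp hyd
  · have : (fun lam => 1 + G lam 1) = fun lam => 1 +
        ContinuousMap.evalCLM ℂ (⟨1, by simp⟩ : Icc (0 : ℝ) 1) (volterra (M lam * y lam)) := by
      funext lam
      rfl
    rw [this]
    refine (differentiable_const _).add ((ContinuousLinearMap.differentiable _).comp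
      ((ContinuousLinearMap.differentiable _).comp (hMd.mul hyd)))

theorem dirichletSolution_spec {q : ℝ → ℝ} (hq : ContinuousOn q (Icc 0 1)) (lam : ℂ) :
    IsSchrodingerSolution q lam (dirichletSolution q lam).1 (dirichletSolution q lam).2 ∧
      (dirichletSolution q lam).1 0 = 0 ∧ (dirichletSolution q lam).2 0 = 1 := by
  obtain ⟨ψ, dψ, h, -, -⟩ := exists_analytic_dirichletSolution hq
  exact Classical.epsilon_spec (p := fun p : (ℝ → ℂ) × (ℝ → ℂ) =>
    IsSchrodingerSolution q lam p.1 p.2 ∧ p.1 0 = 0 ∧ p.2 0 = 1) ⟨(ψ lam, dψ lam), h lam⟩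

theorem dirichletSolution_eqOn {q : ℝ → ℝ} (hq : ContinuousOn q (Icc 0 1)) {lam : ℂ}
    {ψ dψ : ℝ → ℂ} (h : IsSchrodingerSolution q lam ψ dψ) (h0 : ψ 0 = 0) (h1 : dψ 0 = 1) :
    EqOn (dirichletSolution q lam).1 ψ (Icc 0 1) ∧
      EqOn (dirichletSolution q lam).2 dψ (Icc 0 1) := by
  obtain ⟨h', h0', h1'⟩ := dirichletSolution_spec hq lam
  exact h'.eqOn hq h (by rw [h0, h0']) (by rw [h1, h1'])

theorem differentiable_dirichletSolution_one {q : ℝ → ℝ} (hq : ContinuousOn q (Icc 0 1)) :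
    Differentiable ℂ (fun lam => (dirichletSolution q lam).1 1) ∧
      Differentiable ℂ (fun lam => (dirichletSolution q lam).2 1) := by
  obtain ⟨ψ, dψ, h, hd, hd'⟩ := exists_analytic_dirichletSolution hq
  have h1 : (fun lam => (dirichletSolution q lam).1 1) = fun lam => ψ lam 1 := by
    funext lam
    exact (dirichletSolution_eqOn hq (h lam).1 (h lam).2.1 (h lam).2.2).1 (by simp)
  have h2 : (fun lam => (dirichletSolution q lam).2 1) = fun lam => dψ lam 1 := by
    funext lam
    exact (dirichletSolution_eqOn hq (h lam).1 (h lam).2.1 (h lam).2.2).2 (by simp)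
  rw [h1, h2]
  exact ⟨hd, hd'⟩

theorem differentiable_dirichletCharFun {q : ℝ → ℝ} (hq : ContinuousOn q (Icc 0 1)) :
    Differentiable ℂ (dirichletCharFun q) := by
  have h0 := differentiable_dirichletSolution_one (q := fun _ => 0) continuousOn_const
  have h := differentiable_dirichletSolution_one hq
  exact (h0.1.mul h.2).sub (h0.2.mul h.1)

theorem dirichletSolution_conj {q : ℝ → ℝ} (hq : ContinuousOn q (Icc 0 1)) (lam : ℂ) {x : ℝ}
    (hx : x ∈ Icc (0 : ℝ) 1) :
    (dirichletSolution q (conj lam)).1 x = conj ((dirichletSolution q lam).1 x) ∧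
      (dirichletSolution q (conj lam)).2 x = conj ((dirichletSolution q lam).2 x) := by
  obtain ⟨h, h0, h1⟩ := dirichletSolution_spec hq lam
  have h' : IsSchrodingerSolution q (conj lam)
      (fun x => conj ((dirichletSolution q lam).1 x))
      (fun x => conj ((dirichletSolution q lam).2 x)) := by
    refine ⟨fun x hx => ?_, fun x hx => ?_⟩
    · exact (Complex.conjCLE.toContinuousLinearMap.hasFDerivAt.comp_hasDerivWithinAt x
        (h.hasDeriv x hx))
    · have := (Complex.conjCLE.toContinuousLinearMap.hasFDerivAt.comp_hasDerivWithinAt x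
        (h.hasDeriv_deriv x hx))
      refine this.congr_deriv ?_
      change conj (((q x : ℂ) - lam) * _) = _
      simp
  have := dirichletSolution_eqOn hq h' (by simp [h0]) (by simp [h1])
  exact ⟨this.1 hx, this.2 hx⟩

theorem dirichletCharFun_conj {q : ℝ → ℝ} (hq : ContinuousOn q (Icc 0 1)) (lam : ℂ) :
    dirichletCharFun q (conj lam) = conj (dirichletCharFun q lam) := by
  have h0 := dirichletSolution_conj (q := fun _ => 0) continuousOn_const lam
    (x := 1) (by simp)
  have h := dirichletSolution_conj hq lam (x := 1) (by simp)
  simp only [dirichletCharFun, h0.1, h0.2, h.1, h.2, map_sub, map_mul]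

theorem isSchrodingerSolution_zero_sin {k : ℂ} (hk : k ≠ 0) :
    IsSchrodingerSolution (fun _ => 0) (k ^ 2) (fun x => Complex.sin (k * x) / k)
      (fun x => Complex.cos (k * x)) := by
  have hlin : ∀ x : ℝ, HasDerivAt (fun x : ℝ => k * (x : ℂ)) k x := fun x => by
    simpa using (HasDerivAt.ofReal_comp (hasDerivAt_id x)).const_mul k
  refine ⟨fun x _ => ?_, fun x _ => ?_⟩
  · have := ((Complex.hasDerivAt_sin (k * x)).comp x (hlin x)).div_const k
    refine (this.congr_deriv ?_).hasDerivWithinAt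
    field_simp
  · have := ((Complex.hasDerivAt_cos (k * x)).comp x (hlin x))
    refine (this.congr_deriv ?_).hasDerivWithinAt
    simp only [Complex.ofReal_zero]
    field_simp
    ring

theorem dirichletSolution_zero {k : ℂ} (hk : k ≠ 0) {x : ℝ} (hx : x ∈ Icc (0 : ℝ) 1) :
    (dirichletSolution (fun _ => 0) (k ^ 2)).1 x = Complex.sin (k * x) / k ∧
      (dirichletSolution (fun _ => 0) (k ^ 2)).2 x = Complex.cos (k * x) := by
  have := dirichletSolution_eqOn continuousOn_const (isSchrodingerSolution_zero_sin hk)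
    (by simp) (by simp)
  exact ⟨this.1 hx, this.2 hx⟩

theorem IsSchrodingerSolution.const_mul {q : ℝ → ℝ} {lam : ℂ} {ψ dψ : ℝ → ℂ}
    (h : IsSchrodingerSolution q lam ψ dψ) (c : ℂ) :
    IsSchrodingerSolution q lam (fun x => c * ψ x) (fun x => c * dψ x) :=
  ⟨fun x hx => (h.hasDeriv x hx).const_mul c, fun x hx => by
    have := (h.hasDeriv_deriv x hx).const_mul c
    exact this.congr_deriv (by ring)⟩

/-- The solutions vanishing at `0` are the multiples of `dirichletSolution`. -/
theorem IsSchrodingerSolution.eqOn_mul_dirichletSolution {q : ℝ → ℝ}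
    (hq : ContinuousOn q (Icc 0 1)) {lam : ℂ} {ψ dψ : ℝ → ℂ}
    (h : IsSchrodingerSolution q lam ψ dψ) (h0 : ψ 0 = 0) {x : ℝ} (hx : x ∈ Icc (0 : ℝ) 1) :
    ψ x = dψ 0 * (dirichletSolution q lam).1 x ∧ dψ x = dψ 0 * (dirichletSolution q lam).2 x := by
  obtain ⟨h', h0', h1'⟩ := dirichletSolution_spec hq lam
  have := h.eqOn hq (h'.const_mul (dψ 0)) (by simp [h0, h0']) (by simp [h1'])
  exact ⟨this.1 hx, this.2 hx⟩

/-- A solution whose Cauchy data vanish at `1` vanishes identically. -/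
theorem IsSchrodingerSolution.eq_zero_of_one {q : ℝ → ℝ} (hq : ContinuousOn q (Icc 0 1)) {lam : ℂ}
    {ψ dψ : ℝ → ℂ} (h : IsSchrodingerSolution q lam ψ dψ) (h0 : ψ 1 = 0) (h1 : dψ 1 = 0) :
    ψ 0 = 0 ∧ dψ 0 = 0 := by
  have hrefl : ∀ x ∈ Icc (0 : ℝ) 1, (1 - x) ∈ Icc (0 : ℝ) 1 := fun x hx =>
    ⟨by linarith [hx.2], by linarith [hx.1]⟩
  have hd : ∀ x : ℝ, HasDerivWithinAt (fun x : ℝ => 1 - x) (-1) (Icc 0 1) x := fun x =>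
    ((hasDerivAt_id x).const_sub 1).hasDerivWithinAt
  have hr : IsSchrodingerSolution (fun x => q (1 - x)) lam (fun x => ψ (1 - x))
      (fun x => -dψ (1 - x)) := by
    refine ⟨fun x hx => ?_, fun x hx => ?_⟩
    · have := (h.hasDeriv (1 - x) (hrefl x hx)).scomp x (hd x) hrefl
      simpa [Function.comp_def] using this
    · have := ((h.hasDeriv_deriv (1 - x) (hrefl x hx)).scomp x (hd x) hrefl).neg
      refine HasDerivWithinAt.congr_deriv (f' := _) (f := fun x => -dψ (1 - x)) this ?_
      simp
  have hz : IsSchrodingerSolution (fun x => q (1 - x)) lam (fun _ => 0) (fun _ => 0) :=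
    ⟨fun x _ => hasDerivWithinAt_const _ _ _, fun x _ => by
      simpa using hasDerivWithinAt_const _ _ _⟩
  have hq' : ContinuousOn (fun x => q (1 - x)) (Icc 0 1) :=
    hq.comp (by fun_prop) hrefl
  have := hr.eqOn hq' hz (by simpa using h0) (by simpa using h1)
  have h1' := this.1 (show (1 : ℝ) ∈ Icc 0 1 by simp)
  have h2' := this.2 (show (1 : ℝ) ∈ Icc 0 1 by simp)
  simp only [sub_self, neg_eq_zero] at h1' h2'
  exact ⟨h1', h2'⟩

/-- The coupling conditions at `1` say that the Cauchy data there of `φ` and `φ₀` are proportional,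
that is, that their determinant `Δ(lam)` vanishes. -/
theorem isDirichletTransmissionEigenvalue_iff {q : ℝ → ℝ} (hq : ContinuousOn q (Icc 0 1))
    (lam : ℂ) : IsDirichletTransmissionEigenvalue q lam ↔ dirichletCharFun q lam = 0 := by
  have hq0 : ContinuousOn (fun _ : ℝ => (0 : ℝ)) (Icc 0 1) := continuousOn_const
  have h1mem : (1 : ℝ) ∈ Icc (0 : ℝ) 1 := by simp
  obtain ⟨hφ, hφ0, hφ1⟩ := dirichletSolution_spec hq lam
  obtain ⟨hχ, hχ0, hχ1⟩ := dirichletSolution_spec hq0 lam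
  have hnt : ∀ {q : ℝ → ℝ}, ContinuousOn q (Icc 0 1) → (dirichletSolution q lam).1 1 = 0 →
      (dirichletSolution q lam).2 1 = 0 → False := by
    intro q hq h0 h1
    obtain ⟨h, -, h1'⟩ := dirichletSolution_spec hq lam
    have := (h.eq_zero_of_one hq h0 h1).2
    rw [h1'] at this
    exact one_ne_zero this
  constructor
  · rintro ⟨ψ, dψ, ψ₀, dψ₀, h, h', ⟨x, hx, hne⟩, -, hz, hz', he, he'⟩
    have hc : dψ 0 ≠ 0 := by
      intro hc
      apply hne
      rw [(h.eqOn_mul_dirichletSolution hq hz hx).1, hc, zero_mul]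
    have e1 := h.eqOn_mul_dirichletSolution hq hz h1mem
    have e2 := h'.eqOn_mul_dirichletSolution hq0 hz' h1mem
    rw [e1.1, e2.1] at he
    rw [e1.2, e2.2] at he'
    have : dψ 0 * dirichletCharFun q lam = 0 := by
      simp only [dirichletCharFun]
      linear_combination (-(dirichletSolution (fun _ => 0) lam).1 1) * he' +
        (dirichletSolution (fun _ => 0) lam).2 1 * he
    exact (mul_eq_zero.1 this).resolve_left hc
  · intro hD
    have hnt1 : ∀ {q : ℝ → ℝ}, ContinuousOn q (Icc 0 1) →
        ∃ x ∈ Icc (0 : ℝ) 1, (dirichletSolution q lam).1 x ≠ 0 := by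
      intro q hq
      obtain ⟨h, h0, h1'⟩ := dirichletSolution_spec hq lam
      by_contra! hcon
      have hd := (h.hasDeriv 0 (by simp))
      have hd' : HasDerivWithinAt (dirichletSolution q lam).1 0 (Icc 0 1) 0 :=
        (hasDerivWithinAt_const (0 : ℝ) (Icc (0 : ℝ) 1) (0 : ℂ)).congr hcon (hcon 0 (by simp))
      have := (uniqueDiffOn_Icc (zero_lt_one' ℝ) 0 (by simp)).eq_deriv _ hd hd'
      rw [h1'] at this
      exact one_ne_zero this
    -- the multiples are chosen so that the Cauchy data at `1` agree
    obtain ⟨c, c', hc, hc', he, he'⟩ : ∃ c c' : ℂ, c ≠ 0 ∧ c' ≠ 0 ∧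
        c' * (dirichletSolution (fun _ => 0) lam).1 1 = c * (dirichletSolution q lam).1 1 ∧
        c' * (dirichletSolution (fun _ => 0) lam).2 1 = c * (dirichletSolution q lam).2 1 := by
      simp only [dirichletCharFun] at hD
      set A := (dirichletSolution (fun _ => 0) lam).1 1
      set B := (dirichletSolution (fun _ => 0) lam).2 1
      set a := (dirichletSolution q lam).1 1 with ha
      set b := (dirichletSolution q lam).2 1 with hb
      by_cases hA : A = 0
      · have hB : B ≠ 0 := fun hB => hnt hq0 hA hB
        have ha0 : a = 0 := by
          rw [hA, zero_mul, zero_sub, neg_eq_zero] at hD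
          exact (mul_eq_zero.1 hD).resolve_left hB
        have hb0 : b ≠ 0 := fun hb0 => hnt hq ha0 hb0
        exact ⟨B, b, hB, hb0, by rw [hA, ha0]; ring, by ring⟩
      · have ha0 : a ≠ 0 := by
          intro ha0
          have : A * b = 0 := by rw [ha0] at hD; linear_combination hD
          exact hnt hq ha0 ((mul_eq_zero.1 this).resolve_left hA)
        exact ⟨A, a, hA, ha0, by ring, by linear_combination -hD⟩
    obtain ⟨x, hx, hne⟩ := hnt1 hq
    obtain ⟨x', hx', hne'⟩ := hnt1 hq0
    exact ⟨_, _, _, _, hφ.const_mul c, hχ.const_mul c', ⟨x, hx, mul_ne_zero hc hne⟩,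
      ⟨x', hx', mul_ne_zero hc' hne'⟩, by simp [hφ0], by simp [hχ0], he, he'⟩

/-- The condition on the set of eigenvalues follows from that on the multiplicities. -/
theorem enumeratesDirichletEigenvalues_of_order {ι : Type} {q : ℝ → ℝ}
    (hq : ContinuousOn q (Icc 0 1)) {lam : ι → ℂ}
    (h : ∀ z : ℂ, analyticOrderAt (dirichletCharFun q) z = {i | lam i = z}.encard) :
    EnumeratesDirichletEigenvalues q lam := by
  refine ⟨fun z => ?_, h⟩
  have ha : AnalyticAt ℂ (dirichletCharFun q) z :=
    (differentiable_dirichletCharFun hq).analyticAt z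
  rw [isDirichletTransmissionEigenvalue_iff hq, ← ha.analyticOrderAt_ne_zero, h z,
    Set.encard_ne_zero]
  rfl

/-! ### Integral equation and integration by parts -/

theorem ContinuousOn.intervalIntegrable_zero {g : ℝ → ℂ} (hg : ContinuousOn g (Icc 0 1)) {x : ℝ}
    (hx : x ∈ Icc (0 : ℝ) 1) : IntervalIntegrable g volume 0 x :=
  (hg.mono (Icc_subset_Icc_right hx.2)).intervalIntegrable_of_Icc hx.1

theorem Complex.norm_sin_le_exp (z : ℂ) : ‖Complex.sin z‖ ≤ Real.exp |z.im| := by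
  rw [Complex.sin, norm_div, norm_mul, Complex.norm_I, mul_one]
  have h1 : ‖Complex.exp (-z * Complex.I)‖ ≤ Real.exp |z.im| := by
    rw [Complex.norm_exp]; simpa using le_abs_self _
  have h2 : ‖Complex.exp (z * Complex.I)‖ ≤ Real.exp |z.im| := by
    rw [Complex.norm_exp]; simpa using neg_le_abs _
  have := norm_sub_le (Complex.exp (-z * Complex.I)) (Complex.exp (z * Complex.I))
  rw [Complex.norm_two]
  linarith

theorem Complex.norm_cos_le_exp (z : ℂ) : ‖Complex.cos z‖ ≤ Real.exp |z.im| := by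
  rw [Complex.cos, norm_div]
  have h1 : ‖Complex.exp (-z * Complex.I)‖ ≤ Real.exp |z.im| := by
    rw [Complex.norm_exp]; simpa using le_abs_self _
  have h2 : ‖Complex.exp (z * Complex.I)‖ ≤ Real.exp |z.im| := by
    rw [Complex.norm_exp]; simpa using neg_le_abs _
  have := norm_add_le (Complex.exp (z * Complex.I)) (Complex.exp (-z * Complex.I))
  rw [Complex.norm_two]
  linarith

theorem abs_im_mul_ofReal_le {k : ℂ} {x y : ℝ} (h : |y| ≤ x) :
    |(k * (y : ℂ)).im| ≤ |k.im| * x := by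
  rw [Complex.im_mul_ofReal, abs_mul]
  gcongr

theorem norm_sin_mul_le {k : ℂ} {x y : ℝ} (h : |y| ≤ x) :
    ‖Complex.sin (k * y)‖ ≤ Real.exp (|k.im| * x) :=
  (Complex.norm_sin_le_exp _).trans (Real.exp_le_exp.2 (abs_im_mul_ofReal_le h))

theorem norm_cos_mul_le {k : ℂ} {x y : ℝ} (h : |y| ≤ x) :
    ‖Complex.cos (k * y)‖ ≤ Real.exp (|k.im| * x) :=
  (Complex.norm_cos_le_exp _).trans (Real.exp_le_exp.2 (abs_im_mul_ofReal_le h))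

theorem hasDerivAt_sin_affine (k : ℂ) (a b : ℝ) (t : ℝ) :
    HasDerivAt (fun t : ℝ => Complex.sin (k * ((a + b * t : ℝ) : ℂ)))
      (k * b * Complex.cos (k * ((a + b * t : ℝ) : ℂ))) t := by
  have h : HasDerivAt (fun t : ℝ => k * ((a + b * t : ℝ) : ℂ)) (k * b) t := by
    have := (HasDerivAt.ofReal_comp (((hasDerivAt_id t).const_mul b).const_add a)).const_mul k
    simpa using this
  have := (Complex.hasDerivAt_sin _).comp t h
  exact this.congr_deriv (by ring)

theorem hasDerivAt_cos_affine (k : ℂ) (a b : ℝ) (t : ℝ) :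
    HasDerivAt (fun t : ℝ => Complex.cos (k * ((a + b * t : ℝ) : ℂ)))
      (-(k * b * Complex.sin (k * ((a + b * t : ℝ) : ℂ)))) t := by
  have h : HasDerivAt (fun t : ℝ => k * ((a + b * t : ℝ) : ℂ)) (k * b) t := by
    have := (HasDerivAt.ofReal_comp (((hasDerivAt_id t).const_mul b).const_add a)).const_mul k
    simpa using this
  have := (Complex.hasDerivAt_cos _).comp t h
  exact this.congr_deriv (by ring)

/-- Integration by parts of a real absolutely continuous function against a complex `C¹`
function. -/
theorem AbsolutelyContinuousOnInterval.integral_ofReal_mul_deriv {g : ℝ → ℝ} {a b : ℝ}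
    (hg : AbsolutelyContinuousOnInterval g a b) {u u' : ℝ → ℂ}
    (hu : ∀ t, HasDerivAt u (u' t) t) (hu' : Continuous u') :
    ∫ t in a..b, (g t : ℂ) * u' t =
      g b * u b - g a * u a - ∫ t in a..b, ((deriv g t : ℝ) : ℂ) * u t := by
  have huc : Continuous u := continuous_iff_continuousAt.2 fun t => (hu t).continuousAt
  have key : ∀ (L : ℂ →L[ℝ] ℝ), ∫ t in a..b, g t * L (u' t) =
      g b * L (u b) - g a * L (u a) - ∫ t in a..b, deriv g t * L (u t) := by
    intro L
    have hd : ∀ t, HasDerivAt (fun t => L (u t)) (L (u' t)) t := fun t =>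
      L.hasFDerivAt.comp_hasDerivAt t (hu t)
    have hde : deriv (fun t => L (u t)) = fun t => L (u' t) := funext fun t => (hd t).deriv
    have hac : AbsolutelyContinuousOnInterval (fun t => L (u t)) a b := by
      refine ContDiffOn.absolutelyContinuousOnInterval ?_
      refine ContDiff.contDiffOn ?_
      rw [contDiff_one_iff_deriv]
      refine ⟨fun t => (hd t).differentiableAt, ?_⟩
      rw [hde]
      fun_prop
    have := hg.integral_mul_deriv_eq_deriv_mul hac
    rw [hde] at this
    exact this
  have hi1 : IntervalIntegrable (fun t => (g t : ℂ) * u' t) volume a b :=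
    ContinuousOn.intervalIntegrable
      ((Complex.continuous_ofReal.comp_continuousOn hg.continuousOn).mul hu'.continuousOn)
  have hi2 : IntervalIntegrable (fun t => ((deriv g t : ℝ) : ℂ) * u t) volume a b := by
    have h1 : IntervalIntegrable (fun t => ((deriv g t : ℝ) : ℂ)) volume a b := by
      have := hg.intervalIntegrable_deriv
      rw [intervalIntegrable_iff] at this ⊢
      exact this.ofReal
    exact h1.mul_continuousOn huc.continuousOn
  have hre := key Complex.reCLM
  have him := key Complex.imCLM
  have e : ∀ (L : ℂ →L[ℝ] ℝ), (∀ (r : ℝ) (z : ℂ), L (r * z) = r * L z) →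
      L (∫ t in a..b, (g t : ℂ) * u' t) =
      L (g b * u b - g a * u a - ∫ t in a..b, ((deriv g t : ℝ) : ℂ) * u t) := by
    intro L hL
    rw [map_sub, map_sub, hL, hL, ← L.intervalIntegral_comp_comm hi1,
      ← L.intervalIntegral_comp_comm hi2]
    simp only [hL]
    exact key L
  apply Complex.ext
  · exact e Complex.reCLM (fun r z => by simp)
  · exact e Complex.imCLM (fun r z => by simp)

/-- The resolvent form of the initial value problem, obtained by variation of constants. -/
theorem dirichletSolution_integral_eq {q : ℝ → ℝ} (hq : ContinuousOn q (Icc 0 1)) (k : ℂ)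
    {x : ℝ} (hx : x ∈ Icc (0 : ℝ) 1) :
    k * (dirichletSolution q (k ^ 2)).1 x = Complex.sin (k * x) +
      ∫ t in (0 : ℝ)..x, Complex.sin (k * ((x - t : ℝ) : ℂ)) *
        ((q t : ℂ) * (dirichletSolution q (k ^ 2)).1 t) := by
  obtain ⟨h, h0, h1⟩ := dirichletSolution_spec hq (k ^ 2)
  set φ := (dirichletSolution q (k ^ 2)).1
  set dφ := (dirichletSolution q (k ^ 2)).2
  have hφc : ContinuousOn φ (Icc 0 1) := fun t ht => (h.hasDeriv t ht).continuousWithinAt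
  have hdφc : ContinuousOn dφ (Icc 0 1) := fun t ht => (h.hasDeriv_deriv t ht).continuousWithinAt
  have hqc : ContinuousOn (fun t => (q t : ℂ)) (Icc 0 1) :=
    Complex.continuous_ofReal.comp_continuousOn hq
  have hsub : Icc 0 x ⊆ Icc (0 : ℝ) 1 := Icc_subset_Icc_right hx.2
  have := intervalIntegral.integral_eq_sub_of_hasDerivAt_of_le (a := 0) (b := x) hx.1
    (f := fun t => k * φ t * Complex.cos (k * ((x + (-1) * t : ℝ) : ℂ)) +
      dφ t * Complex.sin (k * ((x + (-1) * t : ℝ) : ℂ)))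
    (f' := fun t => Complex.sin (k * ((x - t : ℝ) : ℂ)) * ((q t : ℂ) * φ t)) ?_ ?_ ?_
  · rw [this]
    simp [h0, h1]
  · refine ContinuousOn.add ?_ ?_
    · exact (continuousOn_const.mul (hφc.mono hsub)).mul (by fun_prop)
    · exact (hdφc.mono hsub).mul (by fun_prop)
  · intro t ht
    have ht' : t ∈ Icc (0 : ℝ) 1 := hsub ⟨ht.1.le, ht.2.le⟩
    have hnhds : Icc (0 : ℝ) 1 ∈ 𝓝 t := Icc_mem_nhds ht.1 (ht.2.trans_le hx.2)
    have d1 := (h.hasDeriv t ht').hasDerivAt hnhds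
    have d2 := (h.hasDeriv_deriv t ht').hasDerivAt hnhds
    have := ((d1.const_mul k).mul (hasDerivAt_cos_affine k x (-1) t)).add
      (d2.mul (hasDerivAt_sin_affine k x (-1) t))
    refine this.congr_deriv ?_
    have e : x - t = x + (-1) * t := by ring
    rw [e]
    push_cast
    ring
  · refine ContinuousOn.intervalIntegrable_of_Icc hx.1 (ContinuousOn.mul (by fun_prop) ?_)
    exact (hqc.mul hφc).mono hsub

/-- `Δ(k²)` as an integral over the product of the two solutions: the Wronskian of the two
solutions has derivative `q φ₀ φ`. -/
theorem dirichletCharFun_eq_integral {q : ℝ → ℝ} (hq : ContinuousOn q (Icc 0 1)) {k : ℂ}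
    (hk : k ≠ 0) : k * dirichletCharFun q (k ^ 2) =
      ∫ t in (0 : ℝ)..1, (q t : ℂ) * Complex.sin (k * (t : ℂ)) *
        (dirichletSolution q (k ^ 2)).1 t := by
  obtain ⟨h, h0, h1⟩ := dirichletSolution_spec hq (k ^ 2)
  have hz := dirichletSolution_zero hk (x := 1) (by simp)
  rw [dirichletCharFun, hz.1, hz.2]
  set φ := (dirichletSolution q (k ^ 2)).1
  set dφ := (dirichletSolution q (k ^ 2)).2
  have hφc : ContinuousOn φ (Icc 0 1) := fun t ht => (h.hasDeriv t ht).continuousWithinAt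
  have hdφc : ContinuousOn dφ (Icc 0 1) := fun t ht => (h.hasDeriv_deriv t ht).continuousWithinAt
  have hqc : ContinuousOn (fun t => (q t : ℂ)) (Icc 0 1) :=
    Complex.continuous_ofReal.comp_continuousOn hq
  have := intervalIntegral.integral_eq_sub_of_hasDerivAt_of_le (a := 0) (b := 1) zero_le_one
    (f := fun t => dφ t * Complex.sin (k * ((0 + 1 * t : ℝ) : ℂ)) -
      k * φ t * Complex.cos (k * ((0 + 1 * t : ℝ) : ℂ)))
    (f' := fun t => (q t : ℂ) * Complex.sin (k * (t : ℂ)) * φ t) ?_ ?_ ?_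
  · rw [this]
    simp [h0]
    field_simp
  · refine ContinuousOn.sub ?_ ?_
    · exact hdφc.mul (by fun_prop)
    · exact (continuousOn_const.mul hφc).mul (by fun_prop)
  · intro t ht
    have hnhds : Icc (0 : ℝ) 1 ∈ 𝓝 t := Icc_mem_nhds ht.1 ht.2
    have d1 := (h.hasDeriv t ⟨ht.1.le, ht.2.le⟩).hasDerivAt hnhds
    have d2 := (h.hasDeriv_deriv t ⟨ht.1.le, ht.2.le⟩).hasDerivAt hnhds
    have := (d2.mul (hasDerivAt_sin_affine k 0 1 t)).sub
      ((d1.const_mul k).mul (hasDerivAt_cos_affine k 0 1 t))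
    refine this.congr_deriv ?_
    push_cast
    ring_nf
  · refine ContinuousOn.intervalIntegrable_of_Icc zero_le_one ?_
    exact (hqc.mul (by fun_prop)).mul hφc

/-- The resolvent kernel `sin k(x - t)` is bounded in the sup norm with weight `e^{|Im k| x}`. -/
theorem norm_integral_sin_le {k : ℂ} {g : ℝ → ℂ} {M x : ℝ} (hx : x ∈ Icc (0 : ℝ) 1)
    (hg : ∀ t ∈ Icc (0 : ℝ) x, ‖g t‖ ≤ M * Real.exp (|k.im| * t)) :
    ‖∫ t in (0 : ℝ)..x, Complex.sin (k * ((x - t : ℝ) : ℂ)) * g t‖ ≤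
      M * Real.exp (|k.im| * x) := by
  have hM : 0 ≤ M := by
    have := (norm_nonneg _).trans (hg 0 ⟨le_rfl, hx.1⟩)
    simpa using this
  have := intervalIntegral.norm_integral_le_of_norm_le_const (a := (0 : ℝ)) (b := x)
    (f := fun t => Complex.sin (k * ((x - t : ℝ) : ℂ)) * g t)
    (C := M * Real.exp (|k.im| * x)) ?_
  · refine this.trans ?_
    rw [sub_zero, abs_of_nonneg hx.1]
    exact mul_le_of_le_one_right (by positivity) hx.2
  · intro t ht
    rw [uIoc_of_le hx.1] at ht
    rw [norm_mul]
    calc _ ≤ Real.exp (|k.im| * (x - t)) * (M * Real.exp (|k.im| * t)) := by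
          gcongr
          · exact norm_sin_mul_le (abs_of_nonneg (by linarith [ht.2])).le
          · exact hg t ⟨ht.1.le, ht.2⟩
      _ = M * (Real.exp (|k.im| * (x - t)) * Real.exp (|k.im| * t)) := by ring
      _ = _ := by rw [← Real.exp_add]; ring_nf

/-- The Volterra equation with the resolvent kernel is uniformly solvable for large `|k|`, with
respect to the sup norm with weight `e^{|Im k| x}`. -/
theorem norm_le_of_volterra_eq {q : ℝ → ℝ} {k : ℂ} {Mq M : ℝ}
    (hMq : ∀ t ∈ Icc (0 : ℝ) 1, ‖q t‖ ≤ Mq) (hk : 2 * Mq ≤ ‖k‖) (hk0 : k ≠ 0) {d ρ : ℝ → ℂ}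
    (hd : ContinuousOn d (Icc 0 1))
    (heq : ∀ x ∈ Icc (0 : ℝ) 1, d x = ρ x + k⁻¹ * ∫ t in (0 : ℝ)..x,
      Complex.sin (k * ((x - t : ℝ) : ℂ)) * ((q t : ℂ) * d t))
    (hρ : ∀ x ∈ Icc (0 : ℝ) 1, ‖ρ x‖ ≤ M * Real.exp (|k.im| * x)) :
    ∀ x ∈ Icc (0 : ℝ) 1, ‖d x‖ ≤ 2 * M * Real.exp (|k.im| * x) := by
  have hc : ContinuousOn (fun x => ‖d x‖ * Real.exp (-(|k.im| * x))) (Icc 0 1) :=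
    hd.norm.mul (by fun_prop)
  obtain ⟨x₀, hx₀, hmax⟩ := isCompact_Icc.exists_isMaxOn ⟨0, by simp⟩ hc
  set S := ‖d x₀‖ * Real.exp (-(|k.im| * x₀)) with hS
  have hS0 : 0 ≤ S := by positivity
  have hb : ∀ x ∈ Icc (0 : ℝ) 1, ‖d x‖ ≤ S * Real.exp (|k.im| * x) := by
    intro x hx
    have := hmax hx
    simp only [mem_ofPred_eq] at this
    calc ‖d x‖ = ‖d x‖ * Real.exp (-(|k.im| * x)) * Real.exp (|k.im| * x) := by
          rw [mul_assoc, ← Real.exp_add]; simp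
      _ ≤ _ := by gcongr
  have hMq0 : 0 ≤ Mq := (norm_nonneg _).trans (hMq 0 (by simp))
  have hkpos : 0 < ‖k‖ := norm_pos_iff.2 hk0
  have h1 : ‖d x₀‖ ≤ M * Real.exp (|k.im| * x₀) + S / 2 * Real.exp (|k.im| * x₀) := by
    rw [heq x₀ hx₀]
    refine (norm_add_le _ _).trans (add_le_add (hρ x₀ hx₀) ?_)
    rw [norm_mul, norm_inv]
    have := norm_integral_sin_le (k := k) (g := fun t => (q t : ℂ) * d t) (M := Mq * S) hx₀
      (fun t ht => by
        have ht' : t ∈ Icc (0 : ℝ) 1 := ⟨ht.1, ht.2.trans hx₀.2⟩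
        rw [norm_mul, mul_assoc]
        exact mul_le_mul (by simpa using hMq t ht') (hb t ht') (norm_nonneg _) hMq0)
    calc _ ≤ ‖k‖⁻¹ * (Mq * S * Real.exp (|k.im| * x₀)) := by gcongr
      _ = (Mq / ‖k‖) * (S * Real.exp (|k.im| * x₀)) := by ring
      _ ≤ (1 / 2) * (S * Real.exp (|k.im| * x₀)) := by
          have : Mq / ‖k‖ ≤ 1 / 2 := by rw [div_le_iff₀ hkpos]; linarith
          exact mul_le_mul_of_nonneg_right this (by positivity)
      _ = _ := by ring
  have h2 : S ≤ M + S / 2 := by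
    calc S ≤ (M * Real.exp (|k.im| * x₀) + S / 2 * Real.exp (|k.im| * x₀)) *
          Real.exp (-(|k.im| * x₀)) := by rw [hS]; gcongr
      _ = (M + S / 2) * (Real.exp (|k.im| * x₀) * Real.exp (-(|k.im| * x₀))) := by ring
      _ = _ := by rw [← Real.exp_add]; simp
  intro x hx
  refine (hb x hx).trans ?_
  gcongr
  linarith

/-! ### Asymptotics of the characteristic function -/

section IntegrationByParts

variable {g : ℝ → ℝ}

theorem AbsolutelyContinuousOnInterval.mono_zero_one (hg : AbsolutelyContinuousOnInterval g 0 1)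
    {x : ℝ} (hx : x ∈ Icc (0 : ℝ) 1) : AbsolutelyContinuousOnInterval g 0 x :=
  hg.mono (by rw [uIcc_of_le hx.1, uIcc_of_le zero_le_one]; exact Icc_subset_Icc_right hx.2)

theorem AbsolutelyContinuousOnInterval.continuousOn_zero_one
    (hg : AbsolutelyContinuousOnInterval g 0 1) : ContinuousOn g (Icc 0 1) := by
  have := hg.continuousOn
  rwa [uIcc_of_le zero_le_one] at this

theorem integral_mul_cos_by_parts (hg : AbsolutelyContinuousOnInterval g 0 1) (k : ℂ) :
    2 * k * ∫ t in (0 : ℝ)..1, (g t : ℂ) * Complex.cos (2 * k * t) =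
      g 1 * Complex.sin (2 * k) - ∫ t in (0 : ℝ)..1,
        ((deriv g t : ℝ) : ℂ) * Complex.sin (2 * k * t) := by
  have := hg.integral_ofReal_mul_deriv (hasDerivAt_sin_affine (2 * k) 0 1) (by fun_prop)
  simp only [Complex.ofReal_one, mul_one, zero_add, one_mul, Complex.ofReal_zero, mul_zero,
    Complex.sin_zero, sub_zero] at this
  rw [← this, ← intervalIntegral.integral_const_mul]
  congr 1
  funext t
  ring

theorem integral_mul_sin_by_parts (hg : AbsolutelyContinuousOnInterval g 0 1) (k : ℂ) :
    2 * k * ∫ t in (0 : ℝ)..1, (g t : ℂ) * Complex.sin (2 * k * t) =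
      g 0 - g 1 * Complex.cos (2 * k) + ∫ t in (0 : ℝ)..1,
        ((deriv g t : ℝ) : ℂ) * Complex.cos (2 * k * t) := by
  have := hg.integral_ofReal_mul_deriv (hasDerivAt_cos_affine (2 * k) 0 1) (by fun_prop)
  simp only [Complex.ofReal_one, mul_one, zero_add, one_mul, Complex.ofReal_zero, mul_zero,
    Complex.cos_zero, mul_neg, intervalIntegral.integral_neg] at this
  rw [← intervalIntegral.integral_const_mul]
  have e : (∫ t in (0 : ℝ)..1, 2 * k * ((g t : ℂ) * Complex.sin (2 * k * t))) =
      ∫ t in (0 : ℝ)..1, (g t : ℂ) * (2 * k * Complex.sin (2 * k * t)) := by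
    congr 1; funext t; ring
  rw [e]
  linear_combination -this

theorem integral_mul_cos_sub_by_parts (hg : AbsolutelyContinuousOnInterval g 0 1) (k : ℂ) {x : ℝ}
    (hx : x ∈ Icc (0 : ℝ) 1) :
    2 * k * ∫ t in (0 : ℝ)..x, (g t : ℂ) * Complex.cos (k * ((x - 2 * t : ℝ) : ℂ)) =
      (g x + g 0) * Complex.sin (k * x) + ∫ t in (0 : ℝ)..x,
        ((deriv g t : ℝ) : ℂ) * Complex.sin (k * ((x - 2 * t : ℝ) : ℂ)) := by
  have := (hg.mono_zero_one hx).integral_ofReal_mul_deriv (hasDerivAt_sin_affine k x (-2))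
    (by fun_prop)
  have e1 : ∀ t : ℝ, x + (-2) * t = x - 2 * t := fun t => by ring
  have e2 : x - 2 * x = -x := by ring
  simp only [e1, e2, mul_zero, add_zero] at this
  have e3 : Complex.sin (k * ((-x : ℝ) : ℂ)) = -Complex.sin (k * x) := by
    rw [Complex.ofReal_neg, mul_neg, Complex.sin_neg]
  have e : (∫ t in (0 : ℝ)..x, (g t : ℂ) * (k * ((-2 : ℝ) : ℂ) *
      Complex.cos (k * ((x - 2 * t : ℝ) : ℂ)))) = -(2 * k) *
      ∫ t in (0 : ℝ)..x, (g t : ℂ) * Complex.cos (k * ((x - 2 * t : ℝ) : ℂ)) := by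
    rw [← intervalIntegral.integral_const_mul]
    congr 1; funext t; push_cast; ring
  rw [e, e3] at this
  linear_combination -this

theorem integral_mul_sin_sub_by_parts (hg : AbsolutelyContinuousOnInterval g 0 1) (k : ℂ) {x : ℝ}
    (hx : x ∈ Icc (0 : ℝ) 1) :
    2 * k * ∫ t in (0 : ℝ)..x, (g t : ℂ) * Complex.sin (k * ((x - 2 * t : ℝ) : ℂ)) =
      (g x - g 0) * Complex.cos (k * x) - ∫ t in (0 : ℝ)..x,
        ((deriv g t : ℝ) : ℂ) * Complex.cos (k * ((x - 2 * t : ℝ) : ℂ)) := by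
  have := (hg.mono_zero_one hx).integral_ofReal_mul_deriv (hasDerivAt_cos_affine k x (-2))
    (by fun_prop)
  have e1 : ∀ t : ℝ, x + (-2) * t = x - 2 * t := fun t => by ring
  have e2 : x - 2 * x = -x := by ring
  simp only [e1, e2, mul_zero, add_zero] at this
  have e : (∫ t in (0 : ℝ)..x, (g t : ℂ) * -(k * ((-2 : ℝ) : ℂ) *
      Complex.sin (k * ((x - 2 * t : ℝ) : ℂ)))) = (2 * k) *
      ∫ t in (0 : ℝ)..x, (g t : ℂ) * Complex.sin (k * ((x - 2 * t : ℝ) : ℂ)) := by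
    rw [← intervalIntegral.integral_const_mul]
    congr 1; funext t; push_cast; ring
  have e3 : Complex.cos (k * ((-x : ℝ) : ℂ)) = Complex.cos (k * x) := by
    rw [Complex.ofReal_neg, mul_neg, Complex.cos_neg]
  rw [e, e3] at this
  linear_combination this

theorem abs_sub_two_mul_le {x t : ℝ} (ht : t ∈ Icc 0 x) : |x - 2 * t| ≤ x := by
  rw [abs_le]; constructor <;> linarith [ht.1, ht.2]

theorem norm_integral_deriv_mul_le (hg : AbsolutelyContinuousOnInterval g 0 1) {u : ℝ → ℂ}
    {M x : ℝ} (hM : 0 ≤ M) (hx : x ∈ Icc (0 : ℝ) 1) (hu : ∀ t ∈ Icc (0 : ℝ) x, ‖u t‖ ≤ M) :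
    ‖∫ t in (0 : ℝ)..x, ((deriv g t : ℝ) : ℂ) * u t‖ ≤
      (∫ t in (0 : ℝ)..1, |deriv g t|) * M := by
  have hi : IntervalIntegrable (fun t => |deriv g t|) volume 0 1 := hg.intervalIntegrable_deriv.abs
  have hi' : IntervalIntegrable (fun t => |deriv g t|) volume 0 x :=
    (hg.mono_zero_one hx).intervalIntegrable_deriv.abs
  calc _ ≤ ∫ t in (0 : ℝ)..x, |deriv g t| * M := by
        refine intervalIntegral.norm_integral_le_of_norm_le hx.1
          (Eventually.of_forall fun t ht => ?_) (hi'.mul_const M)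
        rw [norm_mul, Complex.norm_real, Real.norm_eq_abs]
        gcongr
        exact hu t ⟨ht.1.le, ht.2⟩
    _ = (∫ t in (0 : ℝ)..x, |deriv g t|) * M := intervalIntegral.integral_mul_const _ _
    _ ≤ _ := by
        gcongr
        exact intervalIntegral.integral_mono_interval le_rfl hx.1 hx.2
          (Eventually.of_forall fun t => abs_nonneg _) hi

/-- One integration by parts gains a factor `1 / |k|`. -/
theorem exists_norm_integral_sub_le (hg : AbsolutelyContinuousOnInterval g 0 1) :
    ∃ N : ℝ, 0 ≤ N ∧ ∀ k : ℂ, k ≠ 0 → ∀ x ∈ Icc (0 : ℝ) 1,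
      ‖∫ t in (0 : ℝ)..x, (g t : ℂ) * Complex.cos (k * ((x - 2 * t : ℝ) : ℂ))‖ ≤
        N / ‖k‖ * Real.exp (|k.im| * x) ∧
      ‖∫ t in (0 : ℝ)..x, (g t : ℂ) * Complex.sin (k * ((x - 2 * t : ℝ) : ℂ))‖ ≤
        N / ‖k‖ * Real.exp (|k.im| * x) := by
  obtain ⟨M, hM⟩ := isCompact_Icc.exists_bound_of_continuousOn hg.continuousOn_zero_one
  set L := ∫ t in (0 : ℝ)..1, |deriv g t| with hL
  have hL0 : 0 ≤ L := intervalIntegral.integral_nonneg zero_le_one fun t _ => abs_nonneg _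
  have hM0 : 0 ≤ M := (norm_nonneg _).trans (hM 0 (by simp))
  refine ⟨2 * M + L, by positivity, fun k hk x hx => ?_⟩
  have hk' : 0 < ‖k‖ := norm_pos_iff.2 hk
  have hgx := hM x hx
  have hg0 := hM 0 (by simp)
  set E := Real.exp (|k.im| * x)
  have hE : 0 < E := Real.exp_pos _
  have key : ∀ (I J s c : ℂ), 2 * k * I = c * s + J → ‖s‖ ≤ E → ‖c‖ ≤ 2 * M → ‖J‖ ≤ L * E →
      ‖I‖ ≤ (2 * M + L) / ‖k‖ * E := by
    intro I J s c h hs hc hJ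
    have h1 : ‖2 * k * I‖ ≤ 2 * M * E + L * E := by
      rw [h]
      refine (norm_add_le _ _).trans (add_le_add ?_ hJ)
      rw [norm_mul]
      exact mul_le_mul hc hs (norm_nonneg _) (by positivity)
    rw [norm_mul, norm_mul, Complex.norm_two] at h1
    rw [div_mul_eq_mul_div, le_div_iff₀ hk']
    nlinarith [norm_nonneg I]
  have hxx : |x| ≤ x := (abs_of_nonneg hx.1).le
  constructor
  · refine key _ _ _ _ (integral_mul_cos_sub_by_parts hg k hx) (norm_sin_mul_le hxx) ?_
      (norm_integral_deriv_mul_le hg hE.le hx fun t ht => norm_sin_mul_le (abs_sub_two_mul_le ht))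
    refine (norm_add_le _ _).trans ?_
    simp only [Complex.norm_real]
    linarith
  · refine key _ (-_) _ _ ((integral_mul_sin_sub_by_parts hg k hx).trans (sub_eq_add_neg _ _))
      (norm_cos_mul_le hxx) ?_ ?_
    · refine (norm_sub_le _ _).trans ?_
      simp only [Complex.norm_real]
      linarith
    · rw [norm_neg]
      exact norm_integral_deriv_mul_le hg hE.le hx fun t ht =>
        norm_cos_mul_le (abs_sub_two_mul_le ht)

end IntegrationByParts

/-- An approximate solution of the integral equation with residual `ρ` gives an approximation
of `4 k³ Δ(k²)`. -/
theorem norm_charFun_sub_le {q : ℝ → ℝ} (hq : ContinuousOn q (Icc 0 1)) {k : ℂ} {Mq M : ℝ}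
    (hMq : ∀ t ∈ Icc (0 : ℝ) 1, ‖q t‖ ≤ Mq) (hk : 2 * Mq ≤ ‖k‖) (hk0 : k ≠ 0) {Φ : ℝ → ℂ}
    (hΦ : ContinuousOn Φ (Icc 0 1))
    (hρ : ∀ x ∈ Icc (0 : ℝ) 1, ‖Complex.sin (k * x) + (k⁻¹ * ∫ t in (0 : ℝ)..x,
      Complex.sin (k * ((x - t : ℝ) : ℂ)) * ((q t : ℂ) * Φ t)) - Φ x‖ ≤
        M * Real.exp (|k.im| * x)) :
    ‖4 * k ^ 3 * dirichletCharFun q (k ^ 2) -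
      4 * k * ∫ t in (0 : ℝ)..1, (q t : ℂ) * Complex.sin (k * t) * Φ t‖ ≤
      8 * Mq * M * ‖k‖ * Real.exp (2 * |k.im|) := by
  obtain ⟨h, h0, h1⟩ := dirichletSolution_spec hq (k ^ 2)
  have hint := fun x hx => dirichletSolution_integral_eq hq k (x := x) hx
  have hD := dirichletCharFun_eq_integral hq hk0
  set φ := (dirichletSolution q (k ^ 2)).1
  have hφc : ContinuousOn φ (Icc 0 1) := fun t ht => (h.hasDeriv t ht).continuousWithinAt
  have hqc : ContinuousOn (fun t => (q t : ℂ)) (Icc 0 1) :=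
    Complex.continuous_ofReal.comp_continuousOn hq
  have hMq0 : 0 ≤ Mq := (norm_nonneg _).trans (hMq 0 (by simp))
  set d : ℝ → ℂ := fun x => k * φ x - Φ x with hd
  have hdc : ContinuousOn d (Icc 0 1) := (continuousOn_const.mul hφc).sub hΦ
  have hdb := norm_le_of_volterra_eq hMq hk hk0 hdc (fun x hx => by
    have i1 : IntervalIntegrable (fun t => Complex.sin (k * ((x - t : ℝ) : ℂ)) *
        ((q t : ℂ) * φ t)) volume 0 x :=
      ContinuousOn.intervalIntegrable_zero (ContinuousOn.mul (by fun_prop) (hqc.mul hφc)) hx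
    have i2 : IntervalIntegrable (fun t => Complex.sin (k * ((x - t : ℝ) : ℂ)) *
        ((q t : ℂ) * Φ t)) volume 0 x :=
      ContinuousOn.intervalIntegrable_zero (ContinuousOn.mul (by fun_prop) (hqc.mul hΦ)) hx
    have e : (∫ t in (0 : ℝ)..x, Complex.sin (k * ((x - t : ℝ) : ℂ)) * ((q t : ℂ) * d t)) =
        k * (∫ t in (0 : ℝ)..x, Complex.sin (k * ((x - t : ℝ) : ℂ)) * ((q t : ℂ) * φ t)) -
        ∫ t in (0 : ℝ)..x, Complex.sin (k * ((x - t : ℝ) : ℂ)) * ((q t : ℂ) * Φ t) := by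
      rw [← intervalIntegral.integral_const_mul, ← intervalIntegral.integral_sub
        (i1.const_mul k) i2]
      congr 1; funext t; simp only [hd]; ring
    rw [e]
    simp only [hd]
    rw [hint x hx]
    field_simp
    ring) hρ
  have i1 : IntervalIntegrable (fun t => (q t : ℂ) * Complex.sin (k * t) * φ t) volume 0 1 :=
    ContinuousOn.intervalIntegrable_zero ((hqc.mul (by fun_prop)).mul hφc) (by simp)
  have i2 : IntervalIntegrable (fun t => (q t : ℂ) * Complex.sin (k * t) * Φ t) volume 0 1 :=
    ContinuousOn.intervalIntegrable_zero ((hqc.mul (by fun_prop)).mul hΦ) (by simp)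
  have e : 4 * k ^ 3 * dirichletCharFun q (k ^ 2) -
      4 * k * ∫ t in (0 : ℝ)..1, (q t : ℂ) * Complex.sin (k * t) * Φ t =
      4 * k * ∫ t in (0 : ℝ)..1, (q t : ℂ) * Complex.sin (k * t) * d t := by
    have : (∫ t in (0 : ℝ)..1, (q t : ℂ) * Complex.sin (k * t) * d t) =
        k * (∫ t in (0 : ℝ)..1, (q t : ℂ) * Complex.sin (k * t) * φ t) -
        ∫ t in (0 : ℝ)..1, (q t : ℂ) * Complex.sin (k * t) * Φ t := by
      rw [← intervalIntegral.integral_const_mul, ← intervalIntegral.integral_sub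
        (i1.const_mul k) i2]
      congr 1; funext t; simp only [hd]; ring
    rw [this, ← hD]
    ring
  have hM0 : 0 ≤ M := by
    have := (norm_nonneg _).trans (hρ 0 (by simp))
    simpa using this
  have hb : ‖∫ t in (0 : ℝ)..1, (q t : ℂ) * Complex.sin (k * t) * d t‖ ≤
      2 * Mq * M * Real.exp (2 * |k.im|) := by
    have := intervalIntegral.norm_integral_le_of_norm_le_const (a := (0 : ℝ)) (b := 1)
      (f := fun t => (q t : ℂ) * Complex.sin (k * t) * d t)
      (C := 2 * Mq * M * Real.exp (2 * |k.im|)) (fun t ht => by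
        rw [uIoc_of_le zero_le_one] at ht
        have ht' : t ∈ Icc (0 : ℝ) 1 := ⟨ht.1.le, ht.2⟩
        rw [norm_mul, norm_mul]
        have hexp : Real.exp (|k.im| * t) ≤ Real.exp |k.im| :=
          Real.exp_le_exp.2 (mul_le_of_le_one_right (abs_nonneg _) ht.2)
        have e1 : ‖(q t : ℂ)‖ ≤ Mq := by simpa using hMq t ht'
        have e2 : ‖Complex.sin (k * t)‖ ≤ Real.exp |k.im| :=
          (norm_sin_mul_le (abs_of_nonneg ht'.1).le).trans hexp
        have e3 : ‖d t‖ ≤ 2 * M * Real.exp |k.im| := by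
          refine (hdb t ht').trans ?_
          gcongr
        calc _ ≤ Mq * Real.exp |k.im| * (2 * M * Real.exp |k.im|) := by gcongr
          _ = 2 * Mq * M * (Real.exp |k.im| * Real.exp |k.im|) := by ring
          _ = _ := by rw [← Real.exp_add]; ring_nf)
    simpa using this
  rw [e, norm_mul, norm_mul]
  calc _ ≤ ‖(4 : ℂ)‖ * ‖k‖ * (2 * Mq * M * Real.exp (2 * |k.im|)) := by gcongr
    _ = _ := by rw [show ‖(4 : ℂ)‖ = 4 by simp]; ring

section Expansion

variable {q : ℝ → ℝ}

theorem continuousOn_primitive (hq : ContinuousOn q (Icc 0 1)) :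
    ContinuousOn (fun x => ∫ s in (0 : ℝ)..x, q s) (Icc 0 1) := by
  have := intervalIntegral.continuousOn_primitive_interval' (a := (0 : ℝ)) (b₁ := 0) (b₂ := 1)
    (f := q) (μ := volume) (hq.intervalIntegrable_of_Icc zero_le_one) (by simp)
  rwa [uIcc_of_le zero_le_one] at this

theorem hasDerivAt_primitive (hq : ContinuousOn q (Icc 0 1)) {x : ℝ} (hx : x ∈ Ioo (0 : ℝ) 1) :
    HasDerivAt (fun x => ∫ s in (0 : ℝ)..x, q s) (q x) x := by
  have hnhds : Icc (0 : ℝ) 1 ∈ 𝓝 x := Icc_mem_nhds hx.1 hx.2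
  refine intervalIntegral.integral_hasDerivAt_right ?_ ?_ (hq.continuousAt hnhds)
  · exact (hq.mono (Icc_subset_Icc_right hx.2.le)).intervalIntegrable_of_Icc hx.1.le
  · exact ContinuousOn.stronglyMeasurableAtFilter_nhdsWithin
      (hq.mono Ioo_subset_Icc_self) measurableSet_Ioo x |>.filter_mono
      (by rw [isOpen_Ioo.nhdsWithin_eq hx])

theorem integral_mul_primitive (hq : ContinuousOn q (Icc 0 1)) {x : ℝ}
    (hx : x ∈ Icc (0 : ℝ) 1) :
    ∫ t in (0 : ℝ)..x, q t * ∫ s in (0 : ℝ)..t, q s = (∫ s in (0 : ℝ)..x, q s) ^ 2 / 2 := by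
  have hsub : Icc 0 x ⊆ Icc (0 : ℝ) 1 := Icc_subset_Icc_right hx.2
  have hQ := continuousOn_primitive hq
  rw [intervalIntegral.integral_eq_sub_of_hasDerivAt_of_le hx.1
    (f := fun x => (∫ s in (0 : ℝ)..x, q s) ^ 2 / 2)]
  · simp
  · exact ((hQ.pow 2).div_const 2).mono hsub
  · intro t ht
    refine (((hasDerivAt_primitive hq ⟨ht.1, ht.2.trans_le hx.2⟩).pow 2).div_const 2).congr_deriv ?_
    ring
  · exact ((hq.mul hQ).mono hsub).intervalIntegrable_of_Icc hx.1

theorem integral_mul_primitive_sq (hq : ContinuousOn q (Icc 0 1)) :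
    ∫ t in (0 : ℝ)..1, q t * (∫ s in (0 : ℝ)..t, q s) ^ 2 = omega q ^ 3 / 3 := by
  have hQ := continuousOn_primitive hq
  rw [intervalIntegral.integral_eq_sub_of_hasDerivAt_of_le zero_le_one
    (f := fun x => (∫ s in (0 : ℝ)..x, q s) ^ 3 / 3)]
  · simp [omega]
  · exact (hQ.pow 3).div_const 3
  · intro t ht
    refine (((hasDerivAt_primitive hq ht).pow 3).div_const 3).congr_deriv ?_
    ring
  · exact (hq.mul (hQ.pow 2)).intervalIntegrable_of_Icc zero_le_one

/-- The residual of the first order approximation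
`sin kx - (cos kx / 2k) ∫₀ˣ q` in the integral equation. -/
theorem residual_first_order (hq : ContinuousOn q (Icc 0 1)) {k : ℂ} (hk0 : k ≠ 0) {x : ℝ}
    (hx : x ∈ Icc (0 : ℝ) 1) :
    Complex.sin (k * x) + (k⁻¹ * ∫ t in (0 : ℝ)..x, Complex.sin (k * ((x - t : ℝ) : ℂ)) *
      ((q t : ℂ) * (Complex.sin (k * t) -
        Complex.cos (k * t) * ((∫ s in (0 : ℝ)..t, q s : ℝ) : ℂ) / (2 * k)))) -
      (Complex.sin (k * x) - Complex.cos (k * x) * ((∫ s in (0 : ℝ)..x, q s : ℝ) : ℂ) / (2 * k)) =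
    (2 * k)⁻¹ * (∫ t in (0 : ℝ)..x, (q t : ℂ) * Complex.cos (k * ((x - 2 * t : ℝ) : ℂ))) -
      (2 * k ^ 2)⁻¹ * ∫ t in (0 : ℝ)..x, Complex.sin (k * ((x - t : ℝ) : ℂ)) *
        ((q t : ℂ) * (Complex.cos (k * t) * ((∫ s in (0 : ℝ)..t, q s : ℝ) : ℂ))) := by
  have hqc : ContinuousOn (fun t => (q t : ℂ)) (Icc 0 1) :=
    Complex.continuous_ofReal.comp_continuousOn hq
  have hQc : ContinuousOn (fun t => ((∫ s in (0 : ℝ)..t, q s : ℝ) : ℂ)) (Icc 0 1) :=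
    Complex.continuous_ofReal.comp_continuousOn (continuousOn_primitive hq)
  have i1 : IntervalIntegrable (fun t : ℝ => (q t : ℂ) * Complex.cos (k * ((x - 2 * t : ℝ) : ℂ)))
      volume 0 x := ContinuousOn.intervalIntegrable_zero (hqc.mul (by fun_prop)) hx
  have i2 : IntervalIntegrable (fun t : ℝ => (q t : ℂ)) volume 0 x :=
    ContinuousOn.intervalIntegrable_zero hqc hx
  have i3 : IntervalIntegrable (fun t : ℝ => Complex.sin (k * ((x - t : ℝ) : ℂ)) *
        ((q t : ℂ) * (Complex.cos (k * t) * ((∫ s in (0 : ℝ)..t, q s : ℝ) : ℂ)))) volume 0 x :=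
    ContinuousOn.intervalIntegrable_zero (ContinuousOn.mul (by fun_prop)
      (hqc.mul (ContinuousOn.mul (by fun_prop) hQc))) hx
  have e : (∫ t in (0 : ℝ)..x, Complex.sin (k * ((x - t : ℝ) : ℂ)) *
      ((q t : ℂ) * (Complex.sin (k * t) -
        Complex.cos (k * t) * ((∫ s in (0 : ℝ)..t, q s : ℝ) : ℂ) / (2 * k)))) =
      (1 / 2) * ((∫ t in (0 : ℝ)..x, (q t : ℂ) * Complex.cos (k * ((x - 2 * t : ℝ) : ℂ))) -
        Complex.cos (k * x) * ∫ t in (0 : ℝ)..x, (q t : ℂ)) -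
      (2 * k)⁻¹ * ∫ t in (0 : ℝ)..x, Complex.sin (k * ((x - t : ℝ) : ℂ)) *
        ((q t : ℂ) * (Complex.cos (k * t) * ((∫ s in (0 : ℝ)..t, q s : ℝ) : ℂ))) := by
    rw [← intervalIntegral.integral_const_mul (Complex.cos (k * x)),
      ← intervalIntegral.integral_sub i1 (i2.const_mul _), ← intervalIntegral.integral_const_mul,
      ← intervalIntegral.integral_const_mul, ← intervalIntegral.integral_sub
        ((i1.sub (i2.const_mul _)).const_mul _) (i3.const_mul _)]
    refine intervalIntegral.integral_congr fun t _ => ?_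
    have a1 : k * ((x - 2 * t : ℝ) : ℂ) = k * ((x - t : ℝ) : ℂ) - k * t := by push_cast; ring
    have a2 : k * (x : ℂ) = k * ((x - t : ℝ) : ℂ) + k * t := by push_cast; ring
    rw [a1, a2, Complex.cos_sub, Complex.cos_add]
    field_simp
    ring
  rw [e, intervalIntegral.integral_ofReal]
  field_simp
  ring

/-- The first order approximation, inserted in the formula for `Δ`, produces the leading part: the
term `2 ω k` is the mean of `sin²`, and `q(1) sin 2k` is the boundary term of an integration by
parts. -/
theorem integral_first_order (hq : AbsolutelyContinuousOnInterval q 0 1) {k : ℂ} (hk0 : k ≠ 0) :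
    4 * k * ∫ t in (0 : ℝ)..1, (q t : ℂ) * Complex.sin (k * t) * (Complex.sin (k * t) -
        Complex.cos (k * t) * ((∫ s in (0 : ℝ)..t, q s : ℝ) : ℂ) / (2 * k)) =
      2 * omega q * k - q 1 * Complex.sin (2 * k) +
        ∫ t in (0 : ℝ)..1, ((deriv q t - q t * ∫ s in (0 : ℝ)..t, q s : ℝ) : ℂ) *
          Complex.sin (2 * k * t) := by
  have hqq := hq.continuousOn_zero_one
  have hqc : ContinuousOn (fun t => (q t : ℂ)) (Icc 0 1) :=
    Complex.continuous_ofReal.comp_continuousOn hqq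
  have hQc : ContinuousOn (fun t => ((∫ s in (0 : ℝ)..t, q s : ℝ) : ℂ)) (Icc 0 1) :=
    Complex.continuous_ofReal.comp_continuousOn (continuousOn_primitive hqq)
  have h1 : (1 : ℝ) ∈ Icc (0 : ℝ) 1 := by simp
  have i1 : IntervalIntegrable (fun t : ℝ => (q t : ℂ)) volume 0 1 := hqc.intervalIntegrable_zero h1
  have i2 : IntervalIntegrable (fun t : ℝ => (q t : ℂ) * Complex.cos (2 * k * t)) volume 0 1 :=
    ContinuousOn.intervalIntegrable_zero (hqc.mul (by fun_prop)) h1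
  have i3 : IntervalIntegrable (fun t : ℝ => (q t : ℂ) * ((∫ s in (0 : ℝ)..t, q s : ℝ) : ℂ) *
      Complex.sin (2 * k * t)) volume 0 1 :=
    ContinuousOn.intervalIntegrable_zero ((hqc.mul hQc).mul (by fun_prop)) h1
  have i4 : IntervalIntegrable (fun t : ℝ => ((deriv q t : ℝ) : ℂ) *
      Complex.sin (2 * k * t)) volume 0 1 := by
    have h1 : IntervalIntegrable (fun t => ((deriv q t : ℝ) : ℂ)) volume 0 1 := by
      have := hq.intervalIntegrable_deriv
      rw [intervalIntegrable_iff] at this ⊢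
      exact this.ofReal
    exact h1.mul_continuousOn (by fun_prop)
  have e1 : (∫ t in (0 : ℝ)..1, (q t : ℂ) * Complex.sin (k * t) * (Complex.sin (k * t) -
        Complex.cos (k * t) * ((∫ s in (0 : ℝ)..t, q s : ℝ) : ℂ) / (2 * k))) =
      (1 / 2) * ((∫ t in (0 : ℝ)..1, (q t : ℂ)) - ∫ t in (0 : ℝ)..1, (q t : ℂ) *
        Complex.cos (2 * k * t)) - (4 * k)⁻¹ * ∫ t in (0 : ℝ)..1, (q t : ℂ) *
          ((∫ s in (0 : ℝ)..t, q s : ℝ) : ℂ) * Complex.sin (2 * k * t) := by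
    rw [← intervalIntegral.integral_sub i1 i2, ← intervalIntegral.integral_const_mul,
      ← intervalIntegral.integral_const_mul, ← intervalIntegral.integral_sub
        ((i1.sub i2).const_mul _) (i3.const_mul _)]
    refine intervalIntegral.integral_congr fun t _ => ?_
    have a1 : 2 * k * (t : ℂ) = 2 * (k * t) := by ring
    have a2 := Complex.sin_sq_add_cos_sq (k * t)
    simp only [a1, Complex.sin_two_mul, Complex.cos_two_mul']
    field_simp
    linear_combination (4 * k * (q t : ℂ)) * a2
  have e2 : (∫ t in (0 : ℝ)..1, ((deriv q t - q t * ∫ s in (0 : ℝ)..t, q s : ℝ) : ℂ) *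
          Complex.sin (2 * k * t)) = (∫ t in (0 : ℝ)..1, ((deriv q t : ℝ) : ℂ) *
          Complex.sin (2 * k * t)) - ∫ t in (0 : ℝ)..1, (q t : ℂ) *
          ((∫ s in (0 : ℝ)..t, q s : ℝ) : ℂ) * Complex.sin (2 * k * t) := by
    rw [← intervalIntegral.integral_sub i4 i3]
    congr 1; funext t; push_cast; ring
  have e3 := integral_mul_cos_by_parts hq k
  have e4 : (omega q : ℂ) = ∫ t in (0 : ℝ)..1, (q t : ℂ) := by
    rw [omega, intervalIntegral.integral_ofReal]
  have e5 : 4 * k * (4 * k)⁻¹ = 1 := mul_inv_cancel₀ (by simpa using hk0)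
  rw [e1, e2, e4]
  linear_combination (-1) * e3 - (∫ t in (0 : ℝ)..1, (q t : ℂ) *
    ((∫ s in (0 : ℝ)..t, q s : ℝ) : ℂ) * Complex.sin (2 * k * t)) * e5

/-- First order expansion of the characteristic function for `q ∈ W_2^1`. -/
theorem charFun_expansion_first_order (hq : MemW21 q) :
    ∃ g : ℝ → ℝ, MemLp g 2 (volume.restrict (Ioo (0 : ℝ) 1)) ∧ ∃ C K : ℝ, 0 < K ∧
      ∀ k : ℂ, K ≤ ‖k‖ → ‖4 * k ^ 3 * dirichletCharFun q (k ^ 2) -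
        (2 * omega q * k - q 1 * Complex.sin (2 * k)) -
        ∫ t in (0 : ℝ)..1, (g t : ℂ) * Complex.sin (2 * k * t)‖ ≤
        C / ‖k‖ * Real.exp (2 * |k.im|) := by
  obtain ⟨hac, hL2⟩ := hq
  have hqq := hac.continuousOn_zero_one
  have hQ := continuousOn_primitive hqq
  have hqc : ContinuousOn (fun t => (q t : ℂ)) (Icc 0 1) :=
    Complex.continuous_ofReal.comp_continuousOn hqq
  have hQc : ContinuousOn (fun t => ((∫ s in (0 : ℝ)..t, q s : ℝ) : ℂ)) (Icc 0 1) :=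
    Complex.continuous_ofReal.comp_continuousOn hQ
  refine ⟨fun t => deriv q t - q t * ∫ s in (0 : ℝ)..t, q s, hL2.sub ?_, ?_⟩
  · have hqQ := hqq.mul hQ
    obtain ⟨N, hN⟩ := isCompact_Icc.exists_bound_of_continuousOn hqQ
    refine MemLp.of_bound ((hqQ.mono Ioo_subset_Icc_self).aestronglyMeasurable measurableSet_Ioo)
      N ?_
    exact (ae_restrict_iff' measurableSet_Ioo).2 (Eventually.of_forall fun t ht =>
      hN t (Ioo_subset_Icc_self ht))
  obtain ⟨Mq, hMq⟩ := isCompact_Icc.exists_bound_of_continuousOn hqq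
  obtain ⟨MQ, hMQ⟩ := isCompact_Icc.exists_bound_of_continuousOn hQ
  have hMq0 : 0 ≤ Mq := (norm_nonneg _).trans (hMq 0 (by simp))
  have hMQ0 : 0 ≤ MQ := (norm_nonneg _).trans (hMQ 0 (by simp))
  obtain ⟨N, hN0, hN⟩ := exists_norm_integral_sub_le hac
  refine ⟨8 * Mq * (N / 2 + Mq * MQ / 2), 2 * Mq + 1, by positivity, fun k hk => ?_⟩
  have hkpos : 0 < ‖k‖ := by linarith
  have hk0 : k ≠ 0 := norm_pos_iff.1 hkpos
  have := norm_charFun_sub_le hqq (M := (N / 2 + Mq * MQ / 2) / ‖k‖ ^ 2) hMq (by linarith) hk0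
    (Φ := fun t => Complex.sin (k * t) -
        Complex.cos (k * t) * ((∫ s in (0 : ℝ)..t, q s : ℝ) : ℂ) / (2 * k))
    (ContinuousOn.sub (by fun_prop) ((ContinuousOn.mul (by fun_prop) hQc).div_const _))
    (fun x hx => ?_)
  · rw [integral_first_order hac hk0] at this
    rw [sub_sub]
    refine this.trans (le_of_eq ?_)
    field_simp
  · rw [residual_first_order hqq hk0 hx]
    have hb := norm_integral_sin_le (k := k) (M := Mq * MQ) hx (g := fun t =>
      (q t : ℂ) * (Complex.cos (k * t) * ((∫ s in (0 : ℝ)..t, q s : ℝ) : ℂ))) (fun t ht => by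
        have ht' : t ∈ Icc (0 : ℝ) 1 := ⟨ht.1, ht.2.trans hx.2⟩
        rw [norm_mul, norm_mul]
        have e1 : ‖(q t : ℂ)‖ ≤ Mq := by simpa using hMq t ht'
        have e2 : ‖((∫ s in (0 : ℝ)..t, q s : ℝ) : ℂ)‖ ≤ MQ := by
          rw [Complex.norm_real]; exact hMQ t ht'
        have e3 : ‖Complex.cos (k * t)‖ ≤ Real.exp (|k.im| * t) :=
          norm_cos_mul_le (abs_of_nonneg ht'.1).le
        calc _ ≤ Mq * (Real.exp (|k.im| * t) * MQ) := by gcongr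
          _ = _ := by ring)
    have hc := (hN k hk0 x hx).1
    refine (norm_sub_le _ _).trans ?_
    rw [norm_mul, norm_mul, norm_inv, norm_inv, norm_mul, norm_mul, norm_pow, Complex.norm_two]
    calc _ ≤ (2 * ‖k‖)⁻¹ * (N / ‖k‖ * Real.exp (|k.im| * x)) +
          (2 * ‖k‖ ^ 2)⁻¹ * (Mq * MQ * Real.exp (|k.im| * x)) := by gcongr
      _ = _ := by field_simp

end Expansion

/-! ### The second order expansion -/

section SecondOrder

variable {q : ℝ → ℝ}

theorem MemW22.hasDerivAt (hq2 : MemW22 q) {t : ℝ} (ht : t ∈ Ioo (0 : ℝ) 1) :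
    HasDerivAt q (derivWithin q (Icc 0 1) t) t :=
  ((hq2.1 t (Ioo_subset_Icc_self ht)).hasDerivWithinAt).hasDerivAt (Icc_mem_nhds ht.1 ht.2)

theorem MemW22.integral_deriv_mul (hq2 : MemW22 q) (u : ℝ → ℂ) {x : ℝ} (hx : x ∈ Icc (0 : ℝ) 1) :
    ∫ t in (0 : ℝ)..x, ((deriv q t : ℝ) : ℂ) * u t =
      ∫ t in (0 : ℝ)..x, ((derivWithin q (Icc 0 1) t : ℝ) : ℂ) * u t := by
  rw [intervalIntegral.integral_of_le hx.1, intervalIntegral.integral_of_le hx.1,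
    integral_Ioc_eq_integral_Ioo, integral_Ioc_eq_integral_Ioo]
  refine setIntegral_congr_fun measurableSet_Ioo fun t ht => ?_
  rw [(hq2.hasDerivAt ⟨ht.1, ht.2.trans_le hx.2⟩).deriv]

/-- The residual of the second order approximation: the terms with `q'` and `q ∫₀ˣ q` combine into
a single oscillatory integral of an absolutely continuous function. -/
theorem residual_second_order (hac : AbsolutelyContinuousOnInterval q 0 1) (hq2 : MemW22 q)
    {k : ℂ} (hk0 : k ≠ 0) {B : ℝ → ℝ}
    (hB : ∀ t, B t = (q t + q 0) / 4 - (∫ s in (0 : ℝ)..t, q s) ^ 2 / 8) {x : ℝ}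
    (hx : x ∈ Icc (0 : ℝ) 1) :
    Complex.sin (k * x) + (k⁻¹ * ∫ t in (0 : ℝ)..x, Complex.sin (k * ((x - t : ℝ) : ℂ)) *
      ((q t : ℂ) * (Complex.sin (k * t) -
        Complex.cos (k * t) * ((∫ s in (0 : ℝ)..t, q s : ℝ) : ℂ) / (2 * k) +
        (B t : ℂ) * Complex.sin (k * t) / k ^ 2))) -
      (Complex.sin (k * x) - Complex.cos (k * x) * ((∫ s in (0 : ℝ)..x, q s : ℝ) : ℂ) / (2 * k) +
        (B x : ℂ) * Complex.sin (k * x) / k ^ 2) =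
    (4 * k ^ 2)⁻¹ * (∫ t in (0 : ℝ)..x,
      ((derivWithin q (Icc 0 1) t - q t * ∫ s in (0 : ℝ)..t, q s : ℝ) : ℂ) *
        Complex.sin (k * ((x - 2 * t : ℝ) : ℂ))) +
      (k ^ 3)⁻¹ * ∫ t in (0 : ℝ)..x, Complex.sin (k * ((x - t : ℝ) : ℂ)) *
        ((q t : ℂ) * ((B t : ℂ) * Complex.sin (k * t))) := by
  have hqq := hac.continuousOn_zero_one
  have hqc : ContinuousOn (fun t => (q t : ℂ)) (Icc 0 1) :=
    Complex.continuous_ofReal.comp_continuousOn hqq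
  have hQ := continuousOn_primitive hqq
  have hQc : ContinuousOn (fun t => ((∫ s in (0 : ℝ)..t, q s : ℝ) : ℂ)) (Icc 0 1) :=
    Complex.continuous_ofReal.comp_continuousOn hQ
  have hBc : ContinuousOn (fun t => (B t : ℂ)) (Icc 0 1) := by
    refine Complex.continuous_ofReal.comp_continuousOn ?_
    have : B = fun t => (q t + q 0) / 4 - (∫ s in (0 : ℝ)..t, q s) ^ 2 / 8 := funext hB
    rw [this]
    exact ((hqq.add continuousOn_const).div_const _).sub ((hQ.pow 2).div_const _)
  have hpc : ContinuousOn (fun t => ((derivWithin q (Icc 0 1) t : ℝ) : ℂ)) (Icc 0 1) :=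
    Complex.continuous_ofReal.comp_continuousOn hq2.2.1.continuousOn_zero_one
  have i1 : IntervalIntegrable (fun t : ℝ => Complex.sin (k * ((x - t : ℝ) : ℂ)) *
      ((q t : ℂ) * (Complex.sin (k * t) -
        Complex.cos (k * t) * ((∫ s in (0 : ℝ)..t, q s : ℝ) : ℂ) / (2 * k)))) volume 0 x :=
    ContinuousOn.intervalIntegrable_zero (ContinuousOn.mul (by fun_prop) (hqc.mul
      (ContinuousOn.sub (by fun_prop) ((ContinuousOn.mul (by fun_prop) hQc).div_const _)))) hx
  have i2 : IntervalIntegrable (fun t : ℝ => Complex.sin (k * ((x - t : ℝ) : ℂ)) *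
        ((q t : ℂ) * ((B t : ℂ) * Complex.sin (k * t)))) volume 0 x :=
    ContinuousOn.intervalIntegrable_zero (ContinuousOn.mul (by fun_prop) (hqc.mul
      (hBc.mul (by fun_prop)))) hx
  have i3 : IntervalIntegrable (fun t : ℝ => ((q t * ∫ s in (0 : ℝ)..t, q s : ℝ) : ℂ)) volume 0 x :=
    ContinuousOn.intervalIntegrable_zero (Complex.continuous_ofReal.comp_continuousOn
      (hqq.mul hQ)) hx
  have i4 : IntervalIntegrable (fun t : ℝ => ((q t * ∫ s in (0 : ℝ)..t, q s : ℝ) : ℂ) *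
      Complex.sin (k * ((x - 2 * t : ℝ) : ℂ))) volume 0 x :=
    ContinuousOn.intervalIntegrable_zero ((Complex.continuous_ofReal.comp_continuousOn
      (hqq.mul hQ)).mul (by fun_prop)) hx
  have i5 : IntervalIntegrable (fun t : ℝ => ((derivWithin q (Icc 0 1) t : ℝ) : ℂ) *
      Complex.sin (k * ((x - 2 * t : ℝ) : ℂ))) volume 0 x :=
    ContinuousOn.intervalIntegrable_zero (hpc.mul (by fun_prop)) hx
  have e1 : (∫ t in (0 : ℝ)..x, Complex.sin (k * ((x - t : ℝ) : ℂ)) *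
      ((q t : ℂ) * (Complex.sin (k * t) -
        Complex.cos (k * t) * ((∫ s in (0 : ℝ)..t, q s : ℝ) : ℂ) / (2 * k) +
        (B t : ℂ) * Complex.sin (k * t) / k ^ 2))) =
      (∫ t in (0 : ℝ)..x, Complex.sin (k * ((x - t : ℝ) : ℂ)) *
      ((q t : ℂ) * (Complex.sin (k * t) -
        Complex.cos (k * t) * ((∫ s in (0 : ℝ)..t, q s : ℝ) : ℂ) / (2 * k)))) +
      (k ^ 2)⁻¹ * ∫ t in (0 : ℝ)..x, Complex.sin (k * ((x - t : ℝ) : ℂ)) *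
        ((q t : ℂ) * ((B t : ℂ) * Complex.sin (k * t))) := by
    rw [← intervalIntegral.integral_const_mul, ← intervalIntegral.integral_add i1 (i2.const_mul _)]
    congr 1; funext t; ring
  have e2 : (∫ t in (0 : ℝ)..x, Complex.sin (k * ((x - t : ℝ) : ℂ)) *
        ((q t : ℂ) * (Complex.cos (k * t) * ((∫ s in (0 : ℝ)..t, q s : ℝ) : ℂ)))) =
      (1 / 2) * (Complex.sin (k * x) * ∫ t in (0 : ℝ)..x,
        ((q t * ∫ s in (0 : ℝ)..t, q s : ℝ) : ℂ)) + (1 / 2) *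
        ∫ t in (0 : ℝ)..x, ((q t * ∫ s in (0 : ℝ)..t, q s : ℝ) : ℂ) *
          Complex.sin (k * ((x - 2 * t : ℝ) : ℂ)) := by
    rw [← intervalIntegral.integral_const_mul, ← intervalIntegral.integral_const_mul,
      ← intervalIntegral.integral_const_mul, ← intervalIntegral.integral_add
        ((i3.const_mul _).const_mul _) (i4.const_mul _)]
    refine intervalIntegral.integral_congr fun t _ => ?_
    have a1 : k * ((x - 2 * t : ℝ) : ℂ) = k * ((x - t : ℝ) : ℂ) - k * t := by push_cast; ring
    have a2 : k * (x : ℂ) = k * ((x - t : ℝ) : ℂ) + k * t := by push_cast; ring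
    simp only [a1, a2, Complex.sin_sub, Complex.sin_add, Complex.ofReal_mul]
    ring
  have e3 : (∫ t in (0 : ℝ)..x, ((derivWithin q (Icc 0 1) t - q t * ∫ s in (0 : ℝ)..t, q s : ℝ) : ℂ)
        * Complex.sin (k * ((x - 2 * t : ℝ) : ℂ))) =
      (∫ t in (0 : ℝ)..x, ((derivWithin q (Icc 0 1) t : ℝ) : ℂ) *
        Complex.sin (k * ((x - 2 * t : ℝ) : ℂ))) -
      ∫ t in (0 : ℝ)..x, ((q t * ∫ s in (0 : ℝ)..t, q s : ℝ) : ℂ) *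
          Complex.sin (k * ((x - 2 * t : ℝ) : ℂ)) := by
    rw [← intervalIntegral.integral_sub i5 i4]
    congr 1; funext t; push_cast; ring
  have e4 := integral_mul_cos_sub_by_parts hac k hx
  rw [hq2.integral_deriv_mul _ hx] at e4
  have e5 := residual_first_order hqq hk0 hx
  rw [e2, intervalIntegral.integral_ofReal, integral_mul_primitive hqq hx] at e5
  have e6 : (B x : ℂ) = ((q x : ℂ) + q 0) / 4 - ((∫ s in (0 : ℝ)..x, q s : ℝ) : ℂ) ^ 2 / 8 := by
    rw [hB]; push_cast; ring
  have e7 : (∫ t in (0 : ℝ)..x, (q t : ℂ) * Complex.cos (k * ((x - 2 * t : ℝ) : ℂ))) = (2 * k)⁻¹ *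
      (((q x : ℂ) + q 0) * Complex.sin (k * x) + ∫ t in (0 : ℝ)..x,
        ((derivWithin q (Icc 0 1) t : ℝ) : ℂ) * Complex.sin (k * ((x - 2 * t : ℝ) : ℂ))) := by
    rw [← e4, ← mul_assoc, inv_mul_cancel₀ (by simpa using hk0), one_mul]
  rw [e7] at e5
  rw [e1, e3, e6, mul_add, add_sub_assoc]
  have e8 := e5
  push_cast at e8 ⊢
  generalize (∫ t in (0 : ℝ)..x, Complex.sin (k * ((x : ℂ) - t)) *
        ((q t : ℂ) * ((B t : ℂ) * Complex.sin (k * t)))) = J1 at e8 ⊢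
  generalize (∫ t in (0 : ℝ)..x, Complex.sin (k * ((x : ℂ) - t)) *
      ((q t : ℂ) * (Complex.sin (k * t) -
        Complex.cos (k * t) * ((∫ s in (0 : ℝ)..t, q s : ℝ) : ℂ) / (2 * k)))) = J2 at e8 ⊢
  generalize (∫ t in (0 : ℝ)..x, ((derivWithin q (Icc 0 1) t : ℝ) : ℂ) *
        Complex.sin (k * ((x : ℂ) - 2 * t))) = J3 at e8 ⊢
  generalize (∫ t in (0 : ℝ)..x, (q t : ℂ) * ((∫ s in (0 : ℝ)..t, q s : ℝ) : ℂ) *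
          Complex.sin (k * ((x : ℂ) - 2 * t))) = J4 at e8 ⊢
  generalize ((∫ s in (0 : ℝ)..x, q s : ℝ) : ℂ) = J5 at e8 ⊢
  generalize Complex.sin (k * x) = S at e8 ⊢
  generalize Complex.cos (k * x) = Co at e8 ⊢
  linear_combination e8

theorem integral_mul_sin_sq (hq : ContinuousOn q (Icc 0 1)) {B : ℝ → ℝ}
    (hB : ContinuousOn B (Icc 0 1)) (k : ℂ) :
    ∫ t in (0 : ℝ)..1, (q t : ℂ) * Complex.sin (k * t) * ((B t : ℂ) * Complex.sin (k * t)) =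
      (1 / 2) * (((∫ t in (0 : ℝ)..1, q t * B t : ℝ) : ℂ) -
        ∫ t in (0 : ℝ)..1, ((q t * B t : ℝ) : ℂ) * Complex.cos (2 * k * t)) := by
  have hqB : ContinuousOn (fun t => ((q t * B t : ℝ) : ℂ)) (Icc 0 1) :=
    Complex.continuous_ofReal.comp_continuousOn (hq.mul hB)
  have h1 : (1 : ℝ) ∈ Icc (0 : ℝ) 1 := by simp
  have i2 : IntervalIntegrable (fun t : ℝ => ((q t * B t : ℝ) : ℂ) * Complex.cos (2 * k * t))
      volume 0 1 := ContinuousOn.intervalIntegrable_zero (hqB.mul (by fun_prop)) h1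
  rw [← intervalIntegral.integral_ofReal, ← intervalIntegral.integral_sub
    (hqB.intervalIntegrable_zero h1) i2, ← intervalIntegral.integral_const_mul]
  refine intervalIntegral.integral_congr fun t _ => ?_
  have a1 : 2 * k * (t : ℂ) = 2 * (k * t) := by ring
  have a2 := Complex.sin_sq_add_cos_sq (k * t)
  simp only [a1, Complex.cos_two_mul', Complex.ofReal_mul]
  linear_combination (1 / 2 * (q t : ℂ) * B t) * a2

theorem memLp_of_continuousOn {g : ℝ → ℝ} (hg : ContinuousOn g (Icc 0 1)) :
    MemLp g 2 (volume.restrict (Ioo (0 : ℝ) 1)) := by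
  obtain ⟨N, hN⟩ := isCompact_Icc.exists_bound_of_continuousOn hg
  refine MemLp.of_bound ((hg.mono Ioo_subset_Icc_self).aestronglyMeasurable measurableSet_Ioo)
    N ?_
  exact (ae_restrict_iff' measurableSet_Ioo).2 (Eventually.of_forall fun t ht =>
    hN t (Ioo_subset_Icc_self ht))

theorem absolutelyContinuousOnInterval_sub_mul_primitive
    (hac : AbsolutelyContinuousOnInterval q 0 1) (hq2 : MemW22 q) :
    AbsolutelyContinuousOnInterval
      (fun t => derivWithin q (Icc 0 1) t - q t * ∫ s in (0 : ℝ)..t, q s) 0 1 := by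
  have hQac : AbsolutelyContinuousOnInterval (fun t => ∫ s in (0 : ℝ)..t, q s) 0 1 :=
    IntervalIntegrable.absolutelyContinuousOnInterval_intervalIntegral
      (hac.continuousOn_zero_one.intervalIntegrable_of_Icc zero_le_one) (by simp)
  exact hq2.2.1.sub (hac.mul hQac)

theorem memLp_deriv_sub_mul_primitive (hac : AbsolutelyContinuousOnInterval q 0 1)
    (hq2 : MemW22 q) :
    MemLp (deriv (fun t => derivWithin q (Icc 0 1) t - q t * ∫ s in (0 : ℝ)..t, q s)) 2
      (volume.restrict (Ioo (0 : ℝ) 1)) := by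
  have hqq := hac.continuousOn_zero_one
  have hQ := continuousOn_primitive hqq
  have hp := hq2.2.1.continuousOn_zero_one
  refine MemLp.ae_eq ?_ (hq2.2.2.sub (memLp_of_continuousOn
    (g := fun t => derivWithin q (Icc 0 1) t * (∫ s in (0 : ℝ)..t, q s) + q t * q t)
    ((hp.mul hQ).add (hqq.mul hqq))))
  refine (ae_restrict_iff' measurableSet_Ioo).2 ?_
  filter_upwards [hq2.2.1.ae_differentiableAt] with t ht hmem
  have ht' := ht (by rw [uIcc_of_le zero_le_one]; exact Ioo_subset_Icc_self hmem)
  have := ht'.hasDerivAt.sub ((hq2.hasDerivAt hmem).mul (hasDerivAt_primitive hqq hmem))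
  exact this.deriv.symm

/-- Second order expansion of the characteristic function for `q ∈ W_2^2`. -/
theorem charFun_expansion_second_order (hq : MemW21 q) (hq2 : MemW22 q) :
    ∃ (h : ℝ → ℝ) (c₀ : ℝ), MemLp h 2 (volume.restrict (Ioo (0 : ℝ) 1)) ∧
      (omega q = 0 → c₀ = -Q₄ q) ∧ ∃ C K : ℝ, 0 < K ∧
      ∀ k : ℂ, K ≤ ‖k‖ → ‖4 * k ^ 3 * dirichletCharFun q (k ^ 2) -
        (2 * omega q * k - q 1 * Complex.sin (2 * k)) - (2 * k)⁻¹ *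
        (Q₃ q * Complex.cos (2 * k) + c₀ +
          ∫ t in (0 : ℝ)..1, (h t : ℂ) * Complex.cos (2 * k * t))‖ ≤
        C / ‖k‖ ^ 2 * Real.exp (2 * |k.im|) := by
  have hac := hq.1
  have hqq := hac.continuousOn_zero_one
  have hQ := continuousOn_primitive hqq
  have hqc : ContinuousOn (fun t => (q t : ℂ)) (Icc 0 1) :=
    Complex.continuous_ofReal.comp_continuousOn hqq
  have hQc : ContinuousOn (fun t => ((∫ s in (0 : ℝ)..t, q s : ℝ) : ℂ)) (Icc 0 1) :=
    Complex.continuous_ofReal.comp_continuousOn hQ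
  -- `B` is the coefficient of `sin kt / k²` in the second order approximation; with this choice the
  -- residual is again an oscillatory integral, of the function `G` below.
  set B : ℝ → ℝ := fun t => (q t + q 0) / 4 - (∫ s in (0 : ℝ)..t, q s) ^ 2 / 8 with hB
  have hBc : ContinuousOn B (Icc 0 1) :=
    ((hqq.add continuousOn_const).div_const _).sub ((hQ.pow 2).div_const _)
  have hBcc : ContinuousOn (fun t => (B t : ℂ)) (Icc 0 1) :=
    Complex.continuous_ofReal.comp_continuousOn hBc
  set G : ℝ → ℝ := fun t => derivWithin q (Icc 0 1) t - q t * ∫ s in (0 : ℝ)..t, q s with hG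
  have hGac : AbsolutelyContinuousOnInterval G 0 1 :=
    absolutelyContinuousOnInterval_sub_mul_primitive hac hq2
  have hGL : MemLp (deriv G) 2 (volume.restrict (Ioo (0 : ℝ) 1)) :=
    memLp_deriv_sub_mul_primitive hac hq2
  have hG1 : G 1 = -Q₃ q := by simp only [hG, Q₃, omega]; ring
  have hG0 : G 0 = derivWithin q (Icc 0 1) 0 := by simp [hG]
  refine ⟨fun t => deriv G t - 4 * (q t * B t),
    derivWithin q (Icc 0 1) 0 + 4 * ∫ t in (0 : ℝ)..1, q t * B t,
    hGL.sub ((memLp_of_continuousOn (hqq.mul hBc)).const_mul 4), fun hω => ?_, ?_⟩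
  · -- If `ω = 0`, then `∫ q (∫₀ᵗ q)² = ω³ / 3` vanishes, and the constant reduces to `-Q₄`.
    have h1 : IntervalIntegrable (fun t => q t ^ 2) volume 0 1 :=
      (hqq.pow 2).intervalIntegrable_of_Icc zero_le_one
    have h2 : IntervalIntegrable q volume 0 1 := hqq.intervalIntegrable_of_Icc zero_le_one
    have h3 : IntervalIntegrable (fun t => q t * (∫ s in (0 : ℝ)..t, q s) ^ 2) volume 0 1 :=
      (hqq.mul (hQ.pow 2)).intervalIntegrable_of_Icc zero_le_one
    have e1 : (∫ t in (0 : ℝ)..1, q t * B t) = (1 / 4) * (∫ t in (0 : ℝ)..1, q t ^ 2) +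
        (q 0 / 4) * (∫ t in (0 : ℝ)..1, q t) -
        (1 / 8) * ∫ t in (0 : ℝ)..1, q t * (∫ s in (0 : ℝ)..t, q s) ^ 2 := by
      rw [← intervalIntegral.integral_const_mul, ← intervalIntegral.integral_const_mul,
        ← intervalIntegral.integral_const_mul, ← intervalIntegral.integral_add (h1.const_mul _)
        (h2.const_mul _), ← intervalIntegral.integral_sub ((h1.const_mul _).add (h2.const_mul _))
        (h3.const_mul _)]
      congr 1; funext t; simp only [hB]; ring
    have e2 := integral_mul_primitive_sq hqq
    rw [hω] at e2
    have e3 : ∫ t in (0 : ℝ)..1, q t = 0 := hω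
    rw [e1, e2, e3, Q₄, hω]
    ring
  obtain ⟨Mq, hMq⟩ := isCompact_Icc.exists_bound_of_continuousOn hqq
  obtain ⟨MB, hMB⟩ := isCompact_Icc.exists_bound_of_continuousOn hBc
  have hMq0 : 0 ≤ Mq := (norm_nonneg _).trans (hMq 0 (by simp))
  have hMB0 : 0 ≤ MB := (norm_nonneg _).trans (hMB 0 (by simp))
  obtain ⟨N, hN0, hN⟩ := exists_norm_integral_sub_le hGac
  refine ⟨8 * Mq * (N / 4 + Mq * MB), 2 * Mq + 1, by positivity, fun k hk => ?_⟩
  have hkpos : 0 < ‖k‖ := by linarith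
  have hk0 : k ≠ 0 := norm_pos_iff.1 hkpos
  have h1mem : (1 : ℝ) ∈ Icc (0 : ℝ) 1 := by simp
  have := norm_charFun_sub_le hqq (M := (N / 4 + Mq * MB) / ‖k‖ ^ 3) hMq (by linarith) hk0
    (Φ := fun t => Complex.sin (k * t) -
        Complex.cos (k * t) * ((∫ s in (0 : ℝ)..t, q s : ℝ) : ℂ) / (2 * k) +
        (B t : ℂ) * Complex.sin (k * t) / k ^ 2)
    ((ContinuousOn.sub (by fun_prop) ((ContinuousOn.mul (by fun_prop) hQc).div_const _)).add
      ((hBcc.mul (by fun_prop)).div_const _))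
    (fun x hx => ?_)
  · have e1 : (∫ t in (0 : ℝ)..1, (q t : ℂ) * Complex.sin (k * t) * (Complex.sin (k * t) -
        Complex.cos (k * t) * ((∫ s in (0 : ℝ)..t, q s : ℝ) : ℂ) / (2 * k) +
        (B t : ℂ) * Complex.sin (k * t) / k ^ 2)) =
        (∫ t in (0 : ℝ)..1, (q t : ℂ) * Complex.sin (k * t) * (Complex.sin (k * t) -
        Complex.cos (k * t) * ((∫ s in (0 : ℝ)..t, q s : ℝ) : ℂ) / (2 * k))) + (k ^ 2)⁻¹ *
        ∫ t in (0 : ℝ)..1, (q t : ℂ) * Complex.sin (k * t) * ((B t : ℂ) * Complex.sin (k * t)) := by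
      rw [← intervalIntegral.integral_const_mul, ← intervalIntegral.integral_add]
      · congr 1; funext t; ring
      · exact ContinuousOn.intervalIntegrable_zero ((hqc.mul (by fun_prop)).mul
          (ContinuousOn.sub (by fun_prop) ((ContinuousOn.mul (by fun_prop) hQc).div_const _))) h1mem
      · exact (ContinuousOn.intervalIntegrable_zero ((hqc.mul (by fun_prop)).mul
          (hBcc.mul (by fun_prop))) h1mem).const_mul _
    have e2 := integral_first_order hac hk0
    have e3 : (∫ t in (0 : ℝ)..1, ((deriv q t - q t * ∫ s in (0 : ℝ)..t, q s : ℝ) : ℂ) *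
          Complex.sin (2 * k * t)) = ∫ t in (0 : ℝ)..1, (G t : ℂ) * Complex.sin (2 * k * t) := by
      refine intervalIntegral.integral_congr_Ioo_of_le zero_le_one fun t ht => ?_
      simp only [hG, (hq2.hasDerivAt ht).deriv]
    have e4 := integral_mul_sin_by_parts hGac k
    have e5 : (∫ t in (0 : ℝ)..1, ((deriv G t - 4 * (q t * B t) : ℝ) : ℂ) *
          Complex.cos (2 * k * t)) =
        (∫ t in (0 : ℝ)..1, ((deriv G t : ℝ) : ℂ) * Complex.cos (2 * k * t)) - 4 *
        ∫ t in (0 : ℝ)..1, ((q t * B t : ℝ) : ℂ) * Complex.cos (2 * k * t) := by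
      rw [← intervalIntegral.integral_const_mul, ← intervalIntegral.integral_sub]
      · congr 1; funext t; push_cast; ring
      · have h1 : IntervalIntegrable (fun t => ((deriv G t : ℝ) : ℂ)) volume 0 1 := by
          have := hGac.intervalIntegrable_deriv
          rw [intervalIntegrable_iff] at this ⊢
          exact this.ofReal
        exact h1.mul_continuousOn (by fun_prop)
      · exact (ContinuousOn.intervalIntegrable_zero ((Complex.continuous_ofReal.comp_continuousOn
          (hqq.mul hBc)).mul (by fun_prop)) h1mem).const_mul _
    rw [e1, mul_add, e2, e3, integral_mul_sin_sq hqq hBc] at this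
    have e6 : (∫ t in (0 : ℝ)..1, (G t : ℂ) * Complex.sin (2 * k * t)) = (2 * k)⁻¹ *
        (G 0 - G 1 * Complex.cos (2 * k) + ∫ t in (0 : ℝ)..1,
        ((deriv G t : ℝ) : ℂ) * Complex.cos (2 * k * t)) := by
      rw [← e4, ← mul_assoc, inv_mul_cancel₀ (by simpa using hk0), one_mul]
    rw [e6, hG1, hG0] at this
    rw [e5]
    refine (le_of_eq ?_).trans (this.trans (le_of_eq ?_))
    · congr 1
      have e7 : k * (k ^ 2)⁻¹ = k⁻¹ := by field_simp
      push_cast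
      linear_combination (2 * ((∫ t in (0 : ℝ)..1, ((q t : ℂ) * (B t : ℂ)) *
        Complex.cos (2 * k * t)) - ((∫ t in (0 : ℝ)..1, q t * B t : ℝ) : ℂ))) * (-e7)
    · field_simp
  · rw [residual_second_order hac hq2 hk0 (fun _ => rfl) hx]
    have hb := norm_integral_sin_le (k := k) (M := Mq * MB) hx (g := fun t =>
      (q t : ℂ) * ((B t : ℂ) * Complex.sin (k * t))) (fun t ht => by
        have ht' : t ∈ Icc (0 : ℝ) 1 := ⟨ht.1, ht.2.trans hx.2⟩
        rw [norm_mul, norm_mul]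
        have e1 : ‖(q t : ℂ)‖ ≤ Mq := by simpa using hMq t ht'
        have e2 : ‖(B t : ℂ)‖ ≤ MB := by
          rw [Complex.norm_real]; exact hMB t ht'
        have e3 : ‖Complex.sin (k * t)‖ ≤ Real.exp (|k.im| * t) :=
          norm_sin_mul_le (abs_of_nonneg ht'.1).le
        calc _ ≤ Mq * (MB * Real.exp (|k.im| * t)) := by gcongr
          _ = _ := by ring)
    have hc := (hN k hk0 x hx).2
    refine (norm_add_le _ _).trans ?_
    rw [norm_mul, norm_mul, norm_inv, norm_inv, norm_mul, norm_pow, norm_pow,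
      show ‖(4 : ℂ)‖ = 4 by simp]
    calc _ ≤ (4 * ‖k‖ ^ 2)⁻¹ * (N / ‖k‖ * Real.exp (|k.im| * x)) +
          (‖k‖ ^ 3)⁻¹ * (Mq * MB * Real.exp (|k.im| * x)) := by gcongr
      _ = _ := by field_simp

end SecondOrder

/-! ### A Bessel inequality for Fourier–Laplace coefficients -/

/-- Bessel's inequality for a family that is only almost orthogonal: the constant is a bound for
the row sums of the Gram matrix. -/
theorem sum_norm_inner_sq_le_of_gram {ι H : Type*} [NormedAddCommGroup H] [InnerProductSpace ℂ H]
    (s : Finset ι) (v : ι → H) (g : H) {B : ℝ}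
    (hB0 : 0 ≤ B) (hB : ∀ n ∈ s, ∑ m ∈ s, ‖inner ℂ (v n) (v m)‖ ≤ B) :
    ∑ n ∈ s, ‖inner ℂ (v n) g‖ ^ 2 ≤ B * ‖g‖ ^ 2 := by
  set a : ι → ℂ := fun n => inner ℂ (v n) g with ha
  set S : ℝ := ∑ n ∈ s, ‖a n‖ ^ 2 with hS
  set w : H := ∑ n ∈ s, a n • v n with hw
  have hS0 : 0 ≤ S := Finset.sum_nonneg fun n _ => sq_nonneg _
  have hwg : inner ℂ w g = (S : ℂ) := by
    rw [hw, sum_inner, hS]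
    push_cast
    refine Finset.sum_congr rfl fun n _ => ?_
    rw [inner_smul_left, ← Complex.conj_mul']
  have hww : ‖w‖ ^ 2 ≤ B * S := by
    have h1 : ‖w‖ ^ 2 ≤ ∑ n ∈ s, ∑ m ∈ s, ‖a n‖ * ‖a m‖ * ‖inner ℂ (v n) (v m)‖ := by
      have : ((‖w‖ ^ 2 : ℝ) : ℂ) = inner ℂ w w := by
        rw [inner_self_eq_norm_sq_to_K]; push_cast; rfl
      rw [← Real.norm_of_nonneg (sq_nonneg ‖w‖), ← Complex.norm_real, this, hw, sum_inner]
      refine (norm_sum_le _ _).trans (Finset.sum_le_sum fun n _ => ?_)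
      rw [inner_sum]
      refine (norm_sum_le _ _).trans (Finset.sum_le_sum fun m _ => ?_)
      rw [inner_smul_left, inner_smul_right, norm_mul, norm_mul, RCLike.norm_conj, mul_assoc]
    refine h1.trans ?_
    have h3 : ∑ n ∈ s, ∑ m ∈ s, ‖a n‖ * ‖a m‖ * ‖inner ℂ (v n) (v m)‖ ≤
        ∑ n ∈ s, ∑ m ∈ s, (‖a n‖ ^ 2 / 2 * ‖inner ℂ (v n) (v m)‖ +
          ‖a m‖ ^ 2 / 2 * ‖inner ℂ (v n) (v m)‖) := by
      refine Finset.sum_le_sum fun n _ => Finset.sum_le_sum fun m _ => ?_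
      rw [← add_mul]
      refine mul_le_mul_of_nonneg_right ?_ (norm_nonneg _)
      nlinarith [sq_nonneg (‖a n‖ - ‖a m‖)]
    refine h3.trans ?_
    have h4 : ∑ n ∈ s, ∑ m ∈ s, ‖a n‖ ^ 2 / 2 * ‖inner ℂ (v n) (v m)‖ ≤ B * S / 2 := by
      rw [hS, mul_comm, Finset.sum_mul, Finset.sum_div]
      refine Finset.sum_le_sum fun n hn => ?_
      rw [← Finset.mul_sum]
      have := mul_le_mul_of_nonneg_left (hB n hn) (sq_nonneg ‖a n‖)
      linarith
    have h5 : ∑ n ∈ s, ∑ m ∈ s, ‖a m‖ ^ 2 / 2 * ‖inner ℂ (v n) (v m)‖ ≤ B * S / 2 := by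
      rw [Finset.sum_comm]
      simpa only [norm_inner_symm] using h4
    simp only [Finset.sum_add_distrib]
    linarith
  have h2 : S ≤ ‖w‖ * ‖g‖ := by
    have := norm_inner_le_norm (𝕜 := ℂ) w g
    rwa [hwg, Complex.norm_real, Real.norm_of_nonneg hS0] at this
  rcases hS0.eq_or_lt with h0 | h0
  · rw [← h0]
    exact mul_nonneg hB0 (sq_nonneg _)
  · have : S * S ≤ (B * ‖g‖ ^ 2) * S := by nlinarith [mul_self_le_mul_self hS0 h2, sq_nonneg ‖g‖]
    exact le_of_mul_le_mul_right this h0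

theorem exp_neg_mul_abs_eqOn_Iic (X Y : ℝ) :
    EqOn (fun t : ℝ => Complex.exp (-X * |t| + Complex.I * Y * t))
      (fun t : ℝ => Complex.exp ((X + Complex.I * Y) * t)) (Iic 0) := by
  intro t ht
  simp only [mem_Iic] at ht
  simp only [abs_of_nonpos ht]
  congr 1; push_cast; ring

theorem exp_neg_mul_abs_eqOn_Ioi (X Y : ℝ) :
    EqOn (fun t : ℝ => Complex.exp (-X * |t| + Complex.I * Y * t))
      (fun t : ℝ => Complex.exp ((-X + Complex.I * Y) * t)) (Ioi 0) := by
  intro t ht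
  simp only [mem_Ioi] at ht
  simp only [abs_of_pos ht]
  congr 1; ring

theorem integrable_exp_neg_mul_abs_add {X : ℝ} (hX : 0 < X) (Y : ℝ) :
    Integrable fun t : ℝ => Complex.exp (-X * |t| + Complex.I * Y * t) := by
  rw [← integrableOn_univ, ← Iic_union_Ioi (a := (0:ℝ))]
  exact ((integrableOn_congr_fun (exp_neg_mul_abs_eqOn_Iic X Y) measurableSet_Iic).2
    (integrableOn_exp_mul_complex_Iic (by simpa) 0)).union
    ((integrableOn_congr_fun (exp_neg_mul_abs_eqOn_Ioi X Y) measurableSet_Ioi).2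
      (integrableOn_exp_mul_complex_Ioi (by simpa) 0))

theorem integral_exp_neg_mul_abs_add {X : ℝ} (hX : 0 < X) (Y : ℝ) :
    ∫ t : ℝ, Complex.exp (-X * |t| + Complex.I * Y * t) = 2 * X / (X ^ 2 + Y ^ 2) := by
  have hp : (-(X:ℂ) + Complex.I * Y).re < 0 := by simpa
  have hm : 0 < ((X:ℂ) + Complex.I * Y).re := by simpa
  rw [← integral_add_compl₀ (s := Iic 0) measurableSet_Iic.nullMeasurableSet
      (integrable_exp_neg_mul_abs_add hX Y), compl_Iic,
    setIntegral_congr_fun measurableSet_Iic (exp_neg_mul_abs_eqOn_Iic X Y),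
    setIntegral_congr_fun measurableSet_Ioi (exp_neg_mul_abs_eqOn_Ioi X Y),
    integral_exp_mul_complex_Iic hm, integral_exp_mul_complex_Ioi hp]
  have h1 : (X:ℂ) + Complex.I * Y ≠ 0 := fun h => by rw [h] at hm; simp at hm
  have h2 : -(X:ℂ) + Complex.I * Y ≠ 0 := fun h => by rw [h] at hp; simp at hp
  have h3 : (X:ℂ)^2 + Y^2 = - ((X:ℂ) + Complex.I * Y) * (-(X:ℂ) + Complex.I * Y) := by
    linear_combination (Y:ℂ)^2 * Complex.I_sq
  rw [h3]
  simp only [Complex.ofReal_zero, mul_zero, Complex.exp_zero]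
  field_simp
  ring

/-- Summing `x / (x² + b² d²)` over `d ≥ 1` by comparison with the telescoping sum of
`x / (x + b d)`; the bound does not depend on `x`. -/
theorem sum_div_sq_add_sq_le {x b : ℝ} (hx : 0 < x) (hb : 0 < b) (N : ℕ) :
    ∑ d ∈ Finset.range N, x / (x ^ 2 + b ^ 2 * ((d : ℝ) + 1) ^ 2) ≤ 2 / b := by
  have key : ∀ d ∈ Finset.range N, x / (x ^ 2 + b ^ 2 * ((d : ℝ) + 1) ^ 2) ≤
      (2 / b) * (x / (x + b * d)) - (2 / b) * (x / (x + b * ((d + 1 : ℕ) : ℝ))) := by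
    intro d _
    have hd : (0:ℝ) ≤ d := Nat.cast_nonneg d
    have h1 : (2 / b) * (x / (x + b * d)) - (2 / b) * (x / (x + b * ((d + 1 : ℕ) : ℝ))) =
        2 * x / ((x + b * d) * (x + b * (d + 1))) := by
      have : x + b * d ≠ 0 := by positivity
      have : x + b * ((d:ℝ) + 1) ≠ 0 := by positivity
      push_cast
      field_simp
      ring
    rw [h1, div_le_div_iff₀ (by positivity) (by positivity)]
    nlinarith [sq_nonneg (x - b * (d + 1)), mul_pos hx hb, mul_nonneg hb.le hd,
      mul_nonneg hx.le (sq_nonneg (x - b * (d + 1))),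
      mul_nonneg hx.le (mul_nonneg hb.le (mul_nonneg hb.le hd)), mul_pos hx (mul_pos hx hb),
      mul_pos hx (mul_pos hb hb)]
  refine (Finset.sum_le_sum key).trans ?_
  rw [Finset.sum_range_sub' (fun d : ℕ => (2 / b) * (x / (x + b * (d : ℝ))))]
  have h0 : x / (x + b * ((0:ℕ):ℝ)) = 1 := by simp [hx.ne']
  rw [h0]
  have : 0 ≤ (2 / b) * (x / (x + b * (N : ℝ))) := by positivity
  linarith

/-- A sum over a finite set of indices of a nonnegative function of the distance to `n`. -/
theorem sum_dist_le {φ : ℕ → ℝ} (hφ : ∀ d, 0 ≤ φ d) {B : ℝ}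
    (hB : ∀ N, ∑ d ∈ Finset.range N, φ d ≤ B) (s : Finset ℕ) (n : ℕ) :
    ∑ m ∈ s, φ (Nat.dist n m) ≤ 2 * B := by
  have key : ∀ (u : Finset ℕ), Set.InjOn (fun m => Nat.dist n m) u →
      ∑ m ∈ u, φ (Nat.dist n m) ≤ B := by
    intro u hu
    rw [← Finset.sum_image (f := φ) hu]
    obtain ⟨N, hN⟩ := (u.image fun m => Nat.dist n m).exists_nat_subset_range
    exact (Finset.sum_le_sum_of_subset_of_nonneg hN fun d _ _ => hφ d).trans (hB N)
  rw [← Finset.sum_filter_add_sum_filter_not s (fun m => m ≤ n)]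
  have h1 := key (s.filter fun m => m ≤ n) (by
    intro a ha b hb hab
    simp only [Finset.coe_filter, mem_ofPred_eq, Nat.dist] at ha hb hab
    omega)
  have h2 := key (s.filter fun m => ¬ m ≤ n) (by
    intro a ha b hb hab
    simp only [Finset.coe_filter, mem_ofPred_eq, Nat.dist] at ha hb hab
    omega)
  linarith

theorem summable_sqrt_div_sq (b : ℝ) :
    Summable fun d : ℕ => Real.sqrt ((d : ℝ) + 1) / (b * ((d : ℝ) + 1) ^ 2) := by
  have h1 : Summable fun d : ℕ => 1 / ((d + 1 : ℕ) : ℝ) ^ (3 / 2 : ℝ) :=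
    (summable_nat_add_iff 1).2 (Real.summable_one_div_nat_rpow.2 (by norm_num))
  refine (h1.mul_left b⁻¹).congr fun d => ?_
  have hd : (0:ℝ) < (d:ℝ) + 1 := by positivity
  push_cast
  rw [Real.sqrt_eq_rpow, ← Real.rpow_natCast, mul_comm b, ← div_div, ← Real.rpow_sub hd,
    div_eq_mul_inv _ b, mul_comm, one_div, ← Real.rpow_neg hd.le]
  norm_num

/-- Row sums of the Gram matrix of the functions `exp (-x_n |t| - i y_n t)`: they are bounded if
the `y_n` are separated and the `x_n` grow slowly. -/
theorem exists_gram_row_bound {x y : ℕ → ℝ} {C b : ℝ} (hb : 0 < b) (hx : ∀ n, 1 ≤ x n)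
    (hd : ∀ n m, |x n - x m| ≤ C * Real.sqrt (Nat.dist n m))
    (hy : ∀ n m, b * Nat.dist n m ≤ |y n - y m|) :
    ∃ B : ℝ, 0 ≤ B ∧ ∀ (s : Finset ℕ) (n : ℕ),
      ∑ m ∈ s, 2 * (x n + x m) / ((x n + x m) ^ 2 + (y n - y m) ^ 2) ≤ B := by
  have hC : 0 ≤ C := by simpa [Nat.dist] using (abs_nonneg _).trans (hd 0 1)
  obtain ⟨S, hS⟩ : ∃ S, ∀ N, ∑ d ∈ Finset.range N,
      Real.sqrt ((d : ℝ) + 1) / (b ^ 2 * ((d : ℝ) + 1) ^ 2) ≤ S :=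
    ⟨_, fun N => (summable_sqrt_div_sq (b ^ 2)).sum_le_tsum _ fun d _ => by positivity⟩
  have hS0 : 0 ≤ S := by simpa using hS 0
  refine ⟨2 * (4 + 4 * (2 / b) + 2 * C * S), by positivity, fun s n => ?_⟩
  -- In the row of `n` the entries are compared with a function of the distance `d` to the diagonal
  -- only, because `x m ≤ x n + C √d`.
  set φ : ℕ → ℝ := fun d =>
    (4 * x n + 2 * C * Real.sqrt d) / (x n ^ 2 + b ^ 2 * (d : ℝ) ^ 2) with hφ
  have hxn := hx n
  have hxn0 : 0 < x n := by linarith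
  have hφ0 : ∀ d, 0 ≤ φ d := fun d => by rw [hφ]; positivity
  have hle : ∀ m ∈ s, 2 * (x n + x m) / ((x n + x m) ^ 2 + (y n - y m) ^ 2) ≤
      φ (Nat.dist n m) := by
    intro m _
    have hxm := hx m
    have h1 := abs_le.1 (hd n m)
    rw [hφ]
    refine div_le_div₀ (by positivity) (by linarith) (by positivity) (add_le_add ?_ ?_)
    · exact pow_le_pow_left₀ hxn0.le (by linarith) 2
    · rw [← sq_abs (y n - y m), ← mul_pow]
      exact pow_le_pow_left₀ (by positivity) (hy n m) 2
  refine (Finset.sum_le_sum hle).trans (sum_dist_le hφ0 (fun N => ?_) s n)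
  refine (Finset.sum_le_sum_of_subset_of_nonneg
    (Finset.range_mono (Nat.le_succ N)) fun d _ _ => hφ0 d).trans ?_
  rw [Finset.sum_range_succ', add_comm, add_assoc]
  refine add_le_add ?_ ?_
  · simp only [hφ, Nat.cast_zero, Real.sqrt_zero, mul_zero, add_zero]
    rw [zero_pow two_ne_zero, mul_zero, add_zero, div_le_iff₀ (by positivity)]
    nlinarith
  · calc ∑ d ∈ Finset.range N, φ (d + 1) ≤ ∑ d ∈ Finset.range N,
          (4 * (x n / (x n ^ 2 + b ^ 2 * ((d : ℝ) + 1) ^ 2)) +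
            2 * C * (Real.sqrt ((d : ℝ) + 1) / (b ^ 2 * ((d : ℝ) + 1) ^ 2))) := by
          refine Finset.sum_le_sum fun d _ => ?_
          simp only [hφ]
          push_cast
          rw [add_div, mul_div_assoc, mul_div_assoc]
          gcongr
          nlinarith
      _ ≤ _ := by
          rw [Finset.sum_add_distrib, ← Finset.mul_sum, ← Finset.mul_sum]
          have := sum_div_sq_add_sq_le hxn0 hb N
          gcongr
          exact hS N

/-- Bessel-type inequality: the Fourier–Laplace coefficients of a square integrable function along
a sequence of points with separated real parts and slowly varying imaginary parts are square
summable. -/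
theorem summable_norm_integral_mul_exp_sq {h : ℝ → ℝ}
    (hh : MemLp h 2 (volume.restrict (Ioo (0 : ℝ) 1))) {k : ℕ → ℂ} {C c : ℝ} (hc : 0 < c)
    (him : ∀ n, -C ≤ (k n).im)
    (hd : ∀ n m, |(k n).im - (k m).im| ≤ C * Real.sqrt (Nat.dist n m))
    (hre : ∀ n m, c * Nat.dist n m ≤ |(k n).re - (k m).re|) :
    Summable fun n =>
      ‖∫ t in (0 : ℝ)..1, (h t : ℂ) * Complex.exp (2 * Complex.I * k n * t)‖ ^ 2 := by
  -- The weight `exp ((2 C + 1) t)`, moved from the exponentials to `h`, makes the `x n` at least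
  -- `1`; on the whole line, the functions `exp (-x |t| - i y t)` have an explicit Gram matrix.
  set x : ℕ → ℝ := fun n => 2 * (k n).im + (2 * C + 1) with hx
  set y : ℕ → ℝ := fun n => 2 * (k n).re with hy
  have hx1 : ∀ n, 1 ≤ x n := fun n => by have := him n; simp only [hx]; linarith
  obtain ⟨B, hB0, hB⟩ := exists_gram_row_bound (x := x) (y := y) (C := 2 * C) (b := 2 * c)
    (by positivity) hx1
    (fun n m => by
      have : x n - x m = 2 * ((k n).im - (k m).im) := by simp only [hx]; ring
      rw [this, abs_mul, abs_two]; linarith [hd n m])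
    (fun n m => by
      have : y n - y m = 2 * ((k n).re - (k m).re) := by simp only [hy]; ring
      rw [this, abs_mul, abs_two]; linarith [hre n m])
  set v : ℕ → ℝ → ℂ := fun n t => Complex.exp (-(x n) * |t| + Complex.I * (-(y n) : ℝ) * t) with hv
  have hvm : ∀ n, MemLp (v n) 2 volume := by
    intro n
    have hx0 : 0 < x n := by linarith [hx1 n]
    rw [memLp_two_iff_integrable_sq_norm
      (integrable_exp_neg_mul_abs_add hx0 _).aestronglyMeasurable]
    refine (integrable_exp_neg_mul_abs_add (X := 2 * x n) (by positivity) 0).norm.congr ?_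
    refine .of_forall fun t => ?_
    simp only [Complex.norm_exp]
    rw [← Real.exp_nat_mul]
    congr 1
    simp
    ring
  set g : ℝ → ℂ := (Ioo (0:ℝ) 1).indicator
    (fun t => (h t : ℂ) * Complex.exp (((2 * C + 1 : ℝ) : ℂ) * t)) with hg
  have hgm : MemLp g 2 volume := by
    rw [hg, memLp_indicator_iff_restrict measurableSet_Ioo]
    refine MemLp.mul' (p := 2) (q := ⊤) (r := 2) ?_ hh.ofReal
    refine memLp_top_of_bound (by fun_prop) (Real.exp |2 * C + 1|) ?_
    filter_upwards [ae_restrict_mem measurableSet_Ioo] with t ht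
    rw [Complex.norm_exp]
    gcongr
    simp only [← Complex.ofReal_mul, Complex.ofReal_re]
    refine (le_abs_self _).trans ?_
    rw [abs_mul, abs_of_pos ht.1]
    nlinarith [abs_nonneg (2 * C + 1), ht.2]
  have hin : ∀ n, inner ℂ ((hvm n).toLp (v n)) (hgm.toLp g) =
      ∫ t in (0 : ℝ)..1, (h t : ℂ) * Complex.exp (2 * Complex.I * k n * t) := by
    intro n
    rw [L2.inner_def, intervalIntegral.integral_of_le zero_le_one, integral_Ioc_eq_integral_Ioo,
      ← integral_indicator measurableSet_Ioo]
    refine integral_congr_ae ?_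
    filter_upwards [(hvm n).coeFn_toLp, hgm.coeFn_toLp] with t h1 h2
    rw [h1, h2, hg]
    by_cases ht : t ∈ Ioo (0:ℝ) 1
    · simp only [indicator_of_mem ht, RCLike.inner_apply, hv, ← Complex.exp_conj]
      rw [mul_assoc, ← Complex.exp_add]
      congr 2
      simp only [map_add, map_mul, map_neg, Complex.conj_ofReal, Complex.conj_I, abs_of_pos ht.1,
        hx, hy]
      conv_rhs => rw [← Complex.re_add_im (k n)]
      push_cast
      linear_combination (-2 * ((k n).im : ℂ) * t) * Complex.I_sq
    · simp [indicator_of_notMem ht]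
  have hgram : ∀ n m, ‖inner ℂ ((hvm n).toLp (v n)) ((hvm m).toLp (v m))‖ =
      2 * (x n + x m) / ((x n + x m) ^ 2 + (y n - y m) ^ 2) := by
    intro n m
    have hX : 0 < x n + x m := by linarith [hx1 n, hx1 m]
    have : inner ℂ ((hvm n).toLp (v n)) ((hvm m).toLp (v m)) =
        ((2 * (x n + x m) / ((x n + x m) ^ 2 + (y n - y m) ^ 2) : ℝ) : ℂ) := by
      rw [L2.inner_def]
      have := integral_exp_neg_mul_abs_add hX (y n - y m)
      push_cast at this ⊢
      rw [← this]
      refine integral_congr_ae ?_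
      filter_upwards [(hvm n).coeFn_toLp, (hvm m).coeFn_toLp] with t h1 h2
      rw [h1, h2]
      simp only [RCLike.inner_apply, hv, ← Complex.exp_conj, ← Complex.exp_add]
      congr 1
      simp only [map_add, map_mul, map_neg, Complex.conj_ofReal, Complex.conj_I]
      push_cast
      ring
    rw [this, Complex.norm_real, Real.norm_of_nonneg (by positivity)]
  refine summable_of_sum_le (c := B * ‖hgm.toLp g‖ ^ 2) (fun n => by positivity) fun s => ?_
  simp only [← hin]
  refine sum_norm_inner_sq_le_of_gram s _ _ hB0 fun n _ => ?_
  simp only [hgram]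
  exact hB s n

/-! ### Oscillatory integrals along sequences of frequencies -/

theorem memLp_comp_one_sub {h : ℝ → ℝ} (hh : MemLp h 2 (volume.restrict (Ioo (0 : ℝ) 1))) :
    MemLp (fun t => h (1 - t)) 2 (volume.restrict (Ioo (0 : ℝ) 1)) := by
  have h1 : MeasurePreserving (fun t : ℝ => 1 - t) (volume.restrict (Ioo (0 : ℝ) 1))
      (volume.restrict (Ioo (0 : ℝ) 1)) := by
    have := (volume.measurePreserving_sub_left (1 : ℝ)).restrict_preimage
      (measurableSet_Ioo (a := (0:ℝ)) (b := 1))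
    simpa using this
  exact hh.comp_measurePreserving h1

theorem intervalIntegrable_of_memLp {h : ℝ → ℝ}
    (hh : MemLp h 2 (volume.restrict (Ioo (0 : ℝ) 1))) : IntervalIntegrable h volume 0 1 := by
  rw [intervalIntegrable_iff_integrableOn_Ioo_of_le zero_le_one]
  exact hh.integrable one_le_two

theorem IntervalIntegrable.complex_ofReal {g : ℝ → ℝ} {a b : ℝ}
    (hg : IntervalIntegrable g volume a b) :
    IntervalIntegrable (fun t => (g t : ℂ)) volume a b :=
  ⟨hg.1.ofReal, hg.2.ofReal⟩

theorem intervalIntegrable_mul_exp {h : ℝ → ℝ}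
    (hh : MemLp h 2 (volume.restrict (Ioo (0 : ℝ) 1))) (z : ℂ) :
    IntervalIntegrable (fun t : ℝ => (h t : ℂ) * Complex.exp (z * t)) volume 0 1 :=
  (intervalIntegrable_of_memLp hh).complex_ofReal.mul_continuousOn (by fun_prop)

section WeightedBessel

variable {h : ℝ → ℝ} (hh : MemLp h 2 (volume.restrict (Ioo (0 : ℝ) 1))) {k : ℕ → ℂ} {C c : ℝ}
  (hc : 0 < c) (him : ∀ n, -C ≤ (k n).im)
  (hd : ∀ n m, |(k n).im - (k m).im| ≤ C * Real.sqrt (Nat.dist n m))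
  (hre : ∀ n m, c * Nat.dist n m ≤ |(k n).re - (k m).re|)
include hh hc him hd hre

/-- The reflection `t ↦ 1 - t` reduces the growing exponentials to the decaying ones, at the cost of
the factor `exp (-2 Im k)`. -/
theorem summable_norm_integral_mul_exp_neg_sq :
    Summable fun n => (Real.exp (-2 * (k n).im) *
      ‖∫ t in (0 : ℝ)..1, (h t : ℂ) * Complex.exp (-2 * Complex.I * k n * t)‖) ^ 2 := by
  refine (summable_norm_integral_mul_exp_sq (memLp_comp_one_sub hh) hc him hd hre).congr fun n => ?_
  congr 1
  have h1 : Real.exp (-2 * (k n).im) = ‖Complex.exp (2 * Complex.I * k n)‖ := by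
    rw [Complex.norm_exp]; congr 1; simp
  rw [h1, ← norm_mul, ← intervalIntegral.integral_const_mul]
  have h2 := intervalIntegral.integral_comp_sub_left (a := 0) (b := 1)
    (fun t : ℝ => (h t : ℂ) * Complex.exp (2 * Complex.I * k n * (1 - t : ℝ))) 1
  simp only [sub_sub_cancel, sub_self, sub_zero] at h2
  rw [h2]
  congr 1
  refine intervalIntegral.integral_congr fun t _ => ?_
  rw [mul_left_comm, ← Complex.exp_add]
  congr 2
  push_cast
  ring

theorem summable_exp_mul_norm_integral_mul_exp_sq :
    Summable fun n => (Real.exp (-2 * (k n).im) *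
      ‖∫ t in (0 : ℝ)..1, (h t : ℂ) * Complex.exp (2 * Complex.I * k n * t)‖) ^ 2 := by
  refine Summable.of_nonneg_of_le (fun n => by positivity) (fun n => ?_)
    ((summable_norm_integral_mul_exp_sq hh hc him hd hre).mul_left (Real.exp (2 * C) ^ 2))
  rw [mul_pow]
  refine mul_le_mul_of_nonneg_right (pow_le_pow_left₀ (Real.exp_pos _).le
    (Real.exp_le_exp.2 ?_) 2) (sq_nonneg _)
  linarith [him n]

theorem summable_exp_mul_norm_integral_mul_sin_sq :
    Summable fun n => (Real.exp (-2 * (k n).im) *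
      ‖∫ t in (0 : ℝ)..1, (h t : ℂ) * Complex.sin (2 * k n * t)‖) ^ 2 := by
  refine Summable.of_nonneg_of_le (fun n => by positivity) (fun n => ?_)
    ((summable_exp_mul_norm_integral_mul_exp_sq hh hc him hd hre).add
      (summable_norm_integral_mul_exp_neg_sq hh hc him hd hre))
  have h1 : ∫ t in (0 : ℝ)..1, (h t : ℂ) * Complex.sin (2 * k n * t) =
      (Complex.I / 2) * ((∫ t in (0 : ℝ)..1, (h t : ℂ) * Complex.exp (-2 * Complex.I * k n * t)) -
        ∫ t in (0 : ℝ)..1, (h t : ℂ) * Complex.exp (2 * Complex.I * k n * t)) := by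
    rw [← intervalIntegral.integral_sub (intervalIntegrable_mul_exp hh _)
      (intervalIntegrable_mul_exp hh _), ← intervalIntegral.integral_const_mul]
    refine intervalIntegral.integral_congr fun t _ => ?_
    simp only [Complex.sin]
    ring_nf
  rw [h1, norm_mul]
  have h2 : ‖Complex.I / 2‖ = 1 / 2 := by simp
  rw [h2]
  set A := ∫ t in (0 : ℝ)..1, (h t : ℂ) * Complex.exp (-2 * Complex.I * k n * t)
  set B := ∫ t in (0 : ℝ)..1, (h t : ℂ) * Complex.exp (2 * Complex.I * k n * t)
  have h3 := norm_sub_le A B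
  have h4 : ‖A - B‖ ^ 2 ≤ 2 * (‖A‖ ^ 2 + ‖B‖ ^ 2) :=
    (pow_le_pow_left₀ (norm_nonneg _) h3 2).trans (by nlinarith [sq_nonneg (‖A‖ - ‖B‖)])
  simp only [mul_pow]
  nlinarith [sq_nonneg (Real.exp (-2 * (k n).im)), sq_nonneg ‖A‖, sq_nonneg ‖B‖,
    mul_le_mul_of_nonneg_left h4 (sq_nonneg (Real.exp (-2 * (k n).im))),
    mul_nonneg (sq_nonneg (Real.exp (-2 * (k n).im))) (sq_nonneg ‖A‖),
    mul_nonneg (sq_nonneg (Real.exp (-2 * (k n).im))) (sq_nonneg ‖B‖)]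

theorem summable_exp_mul_norm_integral_mul_cos_sq :
    Summable fun n => (Real.exp (-2 * (k n).im) *
      ‖∫ t in (0 : ℝ)..1, (h t : ℂ) * Complex.cos (2 * k n * t)‖) ^ 2 := by
  refine Summable.of_nonneg_of_le (fun n => by positivity) (fun n => ?_)
    ((summable_exp_mul_norm_integral_mul_exp_sq hh hc him hd hre).add
      (summable_norm_integral_mul_exp_neg_sq hh hc him hd hre))
  have h1 : ∫ t in (0 : ℝ)..1, (h t : ℂ) * Complex.cos (2 * k n * t) =
      (1 / 2) * ((∫ t in (0 : ℝ)..1, (h t : ℂ) * Complex.exp (-2 * Complex.I * k n * t)) +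
        ∫ t in (0 : ℝ)..1, (h t : ℂ) * Complex.exp (2 * Complex.I * k n * t)) := by
    rw [← intervalIntegral.integral_add (intervalIntegrable_mul_exp hh _)
      (intervalIntegrable_mul_exp hh _), ← intervalIntegral.integral_const_mul]
    refine intervalIntegral.integral_congr fun t _ => ?_
    simp only [Complex.cos]
    ring_nf
  rw [h1, norm_mul]
  have h2 : ‖(1 / 2 : ℂ)‖ = 1 / 2 := by simp
  rw [h2]
  set A := ∫ t in (0 : ℝ)..1, (h t : ℂ) * Complex.exp (-2 * Complex.I * k n * t)
  set B := ∫ t in (0 : ℝ)..1, (h t : ℂ) * Complex.exp (2 * Complex.I * k n * t)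
  have h3 := norm_add_le A B
  have h4 : ‖A + B‖ ^ 2 ≤ 2 * (‖A‖ ^ 2 + ‖B‖ ^ 2) :=
    (pow_le_pow_left₀ (norm_nonneg _) h3 2).trans (by nlinarith [sq_nonneg (‖A‖ - ‖B‖)])
  simp only [mul_pow]
  nlinarith [sq_nonneg (Real.exp (-2 * (k n).im)), sq_nonneg ‖A‖, sq_nonneg ‖B‖,
    mul_le_mul_of_nonneg_left h4 (sq_nonneg (Real.exp (-2 * (k n).im))),
    mul_nonneg (sq_nonneg (Real.exp (-2 * (k n).im))) (sq_nonneg ‖A‖),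
    mul_nonneg (sq_nonneg (Real.exp (-2 * (k n).im))) (sq_nonneg ‖B‖)]

end WeightedBessel

theorem norm_integral_mul_sin_le {g : ℝ → ℝ} (hg : IntervalIntegrable g volume 0 1) (k : ℂ) :
    ‖∫ t in (0 : ℝ)..1, (g t : ℂ) * Complex.sin (2 * k * t)‖ ≤
      (∫ t in (0 : ℝ)..1, |g t|) * Real.exp (2 * |k.im|) := by
  rw [← intervalIntegral.integral_mul_const]
  refine intervalIntegral.norm_integral_le_of_norm_le zero_le_one ?_ (hg.abs.mul_const _)
  refine .of_forall fun t ht => ?_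
  rw [norm_mul, Complex.norm_real, Real.norm_eq_abs]
  refine mul_le_mul_of_nonneg_left ((Complex.norm_sin_le_exp _).trans ?_) (abs_nonneg _)
  refine Real.exp_le_exp.2 ?_
  have : (2 * k * t : ℂ).im = 2 * k.im * t := by simp
  rw [this, abs_mul, abs_mul, abs_two, abs_of_pos ht.1]
  nlinarith [abs_nonneg k.im, ht.2]

/-- The Riemann–Lebesgue lemma for complex frequencies. -/
theorem exists_norm_integral_mul_sin_le {g : ℝ → ℝ}
    (hg : MemLp g 2 (volume.restrict (Ioo (0 : ℝ) 1))) {ε : ℝ} (hε : 0 < ε) :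
    ∃ K : ℝ, 0 < K ∧ ∀ k : ℂ, K ≤ ‖k‖ →
      ‖∫ t in (0 : ℝ)..1, (g t : ℂ) * Complex.sin (2 * k * t)‖ ≤ ε * Real.exp (2 * |k.im|) := by
  have hg1 : MemLp g 1 (volume.restrict (Ioo (0 : ℝ) 1)) := hg.mono_exponent one_le_two
  -- `g` is approximated in `L¹` by a smooth `u`, for which integration by parts gains `1 / |k|`.
  obtain ⟨u, hu1, hu2, hu3⟩ := hg1.exist_eLpNorm_sub_le ENNReal.one_ne_top le_rfl (half_pos hε)
  have hu : AbsolutelyContinuousOnInterval u 0 1 :=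
    (hu2.of_le (by norm_num)).contDiffOn.absolutelyContinuousOnInterval
  have hui : IntervalIntegrable u volume 0 1 := hu2.continuous.intervalIntegrable _ _
  have hgi := intervalIntegrable_of_memLp hg
  have hgu : ∫ t in (0 : ℝ)..1, |g t - u t| ≤ ε / 2 := by
    rw [intervalIntegral.integral_of_le zero_le_one, integral_Ioc_eq_integral_Ioo]
    have hi : Integrable (g - u) (volume.restrict (Ioo (0 : ℝ) 1)) := by
      have := hgi.sub hui
      rwa [intervalIntegrable_iff_integrableOn_Ioo_of_le zero_le_one] at this
    have h1 := integral_norm_eq_lintegral_enorm hi.aestronglyMeasurable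
    rw [← eLpNorm_one_eq_lintegral_enorm] at h1
    simp only [Pi.sub_apply, Real.norm_eq_abs] at h1
    rw [h1]
    exact ENNReal.toReal_le_of_le_ofReal (half_pos hε).le hu3
  set D : ℝ := |u 0| + |u 1| + ∫ t in (0 : ℝ)..1, |deriv u t| with hD
  have hD0 : 0 ≤ ∫ t in (0 : ℝ)..1, |deriv u t| :=
    intervalIntegral.integral_nonneg zero_le_one fun t _ => abs_nonneg _
  have hD0' : 0 ≤ D := by positivity
  refine ⟨(D + 1) / ε, by positivity, fun k hk => ?_⟩
  have hk0 : 0 < ‖k‖ := lt_of_lt_of_le (by positivity) hk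
  have h1 : ‖∫ t in (0 : ℝ)..1, (u t : ℂ) * Complex.sin (2 * k * t)‖ ≤
      ε / 2 * Real.exp (2 * |k.im|) := by
    have e := congrArg norm (integral_mul_sin_by_parts hu k)
    set E := Real.exp (2 * |k.im|) with hE
    have hE1 : 1 ≤ E := Real.one_le_exp (by positivity)
    have hcos : ∀ t ∈ Icc (0:ℝ) 1, ‖Complex.cos (2 * k * t)‖ ≤ E := by
      intro t ht
      refine (Complex.norm_cos_le_exp _).trans (Real.exp_le_exp.2 ?_)
      have : (2 * k * t : ℂ).im = 2 * k.im * t := by simp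
      rw [this, abs_mul, abs_mul, abs_two, abs_of_nonneg ht.1]
      nlinarith [abs_nonneg k.im, ht.2]
    have h2 : ‖(u 0 : ℂ) - u 1 * Complex.cos (2 * k) + ∫ t in (0 : ℝ)..1,
        ((deriv u t : ℝ) : ℂ) * Complex.cos (2 * k * t)‖ ≤ D * E := by
      refine (norm_add_le _ _).trans ?_
      have a1 := norm_integral_deriv_mul_le hu (by positivity) (right_mem_Icc.2 zero_le_one) hcos
      have a2 : ‖(u 0 : ℂ) - u 1 * Complex.cos (2 * k)‖ ≤ |u 0| + |u 1| * E := by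
        refine (norm_sub_le _ _).trans ?_
        rw [norm_mul, Complex.norm_real, Complex.norm_real]
        have := hcos 1 (right_mem_Icc.2 zero_le_one)
        simp only [Complex.ofReal_one, mul_one] at this
        simp only [Real.norm_eq_abs]
        gcongr
      have a3 : |u 0| ≤ |u 0| * E := le_mul_of_one_le_right (abs_nonneg _) hE1
      rw [hD]
      linarith
    rw [norm_mul, norm_mul, Complex.norm_two] at e
    rw [← e] at h2
    have h3 : D ≤ ε * ‖k‖ := by
      rw [div_le_iff₀ hε] at hk; linarith
    have h4 : 2 * ‖k‖ * ‖∫ t in (0 : ℝ)..1, (u t : ℂ) * Complex.sin (2 * k * t)‖ ≤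
      2 * ‖k‖ * (ε / 2 * E) := by nlinarith [Real.exp_pos (2 * |k.im|)]
    exact le_of_mul_le_mul_left h4 (by positivity)
  have hsplit : ∫ t in (0 : ℝ)..1, (g t : ℂ) * Complex.sin (2 * k * t) =
      (∫ t in (0 : ℝ)..1, ((g t - u t : ℝ) : ℂ) * Complex.sin (2 * k * t)) +
      ∫ t in (0 : ℝ)..1, (u t : ℂ) * Complex.sin (2 * k * t) := by
    rw [← intervalIntegral.integral_add]
    · refine intervalIntegral.integral_congr fun t _ => ?_
      push_cast; ring
    · exact (hgi.sub hui).complex_ofReal.mul_continuousOn (by fun_prop)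
    · exact hui.complex_ofReal.mul_continuousOn (by fun_prop)
  rw [hsplit]
  refine (norm_add_le _ _).trans ?_
  have h5 := norm_integral_mul_sin_le (hgi.sub hui) k
  have h6 := mul_le_mul_of_nonneg_right hgu (Real.exp_pos (2 * |k.im|)).le
  linarith

/-! ### Counting zeros by Jensen's formula -/

/-- The zeros of the entire function `D` are the points of the finite set `Ex`, with arbitrary
multiplicities, and the pairwise distinct simple zeros `t i` outside `Ex`. -/
structure HasSimpleTail {ι : Type*} (D : ℂ → ℂ) (Ex : Finset ℂ) (t : ι → ℂ) : Prop where
  differentiable : Differentiable ℂ D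
  injective : Function.Injective t
  order_eq_one : ∀ i, analyticOrderAt D (t i) = 1
  notMem : ∀ i, t i ∉ Ex
  order_ne_top : ∀ z, analyticOrderAt D z ≠ ⊤
  cover : ∀ z, D z = 0 → z ∈ Ex ∨ ∃ i, t i = z

namespace HasSimpleTail

variable {ι : Type*} {D : ℂ → ℂ} {Ex : Finset ℂ} {t : ι → ℂ} (h : HasSimpleTail D Ex t)
include h

theorem analyticAt (z : ℂ) : AnalyticAt ℂ D z := h.differentiable.analyticAt z

theorem order_eq_zero {z : ℂ} (hz : z ∉ Ex) (hz' : ∀ i, t i ≠ z) : analyticOrderAt D z = 0 := by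
  rw [(h.analyticAt z).analyticOrderAt_eq_zero]
  exact fun h0 => (h.cover z h0).elim hz fun ⟨i, hi⟩ => hz' i hi

theorem divisor_apply {R : ℝ} {z : ℂ} (hz : ‖z‖ ≤ |R|) :
    MeromorphicOn.divisor D (Metric.closedBall 0 |R|) z = (analyticOrderAt D z).toNat := by
  have ha : AnalyticOnNhd ℂ D (Metric.closedBall 0 |R|) := fun z _ => h.analyticAt z
  rw [MeromorphicOn.AnalyticOnNhd.divisor_apply ha (by simpa using hz)]
  obtain ⟨n, hn⟩ := ENat.ne_top_iff_exists.1 (h.order_ne_top z)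
  rw [← hn]
  rfl

theorem finite_norm_le (R : ℝ) : {i | ‖t i‖ ≤ R}.Finite := by
  have hf := (MeromorphicOn.divisor D (Metric.closedBall 0 |R|)).finiteSupport
    (isCompact_closedBall 0 |R|)
  refine (hf.preimage h.injective.injOn).subset fun i hi => ?_
  simp only [mem_preimage, Function.mem_support]
  rw [h.divisor_apply ((show ‖t i‖ ≤ R from hi).trans (le_abs_self R)), h.order_eq_one]
  simp

/-- Jensen's formula in terms of the zeros in `Ex` and the tail. -/
theorem circleAverage_log_norm {R : ℝ} (hR : 0 < R) (hEx : ∀ z ∈ Ex, ‖z‖ ≤ R) {I : Finset ι}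
    (hI : ∀ i, i ∈ I ↔ ‖t i‖ ≤ R) :
    Real.circleAverage (fun z => Real.log ‖D z‖) 0 R =
      ∑ z ∈ Ex, (analyticOrderAt D z).toNat * (Real.log R - Real.log ‖z‖) +
      ∑ i ∈ I, (Real.log R - Real.log ‖t i‖) + Real.log ‖meromorphicTrailingCoeffAt D 0‖ := by
  classical
  have ha : AnalyticOnNhd ℂ D (Metric.closedBall 0 |R|) := fun z _ => h.analyticAt z
  set dv := MeromorphicOn.divisor D (Metric.closedBall 0 |R|) with hdv
  have hf := dv.finiteSupport (isCompact_closedBall 0 |R|)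
  have hdv0 : ∀ z, z ∉ Ex ∪ I.image t → dv z = 0 := by
    intro z hz
    simp only [Finset.mem_union, Finset.mem_image, not_or, not_exists, not_and] at hz
    by_cases hzR : ‖z‖ ≤ |R|
    · rw [h.divisor_apply hzR, h.order_eq_zero hz.1]
      · simp
      · intro i hi
        refine hz.2 i ((hI i).2 ?_) hi
        rwa [hi, ← abs_of_pos hR]
    · exact dv.apply_eq_zero_of_notMem (by simpa using hzR)
  rw [ha.meromorphicOn.circleAverage_log_norm hR.ne',
    ← countingFunction_finsum_eq_finsum_add hR.ne' hf,
    finsum_eq_sum_of_support_subset (s := Ex ∪ I.image t), Finset.sum_union,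
    Finset.sum_image h.injective.injOn]
  · congr 2
    · refine Finset.sum_congr rfl fun z hz => ?_
      rw [h.divisor_apply ((hEx z hz).trans (le_abs_self R))]
      simp
    · refine Finset.sum_congr rfl fun i hi => ?_
      rw [h.divisor_apply (((hI i).1 hi).trans (le_abs_self R)), h.order_eq_one]
      simp
  · rw [Finset.disjoint_right]
    intro z hz
    obtain ⟨i, _, rfl⟩ := Finset.mem_image.1 hz
    exact h.notMem i
  · intro z hz
    by_contra hz'
    exact hz (by simp only [hdv0 z (by exact_mod_cast hz')]; simp)

omit h in
/-- If the circle averages of `log ‖D‖` are those of `log ‖S‖` minus `p log R`, up to `O(1)`, and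
the tails of zeros have comparable moduli, then `D` has `p` exceptional zeros fewer than `S`. -/
theorem card_exceptional_eq {S : ℂ → ℂ} {ExS : Finset ℂ} {s : ι → ℂ}
    (hD : HasSimpleTail D Ex t) (hS : HasSimpleTail S ExS s)
    {R : ℕ → ℝ} (hR : Tendsto R atTop atTop)
    (hRt : ∀ᶠ N in atTop, ∀ i, ‖t i‖ ≤ R N ↔ ‖s i‖ ≤ R N) {T : ℝ}
    (hT : ∀ᶠ N in atTop, ∀ I : Finset ι, (∀ i, i ∈ I ↔ ‖s i‖ ≤ R N) →
      |∑ i ∈ I, (Real.log ‖t i‖ - Real.log ‖s i‖)| ≤ T) {p : ℕ} {B : ℝ} (hB : ∀ᶠ N in atTop,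
      |Real.circleAverage (fun z => Real.log ‖D z‖) 0 (R N) -
        Real.circleAverage (fun z => Real.log ‖S z‖) 0 (R N) + p * Real.log (R N)| ≤ B) :
    ∑ z ∈ Ex, (analyticOrderAt D z).toNat + p = ∑ z ∈ ExS, (analyticOrderAt S z).toNat := by
  set MD := ∑ z ∈ Ex, (analyticOrderAt D z).toNat with hMD
  set MS := ∑ z ∈ ExS, (analyticOrderAt S z).toNat with hMS
  set cD := ∑ z ∈ Ex, ((analyticOrderAt D z).toNat : ℝ) * Real.log ‖z‖ with hcD
  set cS := ∑ z ∈ ExS, ((analyticOrderAt S z).toNat : ℝ) * Real.log ‖z‖ with hcS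
  set lD := Real.log ‖meromorphicTrailingCoeffAt D 0‖
  set lS := Real.log ‖meromorphicTrailingCoeffAt S 0‖
  have hlog : Tendsto (fun N => Real.log (R N)) atTop atTop := Real.tendsto_log_atTop.comp hR
  have hlarge : ∀ (E : Finset ℂ), ∀ᶠ N in atTop, ∀ z ∈ E, ‖z‖ ≤ R N := by
    intro E
    rw [Finset.eventually_all]
    exact fun z _ => hR.eventually_ge_atTop _
  have key : ∀ᶠ N in atTop, |((MD : ℝ) + p - MS) * Real.log (R N)| ≤
      B + |cD| + |cS| + |lD| + |lS| + T := by
    filter_upwards [hB, hRt, hlarge Ex, hlarge ExS, hR.eventually_gt_atTop 0, hT] with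
      N h1 h2 h3 h4 h5 h8
    set I := (hD.finite_norm_le (R N)).toFinset with hI
    have hI1 : ∀ i, i ∈ I ↔ ‖t i‖ ≤ R N := fun i => by simp [hI]
    have hI2 : ∀ i, i ∈ I ↔ ‖s i‖ ≤ R N := fun i => (hI1 i).trans (h2 i)
    rw [hD.circleAverage_log_norm h5 h3 hI1, hS.circleAverage_log_norm h5 h4 hI2] at h1
    have e1 : ∑ i ∈ I, (Real.log (R N) - Real.log ‖s i‖) - ∑ i ∈ I, (Real.log (R N) -
        Real.log ‖t i‖) = ∑ i ∈ I, (Real.log ‖t i‖ - Real.log ‖s i‖) := by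
      rw [← Finset.sum_sub_distrib]
      exact Finset.sum_congr rfl fun i _ => by ring
    have e2 := h8 I hI2
    have e3 : ∑ z ∈ Ex, ((analyticOrderAt D z).toNat : ℝ) * (Real.log (R N) - Real.log ‖z‖) =
        MD * Real.log (R N) - cD := by
      rw [hMD, hcD]; push_cast
      rw [Finset.sum_mul, ← Finset.sum_sub_distrib]
      exact Finset.sum_congr rfl fun i _ => by ring
    have e4 : ∑ z ∈ ExS, ((analyticOrderAt S z).toNat : ℝ) * (Real.log (R N) - Real.log ‖z‖) =
        MS * Real.log (R N) - cS := by
      rw [hMS, hcS]; push_cast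
      rw [Finset.sum_mul, ← Finset.sum_sub_distrib]
      exact Finset.sum_congr rfl fun i _ => by ring
    rw [e3, e4] at h1
    have h6 := abs_le.1 h1
    have h7 := abs_le.1 e2
    rw [abs_le]
    constructor <;> nlinarith [neg_abs_le cD, le_abs_self cD, neg_abs_le cS, le_abs_self cS,
      neg_abs_le lD, le_abs_self lD, neg_abs_le lS, le_abs_self lS]
  -- A bounded multiple of `log R → ∞` has coefficient zero.
  have h0 : (MD : ℝ) + p - MS = 0 := by
    by_contra hne
    have hpos : 0 < |(MD : ℝ) + p - MS| := abs_pos.2 hne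
    obtain ⟨N, hN1, hN2, hN3⟩ := (key.and ((hlog.eventually_gt_atTop
      ((B + |cD| + |cS| + |lD| + |lS| + T) / |(MD : ℝ) + p - MS|)).and
        (hlog.eventually_gt_atTop 0))).exists
    rw [abs_mul, abs_of_pos hN3] at hN1
    rw [div_lt_iff₀ hpos] at hN2
    linarith
  have : ((MD + p : ℕ) : ℝ) = MS := by push_cast; linarith
  exact_mod_cast this

/-- If the exceptional zeros, counted with multiplicity, are as many as the indices in a finite
set `H`, then the tail, indexed by the complement of `H`, can be completed to a family that lists
each zero as often as its order. -/
theorem exists_enumeration {κ : Type*} (H : Finset κ) (e : κ → ℂ) (b : ι → κ)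
    (hb : Function.Injective b) (hbH : ∀ x, x ∈ H ↔ x ∉ range b) (hbe : ∀ i, e (b i) = t i)
    (hcard : ∑ z ∈ Ex, (analyticOrderAt D z).toNat = H.card) :
    ∃ l : κ → ℂ, (∀ x, x ∉ H → l x = e x) ∧
      ∀ z, analyticOrderAt D z = {x | l x = z}.encard := by
  classical
  have hc : Fintype.card (Σ z : Ex, Fin (analyticOrderAt D z).toNat) = Fintype.card H := by
    simp only [Fintype.card_sigma, Fintype.card_coe, ← hcard, Fintype.card_fin]
    exact Finset.sum_coe_sort Ex fun z => (analyticOrderAt D z).toNat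
  set f := Fintype.equivOfCardEq hc
  refine ⟨fun x => if hx : x ∈ H then ((f.symm ⟨x, hx⟩).1 : ℂ) else e x,
    fun x hx => by simp [hx], fun z => ?_⟩
  by_cases hz : z ∈ Ex
  · have hset : {x | (if hx : x ∈ H then ((f.symm ⟨x, hx⟩).1 : ℂ) else e x) = z} =
        range fun j : Fin (analyticOrderAt D z).toNat => ((f ⟨⟨z, hz⟩, j⟩ : H) : κ) := by
      ext x
      simp only [mem_ofPred_eq, mem_range]
      constructor
      · intro hx
        split_ifs at hx with hxH
        · obtain ⟨⟨⟨w, hw⟩, j⟩, hy⟩ : ∃ y, f.symm ⟨x, hxH⟩ = y := ⟨_, rfl⟩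
          rw [hy] at hx
          simp only at hx
          subst hx
          exact ⟨j, by rw [← hy, f.apply_symm_apply]⟩
        · rw [hbH, not_not] at hxH
          obtain ⟨i, rfl⟩ := hxH
          rw [hbe] at hx
          exact absurd (hx ▸ hz) (h.notMem i)
      · rintro ⟨j, rfl⟩
        simp
    rw [hset, ← image_univ, Function.Injective.encard_image]
    · rw [Set.encard_univ]
      simp [ENat.natCast_toNat (h.order_ne_top z)]
    · intro j j' hj
      have := f.injective (Subtype.ext hj)
      simpa using this
  · have hset : {x | (if hx : x ∈ H then ((f.symm ⟨x, hx⟩).1 : ℂ) else e x) = z} =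
        b '' {i | t i = z} := by
      ext x
      simp only [mem_ofPred_eq, mem_image]
      constructor
      · intro hx
        split_ifs at hx with hxH
        · exact absurd (hx ▸ (f.symm ⟨x, hxH⟩).1.2) hz
        · rw [hbH, not_not] at hxH
          obtain ⟨i, rfl⟩ := hxH
          exact ⟨i, by rw [← hbe, hx], rfl⟩
      · rintro ⟨i, hi, rfl⟩
        rw [dif_neg (by rw [hbH]; simp), hbe, hi]
    rw [hset, hb.encard_image]
    by_cases hzt : ∃ i, t i = z
    · obtain ⟨i, rfl⟩ := hzt
      rw [h.order_eq_one]
      have : {j | t j = t i} = {i} := by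
        ext j; simpa using h.injective.eq_iff
      rw [this, encard_singleton]
    · push Not at hzt
      rw [h.order_eq_zero hz hzt]
      have : {j | t j = z} = ∅ := by
        ext j; simpa using hzt j
      rw [this, encard_empty]

end HasSimpleTail

/-! ### Zeros of nearby functions and circle averages -/

/-- An entire function that is uniformly close, near the origin, to a function `G` with a simple
zero at the origin has a unique zero there; it is simple, and the function is bilipschitz. -/
theorem exists_zero_of_close {G : ℂ → ℂ} (hG : Differentiable ℂ G) (hG0 : G 0 = 0)
    (hG1 : deriv G 0 ≠ 0) :
    ∃ r₀ > 0, ∀ r, 0 < r → r ≤ r₀ → ∃ δ > 0, ∀ H : ℂ → ℂ, Differentiable ℂ H →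
      (∀ w, ‖w‖ ≤ 2 * r → ‖H w - G w‖ ≤ δ) →
      (∃ w, ‖w‖ < r ∧ H w = 0 ∧ deriv H w ≠ 0) ∧
      ∀ w w', ‖w‖ ≤ r → ‖w'‖ ≤ r → ‖deriv G 0‖ / 2 * ‖w - w'‖ ≤ ‖H w - H w'‖ := by
  set A := deriv G 0 with hA
  have hA0 : 0 < ‖A‖ := norm_pos_iff.2 hG1
  have hcont : Continuous (deriv G) :=
    (hG.contDiff (n := 1)).continuous_deriv le_rfl
  obtain ⟨r₀, hr₀, hr₀'⟩ := Metric.continuous_iff.1 hcont 0 (‖A‖ / 4) (by positivity)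
  refine ⟨r₀ / 2, by positivity, fun r hr hrr => ⟨‖A‖ * r / 8, by positivity, fun H hH hHG => ?_⟩⟩
  -- Cauchy's estimate on circles of radius `r`, which stay in the disc of radius `2 r`.
  have hderiv : ∀ w, ‖w‖ ≤ r → ‖deriv H w - A‖ ≤ ‖A‖ / 2 := by
    intro w hw
    have h1 : ‖deriv (fun z => H z - G z) w‖ ≤ (‖A‖ * r / 8) / r := by
      refine Complex.norm_deriv_le_of_forall_mem_sphere_norm_le hr
        (hH.sub hG).diffContOnCl fun z hz => hHG z ?_
      rw [mem_sphere_iff_norm] at hz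
      calc ‖z‖ = ‖(z - w) + w‖ := by ring_nf
        _ ≤ 2 * r := (norm_add_le _ _).trans (by linarith)
    rw [deriv_fun_sub (hH w) (hG w)] at h1
    have h2 := (hr₀' w (by rw [dist_zero_right]; linarith)).le
    rw [dist_eq_norm, ← hA] at h2
    have h3 : ‖A‖ * r / 8 / r = ‖A‖ / 8 := by field_simp
    rw [h3] at h1
    calc ‖deriv H w - A‖ = ‖(deriv H w - deriv G w) + (deriv G w - A)‖ := by ring_nf
      _ ≤ ‖A‖ / 2 := (norm_add_le _ _).trans (by linarith)
  have hbil : ∀ w w', ‖w‖ ≤ r → ‖w'‖ ≤ r → ‖A‖ / 2 * ‖w - w'‖ ≤ ‖H w - H w'‖ := by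
    intro w w' hw hw'
    have h1 := (convex_closedBall (0:ℂ) r).norm_image_sub_le_of_norm_deriv_le
      (f := fun z => H z - A * z) (C := ‖A‖ / 2) (x := w') (y := w)
      (fun z _ => (hH z).sub ((differentiableAt_id).const_mul A))
      (fun z hz => by
        have : HasDerivAt (fun z => H z - A * z) (deriv H z - A) z :=
          (hH z).hasDerivAt.sub (by simpa using (hasDerivAt_id z).const_mul A)
        rw [this.deriv]
        exact hderiv z (by simpa using hz))
      (by simpa using hw') (by simpa using hw)
    have h2 : A * (w - w') = (H w - H w') - (H w - A * w - (H w' - A * w')) := by ring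
    have h3 : ‖A‖ * ‖w - w'‖ ≤ ‖H w - H w'‖ + ‖A‖ / 2 * ‖w - w'‖ := by
      rw [← norm_mul, h2]
      exact (norm_sub_le _ _).trans (by linarith)
    linarith
  have hH0 : ‖H 0‖ ≤ ‖A‖ * r / 8 := by
    simpa [hG0] using hHG 0 (by simpa using hr.le)
  refine ⟨?_, hbil⟩
  -- By the quantitative open mapping theorem the image of the disc covers a disc around `H 0` that
  -- contains the origin.
  have himage := (hH.diffContOnCl (s := Metric.ball 0 r)).ball_subset_image_closedBall hr
    (ε := ‖A‖ / 2 * r) (fun z hz => by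
      rw [mem_sphere_zero_iff_norm] at hz
      have := hbil z 0 hz.le (by simpa using hr.le)
      rwa [sub_zero, hz] at this) (by
      have : ∀ᶠ z in 𝓝[≠] (0:ℂ), H z ≠ H 0 := by
        filter_upwards [self_mem_nhdsWithin,
          mem_nhdsWithin_of_mem_nhds (Metric.ball_mem_nhds (0:ℂ) hr)] with z hz hz' heq
        have := hbil z 0 (by simpa using (mem_ball_zero_iff.1 hz').le) (by simpa using hr.le)
        rw [heq, sub_self, norm_zero, sub_zero] at this
        have hz0 : 0 < ‖z‖ := norm_pos_iff.2 hz
        nlinarith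
      exact this.frequently.filter_mono nhdsWithin_le_nhds)
  obtain ⟨w, hw, hw0⟩ := himage (show (0:ℂ) ∈ Metric.ball (H 0) _ by
    rw [Metric.mem_ball, dist_zero_left]; nlinarith [mul_pos hA0 hr])
  have hwr : ‖w‖ ≤ r := by simpa using hw
  have h4 := hbil w 0 hwr (by simpa using hr.le)
  rw [hw0, sub_zero, zero_sub, norm_neg] at h4
  refine ⟨w, ?_, hw0, fun h5 => ?_⟩
  · nlinarith [mul_pos hA0 hr]
  · have := hderiv w hwr
    rw [h5, zero_sub, norm_neg] at this
    linarith

/-- A simple zero `k ≠ 0` of `c(k) D(k²)`, with `c(k) ≠ 0`, gives a simple zero `k²` of `D`. -/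
theorem analyticOrderAt_sq_eq_one {D F c : ℂ → ℂ} (hD : Differentiable ℂ D)
    (hc : Differentiable ℂ c) (hF : ∀ k, F k = c k * D (k ^ 2)) {k : ℂ} (hck : c k ≠ 0)
    (h0 : F k = 0) (h1 : deriv F k ≠ 0) : analyticOrderAt D (k ^ 2) = 1 := by
  have hD0 : D (k ^ 2) = 0 := by
    rw [hF] at h0
    exact (mul_eq_zero.1 h0).resolve_left hck
  refine (hD.analyticAt _).analyticOrderAt_eq_one_of_zero_deriv_ne_zero hD0 fun h2 => h1 ?_
  have hd : HasDerivAt F (deriv c k * D (k ^ 2) + c k * (deriv D (k ^ 2) * (2 * k))) k := by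
    have hsq : HasDerivAt (fun z : ℂ => z ^ 2) (2 * k) k := by simpa using hasDerivAt_pow 2 k
    have h3 : HasDerivAt (fun z => D (z ^ 2)) (deriv D (k ^ 2) * (2 * k)) k :=
      HasDerivAt.comp k (hD _).hasDerivAt hsq
    have := (hc k).hasDerivAt.mul h3
    rwa [show F = c * fun z => D (z ^ 2) from funext hF]
  rw [hd.deriv, hD0, h2]
  ring

theorem div_pi_le_sin_half {θ : ℝ} (h0 : 0 ≤ θ) (h1 : θ ≤ 2 * Real.pi) :
    min θ (2 * Real.pi - θ) / Real.pi ≤ Real.sin (θ / 2) := by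
  have hpi := Real.pi_pos
  rcases le_total θ Real.pi with h | h
  · have := Real.mul_le_sin (x := θ / 2) (by linarith) (by linarith)
    refine le_trans ?_ this
    have h2 : 2 / Real.pi * (θ / 2) = θ / Real.pi := by ring
    rw [h2]
    gcongr
    exact min_le_left _ _
  · have := Real.mul_le_sin (x := Real.pi - θ / 2) (by linarith) (by linarith)
    rw [Real.sin_pi_sub] at this
    refine le_trans ?_ this
    have h2 : 2 / Real.pi * (Real.pi - θ / 2) = (2 * Real.pi - θ) / Real.pi := by ring
    rw [h2]
    gcongr
    exact min_le_right _ _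

theorem exp_neg_mul_sin_half_le {ρ θ : ℝ} (hρ : 0 < ρ) (h0 : 0 ≤ θ) (h1 : θ ≤ 2 * Real.pi) :
    Real.exp (-(ρ * Real.sin (θ / 2))) ≤
      Real.exp (-(ρ / Real.pi) * θ) + Real.exp (-(ρ / Real.pi) * (2 * Real.pi - θ)) := by
  have h := mul_le_mul_of_nonneg_left (div_pi_le_sin_half h0 h1) hρ.le
  have hpi := Real.pi_pos
  rcases min_cases θ (2 * Real.pi - θ) with ⟨h2, _⟩ | ⟨h2, _⟩ <;> rw [h2] at h
  · refine le_add_of_le_of_nonneg (Real.exp_le_exp.2 ?_) (Real.exp_pos _).le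
    have : ρ / Real.pi * θ = ρ * (θ / Real.pi) := by ring
    rw [neg_mul, this]
    linarith
  · refine le_add_of_nonneg_of_le (Real.exp_pos _).le (Real.exp_le_exp.2 ?_)
    have : ρ / Real.pi * (2 * Real.pi - θ) = ρ * ((2 * Real.pi - θ) / Real.pi) := by ring
    rw [neg_mul, this]
    linarith

/-- Jordan's inequality makes the mean of `exp (-ρ sin (θ / 2))` over the circle `O(1 / ρ)`. -/
theorem integral_exp_neg_mul_sin_half_le {ρ : ℝ} (hρ : 0 < ρ) :
    ∫ θ in (0 : ℝ)..2 * Real.pi, Real.exp (-(ρ * Real.sin (θ / 2))) ≤ 2 * Real.pi / ρ := by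
  have hpi := Real.pi_pos
  have hle : (0:ℝ) ≤ 2 * Real.pi := by positivity
  have h1 : ∫ θ in (0 : ℝ)..2 * Real.pi, Real.exp (-(ρ / Real.pi) * θ) ≤ Real.pi / ρ := by
    have hne : -(ρ / Real.pi) ≠ 0 := by simp [hρ.ne', hpi.ne']
    rw [intervalIntegral.integral_comp_mul_left (fun x => Real.exp x) hne, integral_exp]
    have h3 : (-(ρ / Real.pi))⁻¹ = -(Real.pi / ρ) := by rw [inv_neg, inv_div]
    rw [h3, smul_eq_mul, mul_zero, Real.exp_zero]
    have := Real.exp_pos (-(ρ / Real.pi) * (2 * Real.pi))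
    have h4 : 0 < Real.pi / ρ := by positivity
    nlinarith
  have h2 : ∫ θ in (0 : ℝ)..2 * Real.pi, Real.exp (-(ρ / Real.pi) * (2 * Real.pi - θ)) ≤
      Real.pi / ρ := by
    rw [intervalIntegral.integral_comp_sub_left (fun θ => Real.exp (-(ρ / Real.pi) * θ))]
    simpa using h1
  calc _ ≤ ∫ θ in (0 : ℝ)..2 * Real.pi, (Real.exp (-(ρ / Real.pi) * θ) +
        Real.exp (-(ρ / Real.pi) * (2 * Real.pi - θ))) := by
        refine intervalIntegral.integral_mono_on hle
          (by apply Continuous.intervalIntegrable; fun_prop)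
          (by apply Continuous.intervalIntegrable; fun_prop)
          fun θ hθ => exp_neg_mul_sin_half_le hρ hθ.1 hθ.2
    _ ≤ 2 * Real.pi / ρ := by
        rw [intervalIntegral.integral_add (by apply Continuous.intervalIntegrable; fun_prop)
          (by apply Continuous.intervalIntegrable; fun_prop)]
        have : 2 * Real.pi / ρ = Real.pi / ρ + Real.pi / ρ := by ring
        linarith

/-- Comparison of two circle averages on `|z| = ρ²`, parametrized by `z = k²`, from pointwise
bounds that may degenerate near the real axis of the `k`-plane: the factor `√ρ` there is outweighed
by the mean `O(1 / ρ)` of `exp (-Im k)`. -/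
theorem abs_circleAverage_log_norm_sub_le {D S : ℂ → ℂ} (hD : Differentiable ℂ D)
    (hS : Differentiable ℂ S) {ρ A B : ℝ} (hρ : 1 ≤ ρ)
    (hl : ∀ k : ℂ, ‖k‖ = ρ → 0 ≤ k.im → -B ≤ Real.log ‖D (k ^ 2)‖ - Real.log ‖S (k ^ 2)‖ + A)
    (hu : ∀ k : ℂ, ‖k‖ = ρ → 0 ≤ k.im → Real.log ‖D (k ^ 2)‖ - Real.log ‖S (k ^ 2)‖ + A ≤
      B + 2 * Real.sqrt ρ * Real.exp (-k.im)) :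
    |Real.circleAverage (fun z => Real.log ‖D z‖) 0 (ρ ^ 2) -
      Real.circleAverage (fun z => Real.log ‖S z‖) 0 (ρ ^ 2) + A| ≤ B + 2 := by
  have hρ0 : 0 < ρ := by linarith
  have hpi := Real.pi_pos
  have hle : (0:ℝ) ≤ 2 * Real.pi := by positivity
  have hDi : CircleIntegrable (fun z => Real.log ‖D z‖) 0 (ρ ^ 2) :=
    MeromorphicOn.circleIntegrable_log_norm fun z _ => (hD.analyticAt z).meromorphicAt
  have hSi : CircleIntegrable (fun z => Real.log ‖S z‖) 0 (ρ ^ 2) :=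
    MeromorphicOn.circleIntegrable_log_norm fun z _ => (hS.analyticAt z).meromorphicAt
  set u : ℝ → ℝ := fun θ => Real.log ‖D (circleMap 0 (ρ ^ 2) θ)‖ -
    Real.log ‖S (circleMap 0 (ρ ^ 2) θ)‖ + A with hu'
  have hui : IntervalIntegrable u volume 0 (2 * Real.pi) :=
    (IntervalIntegrable.sub hDi hSi).add intervalIntegrable_const
  have havg : Real.circleAverage (fun z => Real.log ‖D z‖) 0 (ρ ^ 2) -
      Real.circleAverage (fun z => Real.log ‖S z‖) 0 (ρ ^ 2) + A =
      (2 * Real.pi)⁻¹ * ∫ θ in (0:ℝ)..2 * Real.pi, u θ := by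
    rw [hu', intervalIntegral.integral_add (IntervalIntegrable.sub hDi hSi)
      intervalIntegrable_const, intervalIntegral.integral_sub hDi hSi,
      intervalIntegral.integral_const, Real.circleAverage_def, Real.circleAverage_def]
    simp only [smul_eq_mul, sub_zero]
    field_simp
  -- A full turn of `z` is a half turn of `k` in the upper half plane.
  have hk : ∀ θ ∈ Icc (0:ℝ) (2 * Real.pi), ∃ k : ℂ, ‖k‖ = ρ ∧ k.im = ρ * Real.sin (θ / 2) ∧
      0 ≤ k.im ∧ k ^ 2 = circleMap 0 (ρ ^ 2) θ := by
    intro θ hθ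
    have him : (circleMap 0 ρ (θ / 2)).im = ρ * Real.sin (θ / 2) := by
      rw [circleMap_zero, Complex.im_ofReal_mul, Complex.exp_ofReal_mul_I_im]
    refine ⟨circleMap 0 ρ (θ / 2), by simp [abs_of_pos hρ0], him, ?_, ?_⟩
    · rw [him]
      exact mul_nonneg hρ0.le (Real.sin_nonneg_of_nonneg_of_le_pi (by linarith [hθ.1])
        (by linarith [hθ.2]))
    · rw [circleMap_zero, circleMap_zero, mul_pow, ← Complex.exp_nat_mul]
      push_cast
      congr 2
      ring
  have hlow : ∫ θ in (0:ℝ)..2 * Real.pi, -B ≤ ∫ θ in (0:ℝ)..2 * Real.pi, u θ := by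
    refine intervalIntegral.integral_mono_on hle intervalIntegrable_const hui fun θ hθ => ?_
    obtain ⟨k, h1, _, h3, h4⟩ := hk θ hθ
    have := hl k h1 h3
    rwa [h4] at this
  have hupp : ∫ θ in (0:ℝ)..2 * Real.pi, u θ ≤ ∫ θ in (0:ℝ)..2 * Real.pi,
      (B + 2 * Real.sqrt ρ * Real.exp (-(ρ * Real.sin (θ / 2)))) := by
    refine intervalIntegral.integral_mono_on hle hui
      (by apply Continuous.intervalIntegrable; fun_prop) fun θ hθ => ?_
    obtain ⟨k, h1, h2, h3, h4⟩ := hk θ hθ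
    have := hu k h1 h3
    rwa [h4, h2] at this
  rw [intervalIntegral.integral_const, smul_eq_mul, sub_zero] at hlow
  rw [intervalIntegral.integral_add intervalIntegrable_const
    (by apply Continuous.intervalIntegrable; fun_prop), intervalIntegral.integral_const,
    intervalIntegral.integral_const_mul, smul_eq_mul, sub_zero] at hupp
  have h5 : 2 * Real.sqrt ρ * (∫ θ in (0 : ℝ)..2 * Real.pi,
      Real.exp (-(ρ * Real.sin (θ / 2)))) ≤ 2 * (2 * Real.pi) := by
    have h6 : Real.sqrt ρ ≤ ρ := Real.sqrt_le_iff.2 ⟨hρ0.le, by nlinarith⟩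
    have h7 := integral_exp_neg_mul_sin_half_le hρ0
    calc _ ≤ 2 * ρ * (2 * Real.pi / ρ) := by
          refine mul_le_mul (by linarith) h7 ?_ (by positivity)
          exact intervalIntegral.integral_nonneg hle fun θ _ => (Real.exp_pos _).le
      _ = _ := by field_simp
  rw [havg, abs_le, ← div_eq_inv_mul, le_div_iff₀ (by positivity), div_le_iff₀ (by positivity)]
  constructor <;> nlinarith

/-! ### The model function `sin 2k` -/

/-- If `exp z` is close to `1`, then `z` is close to a multiple of `2 π i`. -/
theorem exists_int_near_of_exp_near_one {r : ℝ} (hr : 0 < r) :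
    ∃ δ > 0, ∀ z : ℂ, ‖Complex.exp z - 1‖ ≤ δ →
      ∃ m : ℤ, ‖z - m * (2 * Real.pi * Complex.I)‖ < r := by
  have hc : ContinuousAt Complex.log 1 := continuousAt_clog Complex.one_mem_slitPlane
  obtain ⟨δ, hδ, h⟩ := Metric.continuousAt_iff.1 hc r hr
  refine ⟨δ / 2, by positivity, fun z hz => ?_⟩
  have h1 := @h (Complex.exp z) (by rw [dist_eq_norm]; linarith)
  rw [Complex.log_one, dist_zero_right] at h1
  obtain ⟨m, hm⟩ := Complex.exp_eq_exp_iff_exists_int.1 (Complex.exp_log (Complex.exp_ne_zero z))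
  refine ⟨-m, ?_⟩
  have : z - ((-m : ℤ) : ℂ) * (2 * Real.pi * Complex.I) = Complex.log (Complex.exp z) := by
    rw [hm]; push_cast; ring
  rwa [this]

theorem norm_sin_two_mul_eq (k : ℂ) :
    ‖Complex.sin (2 * k)‖ =
      Real.exp (2 * k.im) * ‖Complex.exp (4 * Complex.I * k) - 1‖ / 2 := by
  have h : Complex.sin (2 * k) = (-Complex.I / 2) * (Complex.exp (-2 * Complex.I * k) *
      (Complex.exp (4 * Complex.I * k) - 1)) := by
    rw [mul_sub, ← Complex.exp_add, Complex.sin]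
    ring_nf
  have h2 : ‖Complex.exp (-2 * Complex.I * k)‖ = Real.exp (2 * k.im) := by
    rw [Complex.norm_exp]; congr 1; simp
  rw [h, norm_mul, norm_mul, h2]
  simp
  ring

/-- Away from the zeros `m π / 2`, the function `sin 2k` is as large as `exp (2 Im k)`. -/
theorem exists_near_of_norm_sin_le {r : ℝ} (hr : 0 < r) :
    ∃ δ > 0, ∀ k : ℂ, ‖Complex.sin (2 * k)‖ ≤ δ * Real.exp (2 * k.im) →
      ∃ m : ℤ, ‖k - m * (Real.pi / 2)‖ < r := by
  obtain ⟨δ, hδ, h⟩ := exists_int_near_of_exp_near_one (r := 4 * r) (by positivity)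
  refine ⟨δ / 2, by positivity, fun k hk => ?_⟩
  rw [norm_sin_two_mul_eq] at hk
  have hE := Real.exp_pos (2 * k.im)
  obtain ⟨m, hm⟩ := h (4 * Complex.I * k) (by
    have : Real.exp (2 * k.im) * ‖Complex.exp (4 * Complex.I * k) - 1‖ ≤
      Real.exp (2 * k.im) * δ := by linarith
    exact le_of_mul_le_mul_left this hE)
  refine ⟨m, ?_⟩
  have h1 : 4 * Complex.I * k - m * (2 * Real.pi * Complex.I) =
      (4 * Complex.I) * (k - m * (Real.pi / 2)) := by ring
  rw [h1, norm_mul] at hm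
  simp at hm
  linarith

/-- The circles of radius `(m + 1/2) π / 2` keep a distance `π / 4` from the zeros of `sin 2k`. -/
theorem exists_norm_sin_ge_on_circle : ∃ c > 0, ∀ (m : ℕ) (k : ℂ),
    ‖k‖ = ((m : ℝ) + 1 / 2) * (Real.pi / 2) →
      c * Real.exp (2 * k.im) ≤ ‖Complex.sin (2 * k)‖ := by
  have hpi := Real.pi_pos
  obtain ⟨δ, hδ, h⟩ := exists_near_of_norm_sin_le (r := Real.pi / 4) (by positivity)
  refine ⟨δ, hδ, fun m k hk => ?_⟩
  by_contra hlt
  obtain ⟨j, hj⟩ := h k (not_le.1 hlt).le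
  have h1 := abs_norm_sub_norm_le k (j * (Real.pi / 2))
  have h2 : ‖(j : ℂ) * ((Real.pi : ℂ) / 2)‖ = (j.natAbs : ℝ) * (Real.pi / 2) := by
    rw [norm_mul, norm_div, Complex.norm_real, Complex.norm_intCast, Complex.norm_two,
      Real.norm_of_nonneg hpi.le, Nat.cast_natAbs, Int.cast_abs]
  rw [hk, h2, ← sub_mul, abs_mul, abs_of_pos (half_pos hpi)] at h1
  have h3 : (1:ℝ) / 2 ≤ |(m : ℝ) + 1 / 2 - (j.natAbs : ℝ)| := by
    rcases le_or_gt j.natAbs m with h4 | h4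
    · have : (j.natAbs : ℝ) ≤ m := by exact_mod_cast h4
      rw [abs_of_nonneg (by linarith)]; linarith
    · have : (m : ℝ) + 1 ≤ j.natAbs := by exact_mod_cast h4
      rw [abs_of_nonpos (by linarith)]; linarith
  nlinarith

/-- The entire function `sin (2√λ) / (2√λ)`, as the product of `φ₀(1, λ)` and `φ₀'(1, λ)`. -/
noncomputable def sincDouble (lam : ℂ) : ℂ :=
  (dirichletSolution (fun _ => 0) lam).1 1 * (dirichletSolution (fun _ => 0) lam).2 1

theorem differentiable_sincDouble : Differentiable ℂ sincDouble := by
  have := differentiable_dirichletSolution_one (q := fun _ => 0) continuousOn_const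
  exact this.1.mul this.2

theorem sin_two_mul_eq_sincDouble (k : ℂ) : Complex.sin (2 * k) = 2 * k * sincDouble (k ^ 2) := by
  by_cases hk : k = 0
  · simp [hk]
  have := dirichletSolution_zero hk (right_mem_Icc.2 zero_le_one)
  rw [sincDouble, this.1, this.2, Complex.sin_two_mul]
  simp only [Complex.ofReal_one, mul_one]
  field_simp

theorem hasDerivAt_sin_two_mul (k : ℂ) :
    HasDerivAt (fun k : ℂ => Complex.sin (2 * k)) (Complex.cos (2 * k) * 2) k := by
  have := ((hasDerivAt_id' k).const_mul (2 : ℂ)).csin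
  rwa [mul_one] at this

theorem sincDouble_zero : sincDouble 0 = 1 := by
  have h1 : HasDerivAt (fun k : ℂ => Complex.sin (2 * k)) 2 0 := by
    simpa using hasDerivAt_sin_two_mul 0
  have h2 : HasDerivAt (fun k : ℂ => Complex.sin (2 * k)) (2 * sincDouble 0) 0 := by
    rw [funext sin_two_mul_eq_sincDouble]
    have hd : Differentiable ℂ fun k : ℂ => sincDouble (k ^ 2) :=
      differentiable_sincDouble.comp (by fun_prop)
    have h3 : HasDerivAt (fun k : ℂ => 2 * k) 2 0 := by
      simpa using (hasDerivAt_id (0:ℂ)).const_mul 2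
    have h4 : HasDerivAt (fun k : ℂ => 2 * k * sincDouble (k ^ 2)) _ 0 := h3.mul (hd 0).hasDerivAt
    simpa using h4
  have := h1.unique h2
  simpa using this.symm

theorem analyticOrderAt_sincDouble {m : ℕ} (hm : m ≠ 0) :
    analyticOrderAt sincDouble (((m : ℂ) * (Real.pi / 2)) ^ 2) = 1 := by
  have hpi : (Real.pi : ℂ) ≠ 0 := by exact_mod_cast Real.pi_ne_zero
  have hm' : (m : ℂ) ≠ 0 := by exact_mod_cast hm
  have e : 2 * ((m : ℂ) * (Real.pi / 2)) = m * Real.pi := by ring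
  refine analyticOrderAt_sq_eq_one (F := fun k => Complex.sin (2 * k)) (c := fun k => 2 * k)
    differentiable_sincDouble (by fun_prop) sin_two_mul_eq_sincDouble ?_ ?_ ?_
  · simp [hm', hpi]
  · simp only [e]
    exact Complex.sin_nat_mul_pi m
  · have h1 : HasDerivAt (fun k : ℂ => Complex.sin (2 * k)) (Complex.cos (m * Real.pi) * 2)
        ((m : ℂ) * (Real.pi / 2)) := by
      simpa only [e] using hasDerivAt_sin_two_mul ((m : ℂ) * (Real.pi / 2))
    rw [h1.deriv]
    have h2 := Complex.sin_sq_add_cos_sq (m * Real.pi)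
    rw [Complex.sin_nat_mul_pi] at h2
    intro h3
    rw [mul_eq_zero] at h3
    simp [h3.resolve_right two_ne_zero] at h2

theorem exists_nat_of_sincDouble_eq_zero {z : ℂ} (hz : sincDouble z = 0) :
    ∃ m : ℕ, m ≠ 0 ∧ ((m : ℂ) * (Real.pi / 2)) ^ 2 = z := by
  obtain ⟨k, rfl⟩ : ∃ k : ℂ, k ^ 2 = z := ⟨z ^ (1 / 2 : ℂ), by rw [← Complex.cpow_nat_mul]; simp⟩
  have hk : k ≠ 0 := by
    rintro rfl
    simp [sincDouble_zero] at hz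
  have hs := sin_two_mul_eq_sincDouble k
  rw [hz, mul_zero] at hs
  obtain ⟨j, hj⟩ := Complex.sin_eq_zero_iff.1 hs
  have hk' : k = j * (Real.pi / 2) := by linear_combination hj / 2
  refine ⟨j.natAbs, ?_, ?_⟩
  · rintro h0
    rw [Int.natAbs_eq_zero] at h0
    exact hk (by rw [hk', h0]; simp)
  · rw [hk', mul_pow, mul_pow]
    congr 1
    have h1 : ((j.natAbs : ℂ)) = ((j.natAbs : ℤ) : ℂ)  :=
      (Int.cast_natCast j.natAbs).symm
    rw [h1, ← Int.cast_pow, ← Int.cast_pow, Int.natAbs_sq]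

/-- All zeros of the model function are simple, so any finite set `J` of their indices may be
declared exceptional. -/
theorem hasSimpleTail_sincDouble {ι : Type*} {j : ι → ℕ} (hj : Function.Injective j)
    (J : Finset ℕ) (hJ : ∀ m, m ≠ 0 → (m ∈ J ↔ m ∉ range j)) (hJ0 : 0 ∉ J) (hj0 : ∀ i, j i ≠ 0) :
    ∃ Ex : Finset ℂ, HasSimpleTail sincDouble Ex (fun i => ((j i : ℂ) * (Real.pi / 2)) ^ 2) ∧
      ∑ z ∈ Ex, (analyticOrderAt sincDouble z).toNat = J.card := by
  classical
  have hinj : Function.Injective fun m : ℕ => ((m : ℂ) * (Real.pi / 2)) ^ 2 := by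
    intro m m' h
    simp only [mul_pow] at h
    have h2 := mul_right_cancel₀ (by simp) h
    have h3 : m ^ 2 = m' ^ 2 := by exact_mod_cast h2
    exact Nat.pow_left_injective two_ne_zero h3
  refine ⟨J.image fun m : ℕ => ((m : ℂ) * (Real.pi / 2)) ^ 2, ⟨differentiable_sincDouble,
    hinj.comp hj, fun i => analyticOrderAt_sincDouble (hj0 i), ?_, ?_, ?_⟩, ?_⟩
  · intro i hi
    obtain ⟨m, hm, hmi⟩ := Finset.mem_image.1 hi
    have := hinj hmi
    subst this
    exact (hJ _ (hj0 i)).1 hm ⟨i, rfl⟩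
  · intro z hz
    by_cases h0 : sincDouble z = 0
    · obtain ⟨m, hm, rfl⟩ := exists_nat_of_sincDouble_eq_zero h0
      rw [analyticOrderAt_sincDouble hm] at hz
      exact absurd hz (by decide)
    · rw [(differentiable_sincDouble.analyticAt z).analyticOrderAt_eq_zero.2 h0] at hz
      exact absurd hz (by decide)
  · intro z hz
    obtain ⟨m, hm, rfl⟩ := exists_nat_of_sincDouble_eq_zero hz
    by_cases hmJ : m ∈ J
    · exact Or.inl (Finset.mem_image_of_mem _ hmJ)
    · obtain ⟨i, rfl⟩ := not_not.1 ((hJ m hm).not.1 hmJ)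
      exact Or.inr ⟨i, rfl⟩
  · rw [Finset.sum_image hinj.injOn, Finset.card_eq_sum_ones]
    refine Finset.sum_congr rfl fun m hm => ?_
    rw [analyticOrderAt_sincDouble (fun h => hJ0 (h ▸ hm))]
    rfl

theorem analyticOrderAt_ne_top_of_entire {D : ℂ → ℂ} (hD : Differentiable ℂ D) {z₀ : ℂ}
    (h0 : D z₀ ≠ 0) (z : ℂ) : analyticOrderAt D z ≠ ⊤ := by
  have ha : AnalyticOnNhd ℂ D univ := fun z _ => hD.analyticAt z
  refine ha.analyticOrderAt_ne_top_of_isPreconnected isPreconnected_univ (mem_univ z₀)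
    (mem_univ z) ?_
  rw [(hD.analyticAt z₀).analyticOrderAt_eq_zero.2 h0]
  decide

theorem finite_zeros_of_bounded {D : ℂ → ℂ} (hD : Differentiable ℂ D) {z₀ : ℂ} (h0 : D z₀ ≠ 0)
    {s : Set ℂ} (hs : ∀ z ∈ s, D z = 0) {K : ℝ} (hK : ∀ z ∈ s, ‖z‖ ≤ K) : s.Finite := by
  have hf := (MeromorphicOn.divisor D (Metric.closedBall 0 K)).finiteSupport
    (isCompact_closedBall 0 K)
  have ha : AnalyticOnNhd ℂ D (Metric.closedBall 0 K) := fun z _ => hD.analyticAt z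
  refine hf.subset fun z hz => ?_
  rw [Function.mem_support, MeromorphicOn.AnalyticOnNhd.divisor_apply ha (by simpa using! hK z hz)]
  obtain ⟨n, hn⟩ := ENat.ne_top_iff_exists.1 (analyticOrderAt_ne_top_of_entire hD h0 z)
  have hn0 : n ≠ 0 := by
    rintro rfl
    exact (hD.analyticAt z).analyticOrderAt_eq_zero.1 hn.symm (hs z hz)
  rw [← hn]
  change ((n : ℤ)) ≠ 0
  exact_mod_cast hn0

theorem exists_hasSimpleTail {ι : Type*} {D : ℂ → ℂ} (hD : Differentiable ℂ D) {z₀ : ℂ}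
    (h0 : D z₀ ≠ 0) {t : ι → ℂ} (ht : Function.Injective t)
    (hord : ∀ i, analyticOrderAt D (t i) = 1) {K : ℝ}
    (hK : ∀ z, D z = 0 → K < ‖z‖ → ∃ i, t i = z) : ∃ Ex, HasSimpleTail D Ex t := by
  have hfin : {z | D z = 0 ∧ ∀ i, t i ≠ z}.Finite := by
    refine finite_zeros_of_bounded hD h0 (fun z hz => hz.1) (K := K) fun z hz => ?_
    by_contra hlt
    obtain ⟨i, hi⟩ := hK z hz.1 (not_le.1 hlt)
    exact hz.2 i hi
  refine ⟨hfin.toFinset, hD, ht, hord, fun i hi => ?_, analyticOrderAt_ne_top_of_entire hD h0,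
    fun z hz => ?_⟩
  · simp only [Finite.mem_toFinset] at hi
    exact hi.2 i rfl
  · by_cases h : ∃ i, t i = z
    · exact Or.inr h
    · push Not at h
      exact Or.inl (by simpa using ⟨hz, h⟩)

theorem log_one_add_le_two_mul_sqrt {x : ℝ} (hx : 0 ≤ x) : Real.log (1 + x) ≤ 2 * Real.sqrt x := by
  have hs := Real.sqrt_nonneg x
  have h1 : 1 + x ≤ (1 + Real.sqrt x) ^ 2 := by nlinarith [Real.sq_sqrt hx]
  calc Real.log (1 + x) ≤ Real.log ((1 + Real.sqrt x) ^ 2) := Real.log_le_log (by positivity) h1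
    _ = 2 * Real.log (1 + Real.sqrt x) := by rw [Real.log_pow]; norm_num
    _ ≤ 2 * Real.sqrt x := by
      have := Real.log_le_sub_one_of_pos (show 0 < 1 + Real.sqrt x by positivity)
      linarith

/-- On the circles that separate the zeros of `sin 2k`, two-sided bounds for `4 k³ Δ(k²)` give a
bound for the circle averages of `log ‖Δ‖`, compared with those of the model function. -/
theorem exists_circleAverage_bound {δ C : ℝ} (hδ : 0 < δ) (hC : 0 < C) : ∃ B : ℝ,
    ∀ (D : ℂ → ℂ), Differentiable ℂ D → ∀ m : ℕ, 1 ≤ m →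
      (∀ k : ℂ, ‖k‖ = ((m : ℝ) + 1 / 2) * (Real.pi / 2) → 0 ≤ k.im →
        δ * Real.exp (2 * k.im) ≤ ‖4 * k ^ 3 * D (k ^ 2)‖ ∧
        ‖4 * k ^ 3 * D (k ^ 2)‖ ≤ C * (‖k‖ + Real.exp (2 * k.im))) →
      |Real.circleAverage (fun z => Real.log ‖D z‖) 0 ((((m : ℝ) + 1 / 2) * (Real.pi / 2)) ^ 2) -
        Real.circleAverage (fun z => Real.log ‖sincDouble z‖) 0
          ((((m : ℝ) + 1 / 2) * (Real.pi / 2)) ^ 2) +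
        Real.log ((((m : ℝ) + 1 / 2) * (Real.pi / 2)) ^ 2)| ≤ B := by
  obtain ⟨c, hc, hsin⟩ := exists_norm_sin_ge_on_circle
  have hpi := Real.pi_gt_three
  refine ⟨max (Real.log (2 / δ)) (Real.log (C / (2 * c))) + 2, fun D hD m hm hb => ?_⟩
  set ρ : ℝ := ((m : ℝ) + 1 / 2) * (Real.pi / 2) with hρ
  have hm' : (1:ℝ) ≤ m := by exact_mod_cast hm
  have hρ1 : 1 ≤ ρ := by rw [hρ]; nlinarith
  have hρ0 : 0 < ρ := by linarith
  have key : ∀ k : ℂ, ‖k‖ = ρ → 0 ≤ k.im →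
      Real.log ‖D (k ^ 2)‖ - Real.log ‖sincDouble (k ^ 2)‖ + Real.log (ρ ^ 2) =
        Real.log (‖4 * k ^ 3 * D (k ^ 2)‖ / (2 * ‖Complex.sin (2 * k)‖)) := by
    intro k hk him
    have hE := Real.exp_pos (2 * k.im)
    have h1 : 0 < ‖4 * k ^ 3 * D (k ^ 2)‖ := lt_of_lt_of_le (by positivity) (hb k hk him).1
    have h2 : 0 < ‖Complex.sin (2 * k)‖ := lt_of_lt_of_le (by positivity) (hsin m k hk)
    have h3 : ‖Complex.sin (2 * k)‖ = 2 * ρ * ‖sincDouble (k ^ 2)‖ := by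
      rw [sin_two_mul_eq_sincDouble, norm_mul, norm_mul, hk, Complex.norm_two]
    have h4 : ‖4 * k ^ 3 * D (k ^ 2)‖ = 4 * ρ ^ 3 * ‖D (k ^ 2)‖ := by
      rw [norm_mul, norm_mul, norm_pow, hk]; norm_num
    rw [h3] at h2 ⊢
    rw [h4] at h1 ⊢
    have h5 : 0 < ‖sincDouble (k ^ 2)‖ := by
      by_contra h; exact absurd h2 (by nlinarith)
    have h6 : 0 < ‖D (k ^ 2)‖ := by
      by_contra h; exact absurd h1 (by nlinarith [pow_pos hρ0 3])
    rw [← Real.log_div h6.ne' h5.ne', ← Real.log_mul (by positivity) (by positivity)]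
    congr 1
    field_simp
    ring
  -- The upper bound uses `log (1 + ρ exp (-2 Im k)) ≤ 2 √ρ exp (-Im k)`.
  refine abs_circleAverage_log_norm_sub_le hD differentiable_sincDouble hρ1 ?_ ?_
  · intro k hk him
    rw [key k hk him]
    have hE := Real.exp_pos (2 * k.im)
    have h2 : 0 < ‖Complex.sin (2 * k)‖ := lt_of_lt_of_le (by positivity) (hsin m k hk)
    have h3 : ‖Complex.sin (2 * k)‖ ≤ Real.exp (2 * k.im) := by
      have := Complex.norm_sin_le_exp (2 * k)
      simpa [abs_mul, abs_of_nonneg him] using this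
    have h4 : δ / 2 ≤ ‖4 * k ^ 3 * D (k ^ 2)‖ / (2 * ‖Complex.sin (2 * k)‖) := by
      rw [le_div_iff₀ (by positivity)]
      nlinarith [(hb k hk him).1]
    have h5 := Real.log_le_log (by positivity) h4
    have h6 : Real.log (δ / 2) = -Real.log (2 / δ) := by rw [← Real.log_inv, inv_div]
    have := le_max_left (Real.log (2 / δ)) (Real.log (C / (2 * c)))
    linarith
  · intro k hk him
    rw [key k hk him]
    have hE := Real.exp_pos (2 * k.im)
    have h1 : 0 < ‖4 * k ^ 3 * D (k ^ 2)‖ := lt_of_lt_of_le (by positivity) (hb k hk him).1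
    have h2 := hsin m k hk
    have h4 : ‖4 * k ^ 3 * D (k ^ 2)‖ / (2 * ‖Complex.sin (2 * k)‖) ≤
        C / (2 * c) * (1 + ρ * Real.exp (-(2 * k.im))) := by
      calc _ ≤ C * (ρ + Real.exp (2 * k.im)) / (2 * (c * Real.exp (2 * k.im))) := by
            have := (hb k hk him).2
            rw [hk] at this
            gcongr
        _ = _ := by
            rw [Real.exp_neg]
            field_simp
            ring
    have hs : 0 < ‖Complex.sin (2 * k)‖ := lt_of_lt_of_le (by positivity) h2
    have h5 := Real.log_le_log (by positivity) h4
    rw [Real.log_mul (by positivity) (by positivity)] at h5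
    have h6 := log_one_add_le_two_mul_sqrt (x := ρ * Real.exp (-(2 * k.im))) (by positivity)
    have h7 : Real.sqrt (ρ * Real.exp (-(2 * k.im))) = Real.sqrt ρ * Real.exp (-k.im) := by
      rw [Real.sqrt_mul hρ0.le]
      congr 1
      rw [Real.sqrt_eq_iff_mul_self_eq (Real.exp_pos _).le (Real.exp_pos _).le, ← Real.exp_add]
      congr 1; ring
    rw [h7] at h6
    have := le_max_right (Real.log (2 / δ)) (Real.log (C / (2 * c)))
    linarith

/-! ### The characteristic function in the variable `k` -/

section SquareSummable

theorem MemL2Seq.of_eventually_le {u a : ℕ → ℂ} (ha : MemL2Seq a) (C : ℝ)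
    (h : ∀ᶠ n in atTop, ‖u n‖ ≤ C * ‖a n‖) : MemL2Seq u := by
  refine Summable.of_norm_bounded_eventually_nat (g := fun n => C ^ 2 * ‖a n‖ ^ 2)
    (Summable.mul_left _ ha) ?_
  filter_upwards [h] with n hn
  rw [Real.norm_of_nonneg (sq_nonneg _), ← mul_pow]
  exact pow_le_pow_left₀ (norm_nonneg _) hn 2

theorem MemL2Seq.add {u v : ℕ → ℂ} (hu : MemL2Seq u) (hv : MemL2Seq v) :
    MemL2Seq fun n => u n + v n := by
  refine Summable.of_nonneg_of_le (fun n => sq_nonneg _) (fun n => ?_)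
    ((Summable.add hu hv).mul_left 2)
  have := norm_add_le (u n) (v n)
  nlinarith [norm_nonneg (u n + v n), sq_nonneg (‖u n‖ - ‖v n‖)]

theorem MemL2Seq.of_eventually_le_add {u a b : ℕ → ℂ} (ha : MemL2Seq a) (hb : MemL2Seq b) (C : ℝ)
    (h : ∀ᶠ n in atTop, ‖u n‖ ≤ C * (‖a n‖ + ‖b n‖)) : MemL2Seq u := by
  have ha' : MemL2Seq fun n => (‖a n‖ : ℂ) := ha.of_eventually_le 1 (.of_forall fun n => by simp)
  have hb' : MemL2Seq fun n => (‖b n‖ : ℂ) := hb.of_eventually_le 1 (.of_forall fun n => by simp)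
  refine (ha'.add hb').of_eventually_le C ?_
  filter_upwards [h] with n hn
  rwa [← Complex.ofReal_add, Complex.norm_real, Real.norm_of_nonneg (by positivity)]

theorem memL2Seq_one_div : MemL2Seq fun n => (1 / ((n : ℝ) + 1) : ℝ) := by
  have h : Summable fun n : ℕ => 1 / ((n + 1 : ℕ) : ℝ) ^ 2 :=
    (summable_nat_add_iff 1).2 (Real.summable_one_div_nat_pow.2 one_lt_two)
  refine h.congr fun n => ?_
  rw [Complex.norm_real, Real.norm_of_nonneg (by positivity), div_pow, one_pow]
  push_cast
  rfl

theorem MemL2Seq.exists_norm_le {u : ℕ → ℂ} (hu : MemL2Seq u) : ∃ C, 0 ≤ C ∧ ∀ n, ‖u n‖ ≤ C := by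
  refine ⟨1 + ∑' n, ‖u n‖ ^ 2, add_nonneg zero_le_one (tsum_nonneg fun n => sq_nonneg _),
    fun n => ?_⟩
  have := Summable.le_tsum hu n fun m _ => sq_nonneg _
  nlinarith [sq_nonneg (‖u n‖ - 1)]

end SquareSummable

/-- Sequences of points along which Fourier–Laplace coefficients of square integrable functions
are square summable: the real parts are separated, the imaginary parts are bounded below and vary
slowly, namely by `O(√|n - m|)`, and the points grow at least linearly. -/
def IsBesselSequence (k : ℕ → ℂ) : Prop :=
  ∃ C c : ℝ, 0 < c ∧ (∀ n, -C ≤ (k n).im) ∧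
    (∀ n m, |(k n).im - (k m).im| ≤ C * Real.sqrt (Nat.dist n m)) ∧
    (∀ n m, c * Nat.dist n m ≤ |(k n).re - (k m).re|) ∧ ∀ n : ℕ, c * ((n : ℝ) + 1) ≤ ‖k n‖

/-- `4 k³ Δ(k²)`. -/
noncomputable def scaledCharFun (q : ℝ → ℝ) (k : ℂ) : ℂ := 4 * k ^ 3 * dirichletCharFun q (k ^ 2)

/-- The leading part `2 ω k - q(1) sin 2k` of `4 k³ Δ(k²)`. -/
noncomputable def leadingFun (q : ℝ → ℝ) (k : ℂ) : ℂ :=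
  2 * (omega q : ℂ) * k - (q 1 : ℂ) * Complex.sin (2 * k)

section Expansion

variable {q : ℝ → ℝ}

theorem MemW21.continuousOn (hq : MemW21 q) : ContinuousOn q (Icc 0 1) :=
  hq.1.continuousOn_zero_one

theorem differentiable_scaledCharFun (hq : ContinuousOn q (Icc 0 1)) :
    Differentiable ℂ (scaledCharFun q) := by
  have h : Differentiable ℂ fun k : ℂ => dirichletCharFun q (k ^ 2) :=
    (differentiable_dirichletCharFun hq).comp (by fun_prop)
  have h2 : Differentiable ℂ fun k : ℂ => 4 * k ^ 3 := by fun_prop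
  exact h2.mul h

theorem differentiable_leadingFun (q : ℝ → ℝ) : Differentiable ℂ (leadingFun q) := by
  unfold leadingFun
  fun_prop

theorem scaledCharFun_neg (k : ℂ) : scaledCharFun q (-k) = -scaledCharFun q k := by
  simp only [scaledCharFun, neg_sq]
  ring

theorem scaledCharFun_conj (hq : ContinuousOn q (Icc 0 1)) (k : ℂ) :
    scaledCharFun q (conj k) = conj (scaledCharFun q k) := by
  simp only [scaledCharFun, map_mul, map_pow, ← dirichletCharFun_conj hq, map_ofNat]

/-- The remainder `4 k³ Δ(k²) - (2 ω k - q(1) sin 2k)` is `o(exp (2 |Im k|))`. -/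
theorem exists_norm_remainder_le (hq : MemW21 q) {ε : ℝ} (hε : 0 < ε) :
    ∃ K : ℝ, 0 < K ∧ ∀ k : ℂ, K ≤ ‖k‖ →
      ‖scaledCharFun q k - leadingFun q k‖ ≤ ε * Real.exp (2 * |k.im|) := by
  obtain ⟨g, hg, C, K, hK, h⟩ := charFun_expansion_first_order hq
  obtain ⟨K', hK', h'⟩ := exists_norm_integral_mul_sin_le hg (half_pos hε)
  refine ⟨max (max K K') (|C| / (ε / 2) + 1), by positivity, fun k hk => ?_⟩
  have h1 := h k ((le_max_left _ _).trans ((le_max_left _ _).trans hk))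
  have h2 := h' k ((le_max_right _ _).trans ((le_max_left _ _).trans hk))
  have h3 : |C| / (ε / 2) + 1 ≤ ‖k‖ := (le_max_right _ _).trans hk
  have hk0 : 0 < ‖k‖ := lt_of_lt_of_le (by positivity) h3
  have hE := Real.exp_pos (2 * |k.im|)
  have h4 : C / ‖k‖ ≤ ε / 2 := by
    rw [div_le_iff₀ hk0]
    have : |C| / (ε / 2) ≤ ‖k‖ := by linarith
    rw [div_le_iff₀ (half_pos hε)] at this
    linarith [le_abs_self C]
  have h5 := mul_le_mul_of_nonneg_right h4 hE.le
  calc ‖scaledCharFun q k - leadingFun q k‖ ≤ _ := norm_le_norm_sub_add _ _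
    _ ≤ _ := add_le_add h1 h2
    _ ≤ ε * Real.exp (2 * |k.im|) := by linarith

theorem IsBesselSequence.exp_abs_im_le {k : ℕ → ℂ} {C : ℝ} (him : ∀ n, -C ≤ (k n).im) (n : ℕ) :
    Real.exp (-2 * (k n).im) * Real.exp (2 * |(k n).im|) ≤ Real.exp (4 * |C|) := by
  rw [← Real.exp_add]
  refine Real.exp_le_exp.2 ?_
  have := him n
  rcases abs_cases (k n).im with ⟨h, _⟩ | ⟨h, _⟩ <;> rw [h] <;>
    linarith [abs_nonneg C, le_abs_self C]

theorem IsBesselSequence.eventually_ge {k : ℕ → ℂ} {c : ℝ} (hc : 0 < c)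
    (hk : ∀ n : ℕ, c * ((n : ℝ) + 1) ≤ ‖k n‖) (K : ℝ) : ∀ᶠ n in atTop, K ≤ ‖k n‖ := by
  filter_upwards [tendsto_natCast_atTop_atTop.eventually_ge_atTop (K / c)] with n hn
  rw [div_le_iff₀ hc] at hn
  linarith [hk n]

/-- For `q ∈ W_2^1` the remainder, weighted by `exp (-2 Im k)`, is square summable along Bessel
sequences. -/
theorem memL2Seq_remainder (hq : MemW21 q) {k : ℕ → ℂ} (hk : IsBesselSequence k) :
    MemL2Seq fun n => (Real.exp (-2 * (k n).im) : ℂ) *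
      (scaledCharFun q (k n) - leadingFun q (k n)) := by
  obtain ⟨g, hg, C', K, hK, h⟩ := charFun_expansion_first_order hq
  obtain ⟨C, c, hc, him, hd, hre, hkn⟩ := hk
  have h1 : MemL2Seq fun n => ((Real.exp (-2 * (k n).im) *
      ‖∫ t in (0 : ℝ)..1, (g t : ℂ) * Complex.sin (2 * k n * t)‖ : ℝ) : ℂ) :=
    (summable_exp_mul_norm_integral_mul_sin_sq hg hc him hd hre).congr fun n => by
      rw [Complex.norm_real, Real.norm_eq_abs, sq_abs]
  refine h1.of_eventually_le_add memL2Seq_one_div (1 + |C'| / c * Real.exp (4 * |C|)) ?_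
  filter_upwards [IsBesselSequence.eventually_ge hc hkn K] with n hn
  have h2 := h (k n) hn
  have h3 := IsBesselSequence.exp_abs_im_le him n
  have hE := Real.exp_pos (-2 * (k n).im)
  have hn1 : (0:ℝ) < (n:ℝ) + 1 := by positivity
  set I := ∫ t in (0 : ℝ)..1, (g t : ℂ) * Complex.sin (2 * k n * t) with hI
  rw [norm_mul]
  simp only [Complex.norm_real, norm_mul, Real.norm_eq_abs, Real.abs_exp, abs_norm,
    abs_of_pos (one_div_pos.2 hn1)]
  have h4 : ‖scaledCharFun q (k n) - leadingFun q (k n)‖ ≤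
      C' / ‖k n‖ * Real.exp (2 * |(k n).im|) + ‖I‖ :=
    (norm_le_norm_sub_add _ _).trans (add_le_add h2 le_rfl)
  have h5 : C' / ‖k n‖ ≤ |C'| / c * (1 / ((n:ℝ) + 1)) := by
    rw [div_mul_div_comm, mul_one]
    exact div_le_div₀ (abs_nonneg _) (le_abs_self _) (by positivity) (hkn n)
  have h6 : 0 ≤ |C'| / c * (1 / ((n:ℝ) + 1)) := by positivity
  calc _ ≤ Real.exp (-2 * (k n).im) *
        (|C'| / c * (1 / ((n:ℝ) + 1)) * Real.exp (2 * |(k n).im|) + ‖I‖) := by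
        refine mul_le_mul_of_nonneg_left (h4.trans ?_) hE.le
        gcongr
    _ = |C'| / c * (1 / ((n:ℝ) + 1)) * (Real.exp (-2 * (k n).im) * Real.exp (2 * |(k n).im|)) +
        Real.exp (-2 * (k n).im) * ‖I‖ := by ring
    _ ≤ |C'| / c * (1 / ((n:ℝ) + 1)) * Real.exp (4 * |C|) +
        Real.exp (-2 * (k n).im) * ‖I‖ := by gcongr
    _ ≤ _ := by
        have a1 : 0 ≤ |C'| / c * Real.exp (4 * |C|) := by positivity
        have a2 : 0 ≤ Real.exp (-2 * (k n).im) * ‖I‖ := by positivity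
        have a3 : 0 < 1 / ((n:ℝ) + 1) := by positivity
        nlinarith [mul_nonneg a1 a2]

/-- The second order expansion along a Bessel sequence. -/
theorem exists_remainder_eq (hq : MemW21 q) (hq2 : MemW22 q) :
    ∃ c₀ : ℝ, (omega q = 0 → c₀ = -Q₄ q) ∧ ∀ k : ℕ → ℂ, IsBesselSequence k →
      ∃ e : ℕ → ℂ, (MemL2Seq fun n => (Real.exp (-2 * (k n).im) : ℂ) * e n) ∧
        ∀ n, scaledCharFun q (k n) - leadingFun q (k n) =
          (2 * k n)⁻¹ * ((Q₃ q : ℂ) * Complex.cos (2 * k n) + c₀ + e n) := by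
  obtain ⟨g, c₀, hg, hc₀, C', K, hK, h⟩ := charFun_expansion_second_order hq hq2
  refine ⟨c₀, hc₀, fun k hk => ?_⟩
  obtain ⟨C, c, hc, him, hd, hre, hkn⟩ := hk
  have hk0 : ∀ n, k n ≠ 0 := fun n h0 => by
    have := hkn n
    rw [h0, norm_zero] at this
    have : 0 < c * ((n:ℝ) + 1) := by positivity
    linarith
  -- `e n` is defined by the identity, so only its square summability has to be shown.
  refine ⟨fun n => 2 * k n * (scaledCharFun q (k n) - leadingFun q (k n)) -
    ((Q₃ q : ℂ) * Complex.cos (2 * k n) + c₀), ?_, fun n => ?_⟩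
  swap
  · have := hk0 n
    field_simp
    ring
  have h1 : MemL2Seq fun n => ((Real.exp (-2 * (k n).im) *
      ‖∫ t in (0 : ℝ)..1, (g t : ℂ) * Complex.cos (2 * k n * t)‖ : ℝ) : ℂ) :=
    (summable_exp_mul_norm_integral_mul_cos_sq hg hc him hd hre).congr fun n => by
      rw [Complex.norm_real, Real.norm_eq_abs, sq_abs]
  refine h1.of_eventually_le_add memL2Seq_one_div (1 + 2 * |C'| / c * Real.exp (4 * |C|)) ?_
  filter_upwards [IsBesselSequence.eventually_ge hc hkn K] with n hn
  have h2 := h (k n) hn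
  have h3 := IsBesselSequence.exp_abs_im_le him n
  have hE := Real.exp_pos (-2 * (k n).im)
  have hn1 : (0:ℝ) < (n:ℝ) + 1 := by positivity
  have hkn0 : 0 < ‖k n‖ := norm_pos_iff.2 (hk0 n)
  set I := ∫ t in (0 : ℝ)..1, (g t : ℂ) * Complex.cos (2 * k n * t) with hI
  rw [norm_mul]
  simp only [Complex.norm_real, norm_mul, Real.norm_eq_abs, Real.abs_exp, abs_norm,
    abs_of_pos (one_div_pos.2 hn1)]
  set e := 2 * k n * (scaledCharFun q (k n) - leadingFun q (k n)) -
    ((Q₃ q : ℂ) * Complex.cos (2 * k n) + c₀) with he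
  have h4 : ‖e - I‖ ≤ 2 * |C'| / ‖k n‖ * Real.exp (2 * |(k n).im|) := by
    have e1 : e - I = 2 * k n * (4 * k n ^ 3 * dirichletCharFun q (k n ^ 2) -
        (2 * omega q * k n - q 1 * Complex.sin (2 * k n)) -
        (2 * k n)⁻¹ * (Q₃ q * Complex.cos (2 * k n) + c₀ + I)) := by
      have := hk0 n
      simp only [he, scaledCharFun, leadingFun]
      field_simp
      ring
    rw [e1, norm_mul, norm_mul, Complex.norm_two]
    calc _ ≤ 2 * ‖k n‖ * (|C'| / ‖k n‖ ^ 2 * Real.exp (2 * |(k n).im|)) := by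
          refine mul_le_mul_of_nonneg_left (h2.trans ?_) (by positivity)
          gcongr
          exact le_abs_self _
      _ = _ := by field_simp
  have h5 : 2 * |C'| / ‖k n‖ ≤ 2 * |C'| / c * (1 / ((n:ℝ) + 1)) := by
    rw [div_mul_div_comm, mul_one]
    exact div_le_div_of_nonneg_left (by positivity) (by positivity) (hkn n)
  have h6 : ‖e‖ ≤ 2 * |C'| / c * (1 / ((n:ℝ) + 1)) * Real.exp (2 * |(k n).im|) + ‖I‖ :=
    (norm_le_norm_sub_add e I).trans (add_le_add (h4.trans (by gcongr)) le_rfl)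
  calc _ ≤ Real.exp (-2 * (k n).im) *
        (2 * |C'| / c * (1 / ((n:ℝ) + 1)) * Real.exp (2 * |(k n).im|) + ‖I‖) :=
        mul_le_mul_of_nonneg_left h6 hE.le
    _ = 2 * |C'| / c * (1 / ((n:ℝ) + 1)) * (Real.exp (-2 * (k n).im) *
        Real.exp (2 * |(k n).im|)) + Real.exp (-2 * (k n).im) * ‖I‖ := by ring
    _ ≤ 2 * |C'| / c * (1 / ((n:ℝ) + 1)) * Real.exp (4 * |C|) +
        Real.exp (-2 * (k n).im) * ‖I‖ := by gcongr
    _ ≤ _ := by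
        have a1 : 0 ≤ 2 * |C'| / c * Real.exp (4 * |C|) := by positivity
        have a2 : 0 ≤ Real.exp (-2 * (k n).im) * ‖I‖ := by positivity
        have a3 : 0 < 1 / ((n:ℝ) + 1) := by positivity
        nlinarith [mul_nonneg a1 a2]

end Expansion

/-! ### From a tail of zeros to a list of the eigenvalues -/

/-- A tail of simple zeros that is asymptotic, in the mean, to the zeros `(m π / 2)²`, `m = j i`,
of the model function can be completed to a list of all eigenvalues in which as many further
terms occur as are prescribed by the comparison with the model function. -/
theorem exists_enumeration_of_tail {q : ℝ → ℝ} (hq : ContinuousOn q (Icc 0 1)) {ι κ : Type}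
    {t : ι → ℂ} {Ex : Finset ℂ} (ht : HasSimpleTail (dirichletCharFun q) Ex t)
    {j : ι → ℕ} (hj : Function.Injective j) (hj0 : ∀ i, j i ≠ 0) (J : Finset ℕ)
    (hJ : ∀ m, m ≠ 0 → (m ∈ J ↔ m ∉ range j)) (hJ0 : 0 ∉ J)
    {m : ℕ → ℕ} (hm : Tendsto m atTop atTop)
    (hsep : ∀ᶠ M in atTop, ∀ i,
      ‖t i‖ ≤ (((m M : ℝ) + 1 / 2) * (Real.pi / 2)) ^ 2 ↔ j i ≤ m M)
    {T : ℝ} (hT : ∀ᶠ M in atTop, ∀ I : Finset ι, (∀ i, i ∈ I ↔ j i ≤ m M) →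
      |∑ i ∈ I, (Real.log ‖t i‖ - Real.log ‖((j i : ℂ) * (Real.pi / 2)) ^ 2‖)| ≤ T)
    {δ C : ℝ} (hδ : 0 < δ) (hC : 0 < C)
    (hF : ∀ᶠ M in atTop, ∀ k : ℂ, ‖k‖ = ((m M : ℝ) + 1 / 2) * (Real.pi / 2) → 0 ≤ k.im →
      δ * Real.exp (2 * k.im) ≤ ‖scaledCharFun q k‖ ∧
        ‖scaledCharFun q k‖ ≤ C * (‖k‖ + Real.exp (2 * k.im)))
    (H : Finset κ) (e : κ → ℂ) (b : ι → κ) (hb : Function.Injective b)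
    (hbH : ∀ x, x ∈ H ↔ x ∉ range b) (hbe : ∀ i, e (b i) = t i) (hcard : H.card + 1 = J.card) :
    ∃ l : κ → ℂ, (∀ x, x ∉ H → l x = e x) ∧ EnumeratesDirichletEigenvalues q l := by
  have hpi := Real.pi_pos
  obtain ⟨ExS, hS, hSc⟩ := hasSimpleTail_sincDouble hj J hJ hJ0 hj0
  obtain ⟨B, hB⟩ := exists_circleAverage_bound hδ hC
  have hmodel : ∀ M i, ‖((j i : ℂ) * (Real.pi / 2)) ^ 2‖ ≤
      (((m M : ℝ) + 1 / 2) * (Real.pi / 2)) ^ 2 ↔ j i ≤ m M := by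
    intro M i
    rw [norm_pow, norm_mul, norm_div, Complex.norm_real, Complex.norm_natCast,
      Complex.norm_two, Real.norm_of_nonneg hpi.le, sq_le_sq₀ (by positivity) (by positivity),
      mul_le_mul_iff_left₀ (half_pos hpi)]
    constructor
    · intro h
      have : (j i : ℝ) < (m M : ℝ) + 1 := by linarith
      exact_mod_cast Nat.lt_succ_iff.1 (by exact_mod_cast this)
    · intro h
      have : (j i : ℝ) ≤ m M := by exact_mod_cast h
      linarith
  -- The circle averages differ by `log R`, so `Δ` has one exceptional zero fewer than the model.
  have hcount := HasSimpleTail.card_exceptional_eq ht hS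
    (R := fun M => (((m M : ℝ) + 1 / 2) * (Real.pi / 2)) ^ 2) (T := T) (p := 1) (B := B) ?_ ?_ ?_ ?_
  · rw [hSc, ← hcard] at hcount
    obtain ⟨l, hl, hl'⟩ := ht.exists_enumeration H e b hb hbH hbe (Nat.add_right_cancel hcount)
    exact ⟨l, hl, enumeratesDirichletEigenvalues_of_order hq hl'⟩
  · refine (tendsto_pow_atTop two_ne_zero).comp ?_
    refine Tendsto.atTop_mul_const (half_pos hpi) ?_
    exact tendsto_atTop_add_const_right _ _ (tendsto_natCast_atTop_atTop.comp hm)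
  · filter_upwards [hsep] with M hM i
    rw [hM i, hmodel]
  · filter_upwards [hT] with M hM I hI
    exact hM I fun i => (hI i).trans (hmodel M i)
  · filter_upwards [hF, hm.eventually_ge_atTop 1] with M hM hM1
    have := hB (dirichletCharFun q) (differentiable_dirichletCharFun hq) (m M) hM1 hM
    simpa using this

theorem cpow_half_sq {k : ℂ} (hk : 0 < k.re) : (k ^ 2) ^ (1 / 2 : ℂ) = k := by
  have h := Complex.abs_arg_lt_pi_div_two_iff.2 (Or.inl hk)
  rw [abs_lt] at h
  have := Complex.pow_cpow_nat_inv (x := k) (n := 2) two_ne_zero (by simpa using h.1)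
    (by simpa using h.2.le)
  simpa using this

/-- Every complex number is the square of a number with nonnegative real part. -/
theorem exists_sq_eq_of_re_nonneg (z : ℂ) : ∃ k : ℂ, 0 ≤ k.re ∧ k ^ 2 = z := by
  obtain ⟨k, hk⟩ : ∃ k : ℂ, k ^ 2 = z := ⟨z ^ (1 / 2 : ℂ), by rw [← Complex.cpow_nat_mul]; simp⟩
  rcases le_total 0 k.re with h | h
  · exact ⟨k, h, hk⟩
  · exact ⟨-k, by simpa using h, by rw [neg_sq, hk]⟩

theorem eq_of_sq_eq_sq_of_re_pos {k k' : ℂ} (hk : 0 < k.re) (hk' : 0 < k'.re)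
    (h : k ^ 2 = k' ^ 2) : k = k' := by
  rw [← cpow_half_sq hk, h, cpow_half_sq hk']

theorem norm_sin_sub_self_le {z : ℂ} (hz : ‖z‖ ≤ 1) : ‖Complex.sin z - z‖ ≤ ‖z‖ ^ 2 := by
  have h1 := Complex.norm_exp_sub_one_sub_id_le (x := z * Complex.I) (by simpa using hz)
  have h2 := Complex.norm_exp_sub_one_sub_id_le (x := -z * Complex.I) (by simpa using hz)
  simp only [norm_mul, norm_neg, Complex.norm_I, mul_one] at h1 h2
  have e : Complex.sin z - z = (Complex.I / 2) * ((Complex.exp (-z * Complex.I) - 1 -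
      -z * Complex.I) - (Complex.exp (z * Complex.I) - 1 - z * Complex.I)) := by
    rw [Complex.sin]
    linear_combination (-z) * Complex.I_sq
  rw [e, norm_mul]
  have h3 : ‖Complex.I / 2‖ = 1 / 2 := by simp
  rw [h3]
  have := norm_sub_le (Complex.exp (-z * Complex.I) - 1 - -z * Complex.I)
    (Complex.exp (z * Complex.I) - 1 - z * Complex.I)
  linarith

theorem norm_cos_sub_one_le {z : ℂ} (hz : ‖z‖ ≤ 1) : ‖Complex.cos z - 1‖ ≤ ‖z‖ ^ 2 := by
  have h1 := Complex.norm_exp_sub_one_sub_id_le (x := z * Complex.I) (by simpa using hz)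
  have h2 := Complex.norm_exp_sub_one_sub_id_le (x := -z * Complex.I) (by simpa using hz)
  simp only [norm_mul, norm_neg, Complex.norm_I, mul_one] at h1 h2
  have e : Complex.cos z - 1 = (1 / 2) * ((Complex.exp (z * Complex.I) - 1 - z * Complex.I) +
      (Complex.exp (-z * Complex.I) - 1 - -z * Complex.I)) := by
    rw [Complex.cos]
    ring
  rw [e, norm_mul]
  have h3 : ‖(1 / 2 : ℂ)‖ = 1 / 2 := by simp
  rw [h3]
  have := norm_add_le (Complex.exp (z * Complex.I) - 1 - z * Complex.I)
    (Complex.exp (-z * Complex.I) - 1 - -z * Complex.I)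
  linarith

/-- Comparison of moduli: `|log ‖c + w‖ - log ‖c‖|` for a perturbation `w` of at most half the
size of `c`. -/
theorem abs_log_norm_add_sub_le {c w : ℂ} (h : ‖w‖ ≤ ‖c‖ / 2) (hc : c ≠ 0) :
    |Real.log ‖c + w‖ - Real.log ‖c‖| ≤ 2 * ‖w‖ / ‖c‖ := by
  have hc0 : 0 < ‖c‖ := norm_pos_iff.2 hc
  have h1 : ‖c‖ - ‖w‖ ≤ ‖c + w‖ := norm_sub_le_norm_add c w
  have h2 : ‖c + w‖ ≤ ‖c‖ + ‖w‖ := norm_add_le c w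
  have h3 : 0 < ‖c + w‖ := by linarith
  rw [abs_le]
  constructor
  · have := Real.log_le_sub_one_of_pos (show 0 < ‖c‖ / ‖c + w‖ by positivity)
    rw [Real.log_div hc0.ne' h3.ne'] at this
    have h4 : ‖c‖ / ‖c + w‖ - 1 ≤ 2 * ‖w‖ / ‖c‖ := by
      rw [sub_le_iff_le_add, div_le_iff₀ h3]
      have : (2 * ‖w‖ / ‖c‖ + 1) * (‖c‖ - ‖w‖) ≤ (2 * ‖w‖ / ‖c‖ + 1) * ‖c + w‖ := by gcongr
      refine le_trans ?_ this
      have e : (2 * ‖w‖ / ‖c‖ + 1) * (‖c‖ - ‖w‖) = ‖c‖ + ‖w‖ * (1 - 2 * (‖w‖ / ‖c‖)) := by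
        field_simp
        ring
      rw [e]
      have : ‖w‖ / ‖c‖ ≤ 1 / 2 := by rw [div_le_iff₀ hc0]; linarith
      nlinarith [norm_nonneg w]
    linarith
  · have := Real.log_le_sub_one_of_pos (show 0 < ‖c + w‖ / ‖c‖ by positivity)
    rw [Real.log_div h3.ne' hc0.ne'] at this
    have h4 : ‖c + w‖ / ‖c‖ - 1 ≤ 2 * ‖w‖ / ‖c‖ := by
      rw [sub_le_iff_le_add, div_le_iff₀ hc0, add_mul, div_mul_cancel₀ _ hc0.ne']
      linarith [norm_nonneg w]
    linarith

/-! ### Zeros in the case `ω = 0` -/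

theorem natCast_dist_eq (n m : ℕ) : (Nat.dist n m : ℝ) = |(n : ℝ) - m| := by
  rcases le_total n m with h | h
  · rw [Nat.dist_eq_sub_of_le h, Nat.cast_sub h, abs_of_nonpos (by
      have : (n : ℝ) ≤ m := by exact_mod_cast h
      linarith)]
    ring
  · rw [Nat.dist_eq_sub_of_le_right h, Nat.cast_sub h, abs_of_nonneg (by
      have : (m : ℝ) ≤ n := by exact_mod_cast h
      linarith)]

/-- Bounded perturbations of real multiples of `n` that vary slowly in the imaginary direction. -/
theorem isBesselSequence_of_near {k : ℕ → ℂ} {x : ℕ → ℝ} {C b r : ℝ} (hr : r < b / 2)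
    (hr0 : 0 ≤ r) (hre : ∀ n, |(k n).re - x n| ≤ r) (hx : ∀ n m, x n - x m = b * ((n : ℝ) - m))
    (hx0 : r < x 0) (him : ∀ n, -C ≤ (k n).im)
    (hd : ∀ n m, n ≠ m → |(k n).im - (k m).im| ≤ C * Real.sqrt (Nat.dist n m)) :
    IsBesselSequence k := by
  have hb : 0 < b := by linarith
  refine ⟨C, min (b - 2 * r) (x 0 - r), lt_min (by linarith) (by linarith), him, fun n m => ?_,
    fun n m => ?_, fun n => ?_⟩
  · by_cases h : n = m
    · subst h; simp
    · exact hd n m h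
  · by_cases h : n = m
    · subst h; simp
    have h1 := abs_le.1 (hre n)
    have h2 := abs_le.1 (hre m)
    have h3 := hx n m
    have h4 : (1:ℝ) ≤ Nat.dist n m := by
      have : Nat.dist n m ≠ 0 := fun h0 => h (Nat.eq_of_dist_eq_zero h0)
      exact_mod_cast Nat.one_le_iff_ne_zero.2 this
    refine (mul_le_mul_of_nonneg_right (min_le_left _ _) (by positivity)).trans ?_
    rw [natCast_dist_eq] at h4 ⊢
    rcases abs_cases ((n:ℝ) - m) with ⟨h5, _⟩ | ⟨h5, _⟩ <;> rw [h5] at h4 ⊢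
    · refine le_trans ?_ (le_abs_self _)
      nlinarith
    · refine le_trans ?_ (neg_le_abs _)
      nlinarith
  · have h1 := abs_le.1 (hre n)
    have h2 := hx n 0
    have h3 := (le_abs_self _).trans (Complex.abs_re_le_norm (k n))
    rw [Nat.cast_zero, sub_zero] at h2
    have h4 := mul_le_mul_of_nonneg_right (min_le_left (b - 2 * r) (x 0 - r))
      (Nat.cast_nonneg (α := ℝ) n)
    have h5 := min_le_right (b - 2 * r) (x 0 - r)
    nlinarith [Nat.cast_nonneg (α := ℝ) n]

section ZeroMean

variable {q : ℝ → ℝ}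

/-- The points `(n + 1) π / 2`. -/
noncomputable def sineZero (n : ℕ) : ℂ := ((n : ℂ) + 1) * (Real.pi / 2)

theorem sineZero_eq_ofReal (n : ℕ) : sineZero n = ((((n : ℝ) + 1) * (Real.pi / 2) : ℝ) : ℂ) := by
  simp [sineZero]

theorem norm_sineZero (n : ℕ) : ‖sineZero n‖ = ((n : ℝ) + 1) * (Real.pi / 2) := by
  have := Real.pi_pos
  rw [sineZero_eq_ofReal, Complex.norm_real, Real.norm_of_nonneg (by positivity)]

theorem leadingFun_sineZero_add (hω : omega q = 0) (n : ℕ) (z : ℂ) :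
    leadingFun q (sineZero n + z) = (q 1 : ℂ) * (-1) ^ n * Complex.sin (2 * z) := by
  have h : 2 * (sineZero n + z) = 2 * z + (n + 1 : ℕ) * Real.pi := by
    rw [sineZero]; push_cast; ring
  rw [leadingFun, hω, h, Complex.sin_antiperiodic.add_nat_mul_eq, pow_succ]
  push_cast
  ring

theorem cos_sineZero_add (n : ℕ) (z : ℂ) :
    Complex.cos (2 * (sineZero n + z)) = -(-1) ^ n * Complex.cos (2 * z) := by
  have h : 2 * (sineZero n + z) = 2 * z + (n + 1 : ℕ) * Real.pi := by
    rw [sineZero]; push_cast; ring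
  rw [h, Complex.cos_antiperiodic.add_nat_mul_eq, pow_succ]
  ring

theorem isBesselSequence_sineZero_add {w : ℕ → ℂ} (hw : ∀ n, ‖w n‖ ≤ 1 / 8) :
    IsBesselSequence fun n => sineZero n + w n := by
  have hpi := Real.pi_gt_three
  have him : ∀ n, (sineZero n + w n).im = (w n).im := fun n => by
    rw [sineZero_eq_ofReal]; simp
  have hw' : ∀ n, |(w n).im| ≤ 1 / 8 := fun n => (Complex.abs_im_le_norm _).trans (hw n)
  refine isBesselSequence_of_near (x := fun n => ((n : ℝ) + 1) * (Real.pi / 2)) (b := Real.pi / 2)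
    (r := 1 / 8) (C := 1) (by linarith) (by norm_num) (fun n => ?_) (fun n m => by ring)
    (by norm_num; linarith) (fun n => ?_) (fun n m hnm => ?_)
  · rw [sineZero_eq_ofReal]
    simpa using (Complex.abs_re_le_norm _).trans (hw n)
  · rw [him]
    linarith [(abs_le.1 (hw' n)).1]
  · rw [him, him]
    have h1 : (1:ℝ) ≤ Nat.dist n m := by
      have : Nat.dist n m ≠ 0 := fun h0 => hnm (Nat.eq_of_dist_eq_zero h0)
      exact_mod_cast Nat.one_le_iff_ne_zero.2 this
    have h2 : 1 ≤ Real.sqrt (Nat.dist n m) := Real.one_le_sqrt.2 h1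
    have h3 := abs_sub (w n).im (w m).im
    linarith [hw' n, hw' m]

/-- If `ω = 0`, the large zeros of `4 k³ Δ(k²)` in the right half plane are simple, one near each
of the points `(n + 1) π / 2`. -/
theorem exists_zeros_of_omega_eq_zero (hq : MemW21 q) (hq1 : q 1 ≠ 0) (hω : omega q = 0) :
    ∃ (N : ℕ) (w : ℕ → ℂ) (K : ℝ), 1 ≤ N ∧ (∀ n, ‖w n‖ ≤ 1 / 8) ∧
      (∀ n, N ≤ n → scaledCharFun q (sineZero n + w n) = 0 ∧
        deriv (scaledCharFun q) (sineZero n + w n) ≠ 0 ∧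
        |q 1| * ‖w n‖ ≤ ‖scaledCharFun q (sineZero n)‖) ∧
      ∀ k : ℂ, K ≤ ‖k‖ → 0 ≤ k.re → scaledCharFun q k = 0 → ∃ n, N ≤ n ∧ k = sineZero n + w n := by
  have hpi := Real.pi_gt_three
  have hF := differentiable_scaledCharFun hq.continuousOn
  have hG : Differentiable ℂ fun z : ℂ => Complex.sin (2 * z) := by fun_prop
  have hG1 : deriv (fun z : ℂ => Complex.sin (2 * z)) 0 = 2 := by
    simpa using (hasDerivAt_sin_two_mul 0).deriv
  obtain ⟨r₀, hr₀, hloc⟩ := exists_zero_of_close hG (by simp) (by rw [hG1]; exact two_ne_zero)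
  set r := min r₀ (1 / 8) with hr
  have hrpos : 0 < r := lt_min hr₀ (by norm_num)
  have hr8 : r ≤ 1 / 8 := min_le_right _ _
  obtain ⟨δ, hδ, hloc⟩ := hloc r hrpos (min_le_left _ _)
  rw [hG1] at hloc
  have hq1' : 0 < |q 1| := abs_pos.2 hq1
  have hq1c : (q 1 : ℂ) ≠ 0 := by exact_mod_cast hq1
  obtain ⟨K₁, hK₁, hE₁⟩ := exists_norm_remainder_le hq
    (ε := δ * |q 1| * Real.exp (-(4 * r))) (by positivity)
  obtain ⟨δ₂, hδ₂, hsin⟩ := exists_near_of_norm_sin_le hrpos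
  obtain ⟨K₂, hK₂, hE₂⟩ := exists_norm_remainder_le hq (ε := δ₂ * |q 1|) (by positivity)
  obtain ⟨N, hN⟩ := exists_nat_ge (K₁ + 1)
  -- Near `(n + 1) π / 2` the leading part is `(-1)ⁿ q(1) sin 2z`; `Hn n` is normalized accordingly.
  set Hn : ℕ → ℂ → ℂ := fun n z => (-1) ^ n / (q 1 : ℂ) * scaledCharFun q (sineZero n + z) with hHn
  have hHd : ∀ n, Differentiable ℂ (Hn n) := fun n =>
    (hF.comp (differentiable_id.const_add (sineZero n))).const_mul _
  have hsq : ∀ n : ℕ, ((-1 : ℂ)) ^ n * (-1) ^ n = 1 := fun n => by rw [← mul_pow]; simp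
  have hHG : ∀ n, N ≤ n → ∀ z : ℂ, ‖z‖ ≤ 2 * r → ‖Hn n z - Complex.sin (2 * z)‖ ≤ δ := by
    intro n hn z hz
    have h1 : Hn n z - Complex.sin (2 * z) = (-1) ^ n / (q 1 : ℂ) *
        (scaledCharFun q (sineZero n + z) - leadingFun q (sineZero n + z)) := by
      rw [leadingFun_sineZero_add hω, hHn]
      generalize Complex.sin (2 * z) = s
      field_simp
      linear_combination ((q 1 : ℂ) * s) * hsq n
    have hn' : (N : ℝ) ≤ n := by exact_mod_cast hn
    have h2 : K₁ ≤ ‖sineZero n + z‖ := by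
      have := norm_sub_le_norm_add (sineZero n) z
      rw [norm_sineZero] at this
      nlinarith
    have h3 : |(sineZero n + z).im| ≤ 2 * r := by
      rw [sineZero_eq_ofReal]
      simpa using (Complex.abs_im_le_norm z).trans hz
    have h4 := hE₁ _ h2
    rw [h1, norm_mul, norm_div, norm_pow, norm_neg, norm_one, one_pow, Complex.norm_real,
      Real.norm_eq_abs, one_div_mul_eq_div, div_le_iff₀ hq1']
    refine h4.trans ?_
    have h5 : Real.exp (2 * |(sineZero n + z).im|) ≤ Real.exp (4 * r) :=
      Real.exp_le_exp.2 (by linarith)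
    calc _ ≤ δ * |q 1| * Real.exp (-(4 * r)) * Real.exp (4 * r) := by gcongr
      _ = δ * |q 1| := by rw [mul_assoc, ← Real.exp_add]; simp
  choose! w hw hw0 hw1 using fun n (hn : N ≤ n) => (hloc (Hn n) (hHd n) (hHG n hn)).1
  have hbil := fun n (hn : N ≤ n) => (hloc (Hn n) (hHd n) (hHG n hn)).2
  have hzero : ∀ n z, Hn n z = 0 ↔ scaledCharFun q (sineZero n + z) = 0 := by
    intro n z
    simp [hHn, hq1]
  refine ⟨max N 1, fun n => if N ≤ n then w n else 0, max K₂ (((N : ℝ) + 3) * Real.pi),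
    le_max_right _ _, fun n => ?_, fun n hn => ?_, fun k hk hre hk0 => ?_⟩
  · simp only
    split_ifs with h
    · exact (hw n h).le.trans hr8
    · simp
  · have hn' : N ≤ n := (le_max_left _ _).trans hn
    simp only [if_pos hn']
    refine ⟨(hzero n _).1 (hw0 n hn'), fun h => hw1 n hn' ?_, ?_⟩
    · have : HasDerivAt (Hn n) ((-1) ^ n / (q 1 : ℂ) * deriv (scaledCharFun q)
          (sineZero n + w n)) (w n) :=
        ((hF _).hasDerivAt.comp_const_add (sineZero n) (w n)).const_mul _
      rw [this.deriv, h, mul_zero]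
    · have := hbil n hn' (w n) 0 (hw n hn').le (by simpa using hrpos.le)
      rw [hw0 n hn', sub_zero, zero_sub, norm_neg, hHn] at this
      simp only [Complex.norm_two, add_zero, norm_mul, norm_div, norm_pow, norm_neg, norm_one,
        one_pow, Complex.norm_real, Real.norm_eq_abs] at this
      rw [one_div_mul_eq_div, le_div_iff₀ hq1'] at this
      linarith
  · -- By symmetry under conjugation the zero may be moved to the upper half plane.
    have key : ∀ z : ℂ, 0 ≤ z.im → K₂ ≤ ‖z‖ → scaledCharFun q z = 0 →
        ∃ m : ℤ, ‖z - m * (Real.pi / 2)‖ < r := by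
      intro z him hz hz0
      refine hsin z ?_
      have h1 := hE₂ z hz
      rw [hz0, zero_sub, norm_neg, leadingFun, hω, abs_of_nonneg him] at h1
      simp only [Complex.ofReal_zero, mul_zero, zero_mul, zero_sub, norm_neg, norm_mul,
        Complex.norm_real, Real.norm_eq_abs] at h1
      have h2 : |q 1| * ‖Complex.sin (2 * z)‖ ≤ |q 1| * (δ₂ * Real.exp (2 * z.im)) := by linarith
      exact le_of_mul_le_mul_left h2 hq1'
    obtain ⟨m, hm⟩ : ∃ m : ℤ, ‖k - m * (Real.pi / 2)‖ < r := by
      rcases le_total 0 k.im with h | h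
      · exact key k h ((le_max_left _ _).trans hk) hk0
      · obtain ⟨m, hm⟩ := key (conj k) (by simpa using h)
          (by rw [Complex.norm_conj]; exact (le_max_left _ _).trans hk)
          (by rw [scaledCharFun_conj hq.continuousOn, hk0, map_zero])
        refine ⟨m, ?_⟩
        rw [← Complex.norm_conj, map_sub, map_mul, map_div₀, Complex.conj_ofReal, map_intCast,
          map_ofNat]
        exact hm
    have hk3 : ((N : ℝ) + 3) * Real.pi ≤ ‖k‖ := (le_max_right _ _).trans hk
    have hmre : |k.re - m * (Real.pi / 2)| ≤ 1 / 8 := by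
      have h1 := Complex.abs_re_le_norm (k - m * (Real.pi / 2))
      have h2 : ((m : ℂ) * (Real.pi / 2)) = ((m * (Real.pi / 2) : ℝ) : ℂ) := by push_cast; rfl
      have h3 : (k - m * (Real.pi / 2)).re = k.re - m * (Real.pi / 2) := by
        rw [h2, Complex.sub_re, Complex.ofReal_re]
      rw [h3] at h1
      linarith
    have hmnorm : ((N : ℝ) + 2) * Real.pi ≤ |(m : ℝ)| * (Real.pi / 2) := by
      have h1 := norm_sub_norm_le k (m * (Real.pi / 2))
      rw [norm_mul, norm_div, Complex.norm_real, Complex.norm_intCast, Complex.norm_two,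
        Real.norm_of_nonneg (by linarith)] at h1
      nlinarith
    have hm1 : (N : ℝ) + 2 ≤ m := by
      have h1 := abs_le.1 hmre
      have h2 : 0 ≤ (m : ℝ) := by
        by_contra hneg
        have h3 : (m : ℝ) ≤ -1 := by
          have : m < 0 := by exact_mod_cast not_le.1 hneg
          exact_mod_cast (by omega : m ≤ -1)
        nlinarith
      rw [abs_of_nonneg h2] at hmnorm
      nlinarith [Nat.cast_nonneg (α := ℝ) N]
    obtain ⟨n, hn⟩ : ∃ n : ℕ, m = n + 1 := by
      have h1 : ((N + 2 : ℕ) : ℤ) ≤ m := by exact_mod_cast hm1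
      exact ⟨(m - 1).toNat, by push_cast at h1; omega⟩
    have hNn : max N 1 ≤ n := by
      rw [hn] at hm1
      have : ((N + 1 : ℕ) : ℝ) ≤ n := by push_cast at hm1 ⊢; linarith
      have : N + 1 ≤ n := by exact_mod_cast this
      omega
    have hNn' : N ≤ n := (le_max_left _ _).trans hNn
    refine ⟨n, hNn, ?_⟩
    simp only [if_pos hNn']
    have hm2 : ‖k - sineZero n‖ ≤ r := by
      rw [hn] at hm
      rw [sineZero]
      push_cast at hm
      exact hm.le
    have h1 := hbil n hNn' (k - sineZero n) (w n) hm2 (hw n hNn').le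
    rw [hw0 n hNn', (hzero n (k - sineZero n)).2 (by rw [add_sub_cancel]; exact hk0), sub_zero,
      norm_zero, Complex.norm_two] at h1
    have h2 : ‖k - sineZero n - w n‖ = 0 := le_antisymm (by linarith) (norm_nonneg _)
    rw [norm_eq_zero] at h2
    linear_combination h2

end ZeroMean

theorem MemL2Seq.of_eventually_le_add_add {u a b d : ℕ → ℂ} (ha : MemL2Seq a) (hb : MemL2Seq b)
    (hd : MemL2Seq d) (C : ℝ) (h : ∀ᶠ n in atTop, ‖u n‖ ≤ C * (‖a n‖ + ‖b n‖ + ‖d n‖)) :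
    MemL2Seq u := by
  have hab : MemL2Seq fun n => ((‖a n‖ + ‖b n‖ : ℝ) : ℂ) :=
    ha.of_eventually_le_add hb 1 (.of_forall fun n => by
      rw [Complex.norm_real, Real.norm_of_nonneg (by positivity), one_mul])
  refine hab.of_eventually_le_add hd C ?_
  filter_upwards [h] with n hn
  rwa [Complex.norm_real, Real.norm_of_nonneg (by positivity)]

section ZeroMean

variable {q : ℝ → ℝ}

theorem leadingFun_sineZero (hω : omega q = 0) (n : ℕ) : leadingFun q (sineZero n) = 0 := by
  simpa using leadingFun_sineZero_add hω n 0

theorem isBesselSequence_sineZero : IsBesselSequence sineZero := by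
  simpa using isBesselSequence_sineZero_add (w := fun _ => 0) (by simp)

theorem sineZero_im (n : ℕ) : (sineZero n).im = 0 := by
  rw [sineZero_eq_ofReal, Complex.ofReal_im]

theorem memL2Seq_displacement (hq : MemW21 q) (hq1 : q 1 ≠ 0) (hω : omega q = 0) {N : ℕ}
    {w : ℕ → ℂ} (hw : ∀ n, N ≤ n → |q 1| * ‖w n‖ ≤ ‖scaledCharFun q (sineZero n)‖) :
    MemL2Seq w := by
  have hq1' : 0 < |q 1| := abs_pos.2 hq1
  refine (memL2Seq_remainder hq isBesselSequence_sineZero).of_eventually_le (1 / |q 1|) ?_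
  filter_upwards [eventually_ge_atTop N] with n hn
  rw [leadingFun_sineZero hω, sineZero_im]
  simp only [mul_zero, Real.exp_zero, Complex.ofReal_one, one_mul, sub_zero]
  rw [one_div_mul_eq_div, le_div_iff₀ hq1']
  linarith [hw n hn]

/-- For `q ∈ W_2^2` the zeros are within `O(1 / n)` of the points `(n + 1) π / 2`. -/
theorem exists_displacement_bound (hq : MemW21 q) (hq2 : MemW22 q) (hq1 : q 1 ≠ 0)
    (hω : omega q = 0) {N : ℕ} {w : ℕ → ℂ}
    (hw : ∀ n, N ≤ n → |q 1| * ‖w n‖ ≤ ‖scaledCharFun q (sineZero n)‖) :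
    ∃ C, 0 ≤ C ∧ ∀ n, N ≤ n → ((n : ℝ) + 1) * ‖w n‖ ≤ C := by
  have hpi := Real.pi_gt_three
  have hq1' : 0 < |q 1| := abs_pos.2 hq1
  obtain ⟨c₀, -, h⟩ := exists_remainder_eq hq hq2
  obtain ⟨e, he, heq⟩ := h sineZero isBesselSequence_sineZero
  simp only [sineZero_im, mul_zero, Real.exp_zero, Complex.ofReal_one, one_mul] at he
  obtain ⟨Ce, hCe0, hCe⟩ := he.exists_norm_le
  refine ⟨(|Q₃ q| + |c₀| + Ce) / |q 1|, by positivity, fun n hn => ?_⟩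
  have h1 := heq n
  have hcos : ‖Complex.cos (2 * sineZero n)‖ = 1 := by
    have := cos_sineZero_add n 0
    rw [add_zero] at this
    rw [this]
    simp
  rw [leadingFun_sineZero hω, sub_zero] at h1
  have h2 : ‖(Q₃ q : ℂ) * Complex.cos (2 * sineZero n) + c₀ + e n‖ ≤ |Q₃ q| + |c₀| + Ce := by
    refine (norm_add_le _ _).trans (add_le_add ((norm_add_le _ _).trans ?_) (hCe n))
    rw [norm_mul, hcos, mul_one, Complex.norm_real, Complex.norm_real]
    rfl
  have h3 := hw n hn
  have hn1 : (0:ℝ) < (n:ℝ) + 1 := by positivity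
  have h4 : ‖(2 * sineZero n)⁻¹‖ ≤ ((n:ℝ) + 1)⁻¹ := by
    rw [norm_inv, norm_mul, norm_sineZero, Complex.norm_two]
    exact inv_anti₀ hn1 (by nlinarith)
  rw [h1, norm_mul] at h3
  have h5 := h3.trans (mul_le_mul h4 h2 (norm_nonneg _) (by positivity))
  rw [le_div_iff₀ hq1']
  have h6 : ((n:ℝ) + 1) * (((n:ℝ) + 1)⁻¹ * (|Q₃ q| + |c₀| + Ce)) = |Q₃ q| + |c₀| + Ce := by
    field_simp
  nlinarith [mul_le_mul_of_nonneg_left h5 hn1.le]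

/-- Second order asymptotics of the zeros near `(n + 1) π / 2` in the case `ω = 0`. -/
theorem memL2Seq_second_order_of_omega_eq_zero (hq : MemW21 q) (hq2 : MemW22 q) (hq1 : q 1 ≠ 0)
    (hω : omega q = 0) {N : ℕ} {w : ℕ → ℂ} (hw8 : ∀ n, ‖w n‖ ≤ 1 / 8)
    (hw0 : ∀ n, N ≤ n → scaledCharFun q (sineZero n + w n) = 0)
    (hw : ∀ n, N ≤ n → |q 1| * ‖w n‖ ≤ ‖scaledCharFun q (sineZero n)‖) :
    MemL2Seq fun n => n * w n -
      ((Q₃ q : ℂ) + (-1) ^ n * (Q₄ q : ℂ)) / (2 * (q 1 : ℂ) * (Real.pi : ℂ)) := by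
  have hpi := Real.pi_gt_three
  have hpi4 := Real.pi_lt_four
  have hq1' : 0 < |q 1| := abs_pos.2 hq1
  have hq1c : (q 1 : ℂ) ≠ 0 := by exact_mod_cast hq1
  have hpic : (Real.pi : ℂ) ≠ 0 := by exact_mod_cast Real.pi_ne_zero
  have hwL := memL2Seq_displacement hq hq1 hω hw
  obtain ⟨Cw, hCw0, hCw⟩ := exists_displacement_bound hq hq2 hq1 hω hw
  obtain ⟨c₀, hc₀, h⟩ := exists_remainder_eq hq hq2
  obtain ⟨e, he, heq⟩ := h _ (isBesselSequence_sineZero_add hw8)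
  have heL : MemL2Seq e := by
    refine he.of_eventually_le (Real.exp 1) (.of_forall fun n => ?_)
    rw [norm_mul, Complex.norm_real, Real.norm_eq_abs, Real.abs_exp, ← mul_assoc, ← Real.exp_add]
    refine le_mul_of_one_le_left (norm_nonneg _) (Real.one_le_exp ?_)
    rw [Complex.add_im, sineZero_im]
    have := abs_le.1 ((Complex.abs_im_le_norm _).trans (hw8 n))
    linarith
  obtain ⟨Ce, hCe0, hCe⟩ := heL.exists_norm_le
  rw [hc₀ hω] at heq
  refine hwL.of_eventually_le_add_add heL memL2Seq_one_div
    ((4 * Real.pi * |q 1| * Cw + 2 * (2 * |Q₃ q| + |Q₄ q| + Ce) + |Q₃ q| + 1) /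
      (2 * |q 1| * Real.pi)) ?_
  filter_upwards [eventually_ge_atTop N] with n hn
  have h1 := heq n
  rw [hw0 n hn, leadingFun_sineZero_add hω, cos_sineZero_add] at h1
  set k := sineZero n + w n with hk
  set W := w n with hW
  have hWn : ‖W‖ ≤ 1 / 8 := hw8 n
  have h2W : ‖2 * W‖ = 2 * ‖W‖ := by rw [norm_mul, Complex.norm_two]
  have hs := norm_sin_sub_self_le (z := 2 * W) (by rw [h2W]; linarith)
  have hc := norm_cos_sub_one_le (z := 2 * W) (by rw [h2W]; linarith)
  rw [h2W] at hs hc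
  have hsq : ((-1 : ℂ)) ^ n * (-1) ^ n = 1 := by rw [← mul_pow]; simp
  have hkn : (n : ℝ) + 1 ≤ ‖k‖ := by
    have := norm_sub_le_norm_add (sineZero n) W
    rw [norm_sineZero] at this
    nlinarith [Nat.cast_nonneg (α := ℝ) n]
  have hk0 : k ≠ 0 := norm_pos_iff.1 (by linarith [Nat.cast_nonneg (α := ℝ) n])
  have hk0' : (0:ℝ) < ‖k‖ := norm_pos_iff.2 hk0
  have hn1 : (0:ℝ) < (n:ℝ) + 1 := by positivity
  have h2k : 2 * k = (n : ℂ) * Real.pi + (Real.pi + 2 * W) := by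
    rw [hk, sineZero]; ring
  generalize hS : Complex.sin (2 * W) = S at *
  generalize hCo : Complex.cos (2 * W) = Co at *
  generalize hσ : ((-1 : ℂ)) ^ n = σ at *
  have hσn : ‖σ‖ = 1 := by rw [← hσ]; simp
  set A := (Q₃ q : ℂ) * Co + σ * (Q₄ q : ℂ) - σ * e n with hA
  -- The equation for the zero, solved for `sin 2w`; the main part of `A` is `Q₃ + (-1)ⁿ Q₄`.
  have h3 : (q 1 : ℂ) * S = (2 * k)⁻¹ * A := by
    push_cast at h1
    linear_combination (-σ) * h1 + ((q 1 : ℂ) * S - (2 * k)⁻¹ * Q₃ q * Co) * (-hsq)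
  -- Each of the four terms on the right is bounded by a square summable sequence.
  have h4 : (n * W - ((Q₃ q : ℂ) + σ * (Q₄ q : ℂ)) / (2 * (q 1 : ℂ) * (Real.pi : ℂ))) =
      (Real.pi * n * q 1 * (2 * W - S) + (-(Real.pi + 2 * W) * (2 * k)⁻¹) * A +
        Q₃ q * (Co - 1) - σ * e n) / (2 * (q 1 : ℂ) * (Real.pi : ℂ)) := by
    have h5 : (2 * k)⁻¹ * (2 * k) = 1 := inv_mul_cancel₀ (by simpa using hk0)
    have h6 : -(Real.pi + 2 * W) * (2 * k)⁻¹ = n * Real.pi * (2 * k)⁻¹ - 1 := by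
      linear_combination (-1 : ℂ) * h5 + (2 * k)⁻¹ * h2k
    rw [h6, eq_div_iff (by simp [hq1c, hpic]), sub_mul, div_mul_cancel₀ _ (by simp [hq1c, hpic])]
    rw [hA] at h3 ⊢
    linear_combination (n * Real.pi : ℂ) * h3
  rw [h4, norm_div]
  have hden : ‖2 * (q 1 : ℂ) * (Real.pi : ℂ)‖ = 2 * |q 1| * Real.pi := by
    rw [norm_mul, norm_mul, Complex.norm_two, Complex.norm_real, Complex.norm_real,
      Real.norm_eq_abs, Real.norm_of_nonneg (by linarith)]
  rw [hden, div_mul_eq_mul_div]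
  refine div_le_div_of_nonneg_right ?_ (by positivity)
  have hone : ‖(((1 / ((n:ℝ) + 1) : ℝ)) : ℂ)‖ = 1 / ((n:ℝ) + 1) := by
    rw [Complex.norm_real, Real.norm_of_nonneg (by positivity)]
  rw [hone]
  have hCo2 : ‖Co - 1‖ ≤ ‖W‖ := hc.trans (by nlinarith [norm_nonneg W])
  have hCo1 : ‖Co‖ ≤ 2 := by
    have := norm_le_norm_sub_add Co 1
    rw [norm_one] at this
    linarith
  have hAn : ‖A‖ ≤ 2 * |Q₃ q| + |Q₄ q| + Ce := by
    rw [hA]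
    refine (norm_sub_le _ _).trans (add_le_add ((norm_add_le _ _).trans (add_le_add ?_ ?_)) ?_)
    · rw [norm_mul, Complex.norm_real, Real.norm_eq_abs, mul_comm]
      exact mul_le_mul_of_nonneg_right hCo1 (abs_nonneg _)
    · rw [norm_mul, hσn, one_mul, Complex.norm_real, Real.norm_eq_abs]
    · rw [norm_mul, hσn, one_mul]
      exact hCe n
  have t1 : ‖Real.pi * n * q 1 * (2 * W - S)‖ ≤ 4 * Real.pi * |q 1| * Cw * ‖W‖ := by
    rw [norm_mul, norm_mul, norm_mul, Complex.norm_real, Complex.norm_natCast, Complex.norm_real,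
      Real.norm_eq_abs, Real.norm_eq_abs, abs_of_pos Real.pi_pos, norm_sub_rev]
    have h7 : (n : ℝ) * ‖W‖ ≤ Cw := by
      have := hCw n hn
      nlinarith [norm_nonneg W]
    calc _ ≤ Real.pi * n * |q 1| * (2 * ‖W‖) ^ 2 := by gcongr
      _ = 4 * Real.pi * |q 1| * (n * ‖W‖) * ‖W‖ := by ring
      _ ≤ _ := by gcongr
  have t2 : ‖(-(Real.pi + 2 * W) * (2 * k)⁻¹) * A‖ ≤
      2 * (2 * |Q₃ q| + |Q₄ q| + Ce) * (1 / ((n:ℝ) + 1)) := by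
    have h8 : ‖-(Real.pi + 2 * W : ℂ)‖ ≤ 4 := by
      rw [norm_neg]
      refine (norm_add_le _ _).trans ?_
      rw [h2W, Complex.norm_real, Real.norm_of_nonneg (by linarith)]
      have := Real.pi_lt_d2
      linarith
    have h9 : ‖(2 * k)⁻¹‖ ≤ 1 / (2 * ((n:ℝ) + 1)) := by
      rw [norm_inv, norm_mul, Complex.norm_two, one_div]
      exact inv_anti₀ (by positivity) (by linarith)
    rw [norm_mul, norm_mul]
    calc _ ≤ 4 * (1 / (2 * ((n:ℝ) + 1))) * (2 * |Q₃ q| + |Q₄ q| + Ce) := by gcongr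
      _ = _ := by field_simp; ring
  have t3 : ‖(Q₃ q : ℂ) * (Co - 1)‖ ≤ |Q₃ q| * ‖W‖ := by
    rw [norm_mul, Complex.norm_real, Real.norm_eq_abs]
    gcongr
  have t4 : ‖σ * e n‖ = ‖e n‖ := by rw [norm_mul, hσn, one_mul]
  refine (norm_sub_le _ _).trans ?_
  rw [t4]
  have t5 := (norm_add_le (Real.pi * n * q 1 * (2 * W - S) +
    (-(Real.pi + 2 * W) * (2 * k)⁻¹) * A) (Q₃ q * (Co - 1))).trans
    (add_le_add (norm_add_le _ _) le_rfl)
  have a1 : 0 ≤ 4 * Real.pi * |q 1| * Cw := by positivity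
  have a2 : 0 ≤ 2 * (2 * |Q₃ q| + |Q₄ q| + Ce) := by positivity
  have a3 := abs_nonneg (Q₃ q)
  have a4 : 0 < 1 / ((n:ℝ) + 1) := by positivity
  have a5 := norm_nonneg W
  have a6 := norm_nonneg (e n)
  generalize 4 * Real.pi * |q 1| * Cw = X1 at *
  generalize 2 * (2 * |Q₃ q| + |Q₄ q| + Ce) = X2 at *
  generalize 1 / ((n:ℝ) + 1) = X3 at *
  generalize ‖W‖ = X4 at *
  generalize ‖e n‖ = X5 at *
  have : (X1 + X2 + |Q₃ q| + 1) * (X4 + X5 + X3) = X1 * X4 + X2 * X3 + |Q₃ q| * X4 + X5 +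
    (X1 * (X5 + X3) + X2 * (X4 + X5) + |Q₃ q| * (X5 + X3) + X4 + X3) := by ring
  rw [this]
  have : 0 ≤ X1 * (X5 + X3) + X2 * (X4 + X5) + |Q₃ q| * (X5 + X3) + X4 + X3 := by positivity
  linarith

/-- Two-sided bounds for `4 k³ Δ(k²)` on the circles separating the zeros of `sin 2k`, for
`ω = 0`. -/
theorem exists_bounds_on_circle_of_omega_eq_zero (hq : MemW21 q) (hq1 : q 1 ≠ 0)
    (hω : omega q = 0) : ∃ δ > 0, ∃ C > 0, ∀ᶠ M : ℕ in atTop, ∀ k : ℂ,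
      ‖k‖ = ((M : ℝ) + 1 / 2) * (Real.pi / 2) → 0 ≤ k.im →
      δ * Real.exp (2 * k.im) ≤ ‖scaledCharFun q k‖ ∧
        ‖scaledCharFun q k‖ ≤ C * (‖k‖ + Real.exp (2 * k.im)) := by
  have hpi := Real.pi_gt_three
  have hq1' : 0 < |q 1| := abs_pos.2 hq1
  obtain ⟨c, hc, hsin⟩ := exists_norm_sin_ge_on_circle
  obtain ⟨K, hK, hE⟩ := exists_norm_remainder_le hq (ε := c * |q 1| / 2) (by positivity)
  refine ⟨c * |q 1| / 2, by positivity, |q 1| + c * |q 1| / 2, by positivity, ?_⟩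
  filter_upwards [tendsto_natCast_atTop_atTop.eventually_ge_atTop K] with M hM k hk him
  have hkK : K ≤ ‖k‖ := by rw [hk]; nlinarith
  have h1 := hE k hkK
  rw [abs_of_nonneg him] at h1
  have h2 : ‖leadingFun q k‖ = |q 1| * ‖Complex.sin (2 * k)‖ := by
    rw [leadingFun, hω]
    simp
  have h3 := hsin M k hk
  have h4 : ‖Complex.sin (2 * k)‖ ≤ Real.exp (2 * k.im) := by
    have := Complex.norm_sin_le_exp (2 * k)
    simpa [abs_mul, abs_of_nonneg him] using this
  have h5 := norm_le_norm_sub_add (scaledCharFun q k) (leadingFun q k)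
  have h6 := norm_sub_norm_le (leadingFun q k) (scaledCharFun q k)
  rw [norm_sub_rev] at h6
  rw [h2] at h5 h6
  have hE0 := Real.exp_pos (2 * k.im)
  constructor
  · nlinarith [mul_le_mul_of_nonneg_left h3 hq1'.le]
  · have a1 := mul_le_mul_of_nonneg_left h4 hq1'.le
    have a2 : 0 ≤ (|q 1| + c * |q 1| / 2) * ‖k‖ := by positivity
    nlinarith

end ZeroMean

/-! ### Eigenvalues in the case `ω = 0` -/

/-- The first `N` positive natural numbers. -/
def pnatHead (N : ℕ) : Finset ℕ+ :=
  (Finset.range N).map ⟨Nat.succPNat, Nat.succPNat_injective⟩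

theorem mem_pnatHead {N : ℕ} {x : ℕ+} : x ∈ pnatHead N ↔ (x : ℕ) ≤ N := by
  simp only [pnatHead, Finset.mem_map, Finset.mem_range, Function.Embedding.coeFn_mk]
  constructor
  · rintro ⟨i, hi, rfl⟩
    rw [Nat.succPNat_coe]
    omega
  · intro h
    have := x.pos
    exact ⟨x.natPred, by rw [PNat.natPred]; omega, x.succPNat_natPred⟩

theorem card_pnatHead (N : ℕ) : (pnatHead N).card = N := by
  simp [pnatHead]

/-- Zeros that are simple for `4 k³ Δ(k²)`, lie in the right half plane and exhaust the large
zeros there give a tail of simple zeros of `Δ`. -/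
theorem exists_hasSimpleTail_of_zeros {q : ℝ → ℝ} (hq : ContinuousOn q (Icc 0 1)) {ι : Type*}
    {k : ι → ℂ} (hre : ∀ i, 0 < (k i).re) (hinj : Function.Injective k)
    (h0 : ∀ i, scaledCharFun q (k i) = 0) (h1 : ∀ i, deriv (scaledCharFun q) (k i) ≠ 0)
    [Nonempty ι] {K : ℝ}
    (hK : ∀ z : ℂ, K ≤ ‖z‖ → 0 ≤ z.re → scaledCharFun q z = 0 → ∃ i, z = k i) :
    ∃ Ex, HasSimpleTail (dirichletCharFun q) Ex fun i => k i ^ 2 := by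
  have hD := differentiable_dirichletCharFun hq
  have hk0 : ∀ i, k i ≠ 0 := fun i h => by
    have := hre i
    simp [h] at this
  obtain ⟨z₀, hz₀⟩ : ∃ z, dirichletCharFun q z ≠ 0 := by
    by_contra hall
    push Not at hall
    have : scaledCharFun q = fun _ => 0 := by
      funext z
      simp [scaledCharFun, hall]
    exact h1 (Classical.arbitrary ι) (by rw [this]; simp)
  refine exists_hasSimpleTail hD hz₀ (fun i i' h => hinj (eq_of_sq_eq_sq_of_re_pos (hre i)
    (hre i') h)) (fun i => analyticOrderAt_sq_eq_one (c := fun k => 4 * k ^ 3) hD (by fun_prop)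
    (fun k => rfl) (by simp [hk0]) (h0 i) (h1 i)) (K := (max K 0) ^ 2) fun z hz hzK => ?_
  obtain ⟨κ, hκ, rfl⟩ := exists_sq_eq_of_re_nonneg z
  rw [norm_pow] at hzK
  have h2 : max K 0 ≤ ‖κ‖ := (lt_of_pow_lt_pow_left₀ 2 (norm_nonneg _) hzK).le
  obtain ⟨i, hi⟩ := hK κ ((le_max_left _ _).trans h2) hκ (by simp [scaledCharFun, hz])
  exact ⟨i, by rw [hi]⟩

/-- The eigenvalue with index `n` lies near the model zero with index `m = n + 1`: the model has one
zero more, so that the indices `n ≥ 1` are exactly right. -/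
theorem eigenvalue_asymptotics_of_omega_eq_zero {q : ℝ → ℝ} (hq : MemW21 q) (hq1 : q 1 ≠ 0)
    (hω : omega q = 0) :
    ∃ lam : ℕ → ℂ,
      EnumeratesDirichletEigenvalues q (fun n : ℕ+ => lam n) ∧
      (∃ α : ℕ → ℂ, MemL2Seq α ∧ ∀ n : ℕ, 1 ≤ n →
        lam n ^ (1 / 2 : ℂ) = ((n : ℂ) + 1) * (Real.pi : ℂ) / 2 + α n) ∧
      (MemW22 q → ∃ κ : ℕ → ℂ, MemL2Seq κ ∧ ∀ n : ℕ, 1 ≤ n →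
        lam n ^ (1 / 2 : ℂ) =
          ((n : ℂ) + 1) * (Real.pi : ℂ) / 2 +
            ((Q₃ q : ℂ) + (-1) ^ n * (Q₄ q : ℂ)) / (2 * (q 1 : ℂ) * (n : ℂ) * (Real.pi : ℂ)) +
            κ n / (n : ℂ)) := by
  have hpi := Real.pi_gt_three
  have hpic : (Real.pi : ℂ) ≠ 0 := by exact_mod_cast Real.pi_ne_zero
  have hq1c : (q 1 : ℂ) ≠ 0 := by exact_mod_cast hq1
  obtain ⟨N, w, K, hN1, hw8, hw, hK⟩ := exists_zeros_of_omega_eq_zero hq hq1 hω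
  have hwL := memL2Seq_displacement hq hq1 hω fun n hn => (hw n hn).2.2
  set k : ℕ → ℂ := fun n => sineZero n + w n with hk
  have hkre : ∀ n, |(k n).re - ((n:ℝ) + 1) * (Real.pi / 2)| ≤ 1 / 8 := fun n => by
    simp only [hk, sineZero_eq_ofReal, Complex.add_re, Complex.ofReal_re, add_sub_cancel_left]
    exact (Complex.abs_re_le_norm _).trans (hw8 n)
  have hknorm : ∀ n, |‖k n‖ - ((n:ℝ) + 1) * (Real.pi / 2)| ≤ 1 / 8 := fun n => by
    rw [← norm_sineZero]
    refine (abs_norm_sub_norm_le _ _).trans ?_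
    simpa [hk] using hw8 n
  have hkpos : ∀ n, 0 < (k n).re := fun n => by
    have := (abs_le.1 (hkre n)).1
    nlinarith [Nat.cast_nonneg (α := ℝ) n]
  have hkinj : Function.Injective k := by
    intro n m hnm
    have h1 := abs_le.1 (hkre n)
    have h2 := abs_le.1 (hkre m)
    rw [hnm] at h1
    by_contra hne
    rcases lt_or_gt_of_ne hne with h | h
    · have : (n : ℝ) + 1 ≤ m := by exact_mod_cast h
      nlinarith
    · have : (m : ℝ) + 1 ≤ n := by exact_mod_cast h
      nlinarith
  obtain ⟨Ex, hEx⟩ := exists_hasSimpleTail_of_zeros hq.continuousOn (k := fun i : ℕ => k (i + N))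
    (fun i => hkpos _) (fun i i' h => Nat.add_right_cancel (hkinj h))
    (fun i => (hw _ (by omega)).1) (fun i => (hw _ (by omega)).2.1) (K := K)
    (fun z hz hz1 hz2 => by
      obtain ⟨n, hn, h⟩ := hK z hz hz1 hz2
      exact ⟨n - N, by rw [Nat.sub_add_cancel hn, h]⟩)
  obtain ⟨δ, hδ, C, hC, hF⟩ := exists_bounds_on_circle_of_omega_eq_zero hq hq1 hω
  -- The moduli of the tail are comparable with those of the model zeros.
  have hsum : Summable fun i : ℕ => |Real.log ‖k (i + N) ^ 2‖ -
      Real.log ‖(((i + N + 1 : ℕ) : ℂ) * (Real.pi / 2)) ^ 2‖| := by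
    refine ((summable_nat_add_iff N).2
      ((Summable.add hwL memL2Seq_one_div).mul_left 2)).of_nonneg_of_le
      (fun i => abs_nonneg _) fun i => ?_
    have e1 : (((i + N + 1 : ℕ) : ℂ) * (Real.pi / 2)) = sineZero (i + N) := by
      rw [sineZero]; push_cast; ring
    rw [e1]
    set n := i + N with hn
    rw [norm_pow, norm_pow, Real.log_pow, Real.log_pow, ← mul_sub, abs_mul]
    have hs0 : sineZero n ≠ 0 := norm_pos_iff.1 (by rw [norm_sineZero]; positivity)
    have h2 := abs_log_norm_add_sub_le (c := sineZero n) (w := w n) (by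
      rw [norm_sineZero]
      nlinarith [hw8 n, Nat.cast_nonneg (α := ℝ) n]) hs0
    rw [norm_sineZero] at h2
    have hn1 : (0:ℝ) < (n:ℝ) + 1 := by positivity
    have h3 : 2 * ‖w n‖ / (((n:ℝ) + 1) * (Real.pi / 2)) ≤ 2 * (‖w n‖ * (1 / ((n:ℝ) + 1))) := by
      rw [mul_one_div, ← mul_div_assoc 2 ‖w n‖]
      exact div_le_div_of_nonneg_left (by positivity) hn1 (by nlinarith)
    have h4 : ‖(((1 / ((n:ℝ) + 1) : ℝ)) : ℂ)‖ = 1 / ((n:ℝ) + 1) := by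
      rw [Complex.norm_real, Real.norm_of_nonneg (by positivity)]
    have h5 : |((2 : ℕ) : ℝ)| = 2 := by norm_num
    rw [norm_sineZero, h5, h4]
    nlinarith [sq_nonneg (‖w n‖ - 1 / ((n:ℝ) + 1))]
  have hsep : ∀ M i : ℕ,
      ‖k (i + N) ^ 2‖ ≤ (((M : ℝ) + 1 / 2) * (Real.pi / 2)) ^ 2 ↔ i + N + 1 ≤ M := by
    intro M i
    have h1 := abs_le.1 (hknorm (i + N))
    push_cast at h1
    rw [norm_pow, sq_le_sq₀ (norm_nonneg _) (by positivity)]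
    constructor
    · intro h
      by_contra h2
      have : (M : ℝ) + 1 ≤ (i : ℝ) + N + 1 := by exact_mod_cast not_le.1 h2
      nlinarith
    · intro h
      have : (i : ℝ) + N + 1 ≤ M := by exact_mod_cast h
      nlinarith
  set b : ℕ → ℕ+ := fun i => (i + N - 1).succPNat with hb
  have hbv : ∀ i, (b i : ℕ) = i + N := fun i => by
    rw [hb, Nat.succPNat_coe]
    omega
  obtain ⟨l, hl, hlE⟩ := exists_enumeration_of_tail hq.continuousOn hEx
    (j := fun i => i + N + 1) (fun i i' h => by simpa using h) (fun i => by omega)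
    (Finset.Icc 1 N) (fun m hm => by
      simp only [Finset.mem_Icc, mem_range, not_exists]
      constructor
      · intro h i hi
        omega
      · intro h
        refine ⟨by omega, ?_⟩
        by_contra h2
        exact h (m - N - 1) (by omega)) (by simp) (m := fun M => M) tendsto_id
    (.of_forall hsep) (.of_forall fun M I _ => (Finset.abs_sum_le_sum_abs _ _).trans
      (hsum.sum_le_tsum _ fun i _ => abs_nonneg _)) hδ hC hF (pnatHead (N - 1))
    (fun x : ℕ+ => k x ^ 2) b
    (fun i i' h => by
      have := congrArg PNat.val h
      rw [hbv, hbv] at this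
      exact Nat.add_right_cancel this)
    (fun x => by
      rw [mem_pnatHead]
      simp only [mem_range, not_exists]
      constructor
      · intro h i hi
        rw [← hi, hbv] at h
        omega
      · intro h
        by_contra h2
        exact h (x - N) (PNat.eq (by rw [hbv]; omega))) (fun i => by rw [hbv])
    (by rw [card_pnatHead, Nat.card_Icc]; omega)
  -- The value at `n = 0` is irrelevant, because only `n ≥ 1` is listed.
  set lam : ℕ → ℂ := fun n => l n.toPNat' with hlam
  have hlam1 : ∀ n, N ≤ n → lam n ^ (1 / 2 : ℂ) = ((n : ℂ) + 1) * (Real.pi : ℂ) / 2 + w n := by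
    intro n hn
    have hn0 : 0 < n := by omega
    have hv : (n.toPNat' : ℕ) = n := by rw [Nat.toPNat'_coe, if_pos hn0]
    simp only [hlam]
    rw [hl _ (by rw [mem_pnatHead, hv]; omega), hv, cpow_half_sq (hkpos n)]
    simp only [hk, sineZero]
    ring
  refine ⟨lam, ?_, ⟨fun n => lam n ^ (1 / 2 : ℂ) - ((n : ℂ) + 1) * (Real.pi : ℂ) / 2, ?_,
    fun n _ => by ring⟩, fun hq2 => ⟨fun n => n * (lam n ^ (1 / 2 : ℂ) -
      ((n : ℂ) + 1) * (Real.pi : ℂ) / 2) - ((Q₃ q : ℂ) + (-1) ^ n * (Q₄ q : ℂ)) /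
        (2 * (q 1 : ℂ) * (Real.pi : ℂ)), ?_, fun n hn => ?_⟩⟩
  · have : (fun n : ℕ+ => lam n) = l := by
      funext n
      simp [hlam]
    rwa [this]
  · refine hwL.of_eventually_le 1 ?_
    filter_upwards [eventually_ge_atTop N] with n hn
    rw [hlam1 n hn, add_sub_cancel_left, one_mul]
  · refine (memL2Seq_second_order_of_omega_eq_zero hq hq2 hq1 hω hw8 (fun n hn => (hw n hn).1)
      fun n hn => (hw n hn).2.2).of_eventually_le 1 ?_
    filter_upwards [eventually_ge_atTop N] with n hn
    rw [hlam1 n hn, add_sub_cancel_left, one_mul]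
  · have hn0 : (n : ℂ) ≠ 0 := by exact_mod_cast (by omega : n ≠ 0)
    field_simp
    ring

/-! ### The approximate zeros in the case `ω ≠ 0` -/

/-- The constants in the approximate equation for the zeros of `2 ω k - q(1) sin 2k`: the modulus
`κ = 4 |ω / q(1)|` and the phase `a`, which is `1/4` or `3/4` according to the sign of
`q(1) / ω`; `e` is `0` or `1` accordingly.  The equation `phase` says that the term
`q(1) exp (-2ik) / (2i)` cancels `2 ω n π` at `k = (n + a) π + (i / 2) log (κ n π)`. -/
structure IsPhase (q : ℝ → ℝ) (a κ : ℝ) (e : ℕ) : Prop where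
  kappa_pos : 0 < κ
  a_eq : 4 * a = 2 * e + 1
  e_le : e ≤ 1
  phase : (q 1 : ℂ) * (Complex.exp (-(2 * Complex.I * a * Real.pi)) * κ) =
    -(4 * Complex.I * (omega q : ℂ))

theorem isPhase_of_pos {q : ℝ → ℝ} (h : 0 < q 1 / omega q) :
    IsPhase q (1 / 4) (4 * (omega q / q 1)) 0 := by
  have h1 : q 1 ≠ 0 := fun h0 => by simp [h0] at h
  have h1c : (q 1 : ℂ) ≠ 0 := by exact_mod_cast h1
  refine ⟨by rw [← inv_div]; positivity, by norm_num, by norm_num, ?_⟩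
  have h2 : -(2 * Complex.I * ((1 / 4 : ℝ) : ℂ) * Real.pi) = -(Real.pi / 2 * Complex.I) := by
    push_cast; ring
  rw [h2, Complex.exp_neg, Complex.exp_pi_div_two_mul_I, Complex.inv_I]
  push_cast
  field_simp

theorem isPhase_of_neg {q : ℝ → ℝ} (h : q 1 / omega q < 0) :
    IsPhase q (3 / 4) (-(4 * (omega q / q 1))) 1 := by
  have h1 : q 1 ≠ 0 := fun h0 => by simp [h0] at h
  have h1c : (q 1 : ℂ) ≠ 0 := by exact_mod_cast h1
  refine ⟨by rw [← inv_div]; have := inv_lt_zero.2 h; linarith, by norm_num, by norm_num, ?_⟩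
  have h2 : -(2 * Complex.I * ((3 / 4 : ℝ) : ℂ) * Real.pi) =
      Real.pi / 2 * Complex.I - (2 : ℂ) * Real.pi * Complex.I := by
    push_cast; ring
  rw [h2, Complex.exp_sub, Complex.exp_two_pi_mul_I, Complex.exp_pi_div_two_mul_I]
  push_cast
  field_simp

/-- The logarithm `log (κ n π)` that governs the imaginary parts of the zeros, split so that it is
`log (κ π)` for `n = 0`. -/
noncomputable def logHeight (κ : ℝ) (n : ℕ) : ℝ := Real.log (κ * Real.pi) + Real.log n

/-- The approximate zeros `(n + a) π + (i / 2) log (κ n π)`. -/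
noncomputable def logCentre (a κ : ℝ) (n : ℕ) : ℂ :=
  (((n : ℝ) + a) * Real.pi : ℝ) + Complex.I * (logHeight κ n / 2 : ℝ)

section LogCentre

variable {q : ℝ → ℝ} {a κ : ℝ} {e : ℕ}

theorem logCentre_re (n : ℕ) : (logCentre a κ n).re = ((n : ℝ) + a) * Real.pi := by
  rw [logCentre, Complex.add_re, Complex.ofReal_re, Complex.re_mul_ofReal, Complex.I_re]
  ring

theorem logCentre_im (n : ℕ) : (logCentre a κ n).im = logHeight κ n / 2 := by
  rw [logCentre, Complex.add_im, Complex.ofReal_im, Complex.im_mul_ofReal, Complex.I_im]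
  ring

theorem IsPhase.a_mem (h : IsPhase q a κ e) : 1 / 4 ≤ a ∧ a ≤ 3 / 4 := by
  have h1 := h.a_eq
  have h2 : (e : ℝ) ≤ 1 := by exact_mod_cast h.e_le
  have h3 := Nat.cast_nonneg (α := ℝ) e
  constructor <;> linarith

theorem IsPhase.abs_mul (h : IsPhase q a κ e) : |q 1| * κ = 4 * |omega q| := by
  have := congrArg norm h.phase
  rw [norm_mul, norm_mul, norm_neg, norm_mul, norm_mul, Complex.norm_real, Complex.norm_real,
    Complex.norm_real, Complex.norm_I, Complex.norm_exp, Real.norm_of_nonneg h.kappa_pos.le] at this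
  simpa using this

theorem exp_logHeight (hκ : 0 < κ) {n : ℕ} (hn : 1 ≤ n) :
    Real.exp (logHeight κ n) = κ * Real.pi * n := by
  have hn' : (0:ℝ) < n := by exact_mod_cast hn
  have := Real.pi_pos
  rw [logHeight, Real.exp_add, Real.exp_log (by positivity), Real.exp_log hn']

theorem exp_neg_logCentre (hκ : 0 < κ) {n : ℕ} (hn : 1 ≤ n) :
    Complex.exp (-(2 * Complex.I * logCentre a κ n)) =
      Complex.exp (-(2 * Complex.I * a * Real.pi)) * (κ * Real.pi * n) := by
  have h1 : -(2 * Complex.I * logCentre a κ n) = -(2 * Complex.I * a * Real.pi) +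
      (logHeight κ n : ℂ) + (-n : ℤ) * (2 * Real.pi * Complex.I) := by
    rw [logCentre]
    push_cast
    linear_combination (-(logHeight κ n : ℂ)) * Complex.I_sq
  rw [h1, Complex.exp_add, Complex.exp_int_mul_two_pi_mul_I, mul_one, Complex.exp_add,
    ← Complex.ofReal_exp, exp_logHeight hκ hn]
  push_cast
  rfl

theorem exp_two_im_logCentre_add (hκ : 0 < κ) {n : ℕ} (hn : 1 ≤ n) (w : ℂ) :
    Real.exp (2 * (logCentre a κ n + w).im) = κ * Real.pi * n * Real.exp (2 * w.im) := by
  rw [Complex.add_im, logCentre_im, ← exp_logHeight hκ hn, ← Real.exp_add]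
  congr 1
  ring

/-- The function `2 ω k - q(1) sin 2k` in exponential form. -/
theorem leadingFun_eq_exp (k : ℂ) :
    leadingFun q k = 2 * (omega q : ℂ) * k - (q 1 : ℂ) * (Complex.I / 2) *
      Complex.exp (-(2 * Complex.I * k)) + (q 1 : ℂ) * (Complex.I / 2) *
      Complex.exp (2 * Complex.I * k) := by
  rw [leadingFun, Complex.sin]
  have h1 : -(2 * k) * Complex.I = -(2 * Complex.I * k) := by ring
  have h2 : 2 * k * Complex.I = 2 * Complex.I * k := by ring
  rw [h1, h2]
  ring

/-- Near the approximate zeros the normalized leading part is close to `1 - exp (-2 i w)`; the only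
term omitted here is the decaying exponential in `sin 2k`. -/
theorem norm_leadingFun_div_sub_le (h : IsPhase q a κ e) (hω : omega q ≠ 0) {n : ℕ} (hn : 1 ≤ n)
    (w : ℂ) :
    ‖leadingFun q (logCentre a κ n + w) / (2 * (omega q : ℂ) * Real.pi * n) -
      ((logCentre a κ n + w) / (Real.pi * n) - Complex.exp (-(2 * Complex.I * w)))‖ ≤
      Real.exp (2 * ‖w‖) / (κ * Real.pi * n) ^ 2 := by
  have hκ := h.kappa_pos
  have hpi := Real.pi_pos
  have hn' : (0:ℝ) < n := by exact_mod_cast hn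
  have hnc : (n : ℂ) ≠ 0 := by exact_mod_cast hn'.ne'
  have hωc : (omega q : ℂ) ≠ 0 := by exact_mod_cast hω
  have hpic : (Real.pi : ℂ) ≠ 0 := by exact_mod_cast hpi.ne'
  have hω' : 0 < |omega q| := abs_pos.2 hω
  set k := logCentre a κ n + w with hk
  have h1 : Complex.exp (-(2 * Complex.I * k)) = Complex.exp (-(2 * Complex.I * a * Real.pi)) *
      (κ * Real.pi * n) * Complex.exp (-(2 * Complex.I * w)) := by
    rw [← exp_neg_logCentre hκ hn, ← Complex.exp_add, hk]
    congr 1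
    ring
  have h2 : (q 1 : ℂ) * (Complex.I / 2) * Complex.exp (-(2 * Complex.I * k)) =
      2 * (omega q : ℂ) * Real.pi * n * Complex.exp (-(2 * Complex.I * w)) := by
    rw [h1]
    linear_combination (Complex.I / 2 * (Real.pi * n) * Complex.exp (-(2 * Complex.I * w))) *
      h.phase - (2 * (omega q : ℂ) * Real.pi * n * Complex.exp (-(2 * Complex.I * w))) *
      Complex.I_sq
  have h3 : leadingFun q k / (2 * (omega q : ℂ) * Real.pi * n) -
      (k / (Real.pi * n) - Complex.exp (-(2 * Complex.I * w))) =
      (q 1 : ℂ) * (Complex.I / 2) * Complex.exp (2 * Complex.I * k) /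
        (2 * (omega q : ℂ) * Real.pi * n) := by
    rw [leadingFun_eq_exp, h2]
    generalize Complex.exp (-(2 * Complex.I * w)) = X
    generalize Complex.exp (2 * Complex.I * k) = Y
    field_simp
    ring
  have h4 : ‖Complex.exp (2 * Complex.I * k)‖ ≤ Real.exp (2 * ‖w‖) / (κ * Real.pi * n) := by
    have : ‖Complex.exp (2 * Complex.I * k)‖ = (Real.exp (2 * k.im))⁻¹ := by
      rw [Complex.norm_exp, ← Real.exp_neg]
      congr 1
      simp
    rw [this, hk, exp_two_im_logCentre_add hκ hn, mul_inv, ← Real.exp_neg, div_eq_mul_inv,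
      mul_comm]
    refine mul_le_mul_of_nonneg_right (Real.exp_le_exp.2 ?_) (by positivity)
    have := (abs_le.1 (Complex.abs_im_le_norm w)).1
    linarith
  rw [h3, norm_div, norm_mul, norm_mul, norm_mul, norm_mul, norm_mul, norm_div, Complex.norm_I,
    Complex.norm_two, Complex.norm_real, Complex.norm_real, Complex.norm_real,
    Complex.norm_natCast, Real.norm_eq_abs, Real.norm_eq_abs, Real.norm_of_nonneg hpi.le]
  calc _ ≤ |q 1| * (1 / 2) * (Real.exp (2 * ‖w‖) / (κ * Real.pi * n)) /
        (2 * |omega q| * Real.pi * n) := by gcongr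
    _ = _ := by
      have h5 : |omega q| = |q 1| * κ / 4 := by linarith [h.abs_mul]
      have h6 : 0 < |q 1| := by
        by_contra h7
        have : |q 1| = 0 := le_antisymm (not_lt.1 h7) (abs_nonneg _)
        rw [h5, this] at hω'
        simp at hω'
      rw [h5]
      generalize Real.exp (2 * ‖w‖) = X
      field_simp
      ring

end LogCentre

/-! ### Localization of the zeros -/

section Localization

variable {q : ℝ → ℝ} {a κ : ℝ} {e : ℕ}

theorem norm_clog_le (z : ℂ) : ‖Complex.log z‖ ≤ |Real.log ‖z‖| + Real.pi := by
  refine (Complex.norm_le_abs_re_add_abs_im _).trans ?_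
  rw [Complex.log_re, Complex.log_im]
  linarith [Complex.abs_arg_le_pi z]

theorem exists_forall_abs_log_add_le {ε : ℝ} (hε : 0 < ε) (A : ℝ) :
    ∃ K : ℝ, ∀ x, K ≤ x → |Real.log x| + A ≤ ε * x := by
  have h1 : ∀ᶠ x : ℝ in atTop, ‖Real.log x‖ ≤ ε / 2 * ‖x‖ :=
    Real.isLittleO_log_id_atTop.def (half_pos hε)
  have h2 : ∀ᶠ x : ℝ in atTop, A / (ε / 2) ≤ x := eventually_ge_atTop _
  obtain ⟨K, hK⟩ := eventually_atTop.1 (h1.and (h2.and (eventually_ge_atTop 0)))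
  refine ⟨K, fun x hx => ?_⟩
  obtain ⟨h3, h4, h5⟩ := hK x hx
  rw [div_le_iff₀ (half_pos hε)] at h4
  rw [Real.norm_eq_abs, Real.norm_of_nonneg h5] at h3
  linarith

/-- In the first quadrant, the dominant terms `2 ω k` and `q(1) exp (-2 i k) / (2 i)` of
`2 ω k - q(1) sin 2k` can cancel only if their quotient is close to `-1`. -/
theorem exists_norm_exp_sub_one_le (h : IsPhase q a κ e) (hω : omega q ≠ 0) (hq1 : q 1 ≠ 0)
    {η : ℝ} (hη : 0 < η) (hη4 : η ≤ 1 / 4) :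
    ∃ δ > 0, ∃ K > 0, ∀ k : ℂ, K ≤ ‖k‖ → 0 ≤ k.im →
      ‖leadingFun q k‖ ≤ δ * (‖k‖ + Real.exp (2 * k.im)) →
      ‖Complex.exp (2 * Complex.I * a * Real.pi - 2 * Complex.I * k - Real.log κ -
        Complex.log k) - 1‖ ≤ 3 * η := by
  have hκ := h.kappa_pos
  have hω' : 0 < |omega q| := abs_pos.2 hω
  have hq1' : 0 < |q 1| := abs_pos.2 hq1
  have hωc : (omega q : ℂ) ≠ 0 := by exact_mod_cast hω
  have hκc : (κ : ℂ) ≠ 0 := by exact_mod_cast hκ.ne'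
  refine ⟨min (η * |omega q|) (η * |q 1| / 2), by positivity, |q 1| / (2 * η * |omega q|),
    by positivity, fun k hk him hf => ?_⟩
  set A := 2 * (omega q : ℂ) * k with hA
  set B := (q 1 : ℂ) * (Complex.I / 2) * Complex.exp (-(2 * Complex.I * k)) with hB
  have hAn : ‖A‖ = 2 * |omega q| * ‖k‖ := by
    rw [hA, norm_mul, norm_mul, Complex.norm_two, Complex.norm_real, Real.norm_eq_abs]
  have hBn : ‖B‖ = |q 1| / 2 * Real.exp (2 * k.im) := by
    rw [hB, norm_mul, norm_mul, norm_div, Complex.norm_I, Complex.norm_two, Complex.norm_real,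
      Real.norm_eq_abs, Complex.norm_exp]
    have : (-(2 * Complex.I * k)).re = 2 * k.im := by simp
    rw [this]
    ring
  have hk0 : 0 < ‖k‖ := lt_of_lt_of_le (by positivity) hk
  have hkne : k ≠ 0 := norm_pos_iff.1 hk0
  have hA0 : 0 < ‖A‖ := by rw [hAn]; positivity
  have hsmall : ‖(q 1 : ℂ) * (Complex.I / 2) * Complex.exp (2 * Complex.I * k)‖ ≤ |q 1| / 2 := by
    rw [norm_mul, norm_mul, norm_div, Complex.norm_I, Complex.norm_two, Complex.norm_real,
      Real.norm_eq_abs, Complex.norm_exp]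
    have : (2 * Complex.I * k).re = -(2 * k.im) := by simp
    rw [this]
    have h1 : Real.exp (-(2 * k.im)) ≤ 1 := Real.exp_le_one_iff.2 (by linarith)
    nlinarith
  have hAB : ‖A - B‖ ≤ η * (‖A‖ + ‖B‖) := by
    have h1 : A - B = leadingFun q k -
        (q 1 : ℂ) * (Complex.I / 2) * Complex.exp (2 * Complex.I * k) := by
      rw [leadingFun_eq_exp]; ring
    rw [h1]
    refine (norm_sub_le _ _).trans ((add_le_add hf hsmall).trans ?_)
    rw [hAn, hBn]
    have h2 : |q 1| / 2 ≤ η * |omega q| * ‖k‖ := by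
      rw [div_le_iff₀ (by positivity)] at hk
      linarith
    have hE := Real.exp_pos (2 * k.im)
    have h3 := mul_le_mul_of_nonneg_right
      (min_le_left (η * |omega q|) (η * |q 1| / 2)) hk0.le
    have h4 := mul_le_mul_of_nonneg_right
      (min_le_right (η * |omega q|) (η * |q 1| / 2)) hE.le
    linarith
  have hBA : ‖B‖ ≤ 2 * ‖A‖ := by
    have h1 := norm_sub_norm_le B A
    rw [norm_sub_rev] at h1
    nlinarith [norm_nonneg B]
  have hexp : Complex.exp (2 * Complex.I * a * Real.pi - 2 * Complex.I * k - Real.log κ -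
      Complex.log k) = B / A := by
    have h1 : 2 * Complex.I * a * Real.pi - 2 * Complex.I * k - Real.log κ - Complex.log k =
        -(2 * Complex.I * k) - (-(2 * Complex.I * a * Real.pi)) - Real.log κ - Complex.log k := by
      ring
    rw [h1, Complex.exp_sub, Complex.exp_sub, Complex.exp_sub, Complex.exp_log hkne,
      ← Complex.ofReal_exp, Real.exp_log hκ, hA, hB]
    have hE0 := Complex.exp_ne_zero (-(2 * Complex.I * a * Real.pi))
    have hph := h.phase
    generalize Complex.exp (-(2 * Complex.I * k)) = X
    generalize Complex.exp (-(2 * Complex.I * a * Real.pi)) = E at *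
    rw [div_div, div_div, div_eq_div_iff (by simp [hE0, hκc, hkne]) (by simp [hωc, hkne])]
    linear_combination (-(Complex.I / 2) * X * k) * hph + (2 * (omega q : ℂ) * X * k) *
      Complex.I_sq
  rw [hexp]
  have hAne : A ≠ 0 := norm_pos_iff.1 hA0
  have h5 : B / A - 1 = -(A - B) / A := by field_simp; ring
  rw [h5, norm_div, norm_neg, div_le_iff₀ hA0]
  nlinarith

/-- Every large point of the first quadrant at which `2 ω k - q(1) sin 2k` is small, compared
with its two dominant terms, is close to one of the approximate zeros. -/
theorem exists_near_logCentre (h : IsPhase q a κ e) (hω : omega q ≠ 0) (hq1 : q 1 ≠ 0)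
    {r : ℝ} (hr : 0 < r) :
    ∃ δ > 0, ∃ K > 0, ∀ k : ℂ, K ≤ ‖k‖ → 0 ≤ k.re → 0 ≤ k.im →
      ‖leadingFun q k‖ ≤ δ * (‖k‖ + Real.exp (2 * k.im)) →
      ∃ n : ℕ, 1 ≤ n ∧ ‖k - logCentre a κ n‖ ≤ r := by
  have hκ := h.kappa_pos
  have hpi := Real.pi_gt_three
  have hpi0 := Real.pi_pos
  obtain ⟨ha1, ha2⟩ := h.a_mem
  have hc : ContinuousAt Complex.log 1 := continuousAt_clog Complex.one_mem_slitPlane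
  obtain ⟨η₀, hη₀, hlog⟩ := Metric.continuousAt_iff.1 hc r hr
  obtain ⟨δ₁, hδ₁, hexp⟩ := exists_int_near_of_exp_near_one hr
  obtain ⟨δ, hδ, K₁, hK₁, hmain⟩ := exists_norm_exp_sub_one_le h hω hq1
    (η := min (1 / 4) (δ₁ / 3)) (by positivity) (min_le_left _ _)
  set ε := min (1 / 8) (η₀ / 16) with hε
  have hε0 : 0 < ε := by positivity
  have hε8 : ε ≤ 1 / 8 := min_le_left _ _
  have hεη : ε ≤ η₀ / 16 := min_le_right _ _
  obtain ⟨K₂, hK₂⟩ := exists_forall_abs_log_add_le hε0 (r + |Real.log κ| + 2 * Real.pi)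
  refine ⟨δ, hδ, max K₁ K₂, lt_max_of_lt_left hK₁, fun k hk hre him hf => ?_⟩
  have hk1 : K₁ ≤ ‖k‖ := (le_max_left _ _).trans hk
  have hk2 := hK₂ ‖k‖ ((le_max_right _ _).trans hk)
  have hk0 : 0 < ‖k‖ := lt_of_lt_of_le hK₁ hk1
  have hkne : k ≠ 0 := norm_pos_iff.1 hk0
  have h1 := hmain k hk1 him hf
  obtain ⟨m, hm⟩ := hexp _ (h1.trans (by
    have := min_le_right (1 / 4 : ℝ) (δ₁ / 3)
    linarith))
  -- `D` is the deviation of `k` from the solution of the logarithmic form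
  -- `k = (n + a) π + (i / 2) log (κ k)` of the equation.
  set D := k - (((-m : ℤ) : ℂ) + a) * Real.pi - Complex.I / 2 * (Real.log κ + Complex.log k) with hD
  have hDn : ‖D‖ < r / 2 := by
    have : D = Complex.I / 2 * (2 * Complex.I * a * Real.pi - 2 * Complex.I * k - Real.log κ -
        Complex.log k - m * (2 * Real.pi * Complex.I)) := by
      rw [hD]
      push_cast
      linear_combination (-(a : ℂ) * Real.pi + k + m * Real.pi) * Complex.I_sq
    rw [this, norm_mul, norm_div, Complex.norm_I, Complex.norm_two]
    linarith
  obtain ⟨n₀, hn₀⟩ : ∃ n₀ : ℤ, n₀ = -m := ⟨_, rfl⟩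
  rw [← hn₀] at hD
  have habs := abs_nonneg (Real.log ‖k‖)
  have habs' := abs_nonneg (Real.log κ)
  -- The logarithm is small compared with `k`, so `k` is close to `(n + a) π` in relative terms; in
  -- particular `n > 0`, as `k` lies in the right half plane.
  have h2 : ‖k - (((n₀ : ℝ) + a) * Real.pi : ℝ)‖ ≤ ε * ‖k‖ := by
    have : k - (((n₀ : ℝ) + a) * Real.pi : ℝ) =
        D + Complex.I / 2 * (Real.log κ + Complex.log k) := by
      rw [hD]; push_cast; ring
    rw [this]
    refine (norm_add_le _ _).trans ?_
    have h3 : ‖Complex.I / 2 * (Real.log κ + Complex.log k)‖ ≤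
        1 / 2 * (|Real.log κ| + (|Real.log ‖k‖| + Real.pi)) := by
      rw [norm_mul, norm_div, Complex.norm_I, Complex.norm_two]
      refine mul_le_mul_of_nonneg_left ((norm_add_le _ _).trans (add_le_add ?_ (norm_clog_le k)))
        (by norm_num)
      rw [Complex.norm_real]
      rfl
    linarith
  have h3 : |k.re - ((n₀ : ℝ) + a) * Real.pi| ≤ ε * ‖k‖ := by
    refine le_trans ?_ h2
    have := Complex.abs_re_le_norm (k - (((n₀ : ℝ) + a) * Real.pi : ℝ))
    rwa [Complex.sub_re, Complex.ofReal_re] at this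
  have h4 : (1 - ε) * ‖k‖ ≤ |((n₀ : ℝ) + a) * Real.pi| := by
    have := norm_sub_norm_le k (((n₀ : ℝ) + a) * Real.pi : ℝ)
    rw [Complex.norm_real, Real.norm_eq_abs] at this
    linarith
  have hεk : 2 * Real.pi ≤ ε * ‖k‖ := by linarith
  have h5 : (1 - ε) * ‖k‖ ≤ ((n₀ : ℝ) + a) * Real.pi := by
    rcases abs_cases (((n₀ : ℝ) + a) * Real.pi) with ⟨h6, _⟩ | ⟨h6, _⟩
    · rwa [h6] at h4
    · rw [h6] at h4
      have := (abs_le.1 h3).2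
      nlinarith
  have h6 : 0 < n₀ := by
    have h7 : 0 < (n₀ : ℝ) := by
      have : 14 * Real.pi ≤ ((n₀ : ℝ) + a) * Real.pi := by nlinarith
      have := le_of_mul_le_mul_right this hpi0
      linarith
    exact_mod_cast h7
  obtain ⟨n, rfl⟩ : ∃ n : ℕ, n₀ = n := ⟨n₀.toNat, by omega⟩
  have hn1 : 1 ≤ n := by omega
  have hn' : (0:ℝ) < n := by exact_mod_cast hn1
  have hnπ : (0:ℝ) < n * Real.pi := by positivity
  rw [Int.cast_natCast] at h2 h5
  have h7 : ‖k / (n * Real.pi : ℝ) - 1‖ ≤ 4 * ε := by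
    have hne : ((n * Real.pi : ℝ) : ℂ) ≠ 0 := by exact_mod_cast hnπ.ne'
    rw [div_sub_one hne, norm_div, Complex.norm_real, Real.norm_of_nonneg hnπ.le,
      div_le_iff₀ hnπ]
    have h8 : ‖k - (n * Real.pi : ℝ)‖ ≤ 2 * ε * ‖k‖ := by
      have : k - (n * Real.pi : ℝ) = k - (((n : ℝ) + a) * Real.pi : ℝ) + (a * Real.pi : ℝ) := by
        push_cast; ring
      rw [this]
      refine (norm_add_le _ _).trans ?_
      rw [Complex.norm_real, Real.norm_of_nonneg (by positivity)]
      nlinarith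
    refine h8.trans ?_
    have : ‖k‖ / 2 ≤ n * Real.pi := by nlinarith
    nlinarith
  -- Therefore `log k` may be replaced by `log (n π)`.
  have h8 : ‖Complex.log (k / (n * Real.pi : ℝ))‖ < r := by
    have := @hlog (k / (n * Real.pi : ℝ)) (by rw [dist_eq_norm]; linarith)
    rwa [Complex.log_one, dist_zero_right] at this
  refine ⟨n, hn1, ?_⟩
  have h9 : Complex.log k = (Real.log Real.pi + Real.log n : ℝ) +
      Complex.log (k / (n * Real.pi : ℝ)) := by
    have hne : ((n * Real.pi : ℝ) : ℂ) ≠ 0 := by exact_mod_cast hnπ.ne'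
    have := Complex.log_ofReal_mul hnπ (x := k / (n * Real.pi : ℝ)) (div_ne_zero hkne hne)
    rw [mul_div_cancel₀ _ hne] at this
    rw [this, Real.log_mul hn'.ne' hpi0.ne', add_comm (Real.log Real.pi)]
  have h10 : k - logCentre a κ n = D + Complex.I / 2 * Complex.log (k / (n * Real.pi : ℝ)) := by
    rw [hD, h9, logCentre, logHeight, Real.log_mul hκ.ne' hpi0.ne']
    push_cast
    ring
  rw [h10]
  refine (norm_add_le _ _).trans ?_
  rw [norm_mul, norm_div, Complex.norm_I, Complex.norm_two]
  linarith

end Localization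

/-! ### Zeros near the approximate zeros -/

section ZerosNearCentres

variable {q : ℝ → ℝ} {a κ : ℝ} {e : ℕ}

theorem tendsto_logHeight_atTop : Tendsto (logHeight κ) atTop atTop :=
  tendsto_atTop_add_const_left _ _ (Real.tendsto_log_atTop.comp tendsto_natCast_atTop_atTop)

theorem tendsto_logHeight_sq_div : Tendsto (fun n : ℕ => logHeight κ n ^ 2 / n) atTop (𝓝 0) := by
  have h2 : Tendsto (fun n : ℕ => Real.log n ^ 2 / (n : ℝ)) atTop (𝓝 0) :=
    (Real.isLittleO_pow_log_id_atTop (n := 2)).tendsto_div_nhds_zero.comp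
      tendsto_natCast_atTop_atTop
  have h1 : Tendsto (fun n : ℕ => Real.log n / (n : ℝ)) atTop (𝓝 0) :=
    Real.isLittleO_log_id_atTop.tendsto_div_nhds_zero.comp tendsto_natCast_atTop_atTop
  have h0 : Tendsto (fun n : ℕ => 1 / (n : ℝ)) atTop (𝓝 0) := tendsto_one_div_atTop_nhds_zero_nat
  have := ((h0.const_mul (Real.log (κ * Real.pi) ^ 2)).add
    (h1.const_mul (2 * Real.log (κ * Real.pi)))).add h2
  simp only [mul_zero, add_zero] at this
  refine this.congr fun n => ?_
  rw [logHeight]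
  ring

theorem tendsto_abs_logHeight_add_div (C : ℝ) :
    Tendsto (fun n : ℕ => (|logHeight κ n| + C) / n) atTop (𝓝 0) := by
  have h0 : Tendsto (fun n : ℕ => 1 / (n : ℝ)) atTop (𝓝 0) := tendsto_one_div_atTop_nhds_zero_nat
  have h1 : Tendsto (fun n : ℕ => logHeight κ n ^ 2 / n + (1 + |C|) * (1 / (n : ℝ))) atTop
      (𝓝 0) := by
    simpa using (tendsto_logHeight_sq_div (κ := κ)).add (h0.const_mul (1 + |C|))
  refine squeeze_zero_norm (fun n => ?_) h1
  rw [norm_div, Real.norm_eq_abs, RCLike.norm_natCast, mul_one_div, ← add_div]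
  refine div_le_div_of_nonneg_right ?_ (Nat.cast_nonneg n)
  refine (abs_add_le _ _).trans ?_
  rw [abs_abs]
  nlinarith [sq_nonneg (|logHeight κ n| - 1), sq_abs (logHeight κ n), abs_nonneg (logHeight κ n)]

theorem norm_logCentre_add_div_sub_one_le (h : IsPhase q a κ e) {n : ℕ} (hn : 1 ≤ n) {w : ℂ}
    (hw : ‖w‖ ≤ 1 / 4) :
    ‖(logCentre a κ n + w) / (Real.pi * n) - 1‖ ≤ (|logHeight κ n| + 1) / n := by
  have hpi := Real.pi_gt_three
  have hn' : (0:ℝ) < n := by exact_mod_cast hn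
  have hnc : (n : ℂ) ≠ 0 := by exact_mod_cast hn'.ne'
  have hpic : (Real.pi : ℂ) ≠ 0 := by exact_mod_cast Real.pi_ne_zero
  obtain ⟨ha1, ha2⟩ := h.a_mem
  have h1 : (logCentre a κ n + w) / (Real.pi * n) - 1 =
      ((a * Real.pi : ℝ) + Complex.I * (logHeight κ n / 2 : ℝ) + w) / (Real.pi * n) := by
    rw [logCentre]
    push_cast
    field_simp
    ring
  have h2 : ‖((a * Real.pi : ℝ) : ℂ) + Complex.I * (logHeight κ n / 2 : ℝ) + w‖ ≤
      3 / 4 * Real.pi + |logHeight κ n| / 2 + 1 / 4 := by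
    refine (norm_add_le _ _).trans (add_le_add ((norm_add_le _ _).trans (add_le_add ?_ ?_)) hw)
    · rw [Complex.norm_real, Real.norm_of_nonneg (by positivity)]
      nlinarith
    · rw [norm_mul, Complex.norm_I, one_mul, Complex.norm_real, Real.norm_eq_abs, abs_div,
        abs_of_pos (two_pos (α := ℝ))]
  rw [h1, norm_div, norm_mul, Complex.norm_real, Real.norm_of_nonneg (by positivity),
    Complex.norm_natCast, div_le_div_iff₀ (by positivity) hn']
  have h3 := abs_nonneg (logHeight κ n)
  have h4 : 3 / 4 * Real.pi + |logHeight κ n| / 2 + 1 / 4 ≤ (|logHeight κ n| + 1) * Real.pi := by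
    nlinarith
  nlinarith

/-- A function that differs from `2 ω k - q(1) sin 2k` by `o(exp (2 |Im k|))` is close, after
normalization, to `1 - exp (-2 i w)` near the approximate zeros. -/
theorem eventually_norm_div_sub_le (h : IsPhase q a κ e) (hω : omega q ≠ 0) {F : ℂ → ℂ}
    (hE : ∀ ε > 0, ∃ K : ℝ, 0 < K ∧ ∀ k : ℂ, K ≤ ‖k‖ →
      ‖F k - leadingFun q k‖ ≤ ε * Real.exp (2 * |k.im|)) {δ : ℝ} (hδ : 0 < δ) :
    ∀ᶠ n in atTop, ∀ w : ℂ, ‖w‖ ≤ 1 / 4 →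
      ‖F (logCentre a κ n + w) / (2 * (omega q : ℂ) * Real.pi * n) -
        (1 - Complex.exp (-(2 * Complex.I * w)))‖ ≤ δ := by
  have hpi := Real.pi_gt_three
  have hκ := h.kappa_pos
  have hω' : 0 < |omega q| := abs_pos.2 hω
  obtain ⟨ha1, ha2⟩ := h.a_mem
  obtain ⟨K, hK, hE⟩ := hE (δ / 3 * (2 * |omega q| / (κ * Real.exp (1 / 2)))) (by positivity)
  have h0 : Tendsto (fun n : ℕ => Real.exp (1 / 2) / κ ^ 2 * (1 / (n : ℝ))) atTop (𝓝 0) := by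
    simpa using tendsto_one_div_atTop_nhds_zero_nat.const_mul (Real.exp (1 / 2) / κ ^ 2)
  filter_upwards [eventually_ge_atTop 1, (tendsto_logHeight_atTop (κ := κ)).eventually_ge_atTop 1,
    tendsto_natCast_atTop_atTop.eventually_ge_atTop K,
    h0.eventually_le_const (by positivity : 0 < δ / 3),
    (tendsto_abs_logHeight_add_div (κ := κ) 1).eventually_le_const
      (by positivity : 0 < δ / 3)] with n hn hL hnK h3 h4 w hw
  have hn' : (0:ℝ) < n := by exact_mod_cast hn
  have hn1 : (1:ℝ) ≤ n := by exact_mod_cast hn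
  have him : 0 ≤ (logCentre a κ n + w).im := by
    rw [Complex.add_im, logCentre_im]
    linarith [(abs_le.1 ((Complex.abs_im_le_norm w).trans hw)).1]
  have hkK : K ≤ ‖logCentre a κ n + w‖ := by
    refine le_trans ?_ ((le_abs_self _).trans (Complex.abs_re_le_norm _))
    rw [Complex.add_re, logCentre_re]
    have := (abs_le.1 ((Complex.abs_re_le_norm w).trans hw)).1
    nlinarith
  have h5 := norm_leadingFun_div_sub_le h hω hn w
  have h6 := norm_logCentre_add_div_sub_one_le h hn hw
  have h7 : ‖(F (logCentre a κ n + w) - leadingFun q (logCentre a κ n + w)) /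
      (2 * (omega q : ℂ) * Real.pi * n)‖ ≤ δ / 3 := by
    have h8 := hE _ hkK
    rw [abs_of_nonneg him, exp_two_im_logCentre_add hκ hn] at h8
    have h9 : Real.exp (2 * w.im) ≤ Real.exp (1 / 2) :=
      Real.exp_le_exp.2 (by linarith [(abs_le.1 ((Complex.abs_im_le_norm w).trans hw)).2])
    rw [norm_div, norm_mul, norm_mul, norm_mul, Complex.norm_two, Complex.norm_real,
      Complex.norm_real, Complex.norm_natCast, Real.norm_eq_abs, Real.norm_of_nonneg (by positivity),
      div_le_iff₀ (by positivity)]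
    refine h8.trans ?_
    calc _ ≤ δ / 3 * (2 * |omega q| / (κ * Real.exp (1 / 2))) *
          (κ * Real.pi * n * Real.exp (1 / 2)) := by gcongr
      _ = _ := by field_simp
  have h8 : Real.exp (2 * ‖w‖) / (κ * Real.pi * n) ^ 2 ≤ δ / 3 := by
    refine le_trans ?_ h3
    rw [div_mul_div_comm, mul_one]
    refine div_le_div₀ (by positivity) (Real.exp_le_exp.2 (by linarith)) (by positivity) ?_
    have : (κ * Real.pi * n) ^ 2 = κ ^ 2 * n * (Real.pi ^ 2 * n) := by ring
    rw [this]
    refine le_mul_of_one_le_right (by positivity) ?_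
    nlinarith
  have h9 : F (logCentre a κ n + w) / (2 * (omega q : ℂ) * Real.pi * n) -
      (1 - Complex.exp (-(2 * Complex.I * w))) =
      (leadingFun q (logCentre a κ n + w) / (2 * (omega q : ℂ) * Real.pi * n) -
        ((logCentre a κ n + w) / (Real.pi * n) - Complex.exp (-(2 * Complex.I * w)))) +
      ((logCentre a κ n + w) / (Real.pi * n) - 1) +
      (F (logCentre a κ n + w) - leadingFun q (logCentre a κ n + w)) /
        (2 * (omega q : ℂ) * Real.pi * n) := by
    ring
  rw [h9]
  refine (norm_add₃_le).trans ?_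
  linarith

/-- If `ω ≠ 0`, both `2 ω k - q(1) sin 2k` and its perturbations by `o(exp (2 |Im k|))` have
exactly one zero, a simple one, near each of the approximate zeros `c_n` with `n` large, and no
other large zeros in the first quadrant.  The lower bound says that `2 ω k - q(1) sin 2k` expands
distances near `c_n` by a factor of order `n`. -/
theorem exists_zeros_near_logCentre (h : IsPhase q a κ e) (hω : omega q ≠ 0) (hq1 : q 1 ≠ 0) :
    ∃ r > 0, r ≤ 1 / 8 ∧
      (∀ᶠ n : ℕ in atTop, ∀ z z' : ℂ, ‖z‖ ≤ r → ‖z'‖ ≤ r →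
        2 * |omega q| * Real.pi * n * ‖z - z'‖ ≤
          ‖leadingFun q (logCentre a κ n + z) - leadingFun q (logCentre a κ n + z')‖) ∧
      ∀ F : ℂ → ℂ, Differentiable ℂ F →
        (∀ ε > 0, ∃ K : ℝ, 0 < K ∧ ∀ k : ℂ, K ≤ ‖k‖ →
          ‖F k - leadingFun q k‖ ≤ ε * Real.exp (2 * |k.im|)) →
        ∃ w : ℕ → ℂ, (∀ n, ‖w n‖ ≤ r) ∧
          (∀ᶠ n in atTop, F (logCentre a κ n + w n) = 0 ∧
            deriv F (logCentre a κ n + w n) ≠ 0) ∧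
          ∀ N, ∃ K, ∀ k : ℂ, K ≤ ‖k‖ → 0 ≤ k.re → 0 ≤ k.im → F k = 0 →
            ∃ n, N ≤ n ∧ k = logCentre a κ n + w n := by
  have hω' : 0 < |omega q| := abs_pos.2 hω
  have hωc : (omega q : ℂ) ≠ 0 := by exact_mod_cast hω
  have hpic : (Real.pi : ℂ) ≠ 0 := by exact_mod_cast Real.pi_ne_zero
  have hpi := Real.pi_pos
  have hG : Differentiable ℂ fun w : ℂ => 1 - Complex.exp (-(2 * Complex.I * w)) := by fun_prop
  -- The normalized functions are compared with `1 - exp (-2 i w)`.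
  have hG1 : deriv (fun w : ℂ => 1 - Complex.exp (-(2 * Complex.I * w))) 0 = 2 * Complex.I := by
    have h1 : HasDerivAt (fun w : ℂ => -(2 * Complex.I * w)) (-(2 * Complex.I)) 0 := by
      simpa using ((hasDerivAt_id (0 : ℂ)).const_mul (2 * Complex.I)).fun_neg
    simpa using (h1.cexp.const_sub 1).deriv
  obtain ⟨r₀, hr₀, hloc⟩ := exists_zero_of_close hG (by simp) (by rw [hG1]; simp)
  obtain ⟨r, hr⟩ : ∃ r, r = min r₀ (1 / 8) := ⟨_, rfl⟩
  have hrpos : 0 < r := hr ▸ lt_min hr₀ (by norm_num)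
  have hr8 : r ≤ 1 / 8 := hr ▸ min_le_right _ _
  obtain ⟨δ, hδ, hloc⟩ := hloc r hrpos (hr ▸ min_le_left _ _)
  have hnorm : ‖(2 : ℂ) * Complex.I‖ / 2 = 1 := by simp
  rw [hG1, hnorm] at hloc
  have key : ∀ F : ℂ → ℂ, Differentiable ℂ F →
      (∀ ε > 0, ∃ K : ℝ, 0 < K ∧ ∀ k : ℂ, K ≤ ‖k‖ →
        ‖F k - leadingFun q k‖ ≤ ε * Real.exp (2 * |k.im|)) →
      ∀ᶠ n : ℕ in atTop, (∃ w, ‖w‖ < r ∧ F (logCentre a κ n + w) = 0 ∧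
          deriv F (logCentre a κ n + w) ≠ 0) ∧
        ∀ z z' : ℂ, ‖z‖ ≤ r → ‖z'‖ ≤ r → 2 * |omega q| * Real.pi * n * ‖z - z'‖ ≤
          ‖F (logCentre a κ n + z) - F (logCentre a κ n + z')‖ := by
    intro F hF hE
    filter_upwards [eventually_norm_div_sub_le h hω hE hδ, eventually_ge_atTop 1] with n hn hn1
    have hn' : (0:ℝ) < n := by exact_mod_cast hn1
    have hnc : (n : ℂ) ≠ 0 := by exact_mod_cast hn'.ne'
    have hA : 2 * (omega q : ℂ) * Real.pi * n ≠ 0 := by simp [hωc, hnc, hpi.ne']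
    have hAn : ‖2 * (omega q : ℂ) * Real.pi * n‖ = 2 * |omega q| * Real.pi * n := by
      rw [norm_mul, norm_mul, norm_mul, Complex.norm_two, Complex.norm_real, Complex.norm_real,
        Complex.norm_natCast, Real.norm_eq_abs, Real.norm_of_nonneg hpi.le]
    obtain ⟨⟨w, hw, hw0, hw1⟩, hbil⟩ := hloc
      (fun w => F (logCentre a κ n + w) / (2 * (omega q : ℂ) * Real.pi * n))
      ((hF.comp (differentiable_id.const_add _)).div_const _)
      (fun w hw => hn w (hw.trans (by linarith)))
    refine ⟨⟨w, hw, (div_eq_zero_iff.1 hw0).resolve_right hA, fun h0 => hw1 ?_⟩,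
      fun z z' hz hz' => ?_⟩
    · have := ((hF _).hasDerivAt.comp_const_add (logCentre a κ n) w).div_const
        (2 * (omega q : ℂ) * Real.pi * n)
      rw [this.deriv, h0, zero_div]
    · have := hbil z z' hz hz'
      rw [← sub_div, norm_div, hAn, one_mul, le_div_iff₀ (by positivity)] at this
      linarith
  refine ⟨r, hrpos, hr8, (key _ (differentiable_leadingFun q) fun ε hε =>
    ⟨1, one_pos, fun k _ => by rw [sub_self, norm_zero]; positivity⟩).mono fun n hn => hn.2,
    fun F hF hE => ?_⟩
  obtain ⟨N₀, hN₀⟩ := eventually_atTop.1 (key F hF hE)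
  choose! w hw hw0 hw1 using fun n (hn : N₀ ≤ n) => (hN₀ n hn).1
  refine ⟨fun n => if N₀ ≤ n then w n else 0, fun n => ?_, ?_, fun N => ?_⟩
  · simp only
    split_ifs with hn
    · exact (hw n hn).le
    · simpa using hrpos.le
  · filter_upwards [eventually_ge_atTop N₀] with n hn
    simp only [if_pos hn]
    exact ⟨hw0 n hn, hw1 n hn⟩
  · obtain ⟨δ₁, hδ₁, K₁, hK₁, hnear⟩ := exists_near_logCentre h hω hq1 hrpos
    obtain ⟨K₂, hK₂, hE₂⟩ := hE δ₁ hδ₁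
    refine ⟨max (max K₁ K₂) (∑ n ∈ Finset.range (max N₀ N + 1), ‖logCentre a κ n‖ + 1),
      fun k hk hre him hk0 => ?_⟩
    have h1 := hE₂ k ((le_max_right _ _).trans ((le_max_left _ _).trans hk))
    rw [hk0, zero_sub, norm_neg, abs_of_nonneg him] at h1
    obtain ⟨n, hn1, hn⟩ := hnear k ((le_max_left _ _).trans ((le_max_left _ _).trans hk)) hre him
      (h1.trans (mul_le_mul_of_nonneg_left (by linarith [norm_nonneg k]) hδ₁.le))
    have hnN : max N₀ N ≤ n := by
      by_contra hlt
      have h2 : ‖logCentre a κ n‖ ≤ ∑ n ∈ Finset.range (max N₀ N + 1), ‖logCentre a κ n‖ :=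
        Finset.single_le_sum (f := fun n => ‖logCentre a κ n‖) (fun i _ => norm_nonneg _)
          (Finset.mem_range.2 (by omega))
      have h3 := (le_max_right _ _).trans hk
      have h4 := norm_sub_norm_le k (logCentre a κ n)
      linarith
    have hnN₀ := (le_max_left _ _).trans hnN
    refine ⟨n, (le_max_right _ _).trans hnN, ?_⟩
    simp only [if_pos hnN₀]
    have h5 := (hN₀ n hnN₀).2 (k - logCentre a κ n) (w n) hn (hw n hnN₀).le
    rw [add_sub_cancel, hk0, hw0 n hnN₀, sub_zero, norm_zero] at h5
    have hn' : (0:ℝ) < n := by exact_mod_cast hn1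
    have h6 : ‖k - logCentre a κ n - w n‖ = 0 := by
      refine le_antisymm ?_ (norm_nonneg _)
      by_contra h7
      push Not at h7
      have : 0 < 2 * |omega q| * Real.pi * n * ‖k - logCentre a κ n - w n‖ := by positivity
      linarith
    linear_combination norm_eq_zero.1 h6

end ZerosNearCentres

/-! ### Displacements of the zeros of the leading part -/

section Displacements

variable {q : ℝ → ℝ} {a κ : ℝ} {e : ℕ}

/-- The logarithm varies slowly enough for a Bessel sequence; if `n` or `m` is `0`, the value
`Real.log 0 = 0` is used. -/
theorem abs_log_natCast_sub_le (n m : ℕ) :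
    |Real.log n - Real.log m| ≤ 2 * Real.sqrt (Nat.dist n m) := by
  wlog hmn : m ≤ n generalizing n m
  · have := this m n (by omega)
    rwa [abs_sub_comm, Nat.dist_comm] at this
  have hnonneg : 0 ≤ Real.log n - Real.log m := by
    rcases Nat.eq_zero_or_pos m with rfl | hm
    · simpa using Real.log_natCast_nonneg n
    · exact sub_nonneg.2 (Real.log_le_log (by exact_mod_cast hm) (by exact_mod_cast hmn))
  have hs := Real.sqrt_nonneg (Nat.dist n m : ℝ)
  have hss : Real.sqrt (Nat.dist n m) ^ 2 = (n : ℝ) - m := by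
    rw [Real.sq_sqrt (Nat.cast_nonneg _), Nat.dist_eq_sub_of_le_right hmn, Nat.cast_sub hmn]
  set s := Real.sqrt (Nat.dist n m) with hsdef
  have h1 : Real.log n ≤ Real.log m + Real.log ((1 + s) ^ 2) := by
    rcases Nat.eq_zero_or_pos m with rfl | hm
    · rcases Nat.eq_zero_or_pos n with rfl | hn
      · simpa using Real.log_nonneg (by nlinarith : (1:ℝ) ≤ (1 + s) ^ 2)
      · rw [Nat.cast_zero, Real.log_zero, zero_add]
        refine Real.log_le_log (by exact_mod_cast hn) ?_
        rw [Nat.cast_zero, sub_zero] at hss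
        nlinarith
    · have hm' : (1:ℝ) ≤ m := by exact_mod_cast hm
      rw [← Real.log_mul (by positivity) (by positivity)]
      refine Real.log_le_log (by exact_mod_cast lt_of_lt_of_le hm hmn) ?_
      nlinarith [mul_nonneg (sub_nonneg.2 hm') (sq_nonneg s)]
  rw [Real.log_pow] at h1
  have h2 := Real.log_le_sub_one_of_pos (by positivity : 0 < 1 + s)
  rw [abs_of_nonneg hnonneg]
  push_cast at h1
  linarith

/-- The logarithmic growth of the imaginary parts is slow enough. -/
theorem isBesselSequence_logCentre_add (h : IsPhase q a κ e) {w : ℕ → ℂ}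
    (hw : ∀ n, ‖w n‖ ≤ 1 / 8) : IsBesselSequence fun n => logCentre a κ n + w n := by
  have hpi := Real.pi_gt_three
  obtain ⟨ha1, ha2⟩ := h.a_mem
  have hw' : ∀ n, |(w n).im| ≤ 1 / 8 := fun n => (Complex.abs_im_le_norm _).trans (hw n)
  have habs := abs_nonneg (Real.log (κ * Real.pi))
  refine isBesselSequence_of_near (x := fun n => ((n : ℝ) + a) * Real.pi) (b := Real.pi)
    (r := 1 / 8) (C := |Real.log (κ * Real.pi)| + 2) (by linarith) (by norm_num) (fun n => ?_)
    (fun n m => by ring) (by norm_num; nlinarith) (fun n => ?_) (fun n m hnm => ?_)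
  · rw [Complex.add_re, logCentre_re, add_sub_cancel_left]
    exact (Complex.abs_re_le_norm _).trans (hw n)
  · rw [Complex.add_im, logCentre_im, logHeight]
    have h1 := (abs_le.1 (hw' n)).1
    have h2 := neg_abs_le (Real.log (κ * Real.pi))
    have h3 := Real.log_natCast_nonneg n
    linarith
  · have h1 : (1:ℝ) ≤ Nat.dist n m := by
      have : Nat.dist n m ≠ 0 := fun h0 => hnm (Nat.eq_of_dist_eq_zero h0)
      exact_mod_cast Nat.one_le_iff_ne_zero.2 this
    have h2 : 1 ≤ Real.sqrt (Nat.dist n m) := Real.one_le_sqrt.2 h1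
    have h3 : (logCentre a κ n + w n).im - (logCentre a κ m + w m).im =
        1 / 2 * (Real.log n - Real.log m) + ((w n).im - (w m).im) := by
      rw [Complex.add_im, Complex.add_im, logCentre_im, logCentre_im, logHeight, logHeight]
      ring
    have h4 : |1 / 2 * (Real.log n - Real.log m)| ≤ Real.sqrt (Nat.dist n m) := by
      rw [abs_mul, abs_of_pos (by norm_num : (0:ℝ) < 1 / 2)]
      linarith [abs_log_natCast_sub_le n m]
    rw [h3]
    refine (abs_add_le _ _).trans ?_
    have h5 := abs_sub (w n).im (w m).im
    nlinarith [hw' n, hw' m]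

theorem memL2Seq_abs_logHeight_add_div (C : ℝ) :
    MemL2Seq fun n => (((|logHeight κ n| + C) / n : ℝ) : ℂ) := by
  have h1 : MemL2Seq fun n => (((n : ℝ) ^ (-(3 / 4) : ℝ) : ℝ) : ℂ) := by
    have : Summable fun n : ℕ => (n : ℝ) ^ (-(3 / 2) : ℝ) :=
      Real.summable_nat_rpow.2 (by norm_num)
    refine this.congr fun n => ?_
    rw [Complex.norm_real, Real.norm_of_nonneg (by positivity), ← Real.rpow_natCast,
      ← Real.rpow_mul (Nat.cast_nonneg n)]
    norm_num
  refine h1.of_eventually_le (|Real.log (κ * Real.pi)| + |C| + 1) ?_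
  have h2 : ∀ᶠ n : ℕ in atTop, ‖Real.log n‖ ≤ 1 * ‖(n : ℝ) ^ (1 / 4 : ℝ)‖ :=
    tendsto_natCast_atTop_atTop.eventually
      ((isLittleO_log_rpow_atTop (by norm_num : (0:ℝ) < 1 / 4)).def one_pos)
  filter_upwards [h2, eventually_ge_atTop 1] with n hn hn1
  have hn' : (1:ℝ) ≤ n := by exact_mod_cast hn1
  have hn0 : (0:ℝ) < n := by linarith
  have h3 : (1:ℝ) ≤ (n : ℝ) ^ (1 / 4 : ℝ) := Real.one_le_rpow hn' (by norm_num)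
  have h4 : (n : ℝ) ^ (-(3 / 4) : ℝ) = (n : ℝ) ^ (1 / 4 : ℝ) / n := by
    rw [← Real.rpow_sub_one hn0.ne']
    norm_num
  rw [Complex.norm_real, Complex.norm_real, Real.norm_of_nonneg (Real.rpow_nonneg hn0.le _), h4,
    norm_div, Real.norm_of_nonneg hn0.le, ← mul_div_assoc]
  refine div_le_div_of_nonneg_right ?_ hn0.le
  rw [one_mul, Real.norm_of_nonneg (Real.rpow_nonneg hn0.le _), Real.norm_eq_abs] at hn
  rw [Real.norm_eq_abs, logHeight]
  refine (abs_add_le _ _).trans ?_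
  rw [abs_abs]
  have h5 := abs_add_le (Real.log (κ * Real.pi)) (Real.log n)
  nlinarith [mul_le_mul_of_nonneg_left h3 (abs_nonneg (Real.log (κ * Real.pi))),
    mul_le_mul_of_nonneg_left h3 (abs_nonneg C)]

theorem norm_two_mul_omega_mul_pi_mul (n : ℕ) :
    ‖2 * (omega q : ℂ) * Real.pi * n‖ = 2 * |omega q| * Real.pi * n := by
  rw [norm_mul, norm_mul, norm_mul, Complex.norm_two, Complex.norm_real, Complex.norm_real,
    Complex.norm_natCast, Real.norm_eq_abs, Real.norm_of_nonneg Real.pi_pos.le]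

/-- The zeros of `2 ω k - q(1) sin 2k` are within `O(log n / n)` of the approximate zeros. -/
theorem eventually_norm_displacement_le (h : IsPhase q a κ e) (hω : omega q ≠ 0) {r : ℝ}
    (hr : 0 < r) (hbil : ∀ᶠ n : ℕ in atTop, ∀ z z' : ℂ, ‖z‖ ≤ r → ‖z'‖ ≤ r →
      2 * |omega q| * Real.pi * n * ‖z - z'‖ ≤
        ‖leadingFun q (logCentre a κ n + z) - leadingFun q (logCentre a κ n + z')‖)
    {v : ℕ → ℂ} (hv : ∀ n, ‖v n‖ ≤ r)
    (hv0 : ∀ᶠ n in atTop, leadingFun q (logCentre a κ n + v n) = 0) :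
    ∀ᶠ n in atTop, ‖v n‖ ≤ (|logHeight κ n| + 2) / n := by
  have hpi := Real.pi_gt_three
  have hκ := h.kappa_pos
  have hω' : 0 < |omega q| := abs_pos.2 hω
  filter_upwards [hbil, hv0, eventually_ge_atTop 1,
    tendsto_natCast_atTop_atTop.eventually_ge_atTop (1 / κ ^ 2)] with n hbil hv0 hn hnκ
  have hn' : (0:ℝ) < n := by exact_mod_cast hn
  have h1 := hbil (v n) 0 (hv n) (by simpa using hr.le)
  rw [hv0, sub_zero, zero_sub, norm_neg, add_zero] at h1
  have h2 := norm_leadingFun_div_sub_le h hω hn 0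
  have h3 := norm_logCentre_add_div_sub_one_le h hn (w := 0) (by simp)
  simp only [add_zero, mul_zero, neg_zero, Complex.exp_zero, norm_zero, Real.exp_zero] at h2 h3
  have h4 : 1 / (κ * Real.pi * n) ^ 2 ≤ 1 / n := by
    refine div_le_div_of_nonneg_left zero_le_one hn' ?_
    rw [div_le_iff₀ (by positivity)] at hnκ
    have h5 : (κ * Real.pi * n) ^ 2 = (n * κ ^ 2) * (Real.pi ^ 2 * n) := by ring
    rw [h5]
    have h6 : 1 ≤ Real.pi ^ 2 := by nlinarith
    calc (n : ℝ) ≤ 1 * (1 * n) := by rw [one_mul, one_mul]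
      _ ≤ n * κ ^ 2 * (Real.pi ^ 2 * n) := by gcongr
  have h5 := norm_le_norm_sub_add (leadingFun q (logCentre a κ n) /
    (2 * (omega q : ℂ) * Real.pi * n)) (logCentre a κ n / (Real.pi * n) - 1)
  have h6 : ‖v n‖ ≤ ‖leadingFun q (logCentre a κ n) / (2 * (omega q : ℂ) * Real.pi * n)‖ := by
    rw [norm_div, norm_two_mul_omega_mul_pi_mul, le_div_iff₀ (by positivity)]
    linarith
  have h7 : (|logHeight κ n| + 2) / n = 1 / n + (|logHeight κ n| + 1) / n := by ring
  linarith

/-- The equation for a zero `c_n + v` of the leading part, to first order in `v`, is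
`2 i v = -((a π + (i / 2) log (κ n π)) / (n π))`, which yields the terms of order `log n / n` and
`1 / n` in the asymptotics. -/
theorem hasZeroAsymptotics_logCentre_add (h : IsPhase q a κ e) (hω : omega q ≠ 0) {c : ℝ}
    (hc : 0 < c) (hcκ : κ = 2 / c) {v : ℕ → ℂ} (hv : ∀ n, ‖v n‖ ≤ 1 / 8)
    (hv0 : ∀ᶠ n in atTop, leadingFun q (logCentre a κ n + v n) = 0)
    (hvb : ∀ᶠ n in atTop, ‖v n‖ ≤ (|logHeight κ n| + 2) / n) :
    HasZeroAsymptotics a c fun n => logCentre a κ n + v n := by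
  have hpi := Real.pi_gt_three
  have hpic : (Real.pi : ℂ) ≠ 0 := by exact_mod_cast Real.pi_ne_zero
  have hκ := h.kappa_pos
  set B := (5 + 3 / (κ * Real.pi) ^ 2) * (|Real.log (κ * Real.pi)| + 3) ^ 2 with hB
  -- `T n` is the solution of the equation linearized at `c_n`.
  set T : ℕ → ℂ := fun n => Complex.I / 2 * (((a * Real.pi : ℝ) +
    Complex.I * (logHeight κ n / 2 : ℝ)) / (Real.pi * n : ℝ)) with hT
  have hTre : ∀ n, (T n).re = -(logHeight κ n / (4 * n * Real.pi)) := fun n => by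
    have : T n = ((-(logHeight κ n / (4 * n * Real.pi)) : ℝ) : ℂ) +
        ((a * Real.pi / 2 / (Real.pi * n) : ℝ) : ℂ) * Complex.I := by
      rw [hT]
      push_cast
      linear_combination (logHeight κ n / 4 / (Real.pi * n) : ℂ) * Complex.I_sq
    rw [this]
    simp only [Complex.add_re, Complex.ofReal_re, Complex.re_ofReal_mul, Complex.I_re, mul_zero,
      add_zero]
  have hTim : ∀ n, (T n).im = a * Real.pi / 2 / (Real.pi * n) := fun n => by
    have : T n = ((-(logHeight κ n / (4 * n * Real.pi)) : ℝ) : ℂ) +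
        ((a * Real.pi / 2 / (Real.pi * n) : ℝ) : ℂ) * Complex.I := by
      rw [hT]
      push_cast
      linear_combination (logHeight κ n / 4 / (Real.pi * n) : ℂ) * Complex.I_sq
    rw [this]
    simp only [Complex.add_im, Complex.ofReal_im, Complex.im_ofReal_mul, Complex.I_im, mul_one,
      zero_add]
  have key : ∀ᶠ n in atTop, ‖v n - T n‖ ≤ B * (Real.log n ^ 2 / (n : ℝ) ^ 2) := by
    filter_upwards [hv0, hvb, eventually_ge_atTop 1, (Real.tendsto_log_atTop.comp
      tendsto_natCast_atTop_atTop).eventually_ge_atTop 1] with n hv0 hvb hn hlog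
    have hlog : 1 ≤ Real.log n := hlog
    have hn' : (0:ℝ) < n := by exact_mod_cast hn
    have hn1 : (1:ℝ) ≤ n := by exact_mod_cast hn
    have hnc : (n : ℂ) ≠ 0 := by exact_mod_cast hn'.ne'
    set ℓ := |logHeight κ n| + 2 with hℓ
    have hℓ2 : 2 ≤ ℓ := by linarith [abs_nonneg (logHeight κ n)]
    have hℓB : ℓ ≤ (|Real.log (κ * Real.pi)| + 3) * Real.log n := by
      have h1 := abs_add_le (Real.log (κ * Real.pi)) (Real.log n)
      rw [abs_of_nonneg (by linarith : 0 ≤ Real.log n)] at h1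
      rw [hℓ, logHeight]
      nlinarith [mul_le_mul_of_nonneg_left hlog (abs_nonneg (Real.log (κ * Real.pi)))]
    have hx : ‖-(2 * Complex.I * v n)‖ = 2 * ‖v n‖ := by
      rw [norm_neg, norm_mul, norm_mul, Complex.norm_two, Complex.norm_I, mul_one]
    have h1 := Complex.norm_exp_sub_one_sub_id_le (x := -(2 * Complex.I * v n))
      (by rw [hx]; linarith [hv n])
    rw [hx] at h1
    have h2 := norm_leadingFun_div_sub_le h hω hn (v n)
    rw [hv0, zero_div, zero_sub, norm_neg] at h2
    have h3 : v n - T n = Complex.I / 2 *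
        (-(Complex.exp (-(2 * Complex.I * v n)) - 1 - -(2 * Complex.I * v n)) -
        ((logCentre a κ n + v n) / (Real.pi * n) - Complex.exp (-(2 * Complex.I * v n))) +
          v n / (Real.pi * n)) := by
      rw [hT, logCentre]
      generalize Complex.exp (-(2 * Complex.I * v n)) = X
      push_cast
      have : (((n : ℂ) + a) * Real.pi + Complex.I * (logHeight κ n / 2) + v n) / (Real.pi * n) =
          1 + (a * Real.pi + Complex.I * (logHeight κ n / 2)) / (Real.pi * n) +
            v n / (Real.pi * n) := by
        field_simp
        ring
      rw [this]
      linear_combination v n * Complex.I_sq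
    have h4 : Real.exp (2 * ‖v n‖) / (κ * Real.pi * n) ^ 2 ≤
        3 / (κ * Real.pi) ^ 2 * (ℓ ^ 2 / n ^ 2) := by
      rw [div_mul_div_comm, mul_pow _ (n : ℝ)]
      refine div_le_div_of_nonneg_right ?_ (by positivity)
      have h5 : Real.exp (2 * ‖v n‖) ≤ Real.exp 1 := Real.exp_le_exp.2 (by linarith [hv n])
      have h6 := Real.exp_one_lt_three
      nlinarith
    have h5 : ‖v n / (Real.pi * n)‖ ≤ ℓ ^ 2 / n ^ 2 := by
      rw [norm_div, norm_mul, Complex.norm_real, Complex.norm_natCast,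
        Real.norm_of_nonneg (by linarith), div_le_div_iff₀ (by positivity) (by positivity)]
      rw [le_div_iff₀ hn'] at hvb
      have : ‖v n‖ * n * n ≤ ℓ * n := mul_le_mul_of_nonneg_right hvb hn'.le
      have h6 : ℓ * n ≤ ℓ ^ 2 * (Real.pi * n) := by
        have : ℓ ≤ ℓ ^ 2 * Real.pi := by nlinarith
        nlinarith
      nlinarith
    have h6 : (2 * ‖v n‖) ^ 2 ≤ 4 * (ℓ ^ 2 / n ^ 2) := by
      rw [mul_pow, ← div_pow]
      have := pow_le_pow_left₀ (norm_nonneg _) hvb 2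
      linarith
    have h7 : ‖v n - T n‖ ≤ 1 / 2 * ((5 + 3 / (κ * Real.pi) ^ 2) * (ℓ ^ 2 / n ^ 2)) := by
      rw [h3, norm_mul, norm_div, Complex.norm_I, Complex.norm_two]
      refine mul_le_mul_of_nonneg_left ?_ (by norm_num)
      refine (norm_add_le _ _).trans ((add_le_add (norm_sub_le _ _) le_rfl).trans ?_)
      rw [norm_neg]
      linarith
    refine h7.trans ?_
    have h8 : ℓ ^ 2 / (n : ℝ) ^ 2 ≤
        (|Real.log (κ * Real.pi)| + 3) ^ 2 * (Real.log n ^ 2 / (n : ℝ) ^ 2) := by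
      rw [← mul_div_assoc, ← mul_pow]
      exact div_le_div_of_nonneg_right (pow_le_pow_left₀ (by linarith) hℓB 2) (by positivity)
    have h9 : 0 ≤ ℓ ^ 2 / (n : ℝ) ^ 2 := by positivity
    have h10 : (0:ℝ) < 5 + 3 / (κ * Real.pi) ^ 2 := by positivity
    rw [hB]
    nlinarith [mul_le_mul_of_nonneg_left h8 h10.le, mul_nonneg h10.le h9]
  have hL : ∀ n : ℕ, 1 ≤ n → Real.log (2 * n * Real.pi) - Real.log c = logHeight κ n := by
    intro n hn
    have hn' : (0:ℝ) < n := by exact_mod_cast hn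
    rw [logHeight, hcκ, ← Real.log_div (by positivity) hc.ne', ← Real.log_mul (by positivity)
      hn'.ne']
    congr 1
    field_simp
  constructor
  · refine IsBigO.of_bound B ?_
    filter_upwards [key, eventually_ge_atTop 1] with n hn hn1
    rw [hL n hn1, Real.norm_of_nonneg (by positivity : 0 ≤ Real.log n ^ 2 / (n : ℝ) ^ 2)]
    refine le_trans ?_ hn
    have h1 : (logCentre a κ n + v n).re - (((n : ℝ) + a) * Real.pi -
        logHeight κ n / (4 * n * Real.pi)) = (v n - T n).re := by
      rw [Complex.add_re, logCentre_re, Complex.sub_re, hTre]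
      ring
    rw [h1]
    exact Complex.abs_re_le_norm _
  · refine IsBigO.of_bound B ?_
    filter_upwards [key, eventually_ge_atTop 1] with n hn hn1
    have hn' : (n : ℝ) ≠ 0 := by exact_mod_cast (by omega : n ≠ 0)
    rw [hL n hn1, Real.norm_of_nonneg (by positivity : 0 ≤ Real.log n ^ 2 / (n : ℝ) ^ 2)]
    refine le_trans ?_ hn
    have h1 : (logCentre a κ n + v n).im - 1 / 2 * (logHeight κ n + a / n) = (v n - T n).im := by
      rw [Complex.add_im, logCentre_im, Complex.sub_im, hTim]
      field_simp
      ring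
    rw [h1]
    exact Complex.abs_im_le_norm _

theorem isLeadingZeroSequence_logCentre_add (h : IsPhase q a κ e) {v : ℕ → ℂ}
    (hv : ∀ n, ‖v n‖ ≤ 1 / 8)
    (hv0 : ∀ᶠ n in atTop, leadingFun q (logCentre a κ n + v n) = 0 ∧
      deriv (leadingFun q) (logCentre a κ n + v n) ≠ 0)
    {K : ℝ} (hK : ∀ k : ℂ, K ≤ ‖k‖ → 0 ≤ k.re → 0 ≤ k.im → leadingFun q k = 0 →
      ∃ n, k = logCentre a κ n + v n) :
    IsLeadingZeroSequence q fun n => logCentre a κ n + v n := by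
  have hpi := Real.pi_gt_three
  obtain ⟨ha1, ha2⟩ := h.a_mem
  constructor
  · filter_upwards [hv0, (tendsto_logHeight_atTop (κ := κ)).eventually_ge_atTop 1] with n hn hL
    refine ⟨?_, ?_, hn.1⟩
    · rw [Complex.add_re, logCentre_re]
      have := (abs_le.1 ((Complex.abs_re_le_norm _).trans (hv n))).1
      nlinarith [Nat.cast_nonneg (α := ℝ) n]
    · rw [Complex.add_im, logCentre_im]
      have := (abs_le.1 ((Complex.abs_im_le_norm _).trans (hv n))).1
      linarith
  · obtain ⟨n, -, hn⟩ := hv0.exists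
    obtain ⟨z₀, hz₀⟩ : ∃ z, leadingFun q z ≠ 0 := by
      by_contra hall
      push Not at hall
      have : leadingFun q = fun _ => 0 := funext hall
      exact hn (by rw [this]; simp)
    refine finite_zeros_of_bounded (differentiable_leadingFun q) hz₀ (fun z hz => hz.1.2.2)
      (K := K) fun z hz => ?_
    by_contra hlt
    obtain ⟨n, hn⟩ := hK z (not_le.1 hlt).le hz.1.1.le hz.1.2.1.le hz.1.2.2
    exact hz.2 ⟨n, hn.symm⟩

end Displacements

/-! ### Comparison with the zeros of the leading part -/

section Comparison

variable {q : ℝ → ℝ} {a κ : ℝ} {e : ℕ}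

theorem norm_cos_bounds {z : ℂ} (hz : 2 ≤ Real.exp z.im) :
    Real.exp z.im / 4 ≤ ‖Complex.cos z‖ ∧ ‖Complex.cos z‖ ≤ Real.exp z.im ∧
      ‖Complex.sin z‖ ≤ Real.exp z.im := by
  have h1 : ‖Complex.exp (z * Complex.I)‖ = (Real.exp z.im)⁻¹ := by
    rw [Complex.norm_exp, ← Real.exp_neg]
    simp
  have h2 : ‖Complex.exp (-z * Complex.I)‖ = Real.exp z.im := by
    rw [Complex.norm_exp]
    simp
  have h3 : (Real.exp z.im)⁻¹ ≤ 2⁻¹ := inv_anti₀ two_pos hz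
  refine ⟨?_, ?_, ?_⟩
  · rw [Complex.cos, norm_div, Complex.norm_two]
    have := norm_sub_le_norm_add (Complex.exp (-z * Complex.I)) (Complex.exp (z * Complex.I))
    rw [add_comm, h1, h2] at this
    linarith
  · rw [Complex.cos, norm_div, Complex.norm_two]
    have := norm_add_le (Complex.exp (z * Complex.I)) (Complex.exp (-z * Complex.I))
    rw [h1, h2] at this
    linarith
  · rw [Complex.sin, norm_div, Complex.norm_two, norm_mul, Complex.norm_I, mul_one]
    have := norm_sub_le (Complex.exp (-z * Complex.I)) (Complex.exp (z * Complex.I))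
    rw [h1, h2] at this
    linarith

theorem exp_two_im_bounds (hκ : 0 < κ) {n : ℕ} (hn : 1 ≤ n) {w : ℂ} (hw : ‖w‖ ≤ 1 / 8) :
    κ * n ≤ Real.exp (2 * (logCentre a κ n + w).im) ∧
      Real.exp (2 * (logCentre a κ n + w).im) ≤ 12 * κ * n := by
  have hpi := Real.pi_gt_three
  have hpi4 := Real.pi_lt_four
  have hn' : (0:ℝ) < n := by exact_mod_cast hn
  have him := abs_le.1 ((Complex.abs_im_le_norm w).trans hw)
  rw [exp_two_im_logCentre_add hκ hn]
  have h1 : Real.exp (2 * w.im) ≤ 3 :=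
    (Real.exp_le_exp.2 (by linarith)).trans Real.exp_one_lt_three.le
  have h2 : 1 / 2 ≤ Real.exp (2 * w.im) := by
    have := Real.add_one_le_exp (2 * w.im)
    linarith
  have h3 : 0 < κ * n := by positivity
  constructor
  · have : 1 ≤ Real.pi * Real.exp (2 * w.im) := by nlinarith
    nlinarith [mul_le_mul_of_nonneg_left this h3.le]
  · have : Real.pi * Real.exp (2 * w.im) ≤ 12 := by nlinarith
    nlinarith [mul_le_mul_of_nonneg_left this h3.le]

section Data

variable {r : ℝ} {w v : ℕ → ℂ}

/-- The distance between a zero of `4 k³ Δ(k²)` and the corresponding zero of its leading part is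
controlled by the remainder. -/
theorem eventually_mul_norm_sub_le
    (hbil : ∀ᶠ n : ℕ in atTop, ∀ z z' : ℂ, ‖z‖ ≤ r → ‖z'‖ ≤ r →
      2 * |omega q| * Real.pi * n * ‖z - z'‖ ≤
        ‖leadingFun q (logCentre a κ n + z) - leadingFun q (logCentre a κ n + z')‖)
    (hw : ∀ n, ‖w n‖ ≤ r) (hv : ∀ n, ‖v n‖ ≤ r)
    (hw0 : ∀ᶠ n in atTop, scaledCharFun q (logCentre a κ n + w n) = 0)
    (hv0 : ∀ᶠ n in atTop, leadingFun q (logCentre a κ n + v n) = 0) :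
    ∀ᶠ n : ℕ in atTop, 2 * |omega q| * Real.pi * n * ‖w n - v n‖ ≤
      ‖scaledCharFun q (logCentre a κ n + w n) - leadingFun q (logCentre a κ n + w n)‖ := by
  filter_upwards [hbil, hw0, hv0] with n hbil hw0 hv0
  have := hbil (w n) (v n) (hw n) (hv n)
  rw [hw0, zero_sub, norm_neg]
  rwa [hv0, sub_zero] at this

theorem memL2Seq_sub (h : IsPhase q a κ e) (hq : MemW21 q) (hω : omega q ≠ 0)
    (hw8 : ∀ n, ‖w n‖ ≤ 1 / 8)
    (hd : ∀ᶠ n : ℕ in atTop, 2 * |omega q| * Real.pi * n * ‖w n - v n‖ ≤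
      ‖scaledCharFun q (logCentre a κ n + w n) - leadingFun q (logCentre a κ n + w n)‖) :
    MemL2Seq fun n => w n - v n := by
  have hpi := Real.pi_gt_three
  have hκ := h.kappa_pos
  have hω' : 0 < |omega q| := abs_pos.2 hω
  refine (memL2Seq_remainder hq (isBesselSequence_logCentre_add h hw8)).of_eventually_le
    (12 * κ / (2 * |omega q| * Real.pi)) ?_
  filter_upwards [hd, eventually_ge_atTop 1] with n hn hn1
  have hn' : (0:ℝ) < n := by exact_mod_cast hn1
  obtain ⟨-, hX⟩ := exp_two_im_bounds (a := a) hκ hn1 (hw8 n)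
  set E := scaledCharFun q (logCentre a κ n + w n) - leadingFun q (logCentre a κ n + w n)
  rw [norm_mul, Complex.norm_real, Real.norm_eq_abs, Real.abs_exp, neg_mul, Real.exp_neg,
    div_mul_eq_mul_div, le_div_iff₀ (by positivity)]
  set X := Real.exp (2 * (logCentre a κ n + w n).im) with hXdef
  have hX0 : 0 < X := Real.exp_pos _
  have h1 : ‖E‖ ≤ n * (12 * κ * (X⁻¹ * ‖E‖)) := by
    have : n * (12 * κ * (X⁻¹ * ‖E‖)) = (12 * κ * n) / X * ‖E‖ := by field_simp
    rw [this]
    exact le_mul_of_one_le_left (norm_nonneg _) ((one_le_div hX0).2 hX)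
  have h2 := hn.trans h1
  refine le_of_mul_le_mul_left ?_ hn'
  linarith

set_option maxHeartbeats 1000000 in
/-- Second order comparison of the zeros of `4 k³ Δ(k²)` and of its leading part. -/
theorem memL2Seq_second_order_of_omega_ne_zero (h : IsPhase q a κ e) (hq : MemW21 q)
    (hq2 : MemW22 q) (hω : omega q ≠ 0) (hq1 : q 1 ≠ 0)
    (hw8 : ∀ n, ‖w n‖ ≤ 1 / 8) (hv8 : ∀ n, ‖v n‖ ≤ 1 / 8)
    (hw0 : ∀ᶠ n in atTop, scaledCharFun q (logCentre a κ n + w n) = 0)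
    (hv0 : ∀ᶠ n in atTop, leadingFun q (logCentre a κ n + v n) = 0)
    (hd : ∀ᶠ n : ℕ in atTop, 2 * |omega q| * Real.pi * n * ‖w n - v n‖ ≤
      ‖scaledCharFun q (logCentre a κ n + w n) - leadingFun q (logCentre a κ n + w n)‖) :
    MemL2Seq fun n => n * (w n - v n) - (Q₃ q : ℂ) / (4 * (Real.pi : ℂ) * (q 1 : ℂ)) := by
  have hpi := Real.pi_gt_three
  have hκ := h.kappa_pos
  have hω' : 0 < |omega q| := abs_pos.2 hω
  have hq1' : 0 < |q 1| := abs_pos.2 hq1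
  have hq1c : (q 1 : ℂ) ≠ 0 := by exact_mod_cast hq1
  have hpic : (Real.pi : ℂ) ≠ 0 := by exact_mod_cast Real.pi_ne_zero
  obtain ⟨ha1, ha2⟩ := h.a_mem
  have hεL := memL2Seq_sub h hq hω hw8 hd
  obtain ⟨c₀, -, hE⟩ := exists_remainder_eq hq hq2
  obtain ⟨ρ, hρ, hEq⟩ := hE _ (isBesselSequence_logCentre_add h hw8)
  obtain ⟨Cρ, hCρ0, hCρ⟩ := hρ.exists_norm_le
  -- `M` bounds the remainder, hence `n` times the distance of the zeros.
  obtain ⟨M, hM⟩ : ∃ M, M = (12 * κ * |Q₃ q| + |c₀| + 12 * κ * Cρ) / (2 * |omega q| * Real.pi) :=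
    ⟨_, rfl⟩
  have hM0 : 0 ≤ M := by rw [hM]; positivity
  have hLL := memL2Seq_abs_logHeight_add_div (κ := κ) 1
  have h8 : MemL2Seq fun n => ((((|logHeight κ n| + 1) / n + 1 / ((n:ℝ) + 1) : ℝ)) : ℂ) := by
    simpa using hLL.add memL2Seq_one_div
  refine h8.of_eventually_le_add_add hρ hεL
    (|Q₃ q| / (4 * |q 1|) + 2 * |c₀| / (κ * |q 1|) + 12 / |q 1| +
      (4 * |omega q| / (κ * |q 1|) + 12 * M)) ?_
  filter_upwards [hw0, hv0, hd, eventually_ge_atTop 1,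
    tendsto_natCast_atTop_atTop.eventually_ge_atTop (2 / κ),
    (tendsto_logHeight_atTop (κ := κ)).eventually_ge_atTop 1] with n hw0 hv0 hd hn hnκ hL
  have hn' : (0:ℝ) < n := by exact_mod_cast hn
  have hn1 : (1:ℝ) ≤ n := by exact_mod_cast hn
  have hnc : (n : ℂ) ≠ 0 := by exact_mod_cast hn'.ne'
  obtain ⟨hX1, hX2⟩ := exp_two_im_bounds (a := a) hκ hn (hw8 n)
  have h1 := hEq n
  obtain ⟨k, hk⟩ : ∃ k, k = logCentre a κ n + w n := ⟨_, rfl⟩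
  obtain ⟨ε, hε⟩ : ∃ ε, ε = w n - v n := ⟨_, rfl⟩
  have hμ : logCentre a κ n + v n = k - ε := by rw [hk, hε]; ring
  have hk1 := norm_logCentre_add_div_sub_one_le h hn (w := w n) ((hw8 n).trans (by norm_num))
  have hρn := hCρ n
  have hε4 : ‖ε‖ ≤ 1 / 4 := by
    rw [hε]
    refine (norm_sub_le _ _).trans ?_
    linarith [hw8 n, hv8 n]
  rw [hμ] at hv0
  simp only [← hk, ← hε] at h1 hX1 hX2 hd hw0 hk1 hρn ⊢
  have hkn : (n : ℝ) ≤ ‖k‖ := by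
    refine le_trans ?_ ((le_abs_self _).trans (Complex.abs_re_le_norm _))
    rw [hk, Complex.add_re, logCentre_re]
    have := (abs_le.1 ((Complex.abs_re_le_norm _).trans (hw8 n))).1
    nlinarith
  have hk0' : 0 < ‖k‖ := lt_of_lt_of_le hn' hkn
  have hk0 : k ≠ 0 := norm_pos_iff.1 hk0'
  have him2 : (2 * k).im = 2 * k.im := by simp
  have hexp2 : 2 ≤ Real.exp (2 * k).im := by
    rw [him2]
    rw [div_le_iff₀ hκ] at hnκ
    linarith
  obtain ⟨hc1, hc2, hs2⟩ := norm_cos_bounds hexp2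
  rw [him2] at hc1 hc2 hs2
  set X := Real.exp (2 * k.im) with hX
  have hX0 : 0 < X := Real.exp_pos _
  have hρX : ‖ρ n‖ = X * ‖(Real.exp (-2 * k.im) : ℂ) * ρ n‖ := by
    rw [norm_mul, Complex.norm_real, Real.norm_eq_abs, Real.abs_exp, ← mul_assoc, hX,
      ← Real.exp_add]
    simp
  set R := ‖(Real.exp (-2 * k.im) : ℂ) * ρ n‖ with hR
  have hR0 : 0 ≤ R := norm_nonneg _
  rw [hw0, zero_sub, norm_neg] at hd
  rw [hw0, zero_sub] at h1
  have h2k : ‖(2 * k)⁻¹‖ = 1 / (2 * ‖k‖) := by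
    rw [norm_inv, norm_mul, Complex.norm_two, one_div]
  -- The distance of the zeros is `O(1/n)`.
  have hnε : n * ‖ε‖ ≤ M := by
    have h3 : ‖leadingFun q k‖ ≤ 12 * κ * |Q₃ q| + |c₀| + 12 * κ * Cρ := by
      have h4 : ‖leadingFun q k‖ =
          1 / (2 * ‖k‖) * ‖(Q₃ q : ℂ) * Complex.cos (2 * k) + c₀ + ρ n‖ := by
        rw [← norm_neg, h1, norm_mul, h2k]
      have h5 : ‖(Q₃ q : ℂ) * Complex.cos (2 * k) + c₀ + ρ n‖ ≤
          |Q₃ q| * (12 * κ * n) + |c₀| + 12 * κ * n * Cρ := by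
        refine norm_add₃_le.trans (add_le_add (add_le_add ?_ ?_) ?_)
        · rw [norm_mul, Complex.norm_real, Real.norm_eq_abs]
          exact mul_le_mul_of_nonneg_left (hc2.trans hX2) (abs_nonneg _)
        · rw [Complex.norm_real, Real.norm_eq_abs]
        · rw [hρX]
          exact mul_le_mul hX2 hρn hR0 (by positivity)
      rw [h4, one_div_mul_eq_div, div_le_iff₀ (by positivity)]
      refine h5.trans ?_
      have h6 : |Q₃ q| * (12 * κ * n) + |c₀| + 12 * κ * n * Cρ ≤
          (12 * κ * |Q₃ q| + |c₀| + 12 * κ * Cρ) * n := by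
        have := mul_le_mul_of_nonneg_left hn1 (abs_nonneg c₀)
        linarith
      refine h6.trans (mul_le_mul_of_nonneg_left (by linarith) (by positivity))
    rw [hM, le_div_iff₀ (by positivity)]
    linarith
  have hcos0 : Complex.cos (2 * k) ≠ 0 := norm_pos_iff.1 (lt_of_lt_of_le (by positivity) hc1)
  have h2ε : ‖2 * ε‖ = 2 * ‖ε‖ := by rw [norm_mul, Complex.norm_two]
  have hsε := norm_sin_sub_self_le (z := 2 * ε) (by rw [h2ε]; linarith)
  have hcε := norm_cos_sub_one_le (z := 2 * ε) (by rw [h2ε]; linarith)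
  rw [h2ε] at hsε hcε
  have hv1 : 2 * (omega q : ℂ) * (k - ε) - (q 1 : ℂ) * (Complex.sin (2 * k) *
      Complex.cos (2 * ε) - Complex.cos (2 * k) * Complex.sin (2 * ε)) = 0 := by
    rw [← Complex.sin_sub, ← hv0, leadingFun]
    ring_nf
  rw [leadingFun] at h1
  generalize hcs : Complex.cos (2 * k) = c at *
  generalize Complex.sin (2 * k) = s at *
  generalize Complex.cos (2 * ε) = cε at *
  generalize Complex.sin (2 * ε) = sε at *
  -- The difference of the two equations, solved for `n ε`; the divisor `cos 2k` is of order `n`.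
  have hmain : n * ε - (Q₃ q : ℂ) / (4 * (Real.pi : ℂ) * (q 1 : ℂ)) =
      -((Q₃ q : ℂ) / (4 * q 1)) * ((k / (Real.pi * n) - 1) * (n / k)) +
      (n / k) * ((c₀ + ρ n) / (4 * q 1 * c)) + (omega q : ℂ) / (q 1 * c) * (n * ε) +
      s / c * (n * (cε - 1)) / 2 - n * (sε - 2 * ε) / 2 := by
    have h5 : (2 * k)⁻¹ * (2 * k) = 1 := inv_mul_cancel₀ (by simpa using hk0)
    have hE' : k * (2 * ε * q 1 * c - 2 * (omega q : ℂ) * ε - (q 1 : ℂ) * s * (cε - 1) +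
        q 1 * c * (sε - 2 * ε)) = ((Q₃ q : ℂ) * c + c₀ + ρ n) / 2 := by
      linear_combination k * h1 + k * hv1 + ((Q₃ q : ℂ) * c + c₀ + ρ n) / 2 * h5
    have h6 : n * ε = (n * (Q₃ q : ℂ) / (4 * k * q 1)) +
        (n / k) * ((c₀ + ρ n) / (4 * q 1 * c)) + (omega q : ℂ) / (q 1 * c) * (n * ε) +
      s / c * (n * (cε - 1)) / 2 - n * (sε - 2 * ε) / 2 := by
      field_simp
      linear_combination 4 * hE'
    have h7 : n * (Q₃ q : ℂ) / (4 * k * q 1) - (Q₃ q : ℂ) / (4 * (Real.pi : ℂ) * (q 1 : ℂ)) =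
        -((Q₃ q : ℂ) / (4 * q 1)) * ((k / (Real.pi * n) - 1) * (n / k)) := by
      field_simp
      ring
    rw [← h7]
    linear_combination h6
  have hnk : ‖(n : ℂ) / k‖ ≤ 1 := by
    rw [norm_div, Complex.norm_natCast]
    exact (div_le_one hk0').2 hkn
  have hcκ : κ * n / 4 ≤ ‖c‖ := by linarith
  have hc0 : 0 < ‖c‖ := norm_pos_iff.2 hcos0
  have hsc : ‖s / c‖ ≤ 4 := by
    rw [norm_div, div_le_iff₀ hc0]
    linarith
  have hone : 1 / (n : ℝ) ≤ 2 * (1 / ((n : ℝ) + 1)) := by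
    rw [mul_one_div, div_le_div_iff₀ hn' (by positivity)]
    linarith
  have hε0 := norm_nonneg ε
  have hεM : n * ‖ε‖ * ‖ε‖ ≤ M * ‖ε‖ := mul_le_mul_of_nonneg_right hnε hε0
  set L := (|logHeight κ n| + 1) / n with hLdef
  have hL0 : 0 ≤ L := by positivity
  have hone0 : 0 ≤ 1 / ((n : ℝ) + 1) := by positivity
  -- The five terms of `hmain`.
  have t1 : ‖-((Q₃ q : ℂ) / (4 * q 1)) * ((k / (Real.pi * n) - 1) * (n / k))‖ ≤
      |Q₃ q| / (4 * |q 1|) * L := by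
    rw [norm_mul, norm_neg, norm_div, norm_mul, norm_mul, Complex.norm_real, Complex.norm_real,
      Complex.norm_ofNat, Real.norm_eq_abs, Real.norm_eq_abs]
    refine mul_le_mul_of_nonneg_left ?_ (by positivity)
    exact (mul_le_mul hk1 hnk (norm_nonneg _) hL0).trans (mul_one _).le
  have t2 : ‖(n / k) * ((c₀ + ρ n) / (4 * q 1 * c))‖ ≤
      2 * |c₀| / (κ * |q 1|) * (1 / ((n : ℝ) + 1)) + 12 / |q 1| * R := by
    rw [norm_mul, norm_div _ (4 * (q 1 : ℂ) * c), norm_mul, norm_mul, Complex.norm_real,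
      Complex.norm_ofNat, Real.norm_eq_abs]
    refine (mul_le_of_le_one_left (by positivity) hnk).trans ?_
    have h3 : ‖(c₀ : ℂ) + ρ n‖ ≤ |c₀| + X * R := by
      refine (norm_add_le _ _).trans ?_
      rw [Complex.norm_real, Real.norm_eq_abs, hρX]
    have h4 : |c₀| / (4 * |q 1| * ‖c‖) ≤ 2 * |c₀| / (κ * |q 1|) * (1 / ((n : ℝ) + 1)) := by
      calc |c₀| / (4 * |q 1| * ‖c‖) ≤ |c₀| / (4 * |q 1| * (κ * n / 4)) := by gcongr
        _ = |c₀| / (κ * |q 1|) * (1 / n) := by field_simp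
        _ ≤ |c₀| / (κ * |q 1|) * (2 * (1 / ((n : ℝ) + 1))) := by gcongr
        _ = _ := by ring
    have h5 : X * R / (4 * |q 1| * ‖c‖) ≤ 12 / |q 1| * R := by
      calc X * R / (4 * |q 1| * ‖c‖) ≤ X * R / (4 * |q 1| * (X / 4)) := by gcongr
        _ = 1 / |q 1| * R := by field_simp
        _ ≤ _ := by gcongr; norm_num
    calc _ ≤ (|c₀| + X * R) / (4 * |q 1| * ‖c‖) := by gcongr
      _ = |c₀| / (4 * |q 1| * ‖c‖) + X * R / (4 * |q 1| * ‖c‖) := add_div _ _ _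
      _ ≤ _ := add_le_add h4 h5
  have t3 : ‖(omega q : ℂ) / (q 1 * c) * (n * ε)‖ ≤ 4 * |omega q| / (κ * |q 1|) * ‖ε‖ := by
    rw [norm_mul, norm_div, norm_mul, norm_mul, Complex.norm_real, Complex.norm_real,
      Complex.norm_natCast, Real.norm_eq_abs, Real.norm_eq_abs]
    calc _ ≤ |omega q| / (|q 1| * (κ * n / 4)) * (n * ‖ε‖) := by gcongr
      _ = _ := by field_simp
  have t4 : ‖s / c * (n * (cε - 1)) / 2‖ ≤ 8 * M * ‖ε‖ := by
    rw [norm_div, norm_mul, norm_mul, Complex.norm_natCast, Complex.norm_two]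
    have h3 : ‖s / c‖ * (n * ‖cε - 1‖) ≤ 4 * (n * (2 * ‖ε‖) ^ 2) := by gcongr
    have h4 : 4 * (n * (2 * ‖ε‖) ^ 2) = 16 * (n * ‖ε‖ * ‖ε‖) := by ring
    linarith
  have t5 : ‖n * (sε - 2 * ε) / 2‖ ≤ 4 * M * ‖ε‖ := by
    rw [norm_div, norm_mul, Complex.norm_natCast, Complex.norm_two]
    have h3 := mul_le_mul_of_nonneg_left hsε hn'.le
    have h4 : n * (2 * ‖ε‖) ^ 2 = 4 * (n * ‖ε‖ * ‖ε‖) := by ring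
    have h5 : 0 ≤ M * ‖ε‖ := by positivity
    linarith
  rw [hmain, Complex.norm_real, Real.norm_of_nonneg (by positivity)]
  refine (norm_sub_le _ _).trans ((add_le_add ((norm_add_le _ _).trans (add_le_add
    (norm_add₃_le.trans (add_le_add (add_le_add t1 t2) t3)) t4)) t5).trans ?_)
  have p1 : 0 ≤ |Q₃ q| / (4 * |q 1|) := by positivity
  have p2 : 0 ≤ 2 * |c₀| / (κ * |q 1|) := by positivity
  have p3 : 0 ≤ 12 / |q 1| := by positivity
  have p4 : 0 ≤ 4 * |omega q| / (κ * |q 1|) := by positivity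
  generalize |Q₃ q| / (4 * |q 1|) = A1 at *
  generalize 2 * |c₀| / (κ * |q 1|) = A2 at *
  generalize 12 / |q 1| = A3 at *
  generalize 4 * |omega q| / (κ * |q 1|) = A4 at *
  generalize 1 / ((n : ℝ) + 1) = U at *
  have z1 : A1 * L ≤ A1 * (L + U + R + ‖ε‖) := by gcongr; linarith
  have z2 : A2 * U ≤ A2 * (L + U + R + ‖ε‖) := by gcongr; linarith
  have z3 : A3 * R ≤ A3 * (L + U + R + ‖ε‖) := by gcongr; linarith
  have z4 : (A4 + 12 * M) * ‖ε‖ ≤ (A4 + 12 * M) * (L + U + R + ‖ε‖) := by gcongr; linarith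
  linarith

end Data

end Comparison

/-! ### Counting in the case `ω ≠ 0` -/

section Counting

variable {q : ℝ → ℝ} {a κ : ℝ} {e : ℕ}

theorem sq_norm_logCentre (n : ℕ) :
    ‖logCentre a κ n‖ ^ 2 = (((n : ℝ) + a) * Real.pi) ^ 2 + (logHeight κ n / 2) ^ 2 := by
  rw [Complex.sq_norm, Complex.normSq_apply, logCentre_re, logCentre_im]
  ring

/-- The imaginary part `O(log n)` changes the modulus only by `O(log² n / n)`. -/
theorem eventually_norm_logCentre (h : IsPhase q a κ e) :
    ∀ᶠ n in atTop, |‖logCentre a κ n‖ - ((n : ℝ) + a) * Real.pi| ≤ 1 / 8 := by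
  have hpi := Real.pi_gt_three
  obtain ⟨ha1, ha2⟩ := h.a_mem
  filter_upwards [(tendsto_logHeight_sq_div (κ := κ)).eventually_le_const one_pos,
    eventually_ge_atTop 1] with n hn hn1
  have hn' : (0:ℝ) < n := by exact_mod_cast hn1
  rw [div_le_one hn'] at hn
  have h1 := sq_norm_logCentre (a := a) (κ := κ) n
  have h2 : (n : ℝ) ≤ ((n : ℝ) + a) * Real.pi := by nlinarith
  set x := ((n : ℝ) + a) * Real.pi with hx
  have h3 := norm_nonneg (logCentre a κ n)
  rw [abs_le]
  constructor
  · nlinarith [sq_nonneg (logHeight κ n / 2)]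
  · have : ‖logCentre a κ n‖ ^ 2 ≤ (x + 1 / 8) ^ 2 := by nlinarith
    have := (sq_le_sq₀ h3 (by linarith)).1 this
    linarith

/-- Bounds for `4 k³ Δ(k²)` on circles that pass between consecutive approximate zeros. -/
theorem exists_bounds_on_circle_of_omega_ne_zero (h : IsPhase q a κ e) (hq : MemW21 q)
    (hω : omega q ≠ 0) (hq1 : q 1 ≠ 0) :
    ∃ δ > 0, ∃ C > 0, ∀ᶠ M : ℕ in atTop, ∀ k : ℂ,
      ‖k‖ = (((2 * M + e + 1 : ℕ) : ℝ) + 1 / 2) * (Real.pi / 2) → 0 ≤ k.im →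
      δ * Real.exp (2 * k.im) ≤ ‖scaledCharFun q k‖ ∧
        ‖scaledCharFun q k‖ ≤ C * (‖k‖ + Real.exp (2 * k.im)) := by
  have hpi := Real.pi_gt_three
  obtain ⟨ha1, ha2⟩ := h.a_mem
  have hae := h.a_eq
  obtain ⟨δ, hδ, K₁, hK₁, hnear⟩ := exists_near_logCentre h hω hq1 (by norm_num : (0:ℝ) < 1 / 8)
  obtain ⟨K₂, hK₂, hE₂⟩ := exists_norm_remainder_le hq (half_pos hδ)
  obtain ⟨K₃, hK₃, hE₃⟩ := exists_norm_remainder_le hq one_pos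
  obtain ⟨N, hN⟩ := eventually_atTop.1 (eventually_norm_logCentre h)
  refine ⟨δ / 2, half_pos hδ, 2 * |omega q| + |q 1| + 1, by positivity, ?_⟩
  filter_upwards [tendsto_natCast_atTop_atTop.eventually_ge_atTop (max (max K₁ K₂) (max K₃
    (∑ n ∈ Finset.range N, ‖logCentre a κ n‖ + 1)))] with M hM k hk him
  have hkx : ‖k‖ = ((M : ℝ) + a + 1 / 2) * Real.pi := by
    rw [hk]
    push_cast
    linear_combination (-Real.pi / 4) * hae
  have hMk : (M : ℝ) ≤ ‖k‖ := by
    rw [hkx]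
    nlinarith [Nat.cast_nonneg (α := ℝ) M]
  have hM := hM.trans hMk
  have hk1 : K₁ ≤ ‖k‖ := (le_max_left _ _).trans ((le_max_left _ _).trans hM)
  have hk2 : K₂ ≤ ‖k‖ := (le_max_right _ _).trans ((le_max_left _ _).trans hM)
  have hk3 : K₃ ≤ ‖k‖ := (le_max_left _ _).trans ((le_max_right _ _).trans hM)
  have hk4 := (le_max_right _ _).trans ((le_max_right _ _).trans hM)
  constructor
  · -- A small value would put a point of the circle next to an approximate zero.
    have key : ∀ z : ℂ, ‖z‖ = ‖k‖ → 0 ≤ z.re → 0 ≤ z.im →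
        δ / 2 * Real.exp (2 * z.im) ≤ ‖scaledCharFun q z‖ := by
      intro z hz hre him
      by_contra hlt
      push Not at hlt
      have h1 := hE₂ z (by rwa [hz])
      rw [abs_of_nonneg him] at h1
      have h2 := norm_le_norm_sub_add (leadingFun q z) (scaledCharFun q z)
      rw [norm_sub_rev] at h2
      obtain ⟨n, hn1, hn⟩ := hnear z (by rwa [hz]) hre him (by
        have : 0 ≤ δ * ‖z‖ := by positivity
        linarith)
      have h3 := abs_le.1 ((abs_norm_sub_norm_le z (logCentre a κ n)).trans hn)
      have hnN : N ≤ n := by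
        by_contra hlt
        have h4 : ‖logCentre a κ n‖ ≤ ∑ n ∈ Finset.range N, ‖logCentre a κ n‖ :=
          Finset.single_le_sum (f := fun n => ‖logCentre a κ n‖) (fun i _ => norm_nonneg _)
            (Finset.mem_range.2 (by omega))
        linarith
      have h4 := abs_le.1 (hN n hnN)
      rw [hz, hkx] at h3
      rcases le_or_gt n M with h5 | h5
      · have : (n : ℝ) ≤ M := by exact_mod_cast h5
        nlinarith
      · have : (M : ℝ) + 1 ≤ n := by exact_mod_cast h5
        nlinarith
    -- The reflection in the imaginary axis reduces to the first quadrant.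
    rcases le_total 0 k.re with hre | hre
    · exact key k rfl hre him
    · have := key (-conj k) (by rw [norm_neg, Complex.norm_conj]) (by simpa using hre)
        (by simpa using him)
      rw [scaledCharFun_neg, scaledCharFun_conj hq.continuousOn, norm_neg, Complex.norm_conj] at this
      simpa using this
  · have h1 := hE₃ k hk3
    have h2 := norm_le_norm_sub_add (scaledCharFun q k) (leadingFun q k)
    have h3 : ‖leadingFun q k‖ ≤ 2 * |omega q| * ‖k‖ + |q 1| * Real.exp (2 * k.im) := by
      rw [leadingFun]
      refine (norm_sub_le _ _).trans (add_le_add ?_ ?_)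
      · rw [norm_mul, norm_mul, Complex.norm_two, Complex.norm_real, Real.norm_eq_abs]
      · rw [norm_mul, Complex.norm_real, Real.norm_eq_abs]
        refine mul_le_mul_of_nonneg_left ((Complex.norm_sin_le_exp _).trans ?_) (abs_nonneg _)
        have : (2 * k).im = 2 * k.im := by simp
        rw [this, abs_of_nonneg (by linarith)]
    rw [abs_of_nonneg him] at h1
    have hX := Real.exp_pos (2 * k.im)
    have h4 : 0 ≤ |omega q| * Real.exp (2 * k.im) := by positivity
    have h5 : 0 ≤ |q 1| * ‖k‖ := by positivity
    have h6 := norm_nonneg k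
    linarith

/-- The moduli of a zero near `c_n` and of its conjugate are, jointly, comparable with those of
two neighbouring multiples of `π / 2`. -/
theorem abs_log_norm_pair_le (h : IsPhase q a κ e) {n : ℕ} (hn : 1 ≤ n) {w : ℂ}
    (hw : ‖w‖ ≤ 1 / 8) :
    |(Real.log ‖(logCentre a κ n + w) ^ 2‖ -
        Real.log ‖(((2 * n + e : ℕ) : ℂ) * (Real.pi / 2)) ^ 2‖) +
      (Real.log ‖conj (logCentre a κ n + w) ^ 2‖ -
        Real.log ‖(((2 * n + e + 1 : ℕ) : ℂ) * (Real.pi / 2)) ^ 2‖)| ≤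
      8 * (‖w‖ ^ 2 + ((|logHeight κ n| + 1) / n) ^ 2) := by
  have hpi := Real.pi_gt_three
  obtain ⟨ha1, ha2⟩ := h.a_mem
  have hae := h.a_eq
  have hn' : (0:ℝ) < n := by exact_mod_cast hn
  have hn1 : (1:ℝ) ≤ n := by exact_mod_cast hn
  have hx3 : 3 * (n : ℝ) ≤ ((n : ℝ) + a) * Real.pi := by nlinarith
  have hxπ : (n : ℝ) * Real.pi ≤ ((n : ℝ) + a) * Real.pi := by nlinarith
  have hsq := sq_norm_logCentre (a := a) (κ := κ) n
  have e1 : ((2 * n + e : ℕ) : ℂ) * (Real.pi / 2) =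
      ((((n : ℝ) + a) * Real.pi - Real.pi / 4 : ℝ) : ℂ) := by
    have := congrArg (fun x : ℝ => (x : ℂ)) hae
    push_cast at this ⊢
    linear_combination (-Real.pi / 4 : ℂ) * this
  have e2 : ((2 * n + e + 1 : ℕ) : ℂ) * (Real.pi / 2) =
      ((((n : ℝ) + a) * Real.pi + Real.pi / 4 : ℝ) : ℂ) := by
    have := congrArg (fun x : ℝ => (x : ℂ)) hae
    push_cast at this ⊢
    linear_combination (-Real.pi / 4 : ℂ) * this
  set x := ((n : ℝ) + a) * Real.pi with hx
  have hx0 : 0 < x := by linarith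
  set c := logCentre a κ n with hc
  have hcx : x ≤ ‖c‖ := by
    rw [← sq_le_sq₀ hx0.le (norm_nonneg _), hsq]
    linarith [sq_nonneg (logHeight κ n / 2)]
  have hc0 : c ≠ 0 := norm_pos_iff.1 (by linarith)
  have t1 : |Real.log ‖c + w‖ - Real.log ‖c‖| ≤ (‖w‖ ^ 2 + (1 / n) ^ 2) / 2 := by
    refine (abs_log_norm_add_sub_le (by linarith) hc0).trans ?_
    have h1 : 2 * ‖w‖ / ‖c‖ ≤ ‖w‖ * (1 / n) := by
      rw [mul_one_div, div_le_div_iff₀ (by linarith) hn']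
      nlinarith [norm_nonneg w]
    nlinarith [sq_nonneg (‖w‖ - 1 / n)]
  have t2 : |2 * Real.log ‖c‖ - 2 * Real.log x| ≤ (|logHeight κ n| / n) ^ 2 := by
    have h1 : 2 * Real.log ‖c‖ - 2 * Real.log x = Real.log (‖c‖ ^ 2 / x ^ 2) := by
      rw [Real.log_div (by have := norm_pos_iff.2 hc0; positivity) (by positivity), Real.log_pow,
        Real.log_pow]
      norm_num
    have h2 : ‖c‖ ^ 2 / x ^ 2 = 1 + (logHeight κ n / 2) ^ 2 / x ^ 2 := by
      rw [hsq]
      field_simp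
    have h3 : 0 ≤ (logHeight κ n / 2) ^ 2 / x ^ 2 := by positivity
    rw [h1, h2, abs_of_nonneg (Real.log_nonneg (by linarith))]
    have h4 := Real.log_le_sub_one_of_pos (by linarith : 0 < 1 + (logHeight κ n / 2) ^ 2 / x ^ 2)
    have h5 : (logHeight κ n / 2) ^ 2 / x ^ 2 ≤ (|logHeight κ n| / n) ^ 2 := by
      rw [div_pow _ (n : ℝ), sq_abs]
      refine div_le_div₀ (sq_nonneg _) ?_ (by positivity)
        (pow_le_pow_left₀ hn'.le (by linarith) 2)
      nlinarith [sq_nonneg (logHeight κ n)]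
    linarith
  have hp : 0 < x - Real.pi / 4 := by nlinarith
  have t3 : |Real.log (x - Real.pi / 4) + Real.log (x + Real.pi / 4) - 2 * Real.log x| ≤
      (1 / n) ^ 2 := by
    have hw3 : ‖((-(Real.pi / 4) ^ 2 : ℝ) : ℂ)‖ = (Real.pi / 4) ^ 2 := by
      rw [Complex.norm_real, norm_neg, Real.norm_of_nonneg (by positivity)]
    have hc3 : ‖((x ^ 2 : ℝ) : ℂ)‖ = x ^ 2 := by
      rw [Complex.norm_real, Real.norm_of_nonneg (by positivity)]
    have hpx : Real.pi * n ≤ x := by linarith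
    have hpx2 : (Real.pi * n) ^ 2 ≤ x ^ 2 := pow_le_pow_left₀ (by positivity) hpx 2
    have hn2 : 1 ≤ (n : ℝ) ^ 2 := one_le_pow₀ hn1
    have h0 : Real.pi ^ 2 ≤ x ^ 2 := by nlinarith [sq_nonneg Real.pi]
    have h1 := abs_log_norm_add_sub_le (c := ((x ^ 2 : ℝ) : ℂ))
      (w := ((-(Real.pi / 4) ^ 2 : ℝ) : ℂ)) (by rw [hw3, hc3]; linarith [sq_nonneg Real.pi])
      (norm_pos_iff.1 (by rw [hc3]; positivity))
    have h2 : x ^ 2 + -(Real.pi / 4) ^ 2 = (x - Real.pi / 4) * (x + Real.pi / 4) := by ring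
    rw [hw3, hc3, ← Complex.ofReal_add, h2, Complex.norm_real,
      Real.norm_of_nonneg (by positivity), Real.log_mul hp.ne' (by positivity),
      Real.log_pow] at h1
    push_cast at h1
    refine h1.trans ?_
    rw [div_pow 1 (n : ℝ), one_pow, div_le_div_iff₀ (by positivity) (by positivity)]
    nlinarith [sq_nonneg ((n : ℝ) * Real.pi)]
  rw [e1, e2, norm_pow, norm_pow, norm_pow, norm_pow, Complex.norm_conj, Complex.norm_real,
    Complex.norm_real, Real.norm_of_nonneg (by linarith), Real.norm_of_nonneg (by linarith),
    Real.log_pow, Real.log_pow, Real.log_pow]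
  have hsum : ((2 : ℕ) : ℝ) * Real.log ‖c + w‖ - ((2 : ℕ) : ℝ) * Real.log (x - Real.pi / 4) +
      (((2 : ℕ) : ℝ) * Real.log ‖c + w‖ - ((2 : ℕ) : ℝ) * Real.log (x + Real.pi / 4)) =
      4 * (Real.log ‖c + w‖ - Real.log ‖c‖) + 2 * (2 * Real.log ‖c‖ - 2 * Real.log x) -
      2 * (Real.log (x - Real.pi / 4) + Real.log (x + Real.pi / 4) - 2 * Real.log x) := by
    push_cast
    ring
  rw [hsum]
  have t4 : (1 / (n : ℝ)) ^ 2 + (|logHeight κ n| / n) ^ 2 ≤ ((|logHeight κ n| + 1) / n) ^ 2 := by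
    have : 0 ≤ |logHeight κ n| / n * (1 / n) := by positivity
    rw [add_div, add_sq]
    linarith
  have t5 := sq_nonneg (|logHeight κ n| / n)
  have t6 := sq_nonneg (1 / (n : ℝ))
  have t7 := sq_nonneg ‖w‖
  rw [abs_le] at t1 t2 t3 ⊢
  constructor <;> linarith [t1.1, t1.2, t2.1, t2.2, t3.1, t3.2]

/-- If `ω ≠ 0`, the squares of the zeros near the `c_n` with `n ≥ N` and the conjugates of these
squares, completed by `2 N + e - 2` further numbers, list the eigenvalues. -/
theorem exists_enumeration_of_omega_ne_zero (h : IsPhase q a κ e) (hq : MemW21 q)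
    (hω : omega q ≠ 0) (hq1 : q 1 ≠ 0) {w : ℕ → ℂ} (hw8 : ∀ n, ‖w n‖ ≤ 1 / 8)
    (hwL : MemL2Seq w)
    (hw0 : ∀ᶠ n in atTop, scaledCharFun q (logCentre a κ n + w n) = 0 ∧
      deriv (scaledCharFun q) (logCentre a κ n + w n) ≠ 0)
    (hcover : ∀ N, ∃ K, ∀ k : ℂ, K ≤ ‖k‖ → 0 ≤ k.re → 0 ≤ k.im → scaledCharFun q k = 0 →
      ∃ n, N ≤ n ∧ k = logCentre a κ n + w n) :
    ∃ N, 1 ≤ N ∧ ∀ {ν : Type} (H : Finset ν) (E : ν → ℂ) (b : ℕ ⊕ ℕ → ν),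
      Function.Injective b → (∀ x, x ∈ H ↔ x ∉ range b) →
      (∀ i, E (b (Sum.inl i)) = (logCentre a κ (i + N) + w (i + N)) ^ 2) →
      (∀ i, E (b (Sum.inr i)) = conj (logCentre a κ (i + N) + w (i + N)) ^ 2) →
      H.card + 2 = 2 * N + e →
      ∃ l : ν → ℂ, (∀ x, x ∉ H → l x = E x) ∧ EnumeratesDirichletEigenvalues q l := by
  have hpi := Real.pi_gt_three
  obtain ⟨ha1, ha2⟩ := h.a_mem
  have hae := h.a_eq
  set k : ℕ → ℂ := fun n => logCentre a κ n + w n with hk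
  have hkre : ∀ n, |(k n).re - ((n : ℝ) + a) * Real.pi| ≤ 1 / 8 := fun n => by
    simp only [hk, Complex.add_re, logCentre_re, add_sub_cancel_left]
    exact (Complex.abs_re_le_norm _).trans (hw8 n)
  have hkpos : ∀ n, 0 < (k n).re := fun n => by
    have := (abs_le.1 (hkre n)).1
    nlinarith [Nat.cast_nonneg (α := ℝ) n]
  have hkinj : ∀ n m, (k n).re = (k m).re → n = m := by
    intro n m hnm
    have h1 := abs_le.1 (hkre n)
    have h2 := abs_le.1 (hkre m)
    rw [hnm] at h1
    by_contra hne
    rcases lt_or_gt_of_ne hne with h | h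
    · have : (n : ℝ) + 1 ≤ m := by exact_mod_cast h
      nlinarith
    · have : (m : ℝ) + 1 ≤ n := by exact_mod_cast h
      nlinarith
  obtain ⟨N, hN⟩ := eventually_atTop.1 (hw0.and ((eventually_norm_logCentre h).and
    ((eventually_ge_atTop 1).and ((tendsto_logHeight_atTop (κ := κ)).eventually_ge_atTop 1))))
  have hN1 : 1 ≤ N := (hN N le_rfl).2.2.1
  have hkim : ∀ n, N ≤ n → 0 < (k n).im := fun n hn => by
    have h1 := (hN n hn).2.2.2
    have h2 := (abs_le.1 ((Complex.abs_im_le_norm _).trans (hw8 n))).1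
    simp only [hk, Complex.add_im, logCentre_im]
    linarith
  have hknorm : ∀ n, N ≤ n → |‖k n‖ - ((n : ℝ) + a) * Real.pi| ≤ 1 / 4 := fun n hn => by
    have h1 := abs_le.1 (hN n hn).2.1
    have h2 := abs_le.1 (abs_norm_sub_norm_le (k n) (logCentre a κ n))
    have h3 : k n - logCentre a κ n = w n := by simp [hk]
    rw [h3] at h2
    rw [abs_le]
    constructor <;> linarith [hw8 n]
  obtain ⟨K, hK⟩ := hcover N
  -- The tail of zeros consists of the zeros near `c_n`, `n ≥ N`, and their conjugates; these are
  -- compared with the model zeros with indices `2 n + e` and `2 n + e + 1`.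
  set s : ℕ ⊕ ℕ → ℂ := Sum.elim (fun i => k (i + N)) fun i => conj (k (i + N)) with hs
  have hF := differentiable_scaledCharFun hq.continuousOn
  have hconj : (conj ∘ scaledCharFun q ∘ conj) = scaledCharFun q := by
    funext z
    simp [scaledCharFun_conj hq.continuousOn]
  obtain ⟨Ex, hEx⟩ := exists_hasSimpleTail_of_zeros hq.continuousOn (k := s)
    (by
      rintro (i | i)
      · exact hkpos _
      · simpa [hs] using hkpos (i + N))
    (by
      rintro (i | i) (i' | i') hii
      · have := hkinj _ _ (congrArg Complex.re hii)
        rw [Nat.add_right_cancel this]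
      · have h1 : (k (i + N)).im = -(k (i' + N)).im := congrArg Complex.im hii
        have h2 := hkim (i + N) (by omega)
        have h3 := hkim (i' + N) (by omega)
        linarith
      · have h1 : -(k (i + N)).im = (k (i' + N)).im := congrArg Complex.im hii
        have h2 := hkim (i + N) (by omega)
        have h3 := hkim (i' + N) (by omega)
        linarith
      · have h1 : (s (Sum.inr i)).re = (s (Sum.inr i')).re := congrArg Complex.re hii
        have : (k (i + N)).re = (k (i' + N)).re := h1
        rw [Nat.add_right_cancel (hkinj _ _ this)])
    (by
      rintro (i | i)
      · exact (hN _ (by omega)).1.1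
      · have : scaledCharFun q (k (i + N)) = 0 := (hN (i + N) (by omega)).1.1
        simp [hs, scaledCharFun_conj hq.continuousOn, this])
    (by
      rintro (i | i)
      · exact (hN _ (by omega)).1.2
      · have h1 := (hF (k (i + N))).hasDerivAt.conj_conj
        rw [hconj] at h1
        have h2 : deriv (scaledCharFun q) (k (i + N)) ≠ 0 := (hN (i + N) (by omega)).1.2
        simpa [hs, h1.deriv] using h2)
    (K := K)
    (fun z hz hre hz0 => by
      rcases le_total 0 z.im with him | him
      · obtain ⟨n, hn, rfl⟩ := hK z hz hre him hz0
        exact ⟨Sum.inl (n - N), by simp [hs, hk, Nat.sub_add_cancel hn]⟩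
      · obtain ⟨n, hn, hzn⟩ := hK (conj z) (by rwa [Complex.norm_conj]) (by simpa using hre)
          (by simpa using him) (by rw [scaledCharFun_conj hq.continuousOn, hz0, map_zero])
        refine ⟨Sum.inr (n - N), ?_⟩
        have : z = conj (k n) := by
          rw [show k n = conj z from hzn.symm, Complex.conj_conj]
        simpa [hs, Nat.sub_add_cancel hn] using this)
  obtain ⟨δ, hδ, C, hC, hbd⟩ := exists_bounds_on_circle_of_omega_ne_zero h hq hω hq1
  set j : ℕ ⊕ ℕ → ℕ := Sum.elim (fun i => 2 * (i + N) + e) fun i => 2 * (i + N) + e + 1 with hj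
  have hjM : ∀ M i, (j (Sum.inl i) ≤ 2 * M + e + 1 ↔ i + N ≤ M) ∧
      (j (Sum.inr i) ≤ 2 * M + e + 1 ↔ i + N ≤ M) := fun M i => by
    simp only [hj, Sum.elim_inl, Sum.elim_inr]
    omega
  have hsep : ∀ M n : ℕ, N ≤ n →
      (‖k n‖ ^ 2 ≤ ((((2 * M + e + 1 : ℕ) : ℝ) + 1 / 2) * (Real.pi / 2)) ^ 2 ↔ n ≤ M) := by
    intro M n hn
    have h1 : (((2 * M + e + 1 : ℕ) : ℝ) + 1 / 2) * (Real.pi / 2) =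
        ((M : ℝ) + a + 1 / 2) * Real.pi := by
      push_cast
      linear_combination (-Real.pi / 4) * hae
    have h2 := abs_le.1 (hknorm n hn)
    rw [h1, sq_le_sq₀ (norm_nonneg _) (by positivity)]
    constructor
    · intro h
      by_contra h3
      have : (M : ℝ) + 1 ≤ n := by exact_mod_cast not_le.1 h3
      nlinarith
    · intro h
      have : (n : ℝ) ≤ M := by exact_mod_cast h
      nlinarith
  set d : ℕ → ℝ := fun i => (Real.log ‖k (i + N) ^ 2‖ -
      Real.log ‖(((2 * (i + N) + e : ℕ) : ℂ) * (Real.pi / 2)) ^ 2‖) +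
    (Real.log ‖conj (k (i + N)) ^ 2‖ -
      Real.log ‖(((2 * (i + N) + e + 1 : ℕ) : ℂ) * (Real.pi / 2)) ^ 2‖) with hd
  have hsum : Summable fun i => |d i| := by
    have h1 := memL2Seq_abs_logHeight_add_div (κ := κ) 1
    refine ((summable_nat_add_iff N).2 ((Summable.add hwL h1).mul_left 8)).of_nonneg_of_le
      (fun i => abs_nonneg _) fun i => ?_
    rw [Complex.norm_real, Real.norm_eq_abs, sq_abs]
    exact abs_log_norm_pair_le h (by omega) (hw8 _)
  refine ⟨N, hN1, fun {ν} H E b hb hbH hbl hbr hcard => ?_⟩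
  refine exists_enumeration_of_tail hq.continuousOn hEx (j := j)
    (by
      rintro (i | i) (i' | i') hii <;> simp only [hj, Sum.elim_inl, Sum.elim_inr] at hii
      · exact congrArg Sum.inl (by omega)
      · omega
      · omega
      · exact congrArg Sum.inr (by omega))
    (by rintro (i | i) <;> simp only [hj, Sum.elim_inl, Sum.elim_inr] <;> omega)
    (Finset.Icc 1 (2 * N + e - 1))
    (fun m hm => by
      simp only [Finset.mem_Icc, mem_range, not_exists, Sum.forall, hj, Sum.elim_inl, Sum.elim_inr]
      constructor
      · intro h
        constructor <;> intro i hi <;> omega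
      · intro h
        refine ⟨by omega, ?_⟩
        by_contra h2
        rcases Nat.even_or_odd' (m - e) with ⟨c, hc | hc⟩
        · exact h.1 (c - N) (by omega)
        · exact h.2 (c - N) (by omega)) (by simp) (m := fun M => 2 * M + e + 1)
    (tendsto_atTop_mono (fun M => (by omega : M ≤ 2 * M + e + 1)) tendsto_id)
    (.of_forall fun M => by
      rintro (i | i)
      · rw [(hjM M i).1, norm_pow]
        exact hsep M (i + N) (by omega)
      · rw [(hjM M i).2, norm_pow]
        simp only [hs, Sum.elim_inr, Complex.norm_conj]
        exact hsep M (i + N) (by omega))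
    (T := ∑' i, |d i|) (.of_forall fun M I hI => by
      have hI' : I = (Finset.range (M + 1 - N)).disjSum (Finset.range (M + 1 - N)) := by
        ext x
        rcases x with i | i
        · rw [hI, (hjM M i).1, Finset.inl_mem_disjSum, Finset.mem_range]
          omega
        · rw [hI, (hjM M i).2, Finset.inr_mem_disjSum, Finset.mem_range]
          omega
      rw [hI', Finset.sum_disjSum, ← Finset.sum_add_distrib]
      exact (Finset.abs_sum_le_sum_abs _ _).trans (hsum.sum_le_tsum _ fun i _ => abs_nonneg _))
    hδ hC hbd H E b hb hbH
    (by
      rintro (i | i)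
      · exact hbl i
      · exact hbr i) (by rw [Nat.card_Icc]; omega)

end Counting

/-! ### Listing the eigenvalues in the case `ω ≠ 0` -/

section Listing

variable {q : ℝ → ℝ} {a κ : ℝ} {e : ℕ}

/-- The zeros of `4 k³ Δ(k²)` and of `2 ω k - q(1) sin 2k` near the approximate zeros `c_n`, as
displacements `w n` and `v n` from `c_n`, with everything that is needed about them. -/
theorem exists_displacements (h : IsPhase q a κ e) (hq : MemW21 q) (hω : omega q ≠ 0)
    (hq1 : q 1 ≠ 0) :
    ∃ w v : ℕ → ℂ, (∀ n, ‖w n‖ ≤ 1 / 8) ∧ MemL2Seq w ∧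
      (∀ᶠ n in atTop, scaledCharFun q (logCentre a κ n + w n) = 0 ∧
        deriv (scaledCharFun q) (logCentre a κ n + w n) ≠ 0) ∧
      (∀ N, ∃ K, ∀ k : ℂ, K ≤ ‖k‖ → 0 ≤ k.re → 0 ≤ k.im → scaledCharFun q k = 0 →
        ∃ n, N ≤ n ∧ k = logCentre a κ n + w n) ∧
      (IsLeadingZeroSequence q fun n => logCentre a κ n + v n) ∧
      (∀ c, 0 < c → κ = 2 / c → HasZeroAsymptotics a c fun n => logCentre a κ n + v n) ∧
      (MemL2Seq fun n => w n - v n) ∧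
      (MemW22 q → MemL2Seq fun n =>
        n * (w n - v n) - (Q₃ q : ℂ) / (4 * (Real.pi : ℂ) * (q 1 : ℂ))) := by
  obtain ⟨r, hr, hr8, hbil, hz⟩ := exists_zeros_near_logCentre h hω hq1
  obtain ⟨w, hw, hw0, hwc⟩ := hz _ (differentiable_scaledCharFun hq.continuousOn)
    fun ε hε => exists_norm_remainder_le hq hε
  obtain ⟨v, hv, hv0, hvc⟩ := hz _ (differentiable_leadingFun q) fun ε hε =>
    ⟨1, one_pos, fun k _ => by rw [sub_self, norm_zero]; positivity⟩
  have hw8 : ∀ n, ‖w n‖ ≤ 1 / 8 := fun n => (hw n).trans hr8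
  have hv8 : ∀ n, ‖v n‖ ≤ 1 / 8 := fun n => (hv n).trans hr8
  have hw0' := hw0.mono fun n hn => hn.1
  have hv0' := hv0.mono fun n hn => hn.1
  have hvb := eventually_norm_displacement_le h hω hr hbil hv hv0'
  have hd := eventually_mul_norm_sub_le hbil hw hv hw0' hv0'
  have hεL := memL2Seq_sub h hq hω hw8 hd
  have hvL : MemL2Seq v := by
    refine (memL2Seq_abs_logHeight_add_div (κ := κ) 2).of_eventually_le 1 (hvb.mono fun n hn => ?_)
    rwa [Complex.norm_real, Real.norm_of_nonneg (by positivity), one_mul]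
  have hwL : MemL2Seq w := by simpa using hεL.add hvL
  obtain ⟨K, hK⟩ := hvc 0
  exact ⟨w, v, hw8, hwL, hw0, hwc, isLeadingZeroSequence_logCentre_add h hv8 hv0
      (fun k h1 h2 h3 h4 => let ⟨n, _, hn⟩ := hK k h1 h2 h3 h4; ⟨n, hn⟩),
    fun c hc hcκ => hasZeroAsymptotics_logCentre_add h hω hc hcκ hv8 hv0' hvb, hεL,
    fun hq2 => memL2Seq_second_order_of_omega_ne_zero h hq hq2 hω hq1 hw8 hv8 hw0' hv0' hd⟩

/-- Square roots of the listed eigenvalues, compared with the zeros of the leading part. -/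
theorem cpow_half_asymptotics (h : IsPhase q a κ e) {w v lam : ℕ → ℂ}
    (hw8 : ∀ n, ‖w n‖ ≤ 1 / 8) (h1 : MemL2Seq fun n => w n - v n)
    (h2 : MemW22 q → MemL2Seq fun n =>
        n * (w n - v n) - (Q₃ q : ℂ) / (4 * (Real.pi : ℂ) * (q 1 : ℂ)))
    (hlam : ∀ᶠ n in atTop, lam n = (logCentre a κ n + w n) ^ 2) :
    (∃ ε : ℕ → ℂ, MemL2Seq ε ∧ ∀ n : ℕ,
      lam n ^ (1 / 2 : ℂ) = logCentre a κ n + v n + ε n) ∧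
    (MemW22 q → ∃ β : ℕ → ℂ, MemL2Seq β ∧ ∀ n : ℕ, 1 ≤ n → lam n ^ (1 / 2 : ℂ) =
      logCentre a κ n + v n + (Q₃ q : ℂ) / (4 * (n : ℂ) * (Real.pi : ℂ) * (q 1 : ℂ)) +
        β n / (n : ℂ)) := by
  have hpi := Real.pi_gt_three
  obtain ⟨ha1, ha2⟩ := h.a_mem
  have hsqrt : ∀ᶠ n in atTop,
      lam n ^ (1 / 2 : ℂ) - (logCentre a κ n + v n) = w n - v n := by
    filter_upwards [hlam] with n hn
    rw [hn, cpow_half_sq]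
    · ring
    · rw [Complex.add_re, logCentre_re]
      have := (abs_le.1 ((Complex.abs_re_le_norm _).trans (hw8 n))).1
      nlinarith [Nat.cast_nonneg (α := ℝ) n]
  -- For the finitely many small `n` the error terms are whatever the identities require.
  refine ⟨⟨fun n => lam n ^ (1 / 2 : ℂ) - (logCentre a κ n + v n),
    h1.of_eventually_le 1 (hsqrt.mono fun n hn => by rw [hn, one_mul]), fun n => by ring⟩,
    fun hq2 => ⟨fun n => n * (lam n ^ (1 / 2 : ℂ) - (logCentre a κ n + v n)) -
      (Q₃ q : ℂ) / (4 * (Real.pi : ℂ) * (q 1 : ℂ)),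
    (h2 hq2).of_eventually_le 1 (hsqrt.mono fun n hn => by rw [hn, one_mul]), fun n hn => ?_⟩⟩
  have hn0 : (n : ℂ) ≠ 0 := by exact_mod_cast (by omega : n ≠ 0)
  beta_reduce
  generalize lam n ^ (1 / 2 : ℂ) = x
  rw [sub_div, mul_div_cancel_left₀ _ hn0, div_div]
  ring

theorem coe_succPNat_pred_add {N : ℕ} (hN : 1 ≤ N) (i : ℕ) :
    ((i + N - 1).succPNat : ℕ) = i + N := by
  rw [Nat.succPNat_coe]
  omega

theorem injective_succPNat_pred_add {N : ℕ} (hN : 1 ≤ N) :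
    Function.Injective fun i : ℕ => (i + N - 1).succPNat := fun i i' h => by
  have := congrArg PNat.val h
  rw [coe_succPNat_pred_add hN, coe_succPNat_pred_add hN] at this
  omega

theorem mem_pnatHead_iff_notMem_range {N : ℕ} (hN : 1 ≤ N) (x : ℕ+) :
    x ∈ pnatHead (N - 1) ↔ x ∉ range fun i : ℕ => (i + N - 1).succPNat := by
  rw [mem_pnatHead]
  simp only [mem_range, not_exists]
  constructor
  · intro h i hi
    rw [← hi, coe_succPNat_pred_add hN] at h
    omega
  · intro h
    by_contra h2
    exact h (x - N) (PNat.eq (by rw [coe_succPNat_pred_add hN]; omega))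

theorem mem_disjSum_iff_notMem_range_map {α β γ δ : Type*} {s : Finset α} {t : Finset β}
    {f : γ → α} {g : δ → β} (hs : ∀ x, x ∈ s ↔ x ∉ range f) (ht : ∀ x, x ∈ t ↔ x ∉ range g)
    (x : α ⊕ β) : x ∈ s.disjSum t ↔ x ∉ range (Sum.map f g) := by
  rcases x with x | x
  · rw [Finset.inl_mem_disjSum, hs]
    simp [Sum.exists]
  · rw [Finset.inr_mem_disjSum, ht]
    simp [Sum.exists]

/-- Here `e = 0`: the indices below `N`, starting from `1` in both families, make up the
`2 N - 2` further eigenvalues. -/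
theorem eigenvalue_asymptotics_of_pos (hq : MemW21 q) (hpos : 0 < q 1 / omega q) :
    ∃ lam lam' mu : ℕ → ℂ, (∀ᶠ n in atTop, lam' n = conj (lam n)) ∧
      IsLeadingZeroSequence q mu ∧
      EnumeratesDirichletEigenvalues q
        (Sum.elim (fun n : ℕ+ => lam n) (fun n : ℕ+ => lam' n)) ∧
      HasZeroAsymptotics (1 / 4) (q 1 / (2 * omega q)) mu ∧
      (∃ ε : ℕ → ℂ, MemL2Seq ε ∧ ∀ n : ℕ, lam n ^ (1 / 2 : ℂ) = mu n + ε n) ∧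
      (MemW22 q → ∃ β : ℕ → ℂ, MemL2Seq β ∧ ∀ n : ℕ, 1 ≤ n → lam n ^ (1 / 2 : ℂ) =
        mu n + (Q₃ q : ℂ) / (4 * (n : ℂ) * (Real.pi : ℂ) * (q 1 : ℂ)) + β n / (n : ℂ)) := by
  have hω : omega q ≠ 0 := fun h => by simp [h] at hpos
  have hq1 : q 1 ≠ 0 := fun h => by simp [h] at hpos
  have h := isPhase_of_pos hpos
  obtain ⟨w, v, hw8, hwL, hw0, hwc, hlead, hasymp, hε, hβ⟩ := exists_displacements h hq hω hq1
  obtain ⟨N, hN, hlist⟩ := exists_enumeration_of_omega_ne_zero h hq hω hq1 hw8 hwL hw0 hwc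
  set k : ℕ → ℂ := fun n => logCentre (1 / 4) (4 * (omega q / q 1)) n + w n with hk
  obtain ⟨l, hl, hlE⟩ := hlist ((pnatHead (N - 1)).disjSum (pnatHead (N - 1)))
    (Sum.elim (fun n : ℕ+ => k n ^ 2) fun n : ℕ+ => conj (k n) ^ 2)
    (Sum.map (fun i : ℕ => (i + N - 1).succPNat) fun i : ℕ => (i + N - 1).succPNat)
    ((injective_succPNat_pred_add hN).sumMap (injective_succPNat_pred_add hN))
    (mem_disjSum_iff_notMem_range_map (mem_pnatHead_iff_notMem_range hN)
      (mem_pnatHead_iff_notMem_range hN))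
    (fun i => by rw [Sum.map_inl, Sum.elim_inl, coe_succPNat_pred_add hN])
    (fun i => by rw [Sum.map_inr, Sum.elim_inr, coe_succPNat_pred_add hN])
    (by rw [Finset.card_disjSum, card_pnatHead]; omega)
  have hv : ∀ n, N ≤ n → (n.toPNat' : ℕ) = n := fun n hn => by
    rw [Nat.toPNat'_coe, if_pos (by omega)]
  have hlam : ∀ n, N ≤ n → l (Sum.inl n.toPNat') = k n ^ 2 := fun n hn => by
    rw [hl _ (by rw [Finset.inl_mem_disjSum, mem_pnatHead, hv n hn]; omega), Sum.elim_inl, hv n hn]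
  have hlam' : ∀ n, N ≤ n → l (Sum.inr n.toPNat') = conj (k n) ^ 2 := fun n hn => by
    rw [hl _ (by rw [Finset.inr_mem_disjSum, mem_pnatHead, hv n hn]; omega), Sum.elim_inr, hv n hn]
  obtain ⟨hε', hβ'⟩ := cpow_half_asymptotics h hw8 hε hβ
    ((eventually_ge_atTop N).mono fun n hn => hlam n hn)
  refine ⟨fun n => l (Sum.inl n.toPNat'), fun n => l (Sum.inr n.toPNat'), _, ?_, hlead, ?_,
    hasymp _ (by rw [div_mul_eq_div_div_swap]; positivity) ?_, hε', hβ'⟩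
  · filter_upwards [eventually_ge_atTop N] with n hn
    rw [hlam n hn, hlam' n hn, map_pow]
  · have : (Sum.elim (fun n : ℕ+ => l (Sum.inl (n : ℕ).toPNat'))
        fun n : ℕ+ => l (Sum.inr (n : ℕ).toPNat')) = l := by
      funext x
      rcases x with x | x <;> simp
    rwa [this]
  · field_simp
    norm_num

/-- Here `e = 1`: the indices below `N`, starting from `0` in one family and from `1` in the other,
make up the `2 N - 1` further eigenvalues. -/
theorem eigenvalue_asymptotics_of_neg (hq : MemW21 q) (hneg : q 1 / omega q < 0) :
    ∃ lam lam' mu : ℕ → ℂ, (∀ᶠ n in atTop, lam' n = conj (lam n)) ∧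
      IsLeadingZeroSequence q mu ∧
      EnumeratesDirichletEigenvalues q
        (Sum.elim (fun n : ℕ => lam n) (fun n : ℕ+ => lam' n)) ∧
      HasZeroAsymptotics (3 / 4) (-(q 1 / (2 * omega q))) mu ∧
      (∃ ε : ℕ → ℂ, MemL2Seq ε ∧ ∀ n : ℕ, lam n ^ (1 / 2 : ℂ) = mu n + ε n) ∧
      (MemW22 q → ∃ β : ℕ → ℂ, MemL2Seq β ∧ ∀ n : ℕ, 1 ≤ n → lam n ^ (1 / 2 : ℂ) =
        mu n + (Q₃ q : ℂ) / (4 * (n : ℂ) * (Real.pi : ℂ) * (q 1 : ℂ)) + β n / (n : ℂ)) := by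
  have hω : omega q ≠ 0 := fun h => by simp [h] at hneg
  have hq1 : q 1 ≠ 0 := fun h => by simp [h] at hneg
  have h := isPhase_of_neg hneg
  obtain ⟨w, v, hw8, hwL, hw0, hwc, hlead, hasymp, hε, hβ⟩ := exists_displacements h hq hω hq1
  obtain ⟨N, hN, hlist⟩ := exists_enumeration_of_omega_ne_zero h hq hω hq1 hw8 hwL hw0 hwc
  set k : ℕ → ℂ := fun n => logCentre (3 / 4) (-(4 * (omega q / q 1))) n + w n with hk
  obtain ⟨l, hl, hlE⟩ := hlist ((Finset.range N).disjSum (pnatHead (N - 1)))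
    (Sum.elim (fun n : ℕ => k n ^ 2) fun n : ℕ+ => conj (k n) ^ 2)
    (Sum.map (fun i : ℕ => i + N) fun i : ℕ => (i + N - 1).succPNat)
    ((add_left_injective N).sumMap (injective_succPNat_pred_add hN))
    (mem_disjSum_iff_notMem_range_map (fun x => by
      simp only [Finset.mem_range, mem_range, not_exists]
      exact ⟨fun h i hi => by omega, fun h => by
        by_contra h2
        exact h (x - N) (by omega)⟩) (mem_pnatHead_iff_notMem_range hN))
    (fun i => by rw [Sum.map_inl, Sum.elim_inl])
    (fun i => by rw [Sum.map_inr, Sum.elim_inr, coe_succPNat_pred_add hN])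
    (by rw [Finset.card_disjSum, card_pnatHead, Finset.card_range]; omega)
  have hv : ∀ n, N ≤ n → (n.toPNat' : ℕ) = n := fun n hn => by
    rw [Nat.toPNat'_coe, if_pos (by omega)]
  have hlam : ∀ n, N ≤ n → l (Sum.inl n) = k n ^ 2 := fun n hn => by
    rw [hl _ (by rw [Finset.inl_mem_disjSum, Finset.mem_range]; omega), Sum.elim_inl]
  have hlam' : ∀ n, N ≤ n → l (Sum.inr n.toPNat') = conj (k n) ^ 2 := fun n hn => by
    rw [hl _ (by rw [Finset.inr_mem_disjSum, mem_pnatHead, hv n hn]; omega), Sum.elim_inr, hv n hn]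
  obtain ⟨hε', hβ'⟩ := cpow_half_asymptotics h hw8 hε hβ
    ((eventually_ge_atTop N).mono fun n hn => hlam n hn)
  refine ⟨fun n => l (Sum.inl n), fun n => l (Sum.inr n.toPNat'), _, ?_, hlead, ?_,
    hasymp _ (by rw [div_mul_eq_div_div_swap]; linarith) ?_, hε', hβ'⟩
  · filter_upwards [eventually_ge_atTop N] with n hn
    rw [hlam n hn, hlam' n hn, map_pow]
  · have : (Sum.elim (fun n : ℕ => l (Sum.inl n))
        fun n : ℕ+ => l (Sum.inr (n : ℕ).toPNat')) = l := by
      funext x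
      rcases x with x | x <;> simp
    rwa [this]
  · field_simp
    norm_num

end Listing

theorem mainTheorem4 (q : ℝ → ℝ) (hq : MemW21 q) (hq1 : q 1 ≠ 0) :
    (omega q ≠ 0 →
      ∃ lam lam' mu : ℕ → ℂ,
        (∀ᶠ n in atTop, lam' n = conj (lam n)) ∧
        IsLeadingZeroSequence q mu ∧
        (0 < q 1 / omega q →
          EnumeratesDirichletEigenvalues q
            (Sum.elim (fun n : ℕ+ => lam n) (fun n : ℕ+ => lam' n)) ∧
          HasZeroAsymptotics (1 / 4) (q 1 / (2 * omega q)) mu) ∧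
        (q 1 / omega q < 0 →
          EnumeratesDirichletEigenvalues q
            (Sum.elim (fun n : ℕ => lam n) (fun n : ℕ+ => lam' n)) ∧
          HasZeroAsymptotics (3 / 4) (-(q 1 / (2 * omega q))) mu) ∧
        (∃ ε : ℕ → ℂ, MemL2Seq ε ∧ ∀ n : ℕ, lam n ^ (1 / 2 : ℂ) = mu n + ε n) ∧
        (MemW22 q → ∃ β : ℕ → ℂ, MemL2Seq β ∧ ∀ n : ℕ, 1 ≤ n →
          lam n ^ (1 / 2 : ℂ) =
            mu n + (Q₃ q : ℂ) / (4 * (n : ℂ) * (Real.pi : ℂ) * (q 1 : ℂ)) + β n / (n : ℂ))) ∧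
    (omega q = 0 →
      ∃ lam : ℕ → ℂ,
        EnumeratesDirichletEigenvalues q (fun n : ℕ+ => lam n) ∧
        (∃ α : ℕ → ℂ, MemL2Seq α ∧ ∀ n : ℕ, 1 ≤ n →
          lam n ^ (1 / 2 : ℂ) = ((n : ℂ) + 1) * (Real.pi : ℂ) / 2 + α n) ∧
        (MemW22 q → ∃ κ : ℕ → ℂ, MemL2Seq κ ∧ ∀ n : ℕ, 1 ≤ n →
          lam n ^ (1 / 2 : ℂ) =
            ((n : ℂ) + 1) * (Real.pi : ℂ) / 2 +
              ((Q₃ q : ℂ) + (-1) ^ n * (Q₄ q : ℂ)) / (2 * (q 1 : ℂ) * (n : ℂ) * (Real.pi : ℂ)) +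
              κ n / (n : ℂ))) := by
  refine ⟨fun hω => ?_, eigenvalue_asymptotics_of_omega_eq_zero hq hq1⟩
  rcases lt_or_gt_of_ne (div_ne_zero hq1 hω) with h | h
  · obtain ⟨lam, lam', mu, h1, h2, h3, h4, h5⟩ := eigenvalue_asymptotics_of_neg hq h
    exact ⟨lam, lam', mu, h1, h2, fun h' => absurd h' h.not_gt, fun _ => ⟨h3, h4⟩, h5⟩
  · obtain ⟨lam, lam', mu, h1, h2, h3, h4, h5⟩ := eigenvalue_asymptotics_of_pos hq h
    exact ⟨lam, lam', mu, h1, h2, fun _ => ⟨h3, h4⟩, fun h' => absurd h' h.not_gt, h5⟩
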